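/- **Grassmann algebras.** Let $G_\infty=(V_\infty,E_\infty)$ be a graph without loops and parallel edges, with a fixed linear order on $V_\infty$, and let $V_0\subseteq V_1\subseteq\dots$ be finite sets with union $V_\infty$. Let $\tilde G_n$ be the graph with vertex set $\tilde V_n=V_n\cup\{\delta_n\}$, the edges of $G_\infty$ inside $V_n$, and an edge $i\sim\delta_n$ whenever $i\in V_n$ is adjacent in $G_\infty$ to some vertex outside $V_n$; assume that every $\tilde G_n$ is connected. Let $\mathcal V'$ be a complex vector space (of Grassmann parameters), and let $\mathsf\Lambda$ be the complex Grassmann algebra generated by $\mathcal V'$ together with independent generators $\overline\psi_i,\psi_i$ ($i\in V_\infty$); $\mathsf\Lambda\mathcal V'\subseteq\mathsf\Lambda$ is the subalgebra generated by $\mathcal V'$. The body of an element is its component of degree $0$. Exponentials and smooth functions of even elements are defined by Taylor expansion in the nilpotent parts around the bodies. **Parameters.** Let $W_{ij}=W_{ji}\in\mathsf\Lambda\mathcal V'$ ($i,j\in V_\infty$) be even, with real body $>0$ if $ij\in E_\infty$ and $W_{ij}=0$ otherwise, such that $\sum_jW_{ij}$ converges for every $i$ (after applying any linear functional); this is automatic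 if $G_\infty$ is locally finite. Put $W^{(n)}_{ij}=W_{ij}$ for $i,j\in V_n$, $W^{(n)}_{i\delta_n}=W^{(n)}_{\delta_ni}=\sum_{j\notin V_n}W_{ij}$, $W^{(n)}_{\delta_n\delta_n}=0$. Let $\alpha\in(-\infty,0]^{V_\infty}$ have finite support, $\alpha^{(n)}_i=\alpha_i$ for $i\in V_n$ and $\alpha^{(n)}_{\delta_n}=\sum_{j\notin V_n}\alpha_j$, and let $\tau_i\in\mathsf\Lambda\mathcal V'$ ($i\in V_\infty$) be odd. **The sigma model.** For $u,s\in\mathbb R^{V_n}$ set $u_{\delta_n}=s_{\delta_n}=0$ and $\overline\psi_{\delta_n}=\psi_{\delta_n}=0$. Let $A=A^{(n)}(u)$ be the $\tilde V_n\times\tilde V_n$ matrix with $A_{ij}=-W^{(n)}_{ij}e^{u_i+u_j}$ for $i\ne j$ and $A_{ii}=\sum_{k\in\tilde V_n}W^{(n)}_{ik}e^{u_i+u_k}$. With left Grassmann derivatives, the superintegral of $f:\mathbb R^{V_n}\times\mathbb R^{V_n}\to\mathsf\Lambda$ is $$\int \boldsymbol{d\mu}_n^W f=\int\prod_{i\in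 V_n}\frac{e^{-u_i}}{2\pi}\,du_i\,ds_i\,\partial_{\overline\psi_i}\partial_{\psi_i}\Big(\boldsymbol\rho_n f\Big),\qquad \boldsymbol\rho_n=e^{-\frac12\langle s,As\rangle}\,e^{-\langle\overline\psi,A\psi\rangle}\prod_{i\sim j\text{ in }\tilde G_n}e^{-W^{(n)}_{ij}[\cosh(u_i-u_j)-1]}.$$ It exists if, after the Grassmann derivatives, the integrand is Lebesgue integrable (after applying any linear functional). **Test superfunctions.** Define, for $i\in V_n$, with sums over $j\in\tilde V_n$, $$\beta^{V_n}_i=\tfrac12\sum_jW^{(n)}_{ij}e^{u_j-u_i},\quad \theta^{V_n}_i=\sum_jW^{(n)}_{ij}e^{u_j}(s_i-s_j),\quad \overline\phi^{V_n}_i=\sum_jW^{(n)}_{ij}e^{u_j}(\overline\psi_i-\overline\psi_j),\quad \phi^{V_n}_i=\sum_jW^{(n)}_{ij}e^{u_j}(\psi_i-\psi_j),$$ and $\varpi^{V_n}=(\beta^{V_n},\theta^{V_n},\overline\phi^{V_n},\phi^{V_n})$. A superfunction on $V_n$ is $g(\beta,\theta,\overline\phi,\phi)=\sum_{I,J\subseteq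 V_n}g_{IJ}(\beta,\theta)\overline\phi_I\phi_J$ with coefficients $g_{IJ}\in C^\infty(\mathbb R^{V_n}\times\mathbb R^{V_n},\mathbb C)\otimes\mathsf\Lambda\mathcal V'$ and ordered products $\overline\phi_I,\phi_J$. It is admissible if there is a superfunction $F(x,y,\xi,\eta)=\sum_{I,J}F_{IJ}(x,y)\xi_I\eta_J$ whose coefficients $F_{IJ}$ lie in the tensor product of the Schwartz space with $\mathsf\Lambda\mathcal V'$, such that $e^{\mathcal S_{\rm cart}}g(\varpi^{V_n})=F(x,y,\xi,\eta)$ for all $u,s$, where $$x_i=\sinh u_i-\big(\tfrac12s_i^2+\overline\psi_i\psi_i\big)e^{u_i},\quad z_i=\cosh u_i+\big(\tfrac12s_i^2+\overline\psi_i\psi_i\big)e^{u_i},\quad y_i=s_ie^{u_i},\quad \xi_i=e^{u_i}\overline\psi_i,\quad\eta_i=e^{u_i}\psi_i,$$ $$\mathcal S_{\rm cart}=-\sum_{i\sim j\text{ in }\tilde G_n}W^{(n)}_{ij}\,(-1-x_ix_j-y_iy_j+z_iz_j-\xi_i\eta_j+\eta_i\xi_j).$$ **Theorem.** Let $$M^{(n)}_{\alpha,\tau}=\exp\Big(\sum_{j\in\tilde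 V_n}\alpha^{(n)}_je^{u_j}(1+is_j)+\sum_{j\in V_n}\tau_je^{u_j}(\overline\psi_j+i\psi_j)\Big).$$ For every $n$ and every admissible superfunction $g$ on $V_n$, both superintegrals below exist, take values in $\mathsf\Lambda\mathcal V'$, and are equal: $$\int \boldsymbol{d\mu}_{n+1}^W\,M^{(n+1)}_{\alpha,\tau}\,g(\varpi^{V_{n+1}}|_{V_n})=\int \boldsymbol{d\mu}_n^W\,M^{(n)}_{\alpha,\tau}\,g(\varpi^{V_n}).$$ -/

import Mathlib

open scoped ContDiff TensorProduct

noncomputable section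

namespace SusySigma

/-! ### Grassmann algebras -/

/-- The Grassmann algebra of the parameters, over the vector space `E`. -/
abbrev ParAlg (E : Type*) [AddCommGroup E] [Module ℂ E] : Type _ := ExteriorAlgebra ℂ E

/-- The space of all Grassmann generators: it has the basis `ψbar i, ψ i` (`i : V`), plus the
space `E` of Grassmann parameters. -/
abbrev Gen (V E : Type*) [AddCommGroup E] [Module ℂ E] : Type _ := (V →₀ ℂ) × (V →₀ ℂ) × E

/-- The Grassmann algebra generated by the `ψbar i`, the `ψ i` and the parameters. -/
abbrev Alg (V E : Type*) [AddCommGroup E] [Module ℂ E] : Type _ := ExteriorAlgebra ℂ (Gen V E)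

section Basic

variable {F : Type*} [AddCommGroup F] [Module ℂ F]

/-- The component of degree zero. -/
def body (a : ExteriorAlgebra ℂ F) : ℂ := ExteriorAlgebra.algebraMapInv a

/-- The nilpotent part. -/
def soul (a : ExteriorAlgebra ℂ F) : ExteriorAlgebra ℂ F := a - algebraMap ℂ _ (body a)

def IsEven (a : ExteriorAlgebra ℂ F) : Prop :=
  a ∈ CliffordAlgebra.evenOdd (0 : QuadraticForm ℂ F) 0

def IsOdd (a : ExteriorAlgebra ℂ F) : Prop :=
  a ∈ CliffordAlgebra.evenOdd (0 : QuadraticForm ℂ F) 1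

/-- The exponential of an even element: the power series in its nilpotent part. -/
def superExp (a : ExteriorAlgebra ℂ F) : ExteriorAlgebra ℂ F :=
  Complex.exp (body a) •
    ∑ k ∈ Finset.range (nilpotencyClass (soul a)), ((k.factorial : ℂ)⁻¹) • soul a ^ k

/-- `f j` sums to `x`, tested against all linear functionals. -/
def HasWeakSum {ι : Type*} (f : ι → ExteriorAlgebra ℂ F) (x : ExteriorAlgebra ℂ F) : Prop :=
  ∀ ℓ : Module.Dual ℂ (ExteriorAlgebra ℂ F), HasSum (fun j => ℓ (f j)) (ℓ x)

open Classical in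
/-- The sum of a weakly summable family (`0` if the family is not summable). For a family of
finite support this is the finite sum. -/
def weakSum {ι : Type*} (f : ι → ExteriorAlgebra ℂ F) : ExteriorAlgebra ℂ F :=
  if h : ∃ x, HasWeakSum f x then h.choose else 0

/-- `f` is integrable over `X` with integral `x`, tested against all linear functionals; on a
finite-dimensional subspace this is integrability and integration of all coordinates. -/
def HasWeakIntegral {X : Type*} [MeasureTheory.MeasureSpace X]
    (f : X → ExteriorAlgebra ℂ F) (x : ExteriorAlgebra ℂ F) : Prop :=
  ∀ ℓ : Module.Dual ℂ (ExteriorAlgebra ℂ F),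
    MeasureTheory.Integrable (fun p => ℓ (f p)) ∧ ∫ p, ℓ (f p) = ℓ x

/-- If all `a c` are nilpotent and commute, every product of more than `nilDegree a` of them
vanishes. -/
def nilDegree {κ : Type*} (a : κ → ExteriorAlgebra ℂ F) : ℕ :=
  sInf {N | ∀ k, N < k → ∀ c : Fin k → κ, (List.ofFn fun l => a (c l)).prod = 0}

end Basic

section Generators

variable {V E : Type*} [AddCommGroup E] [Module ℂ E]

def psiBar (i : V) : Alg V E := ExteriorAlgebra.ι ℂ (Finsupp.single i 1, 0, 0)

def psi (i : V) : Alg V E := ExteriorAlgebra.ι ℂ (0, Finsupp.single i 1, 0)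

/-- The inclusion of the parameter algebra. -/
def par : ParAlg E →ₐ[ℂ] Alg V E :=
  ExteriorAlgebra.map
    ((LinearMap.inr ℂ (V →₀ ℂ) ((V →₀ ℂ) × E)).comp (LinearMap.inr ℂ (V →₀ ℂ) E))

/-- The left Grassmann derivative with respect to `ψbar i`. -/
def dPsiBar (i : V) : Module.End ℂ (Alg V E) :=
  CliffordAlgebra.contractLeft ((Finsupp.lapply i).comp (LinearMap.fst ℂ (V →₀ ℂ) _))

/-- The left Grassmann derivative with respect to `ψ i`. -/
def dPsi (i : V) : Module.End ℂ (Alg V E) :=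
  CliffordAlgebra.contractLeft
    ((Finsupp.lapply i).comp ((LinearMap.fst ℂ (V →₀ ℂ) E).comp (LinearMap.snd ℂ (V →₀ ℂ) _)))

/-- `∏ i ∈ s, ∂_{ψbar i} ∂_{ψ i}`. -/
def berezin [LinearOrder V] (s : Finset V) : Module.End ℂ (Alg V E) :=
  ((s.sort (· ≤ ·)).map fun i => dPsiBar i * dPsi i).prod

end Generators

/-! ### Coefficient functions and their evaluation at even elements -/

/-- Pairs of real vectors indexed by `s`. -/
abbrev Pts {V : Type*} (s : Finset V) : Type _ := (s → ℝ) × (s → ℝ)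

/-- Smooth functions of two real vectors indexed by `s`. -/
def Smooth {V : Type*} (s : Finset V) : Submodule ℂ (Pts s → ℂ) where
  carrier := {h | ContDiff ℝ ∞ h}
  add_mem' {a b} ha hb := by
    have ha : ContDiff ℝ ∞ a := ha
    have hb : ContDiff ℝ ∞ b := hb
    exact ha.add hb
  zero_mem' := by
    have h0 : ContDiff ℝ ∞ (fun _ : Pts s => (0 : ℂ)) := contDiff_const
    exact h0
  smul_mem' c a ha := by
    have ha : ContDiff ℝ ∞ a := ha
    exact ha.const_smul c

theorem Smooth.contDiff {V : Type*} {s : Finset V} (h : Smooth s) :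
    ContDiff ℝ ∞ (h : Pts s → ℂ) := h.2

section Evaluation

variable {V E : Type*} [AddCommGroup E] [Module ℂ E] {s : Finset V}

/-- The standard basis vectors of `Pts s`. -/
def basisVec [DecidableEq V] : s ⊕ s → Pts s
  | .inl i => (Pi.single i 1, 0)
  | .inr i => (0, Pi.single i 1)

/-- The Taylor series, in the nilpotent parts of the even elements `p i` and `q i`, of a smooth
function `h` around the bodies of the `p i` and `q i`. -/
def taylor [DecidableEq V] (p q : s → Alg V E) (h : Pts s → ℂ) : Alg V E :=
  ∑ k ∈ Finset.range (nilDegree (fun c => soul (Sum.elim p q c)) + 1),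
    ((k.factorial : ℂ)⁻¹) • ∑ c : Fin k → s ⊕ s,
      (iteratedFDeriv ℝ k h (fun i => (body (p i)).re, fun i => (body (q i)).re)
          fun l => basisVec (c l)) •
        (List.ofFn fun l => soul (Sum.elim p q (c l))).prod

theorem taylor_add [DecidableEq V] (p q : s → Alg V E) (h₁ h₂ : Smooth s) :
    taylor p q ((h₁ + h₂ : Smooth s) : Pts s → ℂ) = taylor p q h₁ + taylor p q h₂ := by
  simp only [taylor, ← Finset.sum_add_distrib, ← smul_add, ← add_smul]
  refine Finset.sum_congr rfl fun k _ => ?_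
  congr 1
  refine Finset.sum_congr rfl fun c _ => ?_
  congr 1
  have e₁ : ContDiff ℝ k (h₁ : Pts s → ℂ) := (Smooth.contDiff h₁).of_le (by exact_mod_cast le_top)
  have e₂ : ContDiff ℝ k (h₂ : Pts s → ℂ) := (Smooth.contDiff h₂).of_le (by exact_mod_cast le_top)
  rw [Submodule.coe_add, iteratedFDeriv_add e₁ e₂]
  rfl

theorem taylor_smul [DecidableEq V] (p q : s → Alg V E) (r : ℂ) (h : Smooth s) :
    taylor p q ((r • h : Smooth s) : Pts s → ℂ) = r • taylor p q h := by
  simp only [taylor, Finset.smul_sum]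
  refine Finset.sum_congr rfl fun k _ => Finset.sum_congr rfl fun c _ => ?_
  have e : ContDiff ℝ k (h : Pts s → ℂ) := (Smooth.contDiff h).of_le (by exact_mod_cast le_top)
  rw [Submodule.coe_smul, iteratedFDeriv_const_smul_apply e.contDiffAt]
  simp only [_root_.smul_apply, smul_smul, smul_eq_mul]
  congr 1
  ring

/-- Evaluation of a smooth coefficient with values in the parameter algebra: `h ⊗ c` is
mapped to `h(p, q) * c`. -/
def evalCoeff [DecidableEq V] (p q : s → Alg V E) :
    (Smooth s) ⊗[ℂ] (ParAlg E) →ₗ[ℂ] Alg V E :=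
  TensorProduct.lift
    (LinearMap.mk₂ ℂ (fun h c => taylor p q (h : Pts s → ℂ) * par c)
      (fun h₁ h₂ c => by rw [taylor_add, add_mul])
      (fun r h c => by rw [taylor_smul, smul_mul_assoc])
      (fun h c₁ c₂ => by rw [map_add, mul_add])
      (fun r h c => by rw [map_smul, mul_smul_comm]))

variable [LinearOrder V]

/-- The ordered product `∏ i ∈ I, v i`. -/
def oddProd (v : s → Alg V E) (I : Finset s) : Alg V E :=
  ((I.sort (· ≤ ·)).map v).prod

/-- Superfunctions `∑ f I J (p, q) vbar_I v_J` of two even vectors `p, q` and two odd vectors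
`vbar, v` indexed by `s`, with Grassmann parameters: the family of their smooth coefficients
`f I J`. -/
abbrev SuperFun {V : Type*} (s : Finset V) (E : Type*) [AddCommGroup E] [Module ℂ E] : Type _ :=
  Finset s → Finset s → (Smooth s) ⊗[ℂ] (ParAlg E)

/-- The superfunction `f` with even arguments `p, q` and odd arguments `vbar, v` inserted. -/
def SuperFun.eval (f : SuperFun s E) (p q vbar v : s → Alg V E) : Alg V E :=
  ∑ I : Finset s, ∑ J : Finset s, evalCoeff p q (f I J) * oddProd vbar I * oddProd v J

/-- Schwartz functions as smooth functions. -/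
def schwartzToSmooth : SchwartzMap (Pts s) ℂ →ₗ[ℂ] Smooth s where
  toFun h := ⟨h, h.smooth ⊤⟩
  map_add' _ _ := rfl
  map_smul' _ _ := rfl

/-- The coefficients lie in the tensor product of the Schwartz space with the parameter
algebra. -/
def SuperFun.IsSchwartz (f : SuperFun s E) : Prop :=
  ∀ I J, f I J ∈ LinearMap.range (LinearMap.rTensor (ParAlg E)
    (schwartzToSmooth : SchwartzMap (Pts s) ℂ →ₗ[ℂ] Smooth s))

end Evaluation

/-! ### The supersymmetric hyperbolic sigma model on the vertex set `s ∪ {δ}`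

The vertex set is `Option s`, with `δ = none`; `w` is a symmetric matrix of even weights, zero
for pairs of vertices which are not joined by an edge. Sums over edges are written as half the
sum over ordered pairs. -/

section Model

variable {V E : Type*} [AddCommGroup E] [Module ℂ E] {s : Finset V}

/-- Extension of a real vector by the value `0` at `δ`. -/
def ext0 (u : s → ℝ) : Option s → ℝ
  | some i => u i
  | none => 0

/-- The variables `ψbar`, with value `0` at `δ`. -/
def psiBarT : Option s → Alg V E
  | some i => psiBar (i : V)
  | none => 0

/-- The variables `ψ`, with value `0` at `δ`. -/
def psiT : Option s → Alg V E
  | some i => psi (i : V)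
  | none => 0

variable (w : Option s → Option s → ParAlg E)

/-- The matrix `A^w(u)`. -/
def matA [DecidableEq V] (u : s → ℝ) (i j : Option s) : ParAlg E :=
  if i = j then ∑ k, (Real.exp (ext0 u i + ext0 u k) : ℂ) • w i k
  else -((Real.exp (ext0 u i + ext0 u j) : ℂ) • w i j)

/-- The superdensity `ρ^w(u, s, ψbar, ψ)`; `t` denotes the variable `s`. -/
def rho [DecidableEq V] (u t : s → ℝ) : Alg V E :=
  superExp (-((1 / 2 : ℂ) •
      ∑ i, ∑ j, ((ext0 t i * ext0 t j : ℝ) : ℂ) • par (matA w u i j))) *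
    superExp (-∑ i, ∑ j, psiBarT i * par (matA w u i j) * psiT j) *
    superExp (-((1 / 2 : ℂ) •
      ∑ i, ∑ j, ((Real.cosh (ext0 u i - ext0 u j) - 1 : ℝ) : ℂ) • par (w i j)))

/-- The superintegral of `f` with respect to the supermeasure `μ^w` exists and has the value
`I`. -/
def HasSuperIntegral [LinearOrder V] (f : (s → ℝ) → (s → ℝ) → Alg V E) (I : ParAlg E) : Prop :=
  HasWeakIntegral
    (fun p : Pts s => ((∏ i, Real.exp (-p.1 i) / (2 * Real.pi) : ℝ) : ℂ) •
      berezin s (rho w p.1 p.2 * f p.1 p.2))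
    (par I)

/-- `β_i(u)`. -/
def beta (u : s → ℝ) (i : s) : Alg V E :=
  (1 / 2 : ℂ) • ∑ j, (Real.exp (ext0 u j - u i) : ℂ) • par (w (some i) j)

/-- `θ_i(u, s)`. -/
def theta (u t : s → ℝ) (i : s) : Alg V E :=
  ∑ j, ((Real.exp (ext0 u j) * (t i - ext0 t j) : ℝ) : ℂ) • par (w (some i) j)

/-- `φbar_i(u, ψbar)`. -/
def phiBar (u : s → ℝ) (i : s) : Alg V E :=
  ∑ j, (Real.exp (ext0 u j) : ℂ) • (par (w (some i) j) * (psiBar (i : V) - psiBarT j))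

/-- `φ_i(u, ψ)`. -/
def phi (u : s → ℝ) (i : s) : Alg V E :=
  ∑ j, (Real.exp (ext0 u j) : ℂ) • (par (w (some i) j) * (psi (i : V) - psiT j))

/-! ### Cartesian coordinates as functions of the horospherical coordinates -/

def cartX (u t : s → ℝ) (i : Option s) : Alg V E :=
  algebraMap ℂ _ (Real.sinh (ext0 u i) : ℂ) -
    (Real.exp (ext0 u i) : ℂ) •
      (algebraMap ℂ _ (((ext0 t i) ^ 2 / 2 : ℝ) : ℂ) + psiBarT i * psiT i)

def cartY (u t : s → ℝ) (i : Option s) : Alg V E :=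
  algebraMap ℂ _ ((ext0 t i * Real.exp (ext0 u i) : ℝ) : ℂ)

def cartZ (u t : s → ℝ) (i : Option s) : Alg V E :=
  algebraMap ℂ _ (Real.cosh (ext0 u i) : ℂ) +
    (Real.exp (ext0 u i) : ℂ) •
      (algebraMap ℂ _ (((ext0 t i) ^ 2 / 2 : ℝ) : ℂ) + psiBarT i * psiT i)

def cartXi (u : s → ℝ) (i : Option s) : Alg V E := (Real.exp (ext0 u i) : ℂ) • psiBarT i

def cartEta (u : s → ℝ) (i : Option s) : Alg V E := (Real.exp (ext0 u i) : ℂ) • psiT i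

/-- The action `S_cart`, in horospherical coordinates. -/
def actionCart (u t : s → ℝ) : Alg V E :=
  -((1 / 2 : ℂ) • ∑ i, ∑ j, par (w i j) *
    (-1 - cartX u t i * cartX u t j - cartY u t i * cartY u t j + cartZ u t i * cartZ u t j
      - cartXi u i * cartEta u j + cartEta u i * cartXi u j))

/-- A superfunction `f(x, y, ξ, η)` of the cartesian coordinates, written in horospherical
coordinates. -/
def SuperFun.hor [LinearOrder V] (f : SuperFun s E) (u t : s → ℝ) : Alg V E :=
  f.eval (fun i => cartX u t (some i)) (fun i => cartY u t (some i))
    (fun i => cartXi u (some i)) (fun i => cartEta u (some i))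

/-- The space of test functions: superfunctions `f` for which `e^{S_cart} f`, written in
cartesian coordinates, is a superfunction `F` with Schwartz coefficients. -/
def IsTest [LinearOrder V] (f : (s → ℝ) → (s → ℝ) → Alg V E) : Prop :=
  ∃ F : SuperFun s E, F.IsSchwartz ∧
    ∀ u t, superExp (actionCart w u t) * f u t = F.hor u t

end Model

/-! ### Wired boundary conditions -/

section Wired

variable {V E : Type*} [AddCommGroup E] [Module ℂ E]

/-- The finite graph with vertex set `s ∪ {δ}` and wired boundary conditions. -/
def wiredGraph (G : SimpleGraph V) (s : Finset V) : SimpleGraph (Option s) where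
  Adj
    | some i, some j => G.Adj i j
    | some i, none => ∃ j ∉ s, G.Adj i j
    | none, some i => ∃ j ∉ s, G.Adj i j
    | none, none => False
  symm := by
    constructor
    rintro (_ | i) (_ | j) h
    · exact h
    · exact h
    · exact h
    · exact SimpleGraph.Adj.symm h
  loopless := by
    constructor
    rintro (_ | i) h
    · exact h
    · exact G.loopless.irrefl _ h

/-- The weights of `wiredGraph G s`. -/
def wiredWeight (W : V → V → ParAlg E) (s : Finset V) : Option s → Option s → ParAlg E
  | some i, some j => W i j
  | some i, none => weakSum fun j : {j : V // j ∉ s} => W i j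
  | none, some i => weakSum fun j : {j : V // j ∉ s} => W i j
  | none, none => 0

/-- The parameters `α` on `s ∪ {δ}`, where `α_δ = ∑_{j ∉ s} α_j`. -/
def wiredAlpha [DecidableEq V] (α : V →₀ ℝ) (s : Finset V) : Option s → ℝ
  | some i => α i
  | none => ∑ j ∈ α.support \ s, α j

/-- `exp (⟨α, e^u (1 + i s)⟩ + ⟨τ, e^u (ψbar + i ψ)⟩)` on `s ∪ {δ}`. -/
def generatingM [DecidableEq V] (α : V →₀ ℝ) (τ : V → ParAlg E) (s : Finset V)
    (u t : s → ℝ) : Alg V E :=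
  superExp
    (algebraMap ℂ _ (∑ j : Option s,
        (wiredAlpha α s j : ℂ) * (Real.exp (ext0 u j) * (1 + Complex.I * ext0 t j))) +
      ∑ i : s, par (τ i) *
        ((Real.exp (u i) : ℂ) • (psiBar (i : V) + Complex.I • psi (i : V))))

/-- `g(ϖ^{s'}|_s)`, for `s ⊆ s'`: the variables `β, θ, φbar, φ` of the model on `s' ∪ {δ}`, with
indices restricted to `s`, are inserted into `g`. -/
def insertVarpi [LinearOrder V] (W : V → V → ParAlg E) {s s' : Finset V} (h : s ⊆ s')
    (g : SuperFun s E) (u t : s' → ℝ) : Alg V E :=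
  g.eval (fun i => beta (wiredWeight W s') u ⟨i, h i.2⟩)
    (fun i => theta (wiredWeight W s') u t ⟨i, h i.2⟩)
    (fun i => phiBar (wiredWeight W s') u ⟨i, h i.2⟩)
    (fun i => phi (wiredWeight W s') u ⟨i, h i.2⟩)

end Wired

end SusySigma

end

/-!
The point `δ` of the graph on `Vn n` carries everything outside `Vn n`. Going from `Vn (n + 1)`
to `Vn n`, the vertices of the difference are removed one at a time: if `a ∉ s`, identifying `a`
with `δ` turns the wired weights on `insert a s` into those on `s` (`contract_wiredWeight`), so it
is enough to integrate out the variables at `a` (`IsPosWeight.density_insert`).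

*Real weights.* Let `H = 2β - W` be the matrix `Hmat` on `s`, which only depends on the variables
`β i` with `i ∈ s`, let `W_a` be the vector of the weights of the edges from `s` to `a`, and let
`κ = H⁻¹ W_a`. The substitution
`e^{u_i} ↦ e^{u_i} + κ_i (1 - e^{u_a})`, `e^{u_i} s_i ↦ e^{u_i} s_i - κ_i e^{u_a} s_a`,
and its analogue for `ψbar`, `ψ`, leads from the model on `insert a s` to the model on `s` and
preserves `β`, `θ`, `φbar`, `φ` on `s` (`IsElim`, `elimPts`). Completing the square, the
superdensity becomes the superdensity on `s` times a kernel in the variables at `a` with a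
parameter `c`, a Schur complement; the Grassmann variables at `a` can be integrated out because
the Berezin integral transforms in a simple way under triangular substitutions
(`IsElim.density_eq`, `berezin_shear`). The factor of `M` which contains `α` becomes the same factor
on `s` times an exponential of the variables at `a` (`alphaExp_elim`), and the kernel times this
exponential has integral `1` (`integral_elimKernel`). The part of the substitution which acts on
`u` preserves Lebesgue measure: composed with `u ↦ β` it is the map `u ↦ β` for another boundary
weight, and the Jacobians of the two maps `u ↦ β` only depend on `β` and the weights on `s`
(`measurePreserving_elimU`). Together this gives `integral_elim_alphaExp`.

*Grassmann weights.* The even nilpotent part of the weights is a sum of even elements with square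
zero. Hence the weights arise from an affine family of real weights by giving its finitely many
real parameters `t` nilpotent values (`IsFamily`, `subst`, `IsPosWeight.exists_family`), and the
integrand on either side arises in the same way from the integrand with real weights
(`IsSuperExt`, `IsFamily.isSuperExt_density`). Such an extension only depends on the germ of the
family at `t = 0` (`IsSuperExt.unique`) and can be interchanged with the integral
(`integral_subst`), so the identity for real weights near the bodies is all that is needed.

*Existence.* In the coordinates `(sinh u, s)` the integrand of an admissible superfunction is a sum
of Schwartz functions with coefficients in the Grassmann algebra (`sinhSchwartz`,
`IsTest.density_mem`). Reinserting a vertex preserves this property, also jointly in the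
parameters `t`: the elimination map and the other quantities have temperate growth, and the
exponent of the kernel, where `c` is bounded below by a negative power of the size of the variables
on `s`, yields decay in the removed directions (`elim_control`,
`exists_schwartz_elim`). The value lies in the algebra of the parameters since the Berezin
integral removes all other generators (`density_mem_range`, `HasWeakIntegral.mem`).
-/

noncomputable section

set_option linter.unusedSectionVars false

namespace SusySigma

/-! ### Even and odd elements of a Grassmann algebra -/

section Parity

variable {F : Type*} [AddCommGroup F] [Module ℂ F]

theorem isEven_algebraMap (c : ℂ) : IsEven (algebraMap ℂ (ExteriorAlgebra ℂ F) c) :=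
  SetLike.algebraMap_mem_graded (CliffordAlgebra.evenOdd (0 : QuadraticForm ℂ F)) c

theorem IsEven.add {a b : ExteriorAlgebra ℂ F} (ha : IsEven a) (hb : IsEven b) :
    IsEven (a + b) := Submodule.add_mem _ ha hb

theorem IsEven.neg {a : ExteriorAlgebra ℂ F} (ha : IsEven a) : IsEven (-a) :=
  Submodule.neg_mem _ ha

theorem IsEven.sub {a b : ExteriorAlgebra ℂ F} (ha : IsEven a) (hb : IsEven b) :
    IsEven (a - b) := Submodule.sub_mem _ ha hb

theorem IsEven.smul {a : ExteriorAlgebra ℂ F} (c : ℂ) (ha : IsEven a) : IsEven (c • a) :=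
  Submodule.smul_mem _ c ha

theorem IsEven.sum {ι : Type*} {s : Finset ι} {f : ι → ExteriorAlgebra ℂ F}
    (h : ∀ i ∈ s, IsEven (f i)) : IsEven (∑ i ∈ s, f i) := Submodule.sum_mem _ h

theorem IsOdd.add {a b : ExteriorAlgebra ℂ F} (ha : IsOdd a) (hb : IsOdd b) :
    IsOdd (a + b) := Submodule.add_mem _ ha hb

theorem IsOdd.smul {a : ExteriorAlgebra ℂ F} (c : ℂ) (ha : IsOdd a) : IsOdd (c • a) :=
  Submodule.smul_mem _ c ha

theorem IsOdd.sum {ι : Type*} {s : Finset ι} {f : ι → ExteriorAlgebra ℂ F}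
    (h : ∀ i ∈ s, IsOdd (f i)) : IsOdd (∑ i ∈ s, f i) := Submodule.sum_mem _ h

theorem isOdd_ι (v : F) : IsOdd (ExteriorAlgebra.ι ℂ v) :=
  CliffordAlgebra.ι_mem_evenOdd_one _ v

theorem IsEven.mul {a b : ExteriorAlgebra ℂ F} (ha : IsEven a) (hb : IsEven b) :
    IsEven (a * b) := by
  have := SetLike.mul_mem_graded (A := CliffordAlgebra.evenOdd (0 : QuadraticForm ℂ F)) ha hb
  simpa [IsEven] using this

theorem IsOdd.mul {a b : ExteriorAlgebra ℂ F} (ha : IsOdd a) (hb : IsOdd b) :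
    IsEven (a * b) := by
  have := SetLike.mul_mem_graded (A := CliffordAlgebra.evenOdd (0 : QuadraticForm ℂ F)) ha hb
  rwa [show (1 : ZMod 2) + 1 = 0 from rfl] at this

theorem IsEven.mul_odd {a b : ExteriorAlgebra ℂ F} (ha : IsEven a) (hb : IsOdd b) :
    IsOdd (a * b) := by
  have := SetLike.mul_mem_graded (A := CliffordAlgebra.evenOdd (0 : QuadraticForm ℂ F)) ha hb
  simpa [IsOdd] using this

theorem IsEven.pow {a : ExteriorAlgebra ℂ F} (ha : IsEven a) (k : ℕ) : IsEven (a ^ k) := by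
  induction k with
  | zero => simpa using isEven_algebraMap (F := F) 1
  | succ k ih => rw [pow_succ]; exact ih.mul ha

theorem ι_mul_swap (v w : F) : ExteriorAlgebra.ι ℂ v * ExteriorAlgebra.ι ℂ w =
    -(ExteriorAlgebra.ι ℂ w * ExteriorAlgebra.ι ℂ v) :=
  eq_neg_of_add_eq_zero_left (ExteriorAlgebra.ι_add_mul_swap v w)

theorem IsEven.commute_ι {a : ExteriorAlgebra ℂ F} (ha : IsEven a) (v : F) :
    Commute a (ExteriorAlgebra.ι ℂ v) := by
  induction a, ha using CliffordAlgebra.even_induction with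
  | algebraMap r => exact Algebra.commutes r _
  | add x y hx hy h1 h2 => exact h1.add_left h2
  | ι_mul_ι_mul m₁ m₂ x hx h =>
    refine Commute.mul_left ?_ h
    change ExteriorAlgebra.ι ℂ m₁ * ExteriorAlgebra.ι ℂ m₂ * ExteriorAlgebra.ι ℂ v =
      ExteriorAlgebra.ι ℂ v * (ExteriorAlgebra.ι ℂ m₁ * ExteriorAlgebra.ι ℂ m₂)
    rw [mul_assoc, ι_mul_swap m₂ v, mul_neg, ← mul_assoc, ι_mul_swap m₁ v, neg_mul, neg_neg,
      mul_assoc]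

/-- Even elements are central. -/
theorem IsEven.commute {a : ExteriorAlgebra ℂ F} (ha : IsEven a) (b : ExteriorAlgebra ℂ F) :
    Commute a b := by
  induction b using ExteriorAlgebra.induction with
  | algebraMap r => exact (Algebra.commutes r a).symm
  | ι v => exact ha.commute_ι v
  | mul x y hx hy => exact hx.mul_right hy
  | add x y hx hy => exact hx.add_right hy

theorem IsOdd.ι_mul {b : ExteriorAlgebra ℂ F} (hb : IsOdd b) (v : F) :
    ExteriorAlgebra.ι ℂ v * b = -(b * ExteriorAlgebra.ι ℂ v) := by
  induction b, hb using CliffordAlgebra.odd_induction with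
  | ι w => exact ι_mul_swap v w
  | add x y hx hy h1 h2 => rw [mul_add, add_mul, h1, h2, neg_add]
  | ι_mul_ι_mul m₁ m₂ x hx h =>
    have := IsEven.commute_ι (a := ExteriorAlgebra.ι ℂ m₁ * ExteriorAlgebra.ι ℂ m₂)
      ((isOdd_ι m₁).mul (isOdd_ι m₂)) v
    change ExteriorAlgebra.ι ℂ v * (ExteriorAlgebra.ι ℂ m₁ * ExteriorAlgebra.ι ℂ m₂ * x) =
      -(ExteriorAlgebra.ι ℂ m₁ * ExteriorAlgebra.ι ℂ m₂ * x * ExteriorAlgebra.ι ℂ v)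
    rw [← mul_assoc, ← this.eq, mul_assoc, h, mul_neg]; simp only [mul_assoc]

/-- Odd elements anticommute. -/
theorem IsOdd.mul_swap {a b : ExteriorAlgebra ℂ F} (ha : IsOdd a) (hb : IsOdd b) :
    a * b = -(b * a) := by
  induction a, ha using CliffordAlgebra.odd_induction with
  | ι w => exact hb.ι_mul w
  | add x y hx hy h1 h2 => rw [mul_add, add_mul, h1, h2, neg_add]
  | ι_mul_ι_mul m₁ m₂ x hx h =>
    have := IsEven.commute (a := ExteriorAlgebra.ι ℂ m₁ * ExteriorAlgebra.ι ℂ m₂)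
      ((isOdd_ι m₁).mul (isOdd_ι m₂)) b
    change ExteriorAlgebra.ι ℂ m₁ * ExteriorAlgebra.ι ℂ m₂ * x * b =
      -(b * (ExteriorAlgebra.ι ℂ m₁ * ExteriorAlgebra.ι ℂ m₂ * x))
    rw [mul_assoc, h, mul_neg, ← mul_assoc, this.eq, mul_assoc]

theorem IsOdd.mul_self {a : ExteriorAlgebra ℂ F} (ha : IsOdd a) : a * a = 0 := by
  have h := ha.mul_swap ha
  have h2 : (2 : ℂ) • (a * a) = 0 := by
    rw [two_smul]; nth_rewrite 1 [h]; exact neg_add_cancel _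
  simpa using h2

/-- The product of two odd elements squares to zero. -/
theorem IsOdd.mul_mul_self {a b : ExteriorAlgebra ℂ F} (ha : IsOdd a) (hb : IsOdd b) :
    a * b * (a * b) = 0 := by
  rw [← mul_assoc, ((ha.mul hb).commute a).eq, ← mul_assoc a a b, ha.mul_self]; simp

/-! ### Body and soul -/

@[simp] theorem body_algebraMap (c : ℂ) : body (algebraMap ℂ (ExteriorAlgebra ℂ F) c) = c :=
  ExteriorAlgebra.algebraMap_leftInverse F c

@[simp] theorem body_add (a b : ExteriorAlgebra ℂ F) : body (a + b) = body a + body b :=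
  map_add _ _ _

@[simp] theorem body_mul (a b : ExteriorAlgebra ℂ F) : body (a * b) = body a * body b :=
  map_mul _ _ _

@[simp] theorem body_smul (c : ℂ) (a : ExteriorAlgebra ℂ F) : body (c • a) = c * body a :=
  map_smul ExteriorAlgebra.algebraMapInv c a

@[simp] theorem body_zero : body (0 : ExteriorAlgebra ℂ F) = 0 := map_zero _

@[simp] theorem body_one : body (1 : ExteriorAlgebra ℂ F) = 1 := map_one _

@[simp] theorem body_ι (v : F) : body (ExteriorAlgebra.ι ℂ v) = 0 := by
  simp [body, ExteriorAlgebra.algebraMapInv]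

theorem IsOdd.body_eq_zero {a : ExteriorAlgebra ℂ F} (ha : IsOdd a) : body a = 0 := by
  have := congrArg body ha.mul_self
  simpa using this

@[simp] theorem soul_algebraMap (c : ℂ) : soul (algebraMap ℂ (ExteriorAlgebra ℂ F) c) = 0 := by
  simp [soul]

theorem soul_add (a b : ExteriorAlgebra ℂ F) : soul (a + b) = soul a + soul b := by
  simp only [soul, body_add, map_add]; abel

theorem soul_eq_self {a : ExteriorAlgebra ℂ F} (h : body a = 0) : soul a = a := by
  simp [soul, h]

theorem IsEven.soul {a : ExteriorAlgebra ℂ F} (ha : IsEven a) : IsEven (soul a) :=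
  ha.sub (isEven_algebraMap _)

theorem algebraMap_body_add_soul (a : ExteriorAlgebra ℂ F) :
    algebraMap ℂ _ (body a) + SusySigma.soul a = a := by simp [SusySigma.soul]

/-- The soul of an even element is a sum of even elements with square zero, since this holds
for multiples of a product of two generators. -/
theorem IsEven.exists_sqZero {a : ExteriorAlgebra ℂ F} (ha : IsEven a) :
    ∃ l : List (ExteriorAlgebra ℂ F), (∀ m ∈ l, IsEven m ∧ m * m = 0) ∧ SusySigma.soul a = l.sum := by
  suffices h : ∃ (c : ℂ) (l : List (ExteriorAlgebra ℂ F)),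
      (∀ m ∈ l, IsEven m ∧ m * m = 0) ∧ a = algebraMap ℂ _ c + l.sum by
    obtain ⟨c, l, hl, rfl⟩ := h
    refine ⟨l, hl, ?_⟩
    have hb : body l.sum = 0 := by
      have : ∀ m ∈ l, body m = 0 := fun m hm => by
        simpa using congrArg body (hl m hm).2
      clear hl ha
      induction l with
      | nil => simp
      | cons m l ih => simp_all
    rw [soul_add, soul_algebraMap, zero_add, soul_eq_self hb]
  induction a, ha using CliffordAlgebra.even_induction with
  | algebraMap r => exact ⟨r, [], by simp, by simp⟩
  | add x y hx hy h1 h2 =>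
    obtain ⟨c, l, hl, e⟩ := h1
    obtain ⟨c', l', hl', e'⟩ := h2
    refine ⟨c + c', l ++ l', ?_, ?_⟩
    · intro m hm
      rcases List.mem_append.1 hm with h | h
      exacts [hl m h, hl' m h]
    · rw [e, e', List.sum_append, map_add]; abel
  | ι_mul_ι_mul m₁ m₂ x hx h =>
    obtain ⟨c, l, hl, e⟩ := h
    set p : ExteriorAlgebra ℂ F := ExteriorAlgebra.ι ℂ m₁ * ExteriorAlgebra.ι ℂ m₂ with hp
    have hpe : IsEven p := (isOdd_ι m₁).mul (isOdd_ι m₂)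
    have hpp : p * p = 0 := (isOdd_ι m₁).mul_mul_self (isOdd_ι m₂)
    refine ⟨0, (c • p) :: l.map (p * ·), ?_, ?_⟩
    · intro m hm
      rcases List.mem_cons.1 hm with rfl | hm
      · exact ⟨hpe.smul c, by simp [hpp]⟩
      · obtain ⟨k, hk, rfl⟩ := List.mem_map.1 hm
        refine ⟨hpe.mul (hl k hk).1, ?_⟩
        show p * k * (p * k) = 0
        rw [mul_assoc, ← mul_assoc k p k, ← (hpe.commute k).eq, mul_assoc p k k, (hl k hk).2]
        simp
    · change p * x = _
      rw [e, map_zero, zero_add, List.sum_cons, mul_add, List.sum_map_mul_left, List.map_id',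
        ← Algebra.commutes, Algebra.smul_def]

end Parity

/-! ### Products of many elements with square zero -/

section Nilpotent

variable {A : Type*} [Ring A] [Algebra ℂ A]

theorem ideal_pow_eq_zero_of_sq {R : Type*} [CommRing R] (l : List R) (hsq : ∀ m ∈ l, m * m = 0) :
    Ideal.span {m | m ∈ l} ^ (2 * l.length + 1) = ⊥ := by
  induction l with
  | nil => simp
  | cons m l ih =>
    have e : Ideal.span {k | k ∈ m :: l} = Ideal.span {m} ⊔ Ideal.span {k | k ∈ l} := by
      rw [← Ideal.span_union]; congr 1; ext k; simp
    have h1 : Ideal.span {m} ^ 2 = ⊥ := by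
      rw [Ideal.span_singleton_pow, pow_two, hsq m (by simp), Ideal.span_singleton_eq_bot]
    rw [e, ← le_bot_iff]
    have : 2 * (m :: l).length + 1 = 2 + (2 * l.length + 1) := by simp; ring
    rw [this]
    refine Ideal.sup_pow_add_le_pow_sup_pow.trans ?_
    rw [h1, ih fun k hk => hsq k (by simp [hk])]; simp

/-- A product of more than `2 * l.length` linear combinations of the central elements with
square zero in `l` vanishes. -/
theorem list_prod_eq_zero_of_sqZero (l : List A) (hc : ∀ m ∈ l, ∀ b, Commute m b)
    (hsq : ∀ m ∈ l, m * m = 0) (ms : List A) (hms : ∀ m ∈ ms, m ∈ Submodule.span ℂ {k | k ∈ l})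
    (hlen : 2 * l.length < ms.length) : ms.prod = 0 := by
  let Z := Subalgebra.center ℂ A
  have hcen : ∀ m, (∀ b, Commute m b) → m ∈ Z := fun m h =>
    Subalgebra.mem_center_iff.2 fun b => ((h b).eq).symm
  let lZ : List Z := l.attach.map fun m => ⟨m.1, hcen _ (hc m.1 m.2)⟩
  have hlZ : ∀ m (hm : m ∈ l), (⟨m, hcen _ (hc m hm)⟩ : Z) ∈ lZ := fun m hm =>
    List.mem_map.2 ⟨⟨m, hm⟩, List.mem_attach _ _, rfl⟩
  have hlen' : lZ.length = l.length := by simp [lZ]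
  have hI := ideal_pow_eq_zero_of_sq lZ (by
    intro m hm
    obtain ⟨k, -, rfl⟩ := List.mem_map.1 hm
    exact Subtype.ext (hsq k.1 k.2))
  have key : ∀ m ∈ Submodule.span ℂ {k | k ∈ l}, ∃ z : Z, z ∈ Ideal.span {m | m ∈ lZ} ∧ (z : A) = m := by
    intro m hm
    induction hm using Submodule.span_induction with
    | mem k hk => exact ⟨_, Ideal.subset_span (hlZ k hk), rfl⟩
    | zero => exact ⟨0, zero_mem _, rfl⟩
    | add x y _ _ h1 h2 =>
      obtain ⟨z, hz, rfl⟩ := h1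
      obtain ⟨z', hz', rfl⟩ := h2
      exact ⟨z + z', add_mem hz hz', rfl⟩
    | smul c x _ h =>
      obtain ⟨z, hz, rfl⟩ := h
      exact ⟨c • z, Submodule.smul_of_tower_mem _ c hz, rfl⟩
  have main : ∀ ms : List A, (∀ m ∈ ms, m ∈ Submodule.span ℂ {k | k ∈ l}) →
      ∃ z : Z, z ∈ Ideal.span {m | m ∈ lZ} ^ ms.length ∧ (z : A) = ms.prod := by
    intro ms hms
    induction ms with
    | nil => exact ⟨1, by simp, rfl⟩
    | cons m ms ih =>
      obtain ⟨z, hz, e⟩ := ih fun k hk => hms k (by simp [hk])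
      obtain ⟨y, hy, e'⟩ := key m (hms m (by simp))
      refine ⟨y * z, ?_, by simp [e, e']⟩
      rw [List.length_cons, pow_succ']
      exact Ideal.mul_mem_mul hy hz
  obtain ⟨z, hz, e⟩ := main ms hms
  have := Ideal.pow_le_pow_right (I := Ideal.span {m | m ∈ lZ})
    (show 2 * lZ.length + 1 ≤ ms.length by omega) hz
  rw [hI, Ideal.mem_bot] at this
  rw [← e, this]; rfl

theorem pow_eq_zero_of_sqZero (l : List A) (hc : ∀ m ∈ l, ∀ b, Commute m b)
    (hsq : ∀ m ∈ l, m * m = 0) {x : A} (hx : x ∈ Submodule.span ℂ {k | k ∈ l}) {N : ℕ}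
    (hN : 2 * l.length < N) : x ^ N = 0 := by
  have := list_prod_eq_zero_of_sqZero l hc hsq (List.replicate N x)
    (fun m hm => by rw [List.eq_of_mem_replicate hm]; exact hx) (by simpa using hN)
  simpa using this

end Nilpotent

/-! ### The exponential of even elements -/

section Exp

variable {F F' : Type*} [AddCommGroup F] [Module ℂ F] [AddCommGroup F'] [Module ℂ F']

theorem IsEven.isNilpotent_soul {a : ExteriorAlgebra ℂ F} (ha : IsEven a) :
    IsNilpotent (SusySigma.soul a) := by
  obtain ⟨l, hl, e⟩ := ha.exists_sqZero
  refine ⟨2 * l.length + 1, pow_eq_zero_of_sqZero l (fun m hm => (hl m hm).1.commute)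
    (fun m hm => (hl m hm).2) ?_ (by omega)⟩
  rw [e]
  exact list_sum_mem fun m hm => Submodule.subset_span hm

theorem superExp_eq_sum {a : ExteriorAlgebra ℂ F} {N : ℕ} (h : soul a ^ N = 0) :
    superExp a = Complex.exp (body a) •
      ∑ k ∈ Finset.range N, ((k.factorial : ℂ)⁻¹) • soul a ^ k := by
  unfold superExp
  congr 1
  refine Finset.sum_subset ?_ ?_
  · intro k hk
    have := Nat.sInf_le (s := {k | soul a ^ k = 0}) h
    rw [Finset.mem_range] at hk ⊢
    exact lt_of_lt_of_le hk this
  · intro k _ hk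
    have hne : IsNilpotent (soul a) := ⟨N, h⟩
    have := pow_nilpotencyClass hne
    rw [Finset.mem_range, not_lt] at hk
    rw [pow_eq_zero_of_le hk this, smul_zero]

theorem superExp_add {a b : ExteriorAlgebra ℂ F} (ha : IsEven a) (hb : IsEven b) :
    superExp (a + b) = superExp a * superExp b := by
  let _ : Module ℚ (ExteriorAlgebra ℂ F) := Module.compHom _ (algebraMap ℚ ℂ)
  have key : ∀ x : ExteriorAlgebra ℂ F, superExp x = Complex.exp (body x) • IsNilpotent.exp (soul x) := by
    intro x
    unfold superExp IsNilpotent.exp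
    congr 1
    refine Finset.sum_congr rfl fun k _ => ?_
    have : ∀ (q : ℚ) (y : ExteriorAlgebra ℂ F), q • y = (q : ℂ) • y := fun q y => rfl
    rw [this]; simp
  rw [key, key, key, soul_add, body_add, Complex.exp_add,
    IsNilpotent.exp_add_of_commute (ha.soul.commute _) ha.isNilpotent_soul hb.isNilpotent_soul,
    smul_mul_smul_comm]

@[simp] theorem superExp_algebraMap (c : ℂ) :
    superExp (algebraMap ℂ (ExteriorAlgebra ℂ F) c) = algebraMap ℂ _ (Complex.exp c) := by
  rw [superExp_eq_sum (N := 1) (by simp)]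
  simp [Algebra.algebraMap_eq_smul_one]

theorem superExp_of_sq {a : ExteriorAlgebra ℂ F} (h : a * a = 0) : superExp a = 1 + a := by
  have hb : body a = 0 := by simpa using congrArg body h
  rw [superExp_eq_sum (N := 2) (by rw [soul_eq_self hb, pow_two, h]), soul_eq_self hb]
  simp [Finset.sum_range_succ, hb]

theorem superExp_list_sum (l : List (ExteriorAlgebra ℂ F)) (h : ∀ m ∈ l, IsEven m) :
    superExp l.sum = (l.map superExp).prod := by
  induction l with
  | nil => simpa using superExp_algebraMap (F := F) 0
  | cons m l ih =>
    have : l.sum ∈ CliffordAlgebra.evenOdd (0 : QuadraticForm ℂ F) 0 :=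
      list_sum_mem fun k hk => h k (List.mem_cons_of_mem _ hk)
    rw [List.sum_cons, superExp_add (h m (by simp)) this, ih fun k hk => h k (by simp [hk])]
    simp

/-- Algebra homomorphisms which preserve the body are compatible with the exponential. -/
theorem map_superExp (f : ExteriorAlgebra ℂ F →ₐ[ℂ] ExteriorAlgebra ℂ F')
    (hf : ∀ x, body (f x) = body x) {a : ExteriorAlgebra ℂ F} (ha : IsEven a) :
    superExp (f a) = f (superExp a) := by
  obtain ⟨N, hN⟩ := ha.isNilpotent_soul
  have hs : soul (f a) = f (soul a) := by simp [soul, hf]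
  rw [superExp_eq_sum (N := N) (by rw [hs, ← map_pow, hN, map_zero]), superExp_eq_sum hN, hs, hf]
  simp [map_sum, map_smul]

theorem superExp_mem {S : Subalgebra ℂ (ExteriorAlgebra ℂ F)} {a : ExteriorAlgebra ℂ F}
    (ha : a ∈ S) : superExp a ∈ S := by
  have hs : soul a ∈ S := S.sub_mem ha (S.algebraMap_mem _)
  exact S.smul_mem (S.sum_mem fun k _ => S.smul_mem (S.pow_mem hs k) _) _

theorem body_map (L : F →ₗ[ℂ] F') (x : ExteriorAlgebra ℂ F) :
    body (ExteriorAlgebra.map L x) = body x := by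
  induction x using ExteriorAlgebra.induction with
  | algebraMap r => simp
  | ι v => simp
  | mul x y hx hy => simp [hx, hy]
  | add x y hx hy => simp [hx, hy]

theorem IsEven.map {a : ExteriorAlgebra ℂ F} (ha : IsEven a) (L : F →ₗ[ℂ] F') :
    IsEven (ExteriorAlgebra.map L a) := by
  induction a, ha using CliffordAlgebra.even_induction with
  | algebraMap r =>
    exact (AlgHom.commutes (ExteriorAlgebra.map L) r).symm ▸ isEven_algebraMap r
  | add x y hx hy h1 h2 => rw [map_add]; exact h1.add h2
  | ι_mul_ι_mul m₁ m₂ x hx h =>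
    change IsEven (ExteriorAlgebra.map L (ExteriorAlgebra.ι ℂ m₁ * ExteriorAlgebra.ι ℂ m₂ * x))
    simp only [map_mul, ExteriorAlgebra.map_apply_ι]
    exact ((isOdd_ι _).mul (isOdd_ι _)).mul h

theorem IsOdd.map {a : ExteriorAlgebra ℂ F} (ha : IsOdd a) (L : F →ₗ[ℂ] F') :
    IsOdd (ExteriorAlgebra.map L a) := by
  induction a, ha using CliffordAlgebra.odd_induction with
  | ι v =>
    change IsOdd (ExteriorAlgebra.map L (ExteriorAlgebra.ι ℂ v))
    rw [ExteriorAlgebra.map_apply_ι]; exact isOdd_ι _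
  | add x y hx hy h1 h2 => rw [map_add]; exact h1.add h2
  | ι_mul_ι_mul m₁ m₂ x hx h =>
    change IsOdd (ExteriorAlgebra.map L (ExteriorAlgebra.ι ℂ m₁ * ExteriorAlgebra.ι ℂ m₂ * x))
    simp only [map_mul, ExteriorAlgebra.map_apply_ι]
    exact ((isOdd_ι _).mul (isOdd_ι _)).mul_odd h

end Exp

/-! ### Grassmann derivatives and the Berezin integral -/

section Contract

variable {F F' : Type*} [AddCommGroup F] [Module ℂ F] [AddCommGroup F'] [Module ℂ F']

/-- The dual of the space of generators. -/
abbrev GenDual (F : Type*) [AddCommGroup F] [Module ℂ F] : Type _ := Module.Dual ℂ F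

/-- The subspaces of the space of generators. -/
abbrev GenSubspace (F : Type*) [AddCommGroup F] [Module ℂ F] : Type _ := Submodule ℂ F

/-- The left Grassmann derivative in the direction of a dual vector. -/
abbrev gderiv (d : Module.Dual ℂ F) : Module.End ℂ (ExteriorAlgebra ℂ F) :=
  CliffordAlgebra.contractLeft d

theorem gderiv_ι_mul (d : Module.Dual ℂ F) (v : F) (b : ExteriorAlgebra ℂ F) :
    gderiv d (ExteriorAlgebra.ι ℂ v * b) = d v • b - ExteriorAlgebra.ι ℂ v * gderiv d b :=
  CliffordAlgebra.contractLeft_ι_mul (Q := (0 : QuadraticForm ℂ F)) (d := d) v b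

theorem gderiv_algebraMap (d : Module.Dual ℂ F) (c : ℂ) :
    gderiv d (algebraMap ℂ (ExteriorAlgebra ℂ F) c) = 0 :=
  CliffordAlgebra.contractLeft_algebraMap (Q := (0 : QuadraticForm ℂ F)) (d := d) c

theorem gderiv_gderiv (d : Module.Dual ℂ F) (x : ExteriorAlgebra ℂ F) :
    gderiv d (gderiv d x) = 0 :=
  CliffordAlgebra.contractLeft_contractLeft (Q := (0 : QuadraticForm ℂ F)) (d := d) x

theorem gderiv_comm (d d' : Module.Dual ℂ F) (x : ExteriorAlgebra ℂ F) :
    gderiv d (gderiv d' x) = -gderiv d' (gderiv d x) :=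
  CliffordAlgebra.contractLeft_comm (Q := (0 : QuadraticForm ℂ F)) (d := d) (d' := d') x

/-- The product rule for an even first factor without derivative. -/
theorem gderiv_even_mul (d : Module.Dual ℂ F) {a : ExteriorAlgebra ℂ F} (ha : IsEven a)
    (b : ExteriorAlgebra ℂ F) : gderiv d (a * b) = gderiv d a * b + a * gderiv d b := by
  induction a, ha using CliffordAlgebra.even_induction with
  | algebraMap r =>
    change gderiv d (algebraMap ℂ (ExteriorAlgebra ℂ F) r * b) =
      gderiv d (algebraMap ℂ (ExteriorAlgebra ℂ F) r) * b +
        algebraMap ℂ (ExteriorAlgebra ℂ F) r * gderiv d b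
    rw [gderiv_algebraMap, zero_mul, zero_add, ← Algebra.smul_def, map_smul, Algebra.smul_def]
  | add x y hx hy h1 h2 =>
    rw [add_mul, map_add, h1, h2, map_add, add_mul, add_mul]; abel
  | ι_mul_ι_mul m₁ m₂ x hx h =>
    change gderiv d (ExteriorAlgebra.ι ℂ m₁ * ExteriorAlgebra.ι ℂ m₂ * x * b) =
      gderiv d (ExteriorAlgebra.ι ℂ m₁ * ExteriorAlgebra.ι ℂ m₂ * x) * b +
        ExteriorAlgebra.ι ℂ m₁ * ExteriorAlgebra.ι ℂ m₂ * x * gderiv d b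
    simp only [mul_assoc, gderiv_ι_mul] at h ⊢
    rw [h]
    simp only [mul_sub, sub_mul, mul_add, smul_mul_assoc, mul_smul_comm, mul_assoc]
    abel

theorem gderiv_map (d : Module.Dual ℂ F') (L : F →ₗ[ℂ] F') (x : ExteriorAlgebra ℂ F) :
    gderiv d (ExteriorAlgebra.map L x) = ExteriorAlgebra.map L (gderiv (d.comp L) x) := by
  induction x using CliffordAlgebra.left_induction with
  | algebraMap r =>
    change gderiv d (ExteriorAlgebra.map L (algebraMap ℂ (ExteriorAlgebra ℂ F) r)) =
      ExteriorAlgebra.map L (gderiv (d.comp L) (algebraMap ℂ (ExteriorAlgebra ℂ F) r))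
    rw [gderiv_algebraMap, AlgHom.commutes, gderiv_algebraMap, map_zero]
  | add x y hx hy => simp only [map_add, hx, hy]
  | ι_mul x v hx =>
    change gderiv d (ExteriorAlgebra.map L (ExteriorAlgebra.ι ℂ v * x)) =
      ExteriorAlgebra.map L (gderiv (d.comp L) (ExteriorAlgebra.ι ℂ v * x))
    rw [gderiv_ι_mul, map_mul, ExteriorAlgebra.map_apply_ι, gderiv_ι_mul, hx]
    simp

/-- The subalgebra generated by a subspace of the generators. -/
def genSub (N : Submodule ℂ F) : Subalgebra ℂ (ExteriorAlgebra ℂ F) :=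
  Algebra.adjoin ℂ (ExteriorAlgebra.ι ℂ '' (N : Set F))

theorem ι_mem_genSub {N : Submodule ℂ F} {v : F} (h : v ∈ N) :
    ExteriorAlgebra.ι ℂ v ∈ genSub N := Algebra.subset_adjoin ⟨v, h, rfl⟩

theorem gderiv_mul_of_mem_genSub {N : Submodule ℂ F} {d : Module.Dual ℂ F}
    (hd : ∀ v ∈ N, d v = 0) {x : ExteriorAlgebra ℂ F} (hx : x ∈ genSub N) :
    ∀ y, gderiv d y = 0 → gderiv d (x * y) = 0 := by
  induction hx using Algebra.adjoin_induction with
  | mem x hx =>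
    obtain ⟨v, hv, rfl⟩ := hx
    intro y hy
    rw [gderiv_ι_mul, hd v hv, hy]; simp
  | algebraMap r =>
    intro y hy
    rw [← Algebra.smul_def, map_smul, hy, smul_zero]
  | add x y _ _ h1 h2 => intro z hz; rw [add_mul, map_add, h1 z hz, h2 z hz, add_zero]
  | mul x y _ _ h1 h2 => intro z hz; rw [mul_assoc]; exact h1 _ (h2 z hz)

theorem gderiv_eq_zero_of_mem_genSub {N : Submodule ℂ F} {d : Module.Dual ℂ F}
    (hd : ∀ v ∈ N, d v = 0) {x : ExteriorAlgebra ℂ F} (hx : x ∈ genSub N) : gderiv d x = 0 := by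
  have := gderiv_mul_of_mem_genSub hd hx 1 (by simp)
  simpa using this

/-- Two derivatives commute with multiplication from the left by an element which does not
contain the corresponding generators. -/
theorem gderiv_gderiv_mul {N : Submodule ℂ F} {d d' : Module.Dual ℂ F}
    (hd : ∀ v ∈ N, d v = 0) (hd' : ∀ v ∈ N, d' v = 0) {x : ExteriorAlgebra ℂ F}
    (hx : x ∈ genSub N) :
    ∀ y, gderiv d (gderiv d' (x * y)) = x * gderiv d (gderiv d' y) := by
  induction hx using Algebra.adjoin_induction with
  | mem x hx =>
    obtain ⟨v, hv, rfl⟩ := hx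
    intro y
    rw [gderiv_ι_mul, hd' v hv, zero_smul, zero_sub, map_neg, gderiv_ι_mul, hd v hv]; simp
  | algebraMap r => intro y; simp only [← Algebra.smul_def, map_smul]
  | add x y _ _ h1 h2 => intro z; simp only [add_mul, map_add, h1, h2]
  | mul x y _ _ h1 h2 => intro z; rw [mul_assoc, h1, h2, mul_assoc]

/-- A derivative removes its generator. -/
theorem gderiv_mem_genSub {N N₀ : Submodule ℂ F} {d : Module.Dual ℂ F} {e : F}
    (hd : ∀ v ∈ N₀, d v = 0) (hN : ∀ v ∈ N, v - d v • e ∈ N₀) (hde : d e = 1)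
    {x : ExteriorAlgebra ℂ F} (hx : x ∈ genSub N) : gderiv d x ∈ genSub N₀ := by
  -- modulo the relation `e * e = 0`, every product of generators in `N` has the normal form
  -- `z₀ + e * z₁` with coefficients which do not contain `e`
  have main : ∀ y, (∃ y₀ ∈ genSub N₀, ∃ y₁ ∈ genSub N₀, y = y₀ + ExteriorAlgebra.ι ℂ e * y₁) →
      ∃ z₀ ∈ genSub N₀, ∃ z₁ ∈ genSub N₀, x * y = z₀ + ExteriorAlgebra.ι ℂ e * z₁ := by
    induction hx using Algebra.adjoin_induction with
    | mem x hx =>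
      obtain ⟨v, hv, rfl⟩ := hx
      rintro y ⟨y₀, h₀, y₁, h₁, rfl⟩
      have hv' := ι_mem_genSub (hN v hv)
      set w := v - d v • e with hw
      refine ⟨ExteriorAlgebra.ι ℂ w * y₀, mul_mem hv' h₀,
        d v • y₀ - ExteriorAlgebra.ι ℂ w * y₁,
        sub_mem (Subalgebra.smul_mem _ h₀ _) (mul_mem hv' h₁), ?_⟩
      have : v = w + d v • e := by rw [hw]; abel
      rw [this, map_add, map_smul]
      have e1 : ExteriorAlgebra.ι ℂ w * (ExteriorAlgebra.ι ℂ e * y₁) =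
          -(ExteriorAlgebra.ι ℂ e * (ExteriorAlgebra.ι ℂ w * y₁)) := by
        rw [← mul_assoc, ι_mul_swap, neg_mul, mul_assoc]
      have e2 : ExteriorAlgebra.ι ℂ e * (ExteriorAlgebra.ι ℂ e * y₁) = 0 := by
        rw [← mul_assoc, ExteriorAlgebra.ι_sq_zero, zero_mul]
      simp only [add_mul, mul_add, smul_mul_assoc, e1, e2, mul_sub, smul_zero, mul_smul_comm,
        ← this]
      abel
    | algebraMap r =>
      rintro y ⟨y₀, h₀, y₁, h₁, rfl⟩
      exact ⟨r • y₀, Subalgebra.smul_mem _ h₀ _, r • y₁, Subalgebra.smul_mem _ h₁ _, by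
        rw [← Algebra.smul_def, smul_add, mul_smul_comm]⟩
    | add x x' _ _ h1 h2 =>
      intro y hy
      obtain ⟨a, ha, b, hb, e1⟩ := h1 y hy
      obtain ⟨a', ha', b', hb', e2⟩ := h2 y hy
      exact ⟨a + a', add_mem ha ha', b + b', add_mem hb hb', by
        rw [add_mul, e1, e2, mul_add]; abel⟩
    | mul x x' _ _ h1 h2 =>
      intro y hy
      rw [mul_assoc]
      exact h1 _ (h2 _ hy)
  obtain ⟨z₀, h₀, z₁, h₁, e1⟩ := main 1 ⟨1, one_mem _, 0, zero_mem _, by simp⟩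
  rw [mul_one] at e1
  rw [e1, map_add, gderiv_ι_mul, gderiv_eq_zero_of_mem_genSub hd h₀,
    gderiv_eq_zero_of_mem_genSub hd h₁, hde]
  simpa using h₁

end Contract

/-! ### The generators of the sigma model -/

section Par

variable {V E : Type*} [AddCommGroup E] [Module ℂ E]

theorem IsEven.par {m : ParAlg E} (h : IsEven m) : IsEven (par m : Alg V E) := h.map _

theorem IsOdd.par {m : ParAlg E} (h : IsOdd m) : IsOdd (par m : Alg V E) := h.map _

@[simp] theorem par_algebraMap (c : ℂ) :
    (par (algebraMap ℂ (ParAlg E) c) : Alg V E) = algebraMap ℂ _ c := AlgHom.commutes _ c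

theorem isOdd_psi (i : V) : IsOdd (psi i : Alg V E) := isOdd_ι _

theorem isOdd_psiBar (i : V) : IsOdd (psiBar i : Alg V E) := isOdd_ι _

theorem isOdd_psiT {s : Finset V} (i : Option s) : IsOdd (psiT i : Alg V E) := by
  cases i with
  | none => exact Submodule.zero_mem _
  | some i => exact isOdd_psi _

theorem isOdd_psiBarT {s : Finset V} (i : Option s) : IsOdd (psiBarT i : Alg V E) := by
  cases i with
  | none => exact Submodule.zero_mem _
  | some i => exact isOdd_psiBar _

/-- The coordinate of a generator along `ψbar i`. -/
def dualBar (i : V) : GenDual (Gen V E) :=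
  (Finsupp.lapply i).comp (LinearMap.fst ℂ (V →₀ ℂ) _)

/-- The coordinate of a generator along `ψ i`. -/
def dualPsi (i : V) : GenDual (Gen V E) :=
  (Finsupp.lapply i).comp ((LinearMap.fst ℂ (V →₀ ℂ) E).comp (LinearMap.snd ℂ (V →₀ ℂ) _))

theorem dPsiBar_eq (i : V) : (dPsiBar i : Module.End ℂ (Alg V E)) = gderiv (F := Gen V E) (dualBar i) := rfl

theorem dPsi_eq (i : V) : (dPsi i : Module.End ℂ (Alg V E)) = gderiv (F := Gen V E) (dualPsi i) := rfl

@[simp] theorem dualBar_apply (i : V) (v : Gen V E) : dualBar i v = v.1 i := rfl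

@[simp] theorem dualPsi_apply (i : V) (v : Gen V E) : dualPsi i v = v.2.1 i := rfl

/-- The generators `ψbar i` (`i ∈ s`), `ψ i` (`i ∈ t`) and the parameters. -/
def genSpace (s t : Set V) : GenSubspace (Gen V E) where
  carrier := {v | (∀ i ∉ s, v.1 i = 0) ∧ ∀ i ∉ t, v.2.1 i = 0}
  add_mem' := by
    rintro a b ⟨h1, h2⟩ ⟨h3, h4⟩
    exact ⟨fun i hi => by simp [h1 i hi, h3 i hi], fun i hi => by simp [h2 i hi, h4 i hi]⟩
  zero_mem' := ⟨fun _ _ => rfl, fun _ _ => rfl⟩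
  smul_mem' := by
    rintro c a ⟨h1, h2⟩
    exact ⟨fun i hi => by simp [h1 i hi], fun i hi => by simp [h2 i hi]⟩

/-- The subalgebra generated by the `ψbar i`, `ψ i` with `i ∈ s` and the parameters. -/
def genAlg (s : Set V) : Subalgebra ℂ (Alg V E) := genSub (F := Gen V E) (genSpace s s)

theorem par_mem_genAlg (s : Set V) (m : ParAlg E) : (par m : Alg V E) ∈ genAlg s := by
  induction m using ExteriorAlgebra.induction with
  | algebraMap r => rw [par_algebraMap]; exact Subalgebra.algebraMap_mem _ r
  | ι v =>
    rw [par, ExteriorAlgebra.map_apply_ι]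
    exact ι_mem_genSub ⟨fun i _ => rfl, fun i _ => rfl⟩
  | mul x y hx hy => rw [map_mul]; exact mul_mem hx hy
  | add x y hx hy => rw [map_add]; exact add_mem hx hy

theorem psi_mem_genAlg {s : Set V} {i : V} (h : i ∈ s) : (psi i : Alg V E) ∈ genAlg s :=
  ι_mem_genSub ⟨fun _ _ => rfl, fun _ hj =>
    Finsupp.single_eq_of_ne (fun e => hj (e ▸ h))⟩

theorem psiBar_mem_genAlg {s : Set V} {i : V} (h : i ∈ s) : (psiBar i : Alg V E) ∈ genAlg s :=
  ι_mem_genSub ⟨fun _ hj => Finsupp.single_eq_of_ne (fun e => hj (e ▸ h)), fun _ _ => rfl⟩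

theorem psiT_mem_genAlg {s : Finset V} (i : Option s) : (psiT i : Alg V E) ∈ genAlg (s : Set V) := by
  cases i with
  | none => exact zero_mem _
  | some i => exact psi_mem_genAlg i.2

theorem psiBarT_mem_genAlg {s : Finset V} (i : Option s) :
    (psiBarT i : Alg V E) ∈ genAlg (s : Set V) := by
  cases i with
  | none => exact zero_mem _
  | some i => exact psiBar_mem_genAlg i.2

theorem genSub_empty_le {x : Alg V E} (hx : x ∈ genAlg (∅ : Set V)) :
    x ∈ Set.range (par : ParAlg E → Alg V E) := by
  change x ∈ (par : ParAlg E →ₐ[ℂ] Alg V E).range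
  induction hx using Algebra.adjoin_induction with
  | mem x hx =>
    obtain ⟨v, ⟨h1, h2⟩, rfl⟩ := hx
    refine ⟨ExteriorAlgebra.ι ℂ v.2.2, ?_⟩
    change ExteriorAlgebra.map _ _ = _
    rw [ExteriorAlgebra.map_apply_ι]
    congr 1
    refine Prod.ext ?_ (Prod.ext ?_ rfl)
    · ext i; exact (h1 i (by simp)).symm
    · ext i; exact (h2 i (by simp)).symm
  | algebraMap r => exact Subalgebra.algebraMap_mem _ r
  | add x y _ _ h1 h2 => exact add_mem h1 h2
  | mul x y _ _ h1 h2 => exact mul_mem h1 h2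

/-- The derivatives with respect to `ψbar a` and `ψ a` remove these two generators: no other
generator and no parameter is affected. -/
theorem dPsiBar_dPsi_mem [DecidableEq V] {s : Set V} {a : V} (ha : a ∉ s) {x : Alg V E}
    (hx : x ∈ genAlg (insert a s)) : dPsiBar a (dPsi a x) ∈ genAlg s := by
  have h1 : gderiv (F := Gen V E) (dualPsi a) x ∈ genSub (F := Gen V E) (genSpace (insert a s) s) := by
    refine gderiv_mem_genSub (F := Gen V E) (N := genSpace (insert a s) (insert a s))
      (N₀ := genSpace (insert a s) s) (d := dualPsi a)
      (e := ((0, Finsupp.single a 1, 0) : Gen V E)) ?_ ?_ (by simp) hx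
    · exact fun v hv => hv.2 a ha
    · intro v hv
      refine ⟨fun i hi => ?_, fun i hi => ?_⟩
      · have := hv.1 i hi
        simpa using this
      · by_cases hia : i = a
        · subst hia; simp
        · have := hv.2 i (by simp [hia, hi])
          simp [this, Finsupp.single_eq_of_ne hia]
  refine gderiv_mem_genSub (F := Gen V E) (N := genSpace (insert a s) s)
    (N₀ := genSpace s s) (d := dualBar a)
    (e := ((Finsupp.single a 1, 0, 0) : Gen V E)) ?_ ?_ (by simp) h1
  · exact fun v hv => hv.1 a ha
  · intro v hv
    refine ⟨fun i hi => ?_, fun i hi => ?_⟩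
    · by_cases hia : i = a
      · subst hia; simp
      · have := hv.1 i (by simp [hia, hi])
        simp [this, Finsupp.single_eq_of_ne hia]
    · have := hv.2 i hi
      simpa using this

theorem dPsiBar_dPsi_mul {s : Set V} {a : V} (ha : a ∉ s) {x : Alg V E}
    (hx : x ∈ genAlg s) (y : Alg V E) :
    dPsiBar a (dPsi a (x * y)) = x * dPsiBar a (dPsi a y) :=
  gderiv_gderiv_mul (F := Gen V E) (N := genSpace s s) (d := dualBar a) (d' := dualPsi a)
    (fun _ hv => hv.1 a ha) (fun _ hv => hv.2 a ha) hx y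

theorem dPair_commute (i j : V) :
    Commute (dPsiBar i * dPsi i : Module.End ℂ (Alg V E)) (dPsiBar j * dPsi j) := by
  refine LinearMap.ext fun x => ?_
  change gderiv (F := Gen V E) (dualBar i) (gderiv (F := Gen V E) (dualPsi i) (gderiv (F := Gen V E) (dualBar j) (gderiv (F := Gen V E) (dualPsi j) x))) =
    gderiv (F := Gen V E) (dualBar j) (gderiv (F := Gen V E) (dualPsi j) (gderiv (F := Gen V E) (dualBar i) (gderiv (F := Gen V E) (dualPsi i) x)))
  rw [gderiv_comm (F := Gen V E) (dualPsi i) (dualBar j), map_neg, gderiv_comm (F := Gen V E) (dualBar i) (dualBar j), neg_neg,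
    gderiv_comm (F := Gen V E) (dualPsi i) (dualPsi j) x, map_neg, map_neg,
    gderiv_comm (F := Gen V E) (dualBar i) (dualPsi j), map_neg, neg_neg]

theorem dPsi_par (i : V) (m : ParAlg E) : dPsiBar i (par m : Alg V E) = 0 ∧ dPsi i (par m : Alg V E) = 0 :=
  ⟨gderiv_eq_zero_of_mem_genSub (F := Gen V E) (N := genSpace ∅ ∅) (d := dualBar i)
      (fun _ hv => hv.1 i (by simp)) (par_mem_genAlg ∅ m),
    gderiv_eq_zero_of_mem_genSub (F := Gen V E) (N := genSpace ∅ ∅) (d := dualPsi i)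
      (fun _ hv => hv.2 i (by simp)) (par_mem_genAlg ∅ m)⟩

variable [LinearOrder V]

@[simp] theorem berezin_empty : berezin (∅ : Finset V) = (1 : Module.End ℂ (Alg V E)) := by
  simp [berezin]

theorem berezin_insert {s : Finset V} {a : V} (ha : a ∉ s) :
    (berezin (insert a s) : Module.End ℂ (Alg V E)) = berezin s * (dPsiBar a * dPsi a) := by
  have hp : ((insert a s).sort (· ≤ ·)).Perm (s.sort (· ≤ ·) ++ [a]) := by
    refine (List.perm_ext_iff_of_nodup (Finset.sort_nodup _ _) ?_).2 ?_
    · rw [List.nodup_append]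
      refine ⟨Finset.sort_nodup _ _, by simp, ?_⟩
      intro x hx y hy
      simp only [List.mem_singleton] at hy
      rintro rfl
      exact ha (hy ▸ (Finset.mem_sort _).1 hx)
    · intro x; simp [or_comm]
  have := (hp.map fun i => (dPsiBar i * dPsi i : Module.End ℂ (Alg V E))).prod_eq' (by
    rw [List.pairwise_map]
    exact List.pairwise_of_forall fun i j => dPair_commute i j)
  rw [berezin, this]
  simp [berezin]

theorem berezin_even_mul (s : Finset V) {m : Alg V E} (hm : IsEven m)
    (hd : ∀ i, dPsiBar i m = 0 ∧ dPsi i m = 0) (x : Alg V E) :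
    berezin s (m * x) = m * berezin s x := by
  induction s using Finset.induction generalizing x with
  | empty => simp
  | insert a s ha ih =>
    rw [berezin_insert ha]
    change berezin s (dPsiBar a (dPsi a (m * x))) = m * berezin s (dPsiBar a (dPsi a x))
    rw [← ih, dPsi_eq, gderiv_even_mul (F := Gen V E) _ hm, ← dPsi_eq, (hd a).2, zero_mul, zero_add, dPsiBar_eq,
      gderiv_even_mul (F := Gen V E) _ hm, ← dPsiBar_eq, (hd a).1, zero_mul, zero_add]

theorem berezin_par_mul (s : Finset V) {m : ParAlg E} (hm : IsEven m) (x : Alg V E) :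
    berezin s (par m * x) = par m * berezin s x :=
  berezin_even_mul s hm.par (fun i => dPsi_par i m) x

/-- The Berezin integral over all generators takes values in the parameter algebra. -/
theorem berezin_mem_range (s : Finset V) {x : Alg V E} (hx : x ∈ genAlg (s : Set V)) :
    berezin s x ∈ Set.range (par : ParAlg E → Alg V E) := by
  induction s using Finset.induction generalizing x with
  | empty => exact genSub_empty_le (by simpa using hx)
  | insert a s ha ih =>
    rw [berezin_insert ha]
    refine ih (dPsiBar_dPsi_mem (by simpa using ha) ?_)
    simpa using hx

end Par

/-! ### Evaluating smooth families at nilpotent parameters -/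

section Subst

open Filter Topology

variable {Z Z' : Type*} [NormedAddCommGroup Z] [NormedSpace ℝ Z]
  [NormedAddCommGroup Z'] [NormedSpace ℝ Z']

/-- The directional derivative. -/
def dirD (v : Z) (φ : Z → ℂ) : Z → ℂ := fun z => fderiv ℝ φ z v

theorem contDiff_dirD {φ : Z → ℂ} (h : ContDiff ℝ ∞ φ) (v : Z) : ContDiff ℝ ∞ (dirD v φ) :=
  (h.fderiv_right (m := ∞) (by simp)).clm_apply contDiff_const

theorem diff_of_contDiff {φ : Z → ℂ} (h : ContDiff ℝ ∞ φ) : Differentiable ℝ φ :=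
  h.differentiable (by simp)

theorem dirD_comm {φ : Z → ℂ} (h : ContDiff ℝ ∞ φ) (v w : Z) :
    dirD v (dirD w φ) = dirD w (dirD v φ) := by
  funext z
  have hd : DifferentiableAt ℝ (fderiv ℝ φ) z :=
    (h.fderiv_right (m := ∞) (by simp)).differentiable (by simp) z
  have key : ∀ a b : Z, dirD a (dirD b φ) z = fderiv ℝ (fderiv ℝ φ) z a b := by
    intro a b
    change fderiv ℝ (fun y => fderiv ℝ φ y b) z a = _
    rw [fderiv_clm_apply hd (differentiableAt_const b)]
    simp
  rw [key, key]
  exact (h.contDiffAt.isSymmSndFDerivAt (by simp only [minSmoothness_of_isRCLikeNormedField]; exact WithTop.coe_le_coe.2 (le_top : (2 : ℕ∞) ≤ ⊤))).eq v w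

theorem dirD_add {φ ψ : Z → ℂ} (hφ : ContDiff ℝ ∞ φ) (hψ : ContDiff ℝ ∞ ψ) (v : Z) :
    dirD v (φ + ψ) = dirD v φ + dirD v ψ := by
  funext z
  simp [dirD, fderiv_add (diff_of_contDiff hφ z) (diff_of_contDiff hψ z)]

theorem dirD_mul {φ ψ : Z → ℂ} (hφ : ContDiff ℝ ∞ φ) (hψ : ContDiff ℝ ∞ ψ) (v : Z) :
    dirD v (φ * ψ) = dirD v φ * ψ + φ * dirD v ψ := by
  funext z
  simp only [dirD, fderiv_mul (diff_of_contDiff hφ z) (diff_of_contDiff hψ z), Pi.add_apply,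
    Pi.mul_apply, _root_.add_apply, _root_.smul_apply, smul_eq_mul]
  ring

theorem dirD_const (c : ℂ) (v : Z) : dirD v (fun _ => c) = 0 := by
  funext z; simp [dirD]

theorem dirD_smul {φ : Z → ℂ} (hφ : ContDiff ℝ ∞ φ) (c : ℂ) (v : Z) :
    dirD v (c • φ) = c • dirD v φ := by
  funext z
  simp [dirD, fderiv_const_smul (diff_of_contDiff hφ z)]

theorem dirD_sum_vec {ι : Type*} (s : Finset ι) (φ : Z → ℂ) (r : ι → ℝ) (v : ι → Z) :
    dirD (∑ i ∈ s, r i • v i) φ = ∑ i ∈ s, (r i : ℂ) • dirD (v i) φ := by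
  funext z
  simp [dirD]

theorem dirD_comp {φ : Z → ℂ} (hφ : ContDiff ℝ ∞ φ) {f : Z' → Z} {f' : Z' →L[ℝ] Z} {z : Z'}
    (hf : HasFDerivAt f f' z) (v : Z') : dirD v (φ ∘ f) z = dirD (f' v) φ (f z) := by
  change fderiv ℝ (φ ∘ f) z v = fderiv ℝ φ (f z) (f' v)
  rw [((diff_of_contDiff hφ (f z)).hasFDerivAt.comp z hf).fderiv]
  rfl

variable {K : Type*} [Fintype K] [DecidableEq K]
variable {A : Type*} [Ring A] [Algebra ℂ A]

/-- The value of a smooth function of the real parameters `t` at the nilpotent elements `n`,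
where `n k * n k = 0`: the product of the operators `1 + n k * ∂_k`, `k ∈ L`, applied at `0`. -/
def subst (n : K → A) : List K → ((K → ℝ) → ℂ) → A
  | [], φ => algebraMap ℂ A (φ 0)
  | k :: L, φ => subst n L φ + n k * subst n L (dirD (Pi.single k 1) φ)

/-- Central elements with square zero. -/
structure IsNil (n : K → A) : Prop where
  comm : ∀ k b, Commute (n k) b
  sq : ∀ k, n k * n k = 0

variable {n : K → A} {L : List K}

theorem subst_congr_of_eventually {φ ψ : (K → ℝ) → ℂ} (h : φ =ᶠ[𝓝 0] ψ) :
    subst n L φ = subst n L ψ := by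
  induction L generalizing φ ψ with
  | nil => simp [subst, h.eq_of_nhds]
  | cons k L ih =>
    have h' : dirD (Pi.single k 1) φ =ᶠ[𝓝 0] dirD (Pi.single k 1) ψ := by
      filter_upwards [h.fderiv (𝕜 := ℝ)] with t ht
      simp [dirD, ht]
    simp only [subst, ih h, ih h']

theorem subst_add {φ ψ : (K → ℝ) → ℂ} (hφ : ContDiff ℝ ∞ φ) (hψ : ContDiff ℝ ∞ ψ) :
    subst n L (φ + ψ) = subst n L φ + subst n L ψ := by
  induction L generalizing φ ψ with
  | nil => simp [subst]
  | cons k L ih =>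
    simp only [subst, dirD_add hφ hψ, ih hφ hψ, ih (contDiff_dirD hφ _) (contDiff_dirD hψ _),
      mul_add]
    abel

theorem subst_smul {φ : (K → ℝ) → ℂ} (hφ : ContDiff ℝ ∞ φ) (c : ℂ) :
    subst n L (c • φ) = c • subst n L φ := by
  induction L generalizing φ with
  | nil => simp [subst, Algebra.smul_def]
  | cons k L ih =>
    simp only [subst, dirD_smul hφ, ih hφ, ih (contDiff_dirD hφ _), smul_add, mul_smul_comm]

theorem subst_const (c : ℂ) : subst n L (fun _ => c) = algebraMap ℂ A c := by
  have h0 : ∀ L : List K, subst n L (0 : (K → ℝ) → ℂ) = 0 := fun L => by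
    have := subst_smul (n := n) (L := L) (φ := 0) contDiff_const 0
    simpa using this
  induction L with
  | nil => simp [subst]
  | cons k L ih => simp only [subst, ih, dirD_const, h0, mul_zero, add_zero]

theorem subst_commute (hn : IsNil n) (φ : (K → ℝ) → ℂ) (b : A) : Commute (subst n L φ) b := by
  induction L generalizing φ with
  | nil => exact Algebra.commutes _ _
  | cons k L ih => exact (ih φ).add_left ((hn.comm k b).mul_left (ih _))

theorem subst_mul (hn : IsNil n) {φ ψ : (K → ℝ) → ℂ} (hφ : ContDiff ℝ ∞ φ)
    (hψ : ContDiff ℝ ∞ ψ) : subst n L (φ * ψ) = subst n L φ * subst n L ψ := by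
  induction L generalizing φ ψ with
  | nil => simp [subst]
  | cons k L ih =>
    have h1 := contDiff_dirD hφ (Pi.single k 1)
    have h2 := contDiff_dirD hψ (Pi.single k 1)
    simp only [subst, dirD_mul hφ hψ, ih hφ hψ]
    rw [subst_add (φ := dirD (Pi.single k 1) φ * ψ) (ψ := φ * dirD (Pi.single k 1) ψ)
      (h1.mul hψ) (hφ.mul h2), ih h1 hψ, ih hφ h2]
    set a := subst n L φ
    set b := subst n L ψ
    set a' := subst n L (dirD (Pi.single k 1) φ)
    set b' := subst n L (dirD (Pi.single k 1) ψ)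
    have e : n k * a' * (n k * b') = 0 := by
      rw [mul_assoc, ← mul_assoc a', ← (hn.comm k a').eq, mul_assoc, ← mul_assoc, hn.sq, zero_mul]
    rw [add_mul, mul_add a, mul_add (n k * a'), e, ← mul_assoc a, ← (hn.comm k a).eq]
    simp only [mul_add, mul_assoc, add_zero]
    abel_nf

theorem map_subst (Λ : A →ₗ[ℂ] A) (hΛ : ∀ k x, Λ (n k * x) = n k * Λ x) (φ : (K → ℝ) → ℂ)
    (x : A) : Λ (subst n L φ * x) = subst n L φ * Λ x := by
  induction L generalizing φ x with
  | nil => simp only [subst, ← Algebra.smul_def, map_smul]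
  | cons k L ih => simp only [subst, add_mul, mul_assoc, map_add, ih, hΛ]

/-- The value of an affine function. -/
theorem subst_affine (c₀ : ℂ) (c : K → ℂ) :
    subst n L (fun t => c₀ + ∑ k, c k * t k) =
      algebraMap ℂ A c₀ + (L.map fun k => c k • n k).sum := by
  induction L with
  | nil => simp [subst]
  | cons k L ih =>
    have : dirD (Pi.single k 1) (fun t : K → ℝ => c₀ + ∑ k, c k * t k) = fun _ => c k := by
      funext t
      have h : HasFDerivAt (fun t : K → ℝ => c₀ + ∑ k, c k * t k)
          (∑ k, c k • (Complex.ofRealCLM.comp (ContinuousLinearMap.proj k :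
            (K → ℝ) →L[ℝ] ℝ))) t := by
        refine HasFDerivAt.const_add _ (HasFDerivAt.fun_sum fun k _ => ?_)
        exact (Complex.ofRealCLM.comp (ContinuousLinearMap.proj k :
            (K → ℝ) →L[ℝ] ℝ)).hasFDerivAt.const_mul (c k)
      simp only [dirD, h.fderiv]
      simp [Pi.single_apply, apply_ite ((↑) : ℝ → ℂ)]
    simp only [subst, this, ih, subst_const, List.map_cons, List.sum_cons]
    rw [← Algebra.commutes, ← Algebra.smul_def]; abel

omit [DecidableEq K] in
theorem contDiff_affine (c₀ : ℂ) (c : K → ℂ) :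
    ContDiff ℝ ∞ (fun t : K → ℝ => c₀ + ∑ k, c k * t k) := by
  refine contDiff_const.add (ContDiff.sum fun k _ => contDiff_const.mul ?_)
  exact Complex.ofRealCLM.contDiff.comp (contDiff_apply ℝ ℝ k)

/-- The value of the exponential of an affine function. -/
theorem subst_exp_affine (c₀ : ℂ) (c : K → ℂ) :
    subst n L (fun t => Complex.exp (c₀ + ∑ k, c k * t k)) =
      Complex.exp c₀ • (L.map fun k => 1 + c k • n k).prod := by
  induction L with
  | nil => simp [subst, Algebra.algebraMap_eq_smul_one]
  | cons k L ih =>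
    have hs : ContDiff ℝ ∞ (fun t : K → ℝ => Complex.exp (c₀ + ∑ k, c k * t k)) :=
      (contDiff_affine c₀ c).cexp
    have : dirD (Pi.single k 1) (fun t : K → ℝ => Complex.exp (c₀ + ∑ k, c k * t k)) =
        c k • fun t : K → ℝ => Complex.exp (c₀ + ∑ k, c k * t k) := by
      funext t
      have h : HasFDerivAt (fun t : K → ℝ => c₀ + ∑ k, c k * t k)
          (∑ k, c k • (Complex.ofRealCLM.comp (ContinuousLinearMap.proj k :
            (K → ℝ) →L[ℝ] ℝ))) t := by
        refine HasFDerivAt.const_add _ (HasFDerivAt.fun_sum fun k _ => ?_)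
        exact (Complex.ofRealCLM.comp (ContinuousLinearMap.proj k :
            (K → ℝ) →L[ℝ] ℝ)).hasFDerivAt.const_mul (c k)
      simp only [dirD, h.cexp.fderiv]
      simp [Pi.single_apply, apply_ite ((↑) : ℝ → ℂ), mul_comm]
    simp only [subst, this, subst_smul hs, ih, List.map_cons, List.prod_cons, add_mul, one_mul,
      smul_add, mul_smul_comm, smul_mul_assoc]
    congr 1
    rw [smul_comm]

/-! ### Taylor expansion -/

section Taylor

variable {C : Type*} [Fintype C]

/-- The homogeneous part of degree `j` of the Taylor series (without the factorial). -/
def taylorPart (e : C → Z) (N : C → A) (z₀ : Z) : ℕ → (Z → ℂ) → A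
  | 0, h => algebraMap ℂ A (h z₀)
  | j + 1, h => ∑ c, taylorPart e N z₀ j (dirD (e c) h) * N c

theorem taylorPart_eq (e : C → Z) (N : C → A) (z₀ : Z) (j : ℕ) {h : Z → ℂ}
    (hh : ContDiff ℝ ∞ h) : taylorPart e N z₀ j h =
      ∑ c : Fin j → C, (iteratedFDeriv ℝ j h z₀ fun l => e (c l)) •
        (List.ofFn fun l => N (c l)).prod := by
  induction j generalizing h with
  | zero => simp [taylorPart, Algebra.algebraMap_eq_smul_one]
  | succ j ih =>
    rw [taylorPart, ← (Fin.snocEquiv fun _ => C).sum_comp, Fintype.sum_prod_type]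
    refine Finset.sum_congr rfl fun c _ => ?_
    rw [ih (contDiff_dirD hh _), Finset.sum_mul]
    refine Finset.sum_congr rfl fun d _ => ?_
    rw [smul_mul_assoc, iteratedFDeriv_succ_apply_right, List.ofFn_succ']
    congr 1
    · have hf : ContDiff ℝ j (fderiv ℝ h) := hh.fderiv_right (by exact_mod_cast le_top)
      have := iteratedFDeriv_clm_apply_const_apply (𝕜 := ℝ) hf le_rfl (x := z₀) (u := e c)
        (m := fun l => e (d l))
      rw [show dirD (e c) h = fun y => fderiv ℝ h y (e c) from rfl, this]
      congr 1
      · congr 1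
        funext l
        simp [Fin.init, Fin.snocEquiv]
      · simp [Fin.snocEquiv]
    · simp [Fin.snocEquiv]

theorem taylorPart_add {e : C → Z} {N : C → A} {z₀ : Z} {j : ℕ} {h₁ h₂ : Z → ℂ}
    (hh₁ : ContDiff ℝ ∞ h₁) (hh₂ : ContDiff ℝ ∞ h₂) : taylorPart e N z₀ j (h₁ + h₂) =
      taylorPart e N z₀ j h₁ + taylorPart e N z₀ j h₂ := by
  induction j generalizing h₁ h₂ with
  | zero => simp [taylorPart]
  | succ j ih =>
    simp only [taylorPart, dirD_add hh₁ hh₂, ih (contDiff_dirD hh₁ _) (contDiff_dirD hh₂ _),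
      add_mul, Finset.sum_add_distrib]

theorem taylorPart_smul {e : C → Z} {N : C → A} {z₀ : Z} {j : ℕ} {h : Z → ℂ}
    (hh : ContDiff ℝ ∞ h) (r : ℂ) : taylorPart e N z₀ j (r • h) =
      r • taylorPart e N z₀ j h := by
  induction j generalizing h with
  | zero => simp [taylorPart, Algebra.smul_def]
  | succ j ih =>
    simp only [taylorPart, dirD_smul hh, ih (contDiff_dirD hh _), smul_mul_assoc, Finset.smul_sum]

theorem taylorPart_sum {ι : Type*} (s : Finset ι) {e : C → Z} {N : C → A} {z₀ : Z} {j : ℕ}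
    {h : ι → Z → ℂ} (hh : ∀ i, ContDiff ℝ ∞ (h i)) : taylorPart e N z₀ j (∑ i ∈ s, h i) =
      ∑ i ∈ s, taylorPart e N z₀ j (h i) := by
  classical
  induction s using Finset.induction with
  | empty =>
    have := taylorPart_smul (e := e) (N := N) (z₀ := z₀) (j := j) (h := fun _ => 0)
      contDiff_const 0
    simpa using this
  | insert a s ha ih =>
    rw [Finset.sum_insert ha, Finset.sum_insert ha, taylorPart_add (hh a), ih]
    have : (∑ i ∈ s, h i) = fun t => ∑ i ∈ s, h i t := by ext; simp
    rw [this]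
    exact ContDiff.sum fun i _ => hh i

/-- Adding a multiple of a central element with square zero to the increment. -/
theorem taylorPart_split {e : C → Z} {N : C → A} {z₀ : Z} {m : A} (hm : ∀ b, Commute m b)
    (hsq : m * m = 0) (r : C → ℝ) (j : ℕ) {h : Z → ℂ} (hh : ContDiff ℝ ∞ h) :
    taylorPart e (fun c => (r c : ℂ) • m + N c) z₀ (j + 1) h =
      taylorPart e N z₀ (j + 1) h +
        ((j : ℂ) + 1) • (m * taylorPart e N z₀ j (dirD (∑ c, r c • e c) h)) := by
  induction j generalizing h with
  | zero =>
    simp only [taylorPart, dirD_sum_vec]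
    simp only [mul_add, Finset.sum_add_distrib, Nat.cast_zero, zero_add, one_smul]
    rw [add_comm]
    congr 1
    simp only [Finset.sum_apply, Pi.smul_apply, map_sum, smul_eq_mul, Finset.mul_sum]
    refine Finset.sum_congr rfl fun c _ => ?_
    rw [map_mul, mul_smul_comm, ← mul_assoc, ← Algebra.commutes ((r c : ℂ)) m, mul_assoc,
      (hm _).eq, Algebra.smul_def]
  | succ j ih =>
    have e1 : ∀ c, taylorPart e (fun c => (r c : ℂ) • m + N c) z₀ (j + 1) (dirD (e c) h) *
        ((r c : ℂ) • m + N c) = taylorPart e N z₀ (j + 1) (dirD (e c) h) * N c +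
          (m * ((r c : ℂ) • taylorPart e N z₀ (j + 1) (dirD (e c) h)) +
          ((j : ℂ) + 1) • (m * (taylorPart e N z₀ j (dirD (e c) (dirD (∑ c, r c • e c) h)) * N c))) := by
      intro c
      rw [ih (contDiff_dirD hh _), dirD_comm hh]
      set a := taylorPart e N z₀ (j + 1) (dirD (e c) h)
      set b := taylorPart e N z₀ j (dirD (e c) (dirD (∑ c, r c • e c) h))
      -- the terms of second order in `m` vanish
      have h0 : m * b * m = 0 := by rw [mul_assoc, ← (hm b).eq, ← mul_assoc, hsq, zero_mul]
      have h1 : a * m = m * a := ((hm a).eq).symm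
      simp only [add_mul, mul_add, smul_mul_assoc, mul_smul_comm, h0, h1, smul_zero, mul_assoc]
      abel
    rw [taylorPart]
    simp only [e1, Finset.sum_add_distrib]
    rw [← Finset.smul_sum, ← Finset.mul_sum, ← Finset.mul_sum]
    have e2 : ∑ c, (r c : ℂ) • taylorPart e N z₀ (j + 1) (dirD (e c) h) =
        taylorPart e N z₀ (j + 1) (dirD (∑ c, r c • e c) h) := by
      rw [dirD_sum_vec, taylorPart_sum]
      · exact Finset.sum_congr rfl fun c _ => (taylorPart_smul (contDiff_dirD hh _) _).symm
      · exact fun c => contDiff_const.mul (contDiff_dirD hh _)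
    rw [e2]
    change _ + (_ + _ • (m * taylorPart e N z₀ (j + 1) (dirD (∑ c, r c • e c) h))) = _
    push_cast
    rw [add_smul ((j : ℂ) + 1) 1, one_smul, add_comm (m * _) (_ • _)]
    rfl

/-- The Taylor series at nilpotent elements `∑ k ∈ L, v c k • n k` is the value at `n` of the
function with these elements replaced by real parameters. -/
theorem sum_taylorPart_eq_subst (hn : IsNil n) (e : C → Z) (v : C → K → ℝ) (z₀ : Z)
    {h : Z → ℂ} (hh : ContDiff ℝ ∞ h) {M : ℕ} (hM : L.length ≤ M) :
    ∑ j ∈ Finset.range (M + 1), ((j.factorial : ℂ)⁻¹) •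
        taylorPart e (fun c => (L.map fun k => (v c k : ℂ) • n k).sum) z₀ j h =
      subst n L fun t => h (z₀ + ∑ k, t k • ∑ c, v c k • e c) := by
  induction L generalizing h M with
  | nil =>
    rw [Finset.sum_range_succ', Finset.sum_eq_zero]
    · simp [taylorPart, subst]
    · intro j _
      simp [taylorPart]
  | cons k L ih =>
    obtain ⟨M, rfl⟩ : ∃ M', M = M' + 1 := ⟨M - 1, by simp at hM; omega⟩
    simp only [List.length_cons, add_le_add_iff_right] at hM
    have hd : dirD (Pi.single k 1) (fun t : K → ℝ => h (z₀ + ∑ k, t k • ∑ c, v c k • e c)) =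
        fun t => dirD (∑ c, v c k • e c) h (z₀ + ∑ k, t k • ∑ c, v c k • e c) := by
      funext t
      have hf : HasFDerivAt (fun t : K → ℝ => z₀ + ∑ k, t k • ∑ c, v c k • e c)
          (∑ k, (ContinuousLinearMap.proj k : (K → ℝ) →L[ℝ] ℝ).smulRight
            (∑ c, v c k • e c)) t := by
        refine HasFDerivAt.const_add _ (HasFDerivAt.fun_sum fun k _ => ?_)
        exact ((ContinuousLinearMap.proj k : (K → ℝ) →L[ℝ] ℝ).smulRight
          (∑ c, v c k • e c)).hasFDerivAt
      have := dirD_comp hh hf (Pi.single k 1)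
      simp only [Function.comp_def] at this
      rw [this]
      congr 1
      simp [Pi.single_apply]
    simp only [subst, hd]
    rw [← ih hh (hM.trans M.le_succ), ← ih (contDiff_dirD hh _) hM, Finset.sum_range_succ',
      Finset.sum_range_succ' _ (M + 1), Finset.mul_sum]
    simp only [List.map_cons, List.sum_cons, taylorPart_split (hn.comm k) (hn.sq k) _ _ hh,
      smul_add, Finset.sum_add_distrib]
    rw [add_right_comm]
    congr 1
    refine Finset.sum_congr rfl fun j _ => ?_
    rw [mul_smul_comm, smul_smul, Nat.factorial_succ]
    congr 1
    have : ((j : ℂ) + 1) ≠ 0 := by exact_mod_cast j.succ_ne_zero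
    push_cast
    field_simp

end Taylor

end Subst

section TaylorEval

variable {V E : Type*} [AddCommGroup E] [Module ℂ E] {s : Finset V} [DecidableEq V]

theorem taylor_eq_sum (p q : s → Alg V E) {h : Pts s → ℂ} (hh : ContDiff ℝ ∞ h) {M : ℕ}
    (hM : ∀ k, M < k → ∀ c : Fin k → s ⊕ s,
      (List.ofFn fun l => soul (Sum.elim p q (c l))).prod = 0) :
    taylor p q h = ∑ j ∈ Finset.range (M + 1), ((j.factorial : ℂ)⁻¹) •
      taylorPart basisVec (fun c => soul (Sum.elim p q c))
        (fun i => (body (p i)).re, fun i => (body (q i)).re) j h := by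
  have h1 : nilDegree (fun c => soul (Sum.elim p q c)) ≤ M := Nat.sInf_le hM
  have h2 : nilDegree (fun c => soul (Sum.elim p q c)) ∈ _ := Nat.sInf_mem ⟨M, hM⟩
  unfold taylor
  rw [← Finset.sum_subset (Finset.range_mono (Nat.succ_le_succ h1))]
  · exact Finset.sum_congr rfl fun j _ => by rw [taylorPart_eq _ _ _ _ hh]
  · intro j _ hj
    rw [taylorPart_eq _ _ _ _ hh, Finset.sum_eq_zero, smul_zero]
    intro c _
    rw [h2 j (by simpa using hj) c, smul_zero]

/-- At real arguments the Taylor series is the value of the function. -/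
theorem taylor_algebraMap (p q : s → ℝ) {h : Pts s → ℂ} (hh : ContDiff ℝ ∞ h) :
    taylor (fun i => algebraMap ℂ (Alg V E) (p i)) (fun i => algebraMap ℂ (Alg V E) (q i)) h =
      algebraMap ℂ (Alg V E) (h (p, q)) := by
  have hs : ∀ c, soul (Sum.elim (fun i => algebraMap ℂ (Alg V E) (p i))
      (fun i => algebraMap ℂ (Alg V E) (q i)) c) = 0 := by
    rintro (c | c) <;> simp [soul_algebraMap]
  rw [taylor_eq_sum _ _ hh (M := 0)]
  · simp [taylorPart]
  · intro k hk c
    obtain ⟨k, rfl⟩ := Nat.exists_eq_succ_of_ne_zero hk.ne'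
    simp [hs]

/-- The Taylor series at affine functions of nilpotent parameters. -/
theorem taylor_subst {K : Type*} [Fintype K] [DecidableEq K] {n : K → Alg V E} {L : List K}
    (hn : IsNil n) (z₀ : Pts s) (v : s ⊕ s → K → ℝ)
    (p q : s → Alg V E)
    (hp : ∀ i, p i = algebraMap ℂ _ (z₀.1 i : ℂ) + (L.map fun k => (v (.inl i) k : ℂ) • n k).sum)
    (hq : ∀ i, q i = algebraMap ℂ _ (z₀.2 i : ℂ) + (L.map fun k => (v (.inr i) k : ℂ) • n k).sum)
    {h : Pts s → ℂ} (hh : ContDiff ℝ ∞ h) :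
    taylor p q h = subst n L fun t => h (fun i => z₀.1 i + ∑ k, v (.inl i) k * t k,
      fun i => z₀.2 i + ∑ k, v (.inr i) k * t k) := by
  have hb : ∀ k, body (n k) = 0 := fun k => by simpa using congrArg body (hn.sq k)
  have hb' : ∀ c, body (L.map fun k => (v c k : ℂ) • n k).sum = 0 := fun c => by
    clear hp hq
    induction L with
    | nil => simp
    | cons k L ih => simp [ih, hb, -Complex.coe_smul]
  have hs : (fun c => soul (Sum.elim p q c)) =
      fun c => (L.map fun k => (v c k : ℂ) • n k).sum := by
    funext c
    obtain (i | i) := c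
    · simp only [Sum.elim_inl, hp, soul_add, soul_algebraMap, zero_add]
      exact soul_eq_self (hb' _)
    · simp only [Sum.elim_inr, hq, soul_add, soul_algebraMap, zero_add]
      exact soul_eq_self (hb' _)
  rw [taylor_eq_sum p q hh (M := 2 * L.length)]
  · rw [hs, sum_taylorPart_eq_subst hn _ _ _ hh (by omega)]
    congr 1
    funext t
    congr 1
    have : (fun i => (body (p i)).re, fun i => (body (q i)).re) = z₀ := by
      ext i
      · simp [hp, hb', -Complex.coe_smul]
      · simp [hq, hb', -Complex.coe_smul]
    rw [this]
    ext i
    · simp [basisVec, Finset.sum_add_distrib, Prod.fst_sum, mul_comm, Pi.single_apply]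
    · simp [basisVec, Finset.sum_add_distrib, Prod.snd_sum, mul_comm, Pi.single_apply]
  · intro k hk c
    refine list_prod_eq_zero_of_sqZero (L.map n) ?_ ?_ _ ?_ (by simpa using hk)
    · simpa using fun k _ => hn.comm k
    · simpa using fun k _ => hn.sq k
    · intro m hm
      obtain ⟨l, rfl⟩ := (List.mem_ofFn' _ _).1 hm
      change soul (Sum.elim p q (c l)) ∈ _
      rw [show soul (Sum.elim p q (c l)) = _ from congrFun hs (c l)]
      refine list_sum_mem fun x hx => ?_
      obtain ⟨k, hk, rfl⟩ := List.mem_map.1 hx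
      exact Submodule.smul_mem _ _ (Submodule.subset_span (List.mem_map_of_mem hk))

end TaylorEval

/-! ### Extending real families of Grassmann-valued functions to nilpotent parameters -/

section IterSubst

variable {Z Z' : Type*} [NormedAddCommGroup Z] [NormedSpace ℝ Z]
  [NormedAddCommGroup Z'] [NormedSpace ℝ Z'] {A : Type*} [Ring A] [Algebra ℂ A]

/-- The product of the operators `1 + m * ∂_v`, `(m, v) ∈ l`, applied to `φ`. -/
def substAlong : List (A × Z) → (Z → ℂ) → Z → A
  | [], φ, z => algebraMap ℂ A (φ z)
  | p :: l, φ, z => substAlong l φ z + p.1 * substAlong l (dirD p.2 φ) z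

theorem substAlong_add (l : List (A × Z)) {φ ψ : Z → ℂ} (hφ : ContDiff ℝ ∞ φ)
    (hψ : ContDiff ℝ ∞ ψ) (z : Z) :
    substAlong l (φ + ψ) z = substAlong l φ z + substAlong l ψ z := by
  induction l generalizing φ ψ with
  | nil => simp [substAlong]
  | cons p l ih =>
    simp only [substAlong, dirD_add hφ hψ, ih hφ hψ, ih (contDiff_dirD hφ _) (contDiff_dirD hψ _),
      mul_add]
    abel

theorem substAlong_perm {l l' : List (A × Z)} (h : l.Perm l')
    (hl : ∀ p ∈ l, ∀ b, Commute p.1 b) {φ : Z → ℂ} (hφ : ContDiff ℝ ∞ φ) (z : Z) :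
    substAlong l φ z = substAlong l' φ z := by
  induction h generalizing φ with
  | nil => rfl
  | cons p _ ih =>
    have hl' := fun p hp => hl p (List.mem_cons_of_mem _ hp)
    simp only [substAlong, ih hl' hφ, ih hl' (contDiff_dirD hφ _)]
  | swap p q l =>
    simp only [substAlong, mul_add, dirD_comm hφ p.2 q.2, ← mul_assoc,
      (hl p (by simp) q.1).eq]
    abel
  | trans h₁ _ ih₁ ih₂ =>
    rw [ih₁ hl hφ, ih₂ (fun p hp => hl p (h₁.mem_iff.2 hp)) hφ]

/-- Applying `1 + n k * ∂` in the direction `v k + w k` amounts to applying it in both directions in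
turn, because the mixed term contains `n k * n k = 0`. -/
theorem substAlong_map_add {K : Type*} {n : K → A} (hn : IsNil n) (L : List K) (v w : K → Z)
    {φ : Z → ℂ} (hφ : ContDiff ℝ ∞ φ) (z : Z) :
    substAlong (L.map fun k => (n k, v k + w k)) φ z =
      substAlong (L.map (fun k => (n k, v k)) ++ L.map fun k => (n k, w k)) φ z := by
  induction L generalizing φ with
  | nil => rfl
  | cons k L ih =>
    set l := L.map (fun k => (n k, v k)) ++ L.map fun k => (n k, w k)
    have hl : ∀ p ∈ l, ∀ b, Commute p.1 b := by
      intro p hp b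
      simp only [l, List.mem_append, List.mem_map] at hp
      obtain ⟨k, -, rfl⟩ | ⟨k, -, rfl⟩ := hp <;> exact hn.comm k b
    have e : dirD (v k + w k) φ = dirD (v k) φ + dirD (w k) φ := by
      funext z; simp [dirD]
    have h1 : substAlong ((n k, v k) :: (n k, w k) :: l) φ z =
        substAlong (((k :: L).map fun k => (n k, v k)) ++ (k :: L).map fun k => (n k, w k)) φ z := by
      refine substAlong_perm ?_ ?_ hφ z
      · simp only [List.map_cons, List.cons_append, l]
        exact (List.perm_middle.symm).cons _
      · intro p hp b
        simp only [List.mem_cons] at hp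
        obtain rfl | rfl | hp := hp
        · exact hn.comm k b
        · exact hn.comm k b
        · exact hl p hp b
    rw [← h1]
    simp only [List.map_cons, substAlong, ih hφ, ih (contDiff_dirD hφ _), e,
      substAlong_add _ (contDiff_dirD hφ (v k)) (contDiff_dirD hφ (w k)), mul_add, ← mul_assoc,
      hn.sq, zero_mul, l]
    simp only [add_zero]
    abel

theorem substAlong_comp (l : List (A × Z')) {φ : Z → ℂ} (hφ : ContDiff ℝ ∞ φ) {f : Z' → Z}
    {f' : Z' →L[ℝ] Z} (hf : ∀ z, HasFDerivAt f f' z) (z : Z') :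
    substAlong l (φ ∘ f) z = substAlong (l.map fun p => (p.1, f' p.2)) φ (f z) := by
  induction l generalizing φ with
  | nil => rfl
  | cons p l ih =>
    have : dirD p.2 (φ ∘ f) = dirD (f' p.2) φ ∘ f := funext fun z => dirD_comp hφ (hf z) _
    simp only [substAlong, List.map_cons, ih hφ, this, ih (contDiff_dirD hφ _)]

variable {K : Type*} [Fintype K] [DecidableEq K] {n : K → A} {L : List K}

theorem subst_eq_substAlong (φ : (K → ℝ) → ℂ) :
    subst n L φ = substAlong (L.map fun k => (n k, Pi.single k 1)) φ 0 := by
  induction L generalizing φ with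
  | nil => rfl
  | cons k L ih => simp only [subst, List.map_cons, substAlong, ih]

end IterSubst

section SuperExt

open Filter Topology

variable {K : Type*} [Fintype K] [DecidableEq K] {A : Type*} [Ring A] [Algebra ℂ A]
  {X Y : Type*} [NormedAddCommGroup X] [NormedSpace ℝ X] [NormedAddCommGroup Y] [NormedSpace ℝ Y]

/-- `f` is obtained from the smooth family `F t` by giving the parameters `t k`, `k ∈ L`, the
nilpotent values `n k`. -/
def IsSuperExt (n : K → A) (L : List K) (F : (K → ℝ) → X → A) (f : X → A) : Prop :=
  ∃ (ι : Type) (_ : Fintype ι) (φ : ι → (K → ℝ) × X → ℂ) (a : ι → A),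
    (∀ i, ContDiff ℝ ∞ (φ i)) ∧ (∀ t x, F t x = ∑ i, φ i (t, x) • a i) ∧
      ∀ x, f x = ∑ i, subst n L (fun t => φ i (t, x)) * a i

variable {n : K → A} {L : List K} {F F' : (K → ℝ) → X → A} {f f' : X → A}

omit [DecidableEq K] in
theorem contDiff_left {φ : (K → ℝ) × X → ℂ} (h : ContDiff ℝ ∞ φ) (x : X) :
    ContDiff ℝ ∞ (fun t => φ (t, x)) := h.comp (contDiff_id.prodMk contDiff_const)

theorem IsSuperExt.congr (h : IsSuperExt n L F f) (hF : ∀ t x, F' t x = F t x)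
    (hf : ∀ x, f' x = f x) : IsSuperExt n L F' f' := by
  obtain ⟨ι, _, φ, a, h1, h2, h3⟩ := h
  exact ⟨ι, _, φ, a, h1, fun t x => (hF t x).trans (h2 t x), fun x => (hf x).trans (h3 x)⟩

theorem isSuperExt_smul_const {φ : (K → ℝ) × X → ℂ} (h : ContDiff ℝ ∞ φ) (a : A) :
    IsSuperExt n L (fun t x => φ (t, x) • a) fun x => subst n L (fun t => φ (t, x)) * a :=
  ⟨Unit, inferInstance, fun _ => φ, fun _ => a, fun _ => h, by simp, by simp⟩

theorem isSuperExt_algebraMap {φ : (K → ℝ) × X → ℂ} (h : ContDiff ℝ ∞ φ) :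
    IsSuperExt n L (fun t x => algebraMap ℂ A (φ (t, x)))
      fun x => subst n L (fun t => φ (t, x)) :=
  (isSuperExt_smul_const h 1).congr (fun _ _ => Algebra.algebraMap_eq_smul_one _)
    fun _ => (mul_one _).symm

/-- Functions which do not depend on the parameters. -/
theorem isSuperExt_smooth {φ : X → ℂ} (h : ContDiff ℝ ∞ φ) (a : A) :
    IsSuperExt n L (fun _ x => φ x • a) fun x => φ x • a :=
  (isSuperExt_smul_const (n := n) (L := L) (φ := fun p => φ p.2) (h.comp contDiff_snd) a).congr
    (fun _ _ => rfl) fun x => by simp only [subst_const, Algebra.smul_def]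

theorem isSuperExt_const (a : A) : IsSuperExt (X := X) n L (fun _ _ => a) fun _ => a :=
  (isSuperExt_smooth (n := n) (L := L) (φ := fun _ => 1) contDiff_const a).congr (by simp) (by simp)

theorem IsSuperExt.add (h : IsSuperExt n L F f) (h' : IsSuperExt n L F' f') :
    IsSuperExt n L (fun t x => F t x + F' t x) fun x => f x + f' x := by
  obtain ⟨ι, _, φ, a, h1, h2, h3⟩ := h
  obtain ⟨ι', _, φ', a', h1', h2', h3'⟩ := h'
  exact ⟨ι ⊕ ι', inferInstance, Sum.elim φ φ', Sum.elim a a', by rintro (i | i) <;> simp [h1, h1'],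
    by simp [h2, h2'], by simp [h3, h3']⟩

theorem IsSuperExt.mul (hn : IsNil n) (h : IsSuperExt n L F f) (h' : IsSuperExt n L F' f') :
    IsSuperExt n L (fun t x => F t x * F' t x) fun x => f x * f' x := by
  obtain ⟨ι, _, φ, a, h1, h2, h3⟩ := h
  obtain ⟨ι', _, φ', a', h1', h2', h3'⟩ := h'
  refine ⟨ι × ι', inferInstance, fun p => φ p.1 * φ' p.2, fun p => a p.1 * a' p.2,
    fun p => (h1 _).mul (h1' _), fun t x => ?_, fun x => ?_⟩
  · simp [h2, h2', Finset.sum_mul_sum, Fintype.sum_prod_type, smul_smul, mul_comm]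
  · simp only [h3, h3', Finset.sum_mul_sum, Fintype.sum_prod_type]
    refine Finset.sum_congr rfl fun i _ => Finset.sum_congr rfl fun j _ => ?_
    have := subst_mul (L := L) hn (contDiff_left (h1 i) x) (contDiff_left (h1' j) x)
    rw [show (fun t => (φ i * φ' j) (t, x)) = (fun t => φ i (t, x)) * fun t => φ' j (t, x) from rfl,
      this, mul_assoc, mul_assoc, ← mul_assoc (a i), ← (subst_commute hn _ (a i)).eq, mul_assoc]

theorem IsSuperExt.smul (h : IsSuperExt n L F f) (hn : IsNil n) {φ : X → ℂ}
    (hφ : ContDiff ℝ ∞ φ) : IsSuperExt n L (fun t x => φ x • F t x) fun x => φ x • f x :=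
  ((isSuperExt_smooth hφ 1).mul hn h).congr (by simp) (by simp)

theorem IsSuperExt.sum {ι : Type*} (s : Finset ι) {F : ι → (K → ℝ) → X → A} {f : ι → X → A}
    (h : ∀ i ∈ s, IsSuperExt n L (F i) (f i)) :
    IsSuperExt n L (fun t x => ∑ i ∈ s, F i t x) fun x => ∑ i ∈ s, f i x := by
  classical
  induction s using Finset.induction with
  | empty => simpa using isSuperExt_const (0 : A)
  | insert a s ha ih =>
    simp only [Finset.sum_insert ha]
    exact (h a (by simp)).add (ih fun i hi => h i (by simp [hi]))

theorem IsSuperExt.list_prod {ι : Type*} (hn : IsNil n) (l : List ι) {F : ι → (K → ℝ) → X → A}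
    {f : ι → X → A} (h : ∀ i, IsSuperExt n L (F i) (f i)) :
    IsSuperExt n L (fun t x => (l.map fun i => F i t x).prod)
      fun x => (l.map fun i => f i x).prod := by
  induction l with
  | nil => simpa using isSuperExt_const (1 : A)
  | cons i l ih => simpa using (h i).mul hn ih

theorem IsSuperExt.map (h : IsSuperExt n L F f) (Λ : A →ₗ[ℂ] A)
    (hΛ : ∀ k x, Λ (n k * x) = n k * Λ x) :
    IsSuperExt n L (fun t x => Λ (F t x)) fun x => Λ (f x) := by
  obtain ⟨ι, _, φ, a, h1, h2, h3⟩ := h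
  refine ⟨ι, inferInstance, φ, fun i => Λ (a i), h1, by simp [h2], fun x => ?_⟩
  simp only [h3, map_sum]
  exact Finset.sum_congr rfl fun i _ => map_subst Λ hΛ _ _

theorem sum_subst_mul_eq_zero {ι : Type*} [Fintype ι] {φ : ι → (K → ℝ) → ℂ} {a : ι → A}
    (hφ : ∀ i, ContDiff ℝ ∞ (φ i)) (h : ∀ᶠ t in 𝓝 0, ∑ i, φ i t • a i = 0) :
    ∑ i, subst n L (φ i) * a i = 0 := by
  induction L generalizing φ with
  | nil => simpa [subst, Algebra.smul_def] using h.self_of_nhds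
  | cons k L ih =>
    have h' : ∀ᶠ t in 𝓝 0, ∑ i, dirD (Pi.single k 1) (φ i) t • a i = 0 := by
      filter_upwards [h.eventually_nhds] with t ht
      rw [← Module.forall_dual_apply_eq_zero_iff ℂ]
      intro ℓ
      have h0 : (fun t => ∑ i, φ i t * ℓ (a i)) =ᶠ[𝓝 t] fun _ => 0 := by
        filter_upwards [ht] with t' ht'
        simpa using congrArg ℓ ht'
      have h1 : HasFDerivAt (fun t => ∑ i, φ i t * ℓ (a i))
          (∑ i, ℓ (a i) • fderiv ℝ (φ i) t) t :=
        HasFDerivAt.fun_sum fun i _ =>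
          ((diff_of_contDiff (hφ i) t).hasFDerivAt.mul_const (ℓ (a i)))
      have h2 := h1.fderiv.symm.trans h0.fderiv_eq
      have h3 := congrArg (fun D => D (Pi.single k 1)) h2
      simpa [dirD, mul_comm] using h3
    simp only [subst, add_mul, Finset.sum_add_distrib, mul_assoc, ← Finset.mul_sum, ih hφ h,
      ih (fun i => contDiff_dirD (hφ i) _) h', mul_zero, add_zero]

/-- The values at nilpotent parameters are determined by the germ of the family at `0`, whatever
decomposition into smooth functions and constants is used to define them. -/
theorem IsSuperExt.unique (h : IsSuperExt n L F f) (h' : IsSuperExt n L F' f') {x : X}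
    (hx : ∀ᶠ t in 𝓝 0, F t x = F' t x) : f x = f' x := by
  obtain ⟨ι, _, φ, a, h1, h2, h3⟩ := h
  obtain ⟨ι', _, φ', a', h1', h2', h3'⟩ := h'
  have := sum_subst_mul_eq_zero (n := n) (L := L)
    (φ := Sum.elim (fun i t => φ i (t, x)) fun i t => φ' i (t, x)) (a := Sum.elim a (-a'))
    (by rintro (i | i); exacts [contDiff_left (h1 i) x, contDiff_left (h1' i) x]) (by
      filter_upwards [hx] with t ht
      simpa [h2, h2', ← sub_eq_add_neg, sub_eq_zero] using ht)
  simpa [← h3, ← h3', ← sub_eq_add_neg, sub_eq_zero] using this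

/-- Giving the parameters nilpotent values inside a family which depends on further parameters. -/
theorem subst_subst (hn : IsNil n) (L₁ L₂ : List K) {φ : (K → ℝ) × (K → ℝ) × Y → ℂ}
    (hφ : ContDiff ℝ ∞ φ) :
    ∃ (ι : Type) (_ : Fintype ι) (ψ : ι → (K → ℝ) × Y → ℂ) (b : ι → A),
      (∀ i, ContDiff ℝ ∞ (ψ i)) ∧
      (∀ t y, subst n L₂ (fun t' => φ (t', t, y)) = ∑ i, ψ i (t, y) • b i) ∧
      ∀ y, substAlong (L₁.map (fun k => (n k, ((0, Pi.single k 1, 0) : (K → ℝ) × (K → ℝ) × Y))) ++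
          L₂.map fun k => (n k, ((Pi.single k 1, 0, 0) : (K → ℝ) × (K → ℝ) × Y))) φ (0, 0, y) =
        ∑ i, subst n L₁ (fun t => ψ i (t, y)) * b i := by
  induction L₂ generalizing φ with
  | nil =>
    refine ⟨Unit, inferInstance, fun _ p => φ (0, p), fun _ => 1,
      fun _ => hφ.comp (contDiff_const.prodMk contDiff_id),
      fun t y => by simp [subst, Algebra.algebraMap_eq_smul_one], fun y => ?_⟩
    have hf : ∀ t : K → ℝ, HasFDerivAt (fun t : K → ℝ => ((0, t, y) : (K → ℝ) × (K → ℝ) × Y))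
        ((0 : (K → ℝ) →L[ℝ] (K → ℝ)).prod ((ContinuousLinearMap.id ℝ _).prod 0)) t := fun t =>
      (hasFDerivAt_const _ _).prodMk ((hasFDerivAt_id t).prodMk (hasFDerivAt_const _ _))
    have := substAlong_comp (L₁.map fun k => (n k, Pi.single k 1)) hφ hf 0
    simp only [List.map_map, Function.comp_def] at this
    simp only [List.map_nil, List.append_nil, subst_eq_substAlong, Finset.univ_unique,
      Finset.sum_singleton, mul_one, this]
    rfl
  | cons k L₂ ih =>
    have hd := contDiff_dirD hφ (Pi.single k 1, 0, 0)
    obtain ⟨ι, _, ψ, b, h1, h2, h3⟩ := ih hφ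
    obtain ⟨ι', _, ψ', b', h1', h2', h3'⟩ := ih hd
    -- the factor `1 + n k * ∂` for the first parameter produces two summands, with coefficients
    -- `b i` and `n k * b' i`
    refine ⟨ι ⊕ ι', inferInstance, Sum.elim ψ ψ', Sum.elim b fun i => n k * b' i, ?_, ?_, ?_⟩
    · rintro (i | i)
      exacts [h1 i, h1' i]
    · intro t y
      have hf : ∀ t' : K → ℝ,
          HasFDerivAt (fun t' : K → ℝ => ((t', t, y) : (K → ℝ) × (K → ℝ) × Y))
          ((ContinuousLinearMap.id ℝ (K → ℝ)).prod 0) t' := fun t' =>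
        (hasFDerivAt_id t').prodMk (hasFDerivAt_const _ _)
      have e : dirD (Pi.single k 1) (fun t' => φ (t', t, y)) =
          fun t' => dirD (Pi.single k 1, 0, 0) φ (t', t, y) := by
        funext t'
        have := dirD_comp hφ (hf t') (Pi.single k 1)
        exact this
      simp only [subst, e, h2, h2', Fintype.sum_sum_type, Sum.elim_inl, Sum.elim_inr,
        Finset.mul_sum, mul_smul_comm]
    · intro y
      have hp : (L₁.map (fun k => (n k, ((0, Pi.single k 1, 0) : (K → ℝ) × (K → ℝ) × Y))) ++
          (k :: L₂).map fun k => (n k, ((Pi.single k 1, 0, 0) : (K → ℝ) × (K → ℝ) × Y))).Perm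
          ((n k, ((Pi.single k 1, 0, 0) : (K → ℝ) × (K → ℝ) × Y)) ::
          (L₁.map (fun k => (n k, ((0, Pi.single k 1, 0) : (K → ℝ) × (K → ℝ) × Y))) ++
          L₂.map fun k => (n k, ((Pi.single k 1, 0, 0) : (K → ℝ) × (K → ℝ) × Y)))) :=
        List.perm_middle
      rw [substAlong_perm hp _ hφ]
      · simp only [substAlong, h3, h3', Fintype.sum_sum_type, Sum.elim_inl, Sum.elim_inr,
          Finset.mul_sum]
        congr 1
        refine Finset.sum_congr rfl fun i _ => ?_
        rw [← mul_assoc, (hn.comm k _).eq, mul_assoc]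
      · intro p hp b
        simp only [List.mem_append, List.mem_map] at hp
        obtain ⟨k, -, rfl⟩ | ⟨k, -, rfl⟩ := hp <;> exact hn.comm k b

/-- Substituting `t`-dependent arguments: since `n k * n k = 0`, giving all occurrences of the
parameters their nilpotent values can be done in two steps. -/
theorem IsSuperExt.comp (hn : IsNil n) (h : IsSuperExt n L F f) {Φ : (K → ℝ) × Y → X}
    (hΦ : ContDiff ℝ ∞ Φ) : ∃ g : Y → A, IsSuperExt n L (fun t y => F t (Φ (t, y))) g ∧
      IsSuperExt n L (fun t y => f (Φ (t, y))) g := by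
  obtain ⟨ι, _, φ, a, h1, h2, h3⟩ := h
  have hs := fun i => subst_subst (Y := Y) hn L L
    (φ := fun p => φ i (p.1, Φ p.2)) ((h1 i).comp (by fun_prop))
  choose κ _ ψ b hψ hb hc using hs
  refine ⟨fun y => ∑ i, subst n L (fun t => φ i (t, Φ (t, y))) * a i,
    ⟨ι, inferInstance, fun i p => φ i (p.1, Φ p), a, fun i => (h1 i).comp (by fun_prop),
      fun t y => h2 _ _, fun y => rfl⟩,
    ⟨Σ i, κ i, inferInstance, fun j => ψ j.1 j.2, fun j => b j.1 j.2 * a j.1,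
    fun j => hψ _ _, fun t y => ?_, fun y => ?_⟩⟩
  · simp only [h3, hb, Finset.sum_mul, Fintype.sum_sigma, smul_mul_assoc]
  · rw [Fintype.sum_sigma]
    refine Finset.sum_congr rfl fun i _ => ?_
    simp only [← mul_assoc]
    -- substituting in both places at once is differentiating along the diagonal direction
    rw [← Finset.sum_mul, ← hc, ← substAlong_map_add hn, subst_eq_substAlong]
    · have hf : ∀ t : K → ℝ, HasFDerivAt (fun t : K → ℝ => ((t, t, y) : (K → ℝ) × (K → ℝ) × Y))
          ((ContinuousLinearMap.id ℝ _).prod ((ContinuousLinearMap.id ℝ _).prod 0)) t := fun t =>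
        (hasFDerivAt_id t).prodMk ((hasFDerivAt_id t).prodMk (hasFDerivAt_const _ _))
      have := substAlong_comp (L.map fun k => (n k, Pi.single k 1))
        (φ := fun p => φ i (p.1, Φ p.2)) ((h1 i).comp (by fun_prop)) hf 0
      simp only [List.map_map, Function.comp_def] at this
      rw [this]
      simp
    · exact (h1 i).comp (by fun_prop)

end SuperExt

/-! ### The integrand and its dependence on the weights -/

section Density

variable {V E : Type*} [AddCommGroup E] [Module ℂ E] {s : Finset V}

theorem contDiff_ofReal {X : Type*} [NormedAddCommGroup X] [NormedSpace ℝ X] {f : X → ℝ}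
    (hf : ContDiff ℝ ∞ f) : ContDiff ℝ ∞ fun x => (f x : ℂ) :=
  Complex.ofRealCLM.contDiff.comp hf

@[fun_prop]
theorem contDiff_ext0 {X : Type*} [NormedAddCommGroup X] [NormedSpace ℝ X] {f : X → s → ℝ}
    (hf : ContDiff ℝ ∞ f) (i : Option s) : ContDiff ℝ ∞ fun x => ext0 (f x) i := by
  cases i with
  | none => exact contDiff_const
  | some i => exact (contDiff_apply ℝ ℝ i).comp hf

@[simp] theorem ext0_some (u : s → ℝ) (i : s) : ext0 u (some i) = u i := rfl

@[simp] theorem ext0_none (u : s → ℝ) : ext0 u none = 0 := rfl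

/-- A matrix of real weights. -/
def realW (b : Option s → Option s → ℝ) : Option s → Option s → ParAlg E :=
  fun i j => algebraMap ℂ _ (b i j : ℂ)

/-- The factor `exp ⟨τ, e^u (ψbar + i ψ)⟩`. -/
def tauExp (τ : V → ParAlg E) (u : s → ℝ) : Alg V E :=
  superExp (∑ i : s, par (τ i) *
    ((Real.exp (u i) : ℂ) • (psiBar (i : V) + Complex.I • psi (i : V))))

/-- The variables `β, θ, φbar, φ` of the model with weights `w`, with indices restricted to `s₀`,
inserted into `g`. -/
def varpiEval [LinearOrder V] {s₀ : Finset V} (h : s₀ ⊆ s) (g : SuperFun s₀ E)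
    (w : Option s → Option s → ParAlg E) (u t : s → ℝ) : Alg V E :=
  g.eval (fun i => beta w u ⟨i, h i.2⟩) (fun i => theta w u t ⟨i, h i.2⟩)
    (fun i => phiBar w u ⟨i, h i.2⟩) (fun i => phi w u ⟨i, h i.2⟩)

/-- The integrand of the superintegral with weights `w`, after the Grassmann derivatives and
without the real parameters `α`. -/
def density [LinearOrder V] {s₀ : Finset V} (h : s₀ ⊆ s) (g : SuperFun s₀ E) (τ : V → ParAlg E)
    (w : Option s → Option s → ParAlg E) (p : Pts s) : Alg V E :=
  ((∏ i, Real.exp (-p.1 i) / (2 * Real.pi) : ℝ) : ℂ) •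
    berezin s (rho w p.1 p.2 * (tauExp τ p.1 * varpiEval h g w p.1 p.2))

/-- The quadratic form of the weighted Laplacian as a sum over pairs of vertices. -/
theorem sum_matA [DecidableEq V] {w : Option s → Option s → ParAlg E} (hs : ∀ i j, w i j = w j i)
    (h0 : ∀ i, w i i = 0) (he : ∀ i j, IsEven (w i j)) (u : s → ℝ) (x z : Option s → Alg V E) :
    ∑ i, ∑ j, x i * par (matA w u i j) * z j =
      ∑ i, ∑ j, (Real.exp (ext0 u i + ext0 u j) / 2 : ℂ) •
        (par (w i j) * ((x i - x j) * (z i - z j))) := by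
  have hc : ∀ i j (b : Alg V E), par (w i j) * b = b * par (w i j) := fun i j b =>
    ((he i j).par.commute b).eq
  have h1 : ∀ i, ∑ j, x i * par (matA w u i j) * z j =
      ∑ j, (Real.exp (ext0 u i + ext0 u j) : ℂ) • (par (w i j) * (x i * z i - x i * z j)) := by
    intro i
    have : ∀ j, x i * par (matA w u i j) * z j =
        (if i = j then ∑ k, (Real.exp (ext0 u i + ext0 u k) : ℂ) • (par (w i k) * (x i * z i))
          else 0) -
        (Real.exp (ext0 u i + ext0 u j) : ℂ) • (par (w i j) * (x i * z j)) := by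
      intro j
      unfold matA
      split_ifs with h
      · subst h
        simp only [h0, map_zero, zero_mul, smul_zero, sub_zero, map_sum, map_smul, Finset.mul_sum,
          Finset.sum_mul, mul_smul_comm, smul_mul_assoc]
        refine Finset.sum_congr rfl fun k _ => ?_
        rw [← hc, mul_assoc]
      · simp only [map_neg, map_smul, mul_neg, neg_mul, mul_smul_comm, smul_mul_assoc, zero_sub]
        rw [← hc, mul_assoc]
    simp only [this, Finset.sum_sub_distrib, Finset.sum_ite_eq, Finset.mem_univ, if_true, mul_sub,
      smul_sub]
  simp only [h1]
  set e : Option s → Option s → ℂ := fun i j => (Real.exp (ext0 u i + ext0 u j) : ℂ)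
  have he' : ∀ i j, (Real.exp (ext0 u i + ext0 u j) : ℂ) = e i j := fun _ _ => rfl
  have hes : ∀ i j, e i j = e j i := fun i j => by simp only [e, add_comm]
  simp only [he']
  have h2 : ∑ i, ∑ j, e i j • (par (w i j) * (x i * z i - x i * z j)) =
      ∑ i, ∑ j, e i j • (par (w i j) * (x j * z j - x j * z i)) := by
    rw [Finset.sum_comm]
    refine Finset.sum_congr rfl fun i _ => Finset.sum_congr rfl fun j _ => ?_
    rw [hes, hs]
  have h3 : ∑ i, ∑ j, e i j • (par (w i j) * (x i * z i - x i * z j)) = (1 / 2 : ℂ) •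
      (∑ i, ∑ j, e i j • (par (w i j) * (x i * z i - x i * z j)) +
      ∑ i, ∑ j, e i j • (par (w i j) * (x j * z j - x j * z i))) := by
    rw [← h2, ← two_smul ℂ, smul_smul]; norm_num
  rw [h3, ← Finset.sum_add_distrib, Finset.smul_sum]
  refine Finset.sum_congr rfl fun i _ => ?_
  rw [← Finset.sum_add_distrib, Finset.smul_sum]
  refine Finset.sum_congr rfl fun j _ => ?_
  rw [← smul_add, ← mul_add, smul_smul]
  congr 1
  · ring
  · congr 1
    simp only [sub_mul, mul_sub]
    abel

/-- The superdensity as a product of functions of single weights: the exponents are sums over pairs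
of vertices, so that nilpotent values can be inserted weight by weight. -/
theorem rho_eq [DecidableEq V] {w : Option s → Option s → ParAlg E} (hs : ∀ i j, w i j = w j i)
    (h0 : ∀ i, w i i = 0) (he : ∀ i j, IsEven (w i j)) (u t : s → ℝ) :
    rho w u t =
      superExp (∑ i, ∑ j, ((-(1 / 4) * Real.exp (ext0 u i + ext0 u j) *
          (ext0 t i - ext0 t j) ^ 2 : ℝ) : ℂ) • par (w i j)) *
      superExp (∑ i, ∑ j, ((-(1 / 2) * Real.exp (ext0 u i + ext0 u j) : ℝ) : ℂ) •
        (par (w i j) * ((psiBarT i - psiBarT j) * (psiT i - psiT j)))) *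
      superExp (∑ i, ∑ j, ((-(1 / 2) * (Real.cosh (ext0 u i - ext0 u j) - 1) : ℝ) : ℂ) •
        par (w i j)) := by
  unfold rho
  congr 1
  · congr 1
    · congr 1
      have := sum_matA hs h0 he u (fun i => algebraMap ℂ (Alg V E) (ext0 t i : ℂ))
        (fun i => algebraMap ℂ (Alg V E) (ext0 t i : ℂ))
      have e : ∀ i j, ((ext0 t i * ext0 t j : ℝ) : ℂ) • (par (matA w u i j) : Alg V E) =
          algebraMap ℂ (Alg V E) (ext0 t i : ℂ) * par (matA w u i j) *
            algebraMap ℂ (Alg V E) (ext0 t j : ℂ) := by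
        intro i j
        rw [← Algebra.smul_def, ← Algebra.commutes, ← Algebra.smul_def, smul_smul]
        push_cast
        rw [mul_comm]
      simp only [e, this, Finset.smul_sum, ← Finset.sum_neg_distrib]
      refine Finset.sum_congr rfl fun i _ => Finset.sum_congr rfl fun j _ => ?_
      rw [← map_sub, ← map_mul, ← Algebra.commutes, ← Algebra.smul_def, smul_smul, smul_smul,
        ← neg_smul]
      congr 1
      push_cast
      ring
    · rw [sum_matA hs h0 he u]
      simp only [← Finset.sum_neg_distrib]
      congr 1
      refine Finset.sum_congr rfl fun i _ => Finset.sum_congr rfl fun j _ => ?_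
      rw [← neg_smul]
      congr 1
      push_cast
      ring
  · congr 1
    simp only [Finset.smul_sum, ← Finset.sum_neg_distrib]
    refine Finset.sum_congr rfl fun i _ => Finset.sum_congr rfl fun j _ => ?_
    rw [smul_smul, ← neg_smul]
    congr 1
    push_cast
    ring

end Density

section Family

variable {V E : Type*} [AddCommGroup E] [Module ℂ E] {s : Finset V}
  {K : Type*} [Fintype K] [DecidableEq K]
  {X : Type*} [NormedAddCommGroup X] [NormedSpace ℝ X]

/-- Real weights which depend in an affine way on real parameters. -/
def affW (b : Option s → Option s → ℝ) (Λ : Option s → Option s → K → ℝ) (t : K → ℝ) :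
    Option s → Option s → ℝ := fun i j => b i j + ∑ k, Λ i j k * t k

theorem contDiff_affW {b : Option s → Option s → ℝ} {Λ : Option s → Option s → K → ℝ}
    {f : X → K → ℝ} (hf : ContDiff ℝ ∞ f) (i j : Option s) :
    ContDiff ℝ ∞ fun x => affW b Λ (f x) i j :=
  contDiff_const.add (ContDiff.sum fun k _ =>
    contDiff_const.mul ((contDiff_apply ℝ ℝ k).comp hf))

/-- The weights `w` are obtained from `affW b Λ` by giving the parameters in `L` the even
nilpotent values `par (m k)`. -/
structure IsFamily (m : K → ParAlg E) (L : List K) (b : Option s → Option s → ℝ)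
    (Λ : Option s → Option s → K → ℝ) (w : Option s → Option s → ParAlg E) : Prop where
  even : ∀ k, IsEven (m k)
  sq : ∀ k, m k * m k = 0
  eq : ∀ i j, w i j = algebraMap ℂ _ (b i j : ℂ) + (L.map fun k => (Λ i j k : ℂ) • m k).sum
  b_symm : ∀ i j, b i j = b j i
  b_diag : ∀ i, b i i = 0
  Λ_symm : ∀ i j, Λ i j = Λ j i
  Λ_diag : ∀ i, Λ i i = 0

variable {m : K → ParAlg E} {L : List K} {b : Option s → Option s → ℝ}
  {Λ : Option s → Option s → K → ℝ} {w : Option s → Option s → ParAlg E}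

theorem IsFamily.isNil (h : IsFamily m L b Λ w) :
    IsNil (fun k => (par (m k) : Alg V E)) where
  comm k b := (h.even k).par.commute b
  sq k := by rw [← map_mul, h.sq, map_zero]

theorem IsFamily.w_even (h : IsFamily m L b Λ w) (i j : Option s) : IsEven (w i j) := by
  rw [h.eq]
  refine (isEven_algebraMap _).add ?_
  refine list_sum_mem (S := CliffordAlgebra.evenOdd (0 : QuadraticForm ℂ E) 0) fun x hx => ?_
  obtain ⟨k, -, rfl⟩ := List.mem_map.1 hx
  exact (h.even k).smul _

theorem IsFamily.w_symm (h : IsFamily m L b Λ w) (i j : Option s) : w i j = w j i := by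
  rw [h.eq, h.eq, h.b_symm, h.Λ_symm]

theorem IsFamily.w_diag (h : IsFamily m L b Λ w) (i : Option s) : w i i = 0 := by
  rw [h.eq, h.b_diag, h.Λ_diag]
  simp

theorem IsFamily.par_eq (h : IsFamily m L b Λ w) (i j : Option s) : (par (w i j) : Alg V E) =
    algebraMap ℂ _ (b i j : ℂ) + (L.map fun k => (Λ i j k : ℂ) • (par (m k) : Alg V E)).sum := by
  rw [h.eq, map_add, par_algebraMap, map_list_sum, List.map_map]
  simp only [Function.comp_def, map_smul]

theorem isEven_realW (b : Option s → Option s → ℝ) (i j : Option s) :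
    IsEven (realW b i j : ParAlg E) := isEven_algebraMap _

theorem IsFamily.affW_symm (h : IsFamily m L b Λ w) (t : K → ℝ) (i j : Option s) :
    affW b Λ t i j = affW b Λ t j i := by
  simp only [affW, h.b_symm i j, h.Λ_symm i j]

theorem IsFamily.affW_diag (h : IsFamily m L b Λ w) (t : K → ℝ) (i : Option s) :
    affW b Λ t i i = 0 := by
  simp [affW, h.b_diag, h.Λ_diag]

local notation "SE" => IsSuperExt (fun k => (par (m k) : Alg V E)) L

theorem IsFamily.isSuperExt_weight (h : IsFamily m L b Λ w) (i j : Option s) :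
    SE (fun t (_ : X) => par (realW (affW b Λ t) i j)) fun _ => par (w i j) := by
  refine (isSuperExt_algebraMap (φ := fun p : (K → ℝ) × X => ((affW b Λ p.1 i j : ℝ) : ℂ)) ?_).congr
    (fun t x => ?_) fun x => ?_
  · exact contDiff_ofReal (contDiff_affW contDiff_fst i j)
  · simp [realW]
  · rw [h.par_eq]
    have := subst_affine (n := fun k => (par (m k) : Alg V E)) (L := L) (b i j : ℂ)
      fun k => (Λ i j k : ℂ)
    rw [← this]
    congr 1
    funext t
    simp [affW]

/-- The exponential of a multiple of a weight, as defined by Taylor expansion around the body, is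
obtained from the exponentials of the real weights by nilpotent substitution. -/
theorem IsFamily.isSuperExt_exp_weight (h : IsFamily m L b Λ w) (i j : Option s) {r : X → ℝ}
    (hr : ContDiff ℝ ∞ r) :
    SE (fun t x => superExp ((r x : ℂ) • (par (realW (affW b Λ t) i j) : Alg V E)))
      fun x => superExp ((r x : ℂ) • (par (w i j) : Alg V E)) := by
  refine (isSuperExt_algebraMap
    (φ := fun p : (K → ℝ) × X => Complex.exp ((r p.2 * affW b Λ p.1 i j : ℝ) : ℂ)) ?_).congr
    (fun t x => ?_) fun x => ?_
  · exact (contDiff_ofReal ((hr.comp contDiff_snd).mul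
      (contDiff_affW contDiff_fst i j))).cexp
  · rw [realW, par_algebraMap, Algebra.smul_def, ← map_mul, superExp_algebraMap]
    push_cast
    rfl
  · have := subst_exp_affine (n := fun k => (par (m k) : Alg V E)) (L := L) (r x * b i j : ℂ)
      fun k => (r x * Λ i j k : ℂ)
    rw [show (fun t => Complex.exp ((r x * affW b Λ t i j : ℝ) : ℂ)) =
      fun t => Complex.exp ((r x * b i j : ℂ) + ∑ k, (r x * Λ i j k : ℂ) * t k) from by
        funext t; simp [affW, mul_add, Finset.mul_sum, mul_assoc], this, h.par_eq, smul_add,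
        Algebra.smul_def (r x : ℂ) (algebraMap ℂ (Alg V E) _), ← map_mul, superExp_add
        (isEven_algebraMap _), superExp_algebraMap, ← Algebra.smul_def, List.smul_sum, List.map_map]
    · rw [superExp_list_sum, List.map_map]
      · congr 2
        refine List.map_congr_left fun k _ => ?_
        simp only [Function.comp_apply, smul_smul]
        refine superExp_of_sq ?_
        rw [smul_mul_smul_comm, h.isNil.sq, smul_zero]
      · intro a ha
        obtain ⟨k, -, rfl⟩ := List.mem_map.1 ha
        exact ((h.even k).par.smul _).smul _
    · rw [List.smul_sum]
      refine list_sum_mem (S := CliffordAlgebra.evenOdd (0 : QuadraticForm ℂ (Gen V E)) 0)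
        fun x hx => ?_
      simp only [List.map_map, List.mem_map] at hx
      obtain ⟨k, -, rfl⟩ := hx
      exact ((h.even k).par.smul _).smul _

/-- Exponentials of sums. -/
theorem isSuperExt_superExp_sum {n : K → Alg V E} (hn : IsNil n) {ι : Type*} (s : Finset ι)
    {F : ι → (K → ℝ) → X → Alg V E} {f : ι → X → Alg V E}
    (hF : ∀ i ∈ s, (∀ t x, IsEven (F i t x)) ∧ (∀ x, IsEven (f i x)) ∧
      IsSuperExt n L (fun t x => superExp (F i t x)) fun x => superExp (f i x)) :
    (∀ t x, IsEven (∑ i ∈ s, F i t x)) ∧ (∀ x, IsEven (∑ i ∈ s, f i x)) ∧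
      IsSuperExt n L (fun t x => superExp (∑ i ∈ s, F i t x))
        fun x => superExp (∑ i ∈ s, f i x) := by
  classical
  refine ⟨fun t x => IsEven.sum fun i hi => (hF i hi).1 t x,
    fun x => IsEven.sum fun i hi => (hF i hi).2.1 x, ?_⟩
  induction s using Finset.induction with
  | empty =>
    simp only [Finset.sum_empty]
    exact isSuperExt_const _
  | insert a s ha ih =>
    simp only [Finset.sum_insert ha]
    have hs := fun i hi => hF i (Finset.mem_insert_of_mem hi)
    refine ((hF a (by simp)).2.2.mul hn (ih hs)).congr (fun t x => superExp_add
      ((hF a (by simp)).1 t x) (IsEven.sum fun i hi => (hs i hi).1 t x)) fun x => superExp_add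
      ((hF a (by simp)).2.1 x) (IsEven.sum fun i hi => (hs i hi).2.1 x)

/-- The superdensity is obtained from the superdensities with real weights by nilpotent
substitution. -/
theorem IsFamily.isSuperExt_rho [DecidableEq V] (h : IsFamily m L b Λ w) :
    SE (fun t (p : Pts s) => rho (realW (affW b Λ t)) p.1 p.2)
      fun p => rho w p.1 p.2 := by
  have hr : ∀ t (p : Pts s), rho (realW (affW b Λ t)) p.1 p.2 = _ := fun t p =>
    rho_eq (w := (realW (affW b Λ t) : Option s → Option s → ParAlg E))
      (fun i j => by simp only [realW, h.affW_symm t i j])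
      (fun i => by simp [realW, h.affW_diag]) (isEven_realW _) p.1 p.2
  refine IsSuperExt.congr (F := fun t p => _) (f := fun p => _) ?_ hr
    fun p => rho_eq h.w_symm h.w_diag h.w_even p.1 p.2
  refine IsSuperExt.mul h.isNil (IsSuperExt.mul h.isNil ?_ ?_) ?_
  · refine (isSuperExt_superExp_sum h.isNil _ fun i _ =>
      isSuperExt_superExp_sum h.isNil _ fun j _ => ⟨fun t x => ?_, fun x => ?_, ?_⟩).2.2
    · exact (isEven_realW _ _ _).par.smul _
    · exact (h.w_even _ _).par.smul _
    · exact h.isSuperExt_exp_weight i j (r := fun p : Pts s =>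
        -(1 / 4) * Real.exp (ext0 p.1 i + ext0 p.1 j) * (ext0 p.2 i - ext0 p.2 j) ^ 2) (by fun_prop)
  · refine (isSuperExt_superExp_sum h.isNil _ fun i _ =>
      isSuperExt_superExp_sum h.isNil _ fun j _ => ?_).2.2
    have h1 : IsOdd (psiBarT i - psiBarT j : Alg V E) := by
      have := (isOdd_psiBarT (V := V) (E := E) i).add ((isOdd_psiBarT j).smul (-1))
      simpa [← sub_eq_add_neg] using this
    have h2 : IsOdd (psiT i - psiT j : Alg V E) := by
      have := (isOdd_psiT (V := V) (E := E) i).add ((isOdd_psiT j).smul (-1))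
      simpa [← sub_eq_add_neg] using this
    set q : Alg V E := (psiBarT i - psiBarT j) * (psiT i - psiT j)
    have hq : q * q = 0 := by simpa [pow_two] using h1.mul_mul_self h2
    -- the fermionic exponents of single weights have square zero, so that their exponentials are
    -- affine in the weight
    have hsq : ∀ (w' : ParAlg E) (c : ℂ), IsEven w' → (c • (par w' * q)) * (c • (par w' * q)) = 0 := by
      intro w' c hw
      rw [smul_mul_smul_comm, mul_assoc, ← mul_assoc q, ← (hw.par.commute q).eq, mul_assoc _ q q,
        hq, mul_zero, mul_zero, smul_zero]
    refine ⟨fun t x => ?_, fun x => ?_, ?_⟩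
    · exact ((isEven_realW _ _ _).par.mul (h1.mul h2)).smul _
    · exact ((h.w_even _ _).par.mul (h1.mul h2)).smul _
    · refine IsSuperExt.congr (F := fun t p => 1 + _) (f := fun p => 1 + _) ?_
        (fun t x => superExp_of_sq (hsq _ _ (isEven_realW _ _ _)))
        fun x => superExp_of_sq (hsq _ _ (h.w_even _ _))
      refine (isSuperExt_const 1).add (IsSuperExt.smul (φ := fun p : Pts s =>
        ((-(1 / 2) * Real.exp (ext0 p.1 i + ext0 p.1 j) : ℝ) : ℂ)) (IsSuperExt.mul h.isNil
        (h.isSuperExt_weight i j) (isSuperExt_const q)) h.isNil ?_)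
      exact contDiff_ofReal (by fun_prop)
  · refine (isSuperExt_superExp_sum h.isNil _ fun i _ =>
      isSuperExt_superExp_sum h.isNil _ fun j _ => ⟨fun t x => ?_, fun x => ?_, ?_⟩).2.2
    · exact (isEven_realW _ _ _).par.smul _
    · exact (h.w_even _ _).par.smul _
    · exact h.isSuperExt_exp_weight i j (r := fun p : Pts s =>
        -(1 / 2) * (Real.cosh (ext0 p.1 i - ext0 p.1 j) - 1)) (by fun_prop)

theorem isOdd_psiBar_add (i : V) : IsOdd (psiBar i + Complex.I • psi i : Alg V E) :=
  (isOdd_psiBar i).add ((isOdd_psi i).smul _)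

theorem tauTerm_mul_self {τ : ParAlg E} (hτ : IsOdd τ) (i : V) (c : ℂ) :
    ((par τ : Alg V E) * (c • (psiBar i + Complex.I • psi i))) *
      (par τ * (c • (psiBar i + Complex.I • psi i))) = 0 := by
  simpa [pow_two] using hτ.par.mul_mul_self ((isOdd_psiBar_add (V := V) (E := E) i).smul c)

theorem isSuperExt_tauExp {n : K → Alg V E} (hn : IsNil n) {τ : V → ParAlg E}
    (hτ : ∀ i, IsOdd (τ i)) :
    IsSuperExt n L (fun _ (p : Pts s) => (tauExp τ p.1 : Alg V E)) fun p => tauExp τ p.1 := by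
  unfold tauExp
  refine (isSuperExt_superExp_sum hn _ fun i _ => ⟨fun t x => ?_, fun x => ?_, ?_⟩).2.2
  · exact (hτ i).par.mul ((isOdd_psiBar_add _).smul _)
  · exact (hτ i).par.mul ((isOdd_psiBar_add _).smul _)
  · have e : ∀ p : Pts s, superExp ((par (τ i) : Alg V E) *
        ((Real.exp (p.1 i) : ℂ) • (psiBar (i : V) + Complex.I • psi (i : V)))) =
        1 + (Real.exp (p.1 i) : ℂ) • (par (τ i) * (psiBar (i : V) + Complex.I • psi (i : V))) :=
      fun p => by rw [superExp_of_sq (tauTerm_mul_self (hτ i) _ _), mul_smul_comm]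
    simp only [e]
    refine (isSuperExt_const (1 : Alg V E)).add (isSuperExt_smooth
      (φ := fun p : Pts s => (Real.exp (p.1 i) : ℂ)) ?_ _)
    exact contDiff_ofReal (by fun_prop)

variable [LinearOrder V] {s₀ : Finset V}

theorem IsFamily.isSuperExt_phiBar (h : IsFamily m L b Λ w) (i : s) :
    SE (fun t (p : Pts s) => phiBar (realW (affW b Λ t)) p.1 i) fun p => phiBar w p.1 i := by
  unfold phiBar
  refine IsSuperExt.sum _ fun j _ => (IsSuperExt.mul h.isNil (h.isSuperExt_weight (some i) j)
    (isSuperExt_const _)).smul (φ := fun p : Pts s => (Real.exp (ext0 p.1 j) : ℂ)) h.isNil ?_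
  exact contDiff_ofReal (by fun_prop)

theorem IsFamily.isSuperExt_phi (h : IsFamily m L b Λ w) (i : s) :
    SE (fun t (p : Pts s) => phi (realW (affW b Λ t)) p.1 i) fun p => phi w p.1 i := by
  unfold phi
  refine IsSuperExt.sum _ fun j _ => (IsSuperExt.mul h.isNil (h.isSuperExt_weight (some i) j)
    (isSuperExt_const _)).smul (φ := fun p : Pts s => (Real.exp (ext0 p.1 j) : ℂ)) h.isNil ?_
  exact contDiff_ofReal (by fun_prop)

/-- The variables `β` of the model with real weights, as real numbers. -/
def realBeta (b : Option s → Option s → ℝ) (u : s → ℝ) (i : s) : ℝ :=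
  (1 / 2) * ∑ j, Real.exp (ext0 u j - u i) * b (some i) j

/-- The variables `θ` of the model with real weights, as real numbers. -/
def realTheta (b : Option s → Option s → ℝ) (u t : s → ℝ) (i : s) : ℝ :=
  ∑ j, Real.exp (ext0 u j) * (t i - ext0 t j) * b (some i) j

theorem beta_realW (b : Option s → Option s → ℝ) (u : s → ℝ) (i : s) :
    (beta (realW b) u i : Alg V E) = algebraMap ℂ _ (realBeta b u i : ℂ) := by
  simp only [beta, realBeta, realW, par_algebraMap]
  push_cast
  simp only [map_mul, map_sum, Algebra.smul_def]

theorem theta_realW (b : Option s → Option s → ℝ) (u t : s → ℝ) (i : s) :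
    (theta (realW b) u t i : Alg V E) = algebraMap ℂ _ (realTheta b u t i : ℂ) := by
  simp only [theta, realTheta, realW, par_algebraMap]
  push_cast
  simp only [map_mul, map_sum, Algebra.smul_def]

theorem varpiEval_realW (h : s₀ ⊆ s) (g : SuperFun s₀ E) (b : Option s → Option s → ℝ)
    (u t : s → ℝ) : (varpiEval h g (realW b) u t : Alg V E) =
      g.eval (fun i => algebraMap ℂ _ (realBeta b u ⟨i, h i.2⟩ : ℂ))
        (fun i => algebraMap ℂ _ (realTheta b u t ⟨i, h i.2⟩ : ℂ))
        (fun i => phiBar (realW b) u ⟨i, h i.2⟩) (fun i => phi (realW b) u ⟨i, h i.2⟩) := by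
  simp only [varpiEval, beta_realW, theta_realW]

theorem list_sum_smul_map {ι : Type*} (J : Finset ι) (c : ι → ℂ) (l : ι → K → ℂ)
    (n : K → Alg V E) : ∑ j ∈ J, c j • (L.map fun k => l j k • n k).sum =
      (L.map fun k => (∑ j ∈ J, c j * l j k) • n k).sum := by
  induction L with
  | nil => simp
  | cons k L ih =>
    simp only [List.map_cons, List.sum_cons, smul_add, Finset.sum_add_distrib, ih, Finset.sum_smul,
      smul_smul]

/-- A smooth function of the variables `β`, `θ` is obtained by nilpotent substitution, since these
variables are affine in the weights. -/
theorem IsFamily.isSuperExt_taylor (h : IsFamily m L b Λ w) (hs : s₀ ⊆ s) {f : Pts s₀ → ℂ}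
    (hf : ContDiff ℝ ∞ f) :
    SE (fun t (p : Pts s) => algebraMap ℂ (Alg V E)
        (f (fun i => realBeta (affW b Λ t) p.1 ⟨i, hs i.2⟩,
          fun i => realTheta (affW b Λ t) p.1 p.2 ⟨i, hs i.2⟩)))
      fun p => taylor (fun i => (beta w p.1 ⟨i, hs i.2⟩ : Alg V E))
        (fun i => theta w p.1 p.2 ⟨i, hs i.2⟩) f := by
  refine (isSuperExt_algebraMap (φ := fun p : (K → ℝ) × Pts s =>
    f (fun i => realBeta (affW b Λ p.1) p.2.1 ⟨i, hs i.2⟩,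
          fun i => realTheta (affW b Λ p.1) p.2.1 p.2.2 ⟨i, hs i.2⟩)) ?_).congr
    (fun _ _ => rfl) fun p => ?_
  · refine hf.comp (ContDiff.prodMk (contDiff_pi.2 fun i => ?_) (contDiff_pi.2 fun i => ?_))
    · exact contDiff_const.mul (ContDiff.sum fun j _ =>
        ContDiff.mul (by fun_prop) (contDiff_affW contDiff_fst _ _))
    · exact ContDiff.sum fun j _ => ContDiff.mul (by fun_prop) (contDiff_affW contDiff_fst _ _)
  · rw [taylor_subst h.isNil (fun i => realBeta b p.1 ⟨i, hs i.2⟩,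
      fun i => realTheta b p.1 p.2 ⟨i, hs i.2⟩) (fun c k => Sum.elim
        (fun i : s₀ => (1 / 2) * ∑ j, Real.exp (ext0 p.1 j - p.1 ⟨i, hs i.2⟩) *
          Λ (some ⟨i, hs i.2⟩) j k)
        (fun i : s₀ => ∑ j, Real.exp (ext0 p.1 j) * (p.2 ⟨i, hs i.2⟩ - ext0 p.2 j) *
          Λ (some ⟨i, hs i.2⟩) j k) c) _ _ ?_ ?_ hf]
    · congr 1
      funext t
      congr 1
      ext i
      · simp only [realBeta, affW, Sum.elim_inl, mul_add, Finset.sum_add_distrib, Finset.mul_sum,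
          Finset.sum_mul]
        congr 1
        rw [Finset.sum_comm]
        refine Finset.sum_congr rfl fun j _ => Finset.sum_congr rfl fun k _ => ?_
        ring
      · simp only [realTheta, affW, Sum.elim_inr, mul_add, Finset.sum_add_distrib, Finset.mul_sum,
          Finset.sum_mul]
        congr 1
        rw [Finset.sum_comm]
        refine Finset.sum_congr rfl fun j _ => Finset.sum_congr rfl fun k _ => ?_
        ring
    · intro i
      simp only [beta, h.par_eq, smul_add, Finset.sum_add_distrib, list_sum_smul_map, Sum.elim_inl]
      congr 1
      · rw [← beta_realW]
        simp only [beta, realW, par_algebraMap]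
      · have := list_sum_smul_map (L := L) {()} (fun _ => (1 / 2 : ℂ)) (fun _ k => ∑ j,
          (Real.exp (ext0 p.1 j - p.1 ⟨i, hs i.2⟩) : ℂ) * (Λ (some ⟨i, hs i.2⟩) j k : ℂ))
          (fun k => (par (m k) : Alg V E))
        simp only [Finset.sum_singleton] at this
        rw [this]
        push_cast
        rfl
    · intro i
      simp only [theta, h.par_eq, smul_add, Finset.sum_add_distrib, list_sum_smul_map, Sum.elim_inr]
      congr 1
      · rw [← theta_realW]
        simp only [theta, realW, par_algebraMap]
      · push_cast
        rfl

theorem IsFamily.isSuperExt_evalCoeff (h : IsFamily m L b Λ w) (hs : s₀ ⊆ s)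
    (x : (Smooth s₀) ⊗[ℂ] (ParAlg E)) :
    SE (fun t (p : Pts s) => evalCoeff (fun i => (beta (realW (affW b Λ t)) p.1 ⟨i, hs i.2⟩))
        (fun i => (theta (realW (affW b Λ t)) p.1 p.2 ⟨i, hs i.2⟩)) x)
      fun p => evalCoeff (fun i => (beta w p.1 ⟨i, hs i.2⟩ : Alg V E))
        (fun i => theta w p.1 p.2 ⟨i, hs i.2⟩) x := by
  induction x using TensorProduct.induction_on with
  | zero => simpa using isSuperExt_const 0
  | add x y hx hy => simpa using hx.add hy
  | tmul f c =>
    refine ((h.isSuperExt_taylor hs (Smooth.contDiff f)).mul h.isNil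
      (isSuperExt_const (par c))).congr (fun t p => ?_) fun p => rfl
    change taylor _ _ _ * _ = _
    simp only [beta_realW, theta_realW]
    rw [taylor_algebraMap _ _ (Smooth.contDiff f)]

/-- The integrand is obtained from the integrands with real weights by nilpotent substitution. The
Berezin integral may be carried out before or after it, because it commutes with multiplication by
even parameters. -/
theorem IsFamily.isSuperExt_density (h : IsFamily m L b Λ w) (hs : s₀ ⊆ s) (g : SuperFun s₀ E)
    {τ : V → ParAlg E} (hτ : ∀ i, IsOdd (τ i)) :
    SE (fun t => density hs g τ (realW (affW b Λ t))) (density hs g τ w) := by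
  unfold density
  refine IsSuperExt.smul (IsSuperExt.map (IsSuperExt.mul h.isNil h.isSuperExt_rho
    (IsSuperExt.mul h.isNil (isSuperExt_tauExp h.isNil hτ) ?_)) _ ?_) h.isNil ?_
  · unfold varpiEval SuperFun.eval
    refine IsSuperExt.sum _ fun I _ => IsSuperExt.sum _ fun J _ => IsSuperExt.mul h.isNil
      (IsSuperExt.mul h.isNil (h.isSuperExt_evalCoeff hs (g I J)) ?_) ?_
    · exact IsSuperExt.list_prod h.isNil _ fun i => h.isSuperExt_phiBar _
    · exact IsSuperExt.list_prod h.isNil _ fun i => h.isSuperExt_phi _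
  · exact fun k x => berezin_par_mul s (h.even k) x
  · refine contDiff_ofReal (contDiff_prod fun i _ => ?_)
    fun_prop

end Family

/-! ### The model with real weights -/

section Hmat

variable {V E : Type*} [AddCommGroup E] [Module ℂ E] {s : Finset V} [DecidableEq V]

/-- The matrix `2β - b` of the random Schrödinger operator. -/
def Hmat (b : Option s → Option s → ℝ) (β : s → ℝ) (i j : s) : ℝ :=
  (if i = j then 2 * β i else 0) - b (some i) (some j)

/-- The definition of `β` as the eigenvalue equation `H e^u = W_δ`, with the diagonal term on the
left. -/
theorem two_mul_realBeta_mul_exp (b : Option s → Option s → ℝ) (u : s → ℝ) (i : s) :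
    2 * realBeta b u i * Real.exp (u i) =
      ∑ j : Option s, Real.exp (ext0 u j) * b (some i) j := by
  rw [realBeta, ← mul_assoc, show (2 : ℝ) * (1 / 2) = 1 by norm_num, one_mul, Finset.sum_mul]
  refine Finset.sum_congr rfl fun j _ => ?_
  rw [Real.exp_sub]
  field_simp

theorem sum_Hmat_mul (b : Option s → Option s → ℝ) (β : s → ℝ) (i : s) (y : s → ℝ) :
    ∑ j, Hmat b β i j * y j = 2 * β i * y i - ∑ j : s, b (some i) (some j) * y j := by
  simp [Hmat, sub_mul, Finset.sum_sub_distrib]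

theorem sum_Hmat_mul_exp (b : Option s → Option s → ℝ) (u : s → ℝ) (i : s) :
    ∑ j, Hmat b (realBeta b u) i j * Real.exp (u j) = b (some i) none := by
  rw [sum_Hmat_mul, two_mul_realBeta_mul_exp, Fintype.sum_option]
  simp [mul_comm]

theorem realTheta_eq (b : Option s → Option s → ℝ) (u t : s → ℝ) (i : s) :
    realTheta b u t i = ∑ j, Hmat b (realBeta b u) i j * (Real.exp (u j) * t j) := by
  rw [sum_Hmat_mul, ← mul_assoc, two_mul_realBeta_mul_exp]
  simp only [realTheta, Fintype.sum_option, ext0_some, ext0_none, add_mul, Finset.sum_mul]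
  rw [add_sub_assoc, ← Finset.sum_sub_distrib]
  refine congrArg₂ (· + ·) (by ring) (Finset.sum_congr rfl fun j _ => by ring)

/-- The weighted Laplacian applied to a vector with value `0` at `δ`. -/
theorem sum_lap {M : Type*} [AddCommGroup M] [Module ℂ M] (b : Option s → Option s → ℝ)
    (u : s → ℝ) (v : Option s → M) (hv : v none = 0) (i : s) :
    ∑ j, ((Real.exp (ext0 u j) * b (some i) j : ℝ) : ℂ) • (v (some i) - v j) =
      ∑ j : s, ((Hmat b (realBeta b u) i j : ℝ) : ℂ) • ((Real.exp (u j) : ℂ) • v (some j)) := by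
  have h := two_mul_realBeta_mul_exp b u i
  simp only [smul_sub, Finset.sum_sub_distrib, ← Finset.sum_smul, ← Complex.ofReal_sum, ← h]
  rw [Fintype.sum_option, hv, smul_zero, zero_add]
  simp only [Hmat, Complex.ofReal_sub, sub_smul, Finset.sum_sub_distrib]
  congr 1
  · rw [Finset.sum_eq_single i]
    · simp [smul_smul]
    · intro j _ hj
      simp [hj.symm]
    · simp
  · refine Finset.sum_congr rfl fun j _ => ?_
    rw [smul_smul]
    push_cast
    simp [mul_comm]

theorem phiBar_realW (b : Option s → Option s → ℝ) (u : s → ℝ) (i : s) :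
    (phiBar (realW b) u i : Alg V E) = ∑ j : s, ((Hmat b (realBeta b u) i j : ℝ) : ℂ) •
      ((Real.exp (u j) : ℂ) • psiBar (j : V)) := by
  refine Eq.trans ?_ (sum_lap b u (fun j => (psiBarT j : Alg V E)) rfl i)
  simp only [phiBar, realW, par_algebraMap]
  refine Finset.sum_congr rfl fun j _ => ?_
  rw [← Algebra.smul_def, smul_smul]
  push_cast
  rfl

theorem phi_realW (b : Option s → Option s → ℝ) (u : s → ℝ) (i : s) :
    (phi (realW b) u i : Alg V E) = ∑ j : s, ((Hmat b (realBeta b u) i j : ℝ) : ℂ) •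
      ((Real.exp (u j) : ℂ) • psi (j : V)) := by
  refine Eq.trans ?_ (sum_lap b u (fun j => (psiT j : Alg V E)) rfl i)
  simp only [phi, realW, par_algebraMap]
  refine Finset.sum_congr rfl fun j _ => ?_
  rw [← Algebra.smul_def, smul_smul]
  push_cast
  rfl

theorem matA_realW {b : Option s → Option s → ℝ} (h0 : ∀ i, b i i = 0) (u : s → ℝ) (i j : s) :
    (matA (realW b) u (some i) (some j) : ParAlg E) =
      algebraMap ℂ _ ((Real.exp (u i) * Hmat b (realBeta b u) i j * Real.exp (u j) : ℝ) : ℂ) := by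
  have h := two_mul_realBeta_mul_exp b u i
  unfold matA Hmat
  by_cases hij : i = j
  · subst hij
    simp only [if_true, h0, sub_zero, realW]
    rw [mul_assoc, h, Finset.mul_sum]
    push_cast
    rw [map_sum]
    refine Finset.sum_congr rfl fun k _ => ?_
    rw [Algebra.smul_def, ← map_mul, Complex.exp_add, mul_assoc]
    rfl
  · rw [if_neg (by simpa using hij), if_neg hij, realW, Algebra.smul_def, ← map_mul, ← map_neg]
    congr 1
    push_cast
    rw [Complex.exp_add]
    simp only [ext0_some]
    ring

/-- The energy of the variables `u`. -/
def coshEnergy (b : Option s → Option s → ℝ) (u : s → ℝ) : ℝ :=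
  ∑ i, ∑ j, (Real.cosh (ext0 u i - ext0 u j) - 1) * b i j

/-- The superdensity in terms of the matrix `Hmat` and the variables `e^u s`, `e^u ψbar`, `e^u ψ`. -/
theorem rho_realW {b : Option s → Option s → ℝ} (h0 : ∀ i, b i i = 0) (u t : s → ℝ) :
    (rho (realW b) u t : Alg V E) =
      (Real.exp (-(1 / 2) * (∑ i : s, ∑ j : s, Hmat b (realBeta b u) i j *
        ((Real.exp (u i) * t i) * (Real.exp (u j) * t j)) + coshEnergy b u)) : ℂ) •
      superExp (-∑ i : s, ∑ j : s, ((Hmat b (realBeta b u) i j : ℝ) : ℂ) •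
        (((Real.exp (u i) : ℂ) • (psiBar (i : V) : Alg V E)) *
          ((Real.exp (u j) : ℂ) • (psi (j : V) : Alg V E)))) := by
  unfold rho
  have h1 : -((1 / 2 : ℂ) • ∑ i, ∑ j, ((ext0 t i * ext0 t j : ℝ) : ℂ) •
      (par (matA (realW b) u i j) : Alg V E)) =
      algebraMap ℂ _ ((-(1 / 2) * ∑ i : s, ∑ j : s, Hmat b (realBeta b u) i j *
        ((Real.exp (u i) * t i) * (Real.exp (u j) * t j)) : ℝ) : ℂ) := by
    simp only [Fintype.sum_option, ext0_none, zero_mul, mul_zero, Complex.ofReal_zero, zero_smul,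
      Finset.sum_const_zero, zero_add, ext0_some, matA_realW h0, par_algebraMap]
    rw [Complex.ofReal_mul, map_mul, ← Algebra.smul_def, ← neg_smul]
    congr 1
    · push_cast; ring
    · simp only [Complex.ofReal_sum, map_sum]
      refine Finset.sum_congr rfl fun i _ => Finset.sum_congr rfl fun j _ => ?_
      rw [Algebra.smul_def, ← map_mul]
      congr 1
      push_cast
      ring
  have h2 : -∑ i, ∑ j, psiBarT i * (par (matA (realW b) u i j) : Alg V E) * psiT j =
      -∑ i : s, ∑ j : s, ((Hmat b (realBeta b u) i j : ℝ) : ℂ) •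
        (((Real.exp (u i) : ℂ) • (psiBar (i : V) : Alg V E)) *
          ((Real.exp (u j) : ℂ) • (psi (j : V) : Alg V E))) := by
    congr 1
    simp only [Fintype.sum_option, psiBarT, psiT, zero_mul, mul_zero, Finset.sum_const_zero,
      zero_add, matA_realW h0, par_algebraMap]
    refine Finset.sum_congr rfl fun i _ => Finset.sum_congr rfl fun j _ => ?_
    rw [← Algebra.commutes, ← Algebra.smul_def, smul_mul_smul_comm, smul_smul, smul_mul_assoc]
    congr 1
    push_cast
    ring
  have h3 : -((1 / 2 : ℂ) • ∑ i, ∑ j, ((Real.cosh (ext0 u i - ext0 u j) - 1 : ℝ) : ℂ) •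
      (par (realW b i j) : Alg V E)) =
      algebraMap ℂ _ ((-(1 / 2) * coshEnergy b u : ℝ) : ℂ) := by
    rw [Complex.ofReal_mul, map_mul, ← Algebra.smul_def, ← neg_smul]
    congr 1
    · push_cast; ring
    · simp only [coshEnergy, Complex.ofReal_sum, map_sum, realW, par_algebraMap]
      refine Finset.sum_congr rfl fun i _ => Finset.sum_congr rfl fun j _ => ?_
      rw [Algebra.smul_def, ← map_mul]
      congr 1
      push_cast
      ring
  rw [h1, h2, h3, superExp_algebraMap, superExp_algebraMap, ← Algebra.smul_def, smul_mul_assoc,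
    ← Algebra.commutes, ← Algebra.smul_def, smul_smul, ← Complex.exp_add]
  congr 1
  push_cast
  congr 1
  ring

/-- The energy is affine in `β` and `e^u`: the sum of `W_ij e^{u_j - u_i}` over `j` is `2 β_i`. -/
theorem coshEnergy_eq {b : Option s → Option s → ℝ} (hs : ∀ i j, b i j = b j i)
    (h0 : ∀ i, b i i = 0) (u : s → ℝ) :
    coshEnergy b u = ∑ i : s, 2 * realBeta b u i + ∑ j : s, Real.exp (u j) * b (some j) none -
      (∑ i : s, ∑ j : s, b (some i) (some j) + 2 * ∑ i : s, b (some i) none) := by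
  have h1 : coshEnergy b u = ∑ i, ∑ j, (Real.exp (ext0 u j - ext0 u i) - 1) * b i j := by
    have h2 : ∑ i, ∑ j, (Real.exp (ext0 u j - ext0 u i) - 1) * b i j =
        ∑ i, ∑ j, (Real.exp (ext0 u i - ext0 u j) - 1) * b i j := by
      rw [Finset.sum_comm]
      exact Finset.sum_congr rfl fun i _ => Finset.sum_congr rfl fun j _ => by rw [hs]
    have h3 : coshEnergy b u =
        (1 / 2) * ∑ i, ∑ j, (Real.exp (ext0 u j - ext0 u i) - 1) * b i j +
        (1 / 2) * ∑ i, ∑ j, (Real.exp (ext0 u i - ext0 u j) - 1) * b i j := by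
      simp only [coshEnergy, Finset.mul_sum, ← Finset.sum_add_distrib]
      refine Finset.sum_congr rfl fun i _ => Finset.sum_congr rfl fun j _ => ?_
      rw [Real.cosh_eq, neg_sub]
      ring
    rw [h3, ← h2]; ring
  rw [h1]
  simp only [realBeta, Fintype.sum_option, ext0_none, ext0_some, h0, hs none (some _),
    Finset.sum_add_distrib, sub_mul, Finset.sum_sub_distrib, Finset.mul_sum, mul_add]
  norm_num
  simp only [← Finset.mul_sum]
  ring_nf

end Hmat

/-! ### Linear substitutions in the Berezin integral -/

section GrassmannSubst

variable {V E : Type*} [AddCommGroup E] [Module ℂ E]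

/-- The linear map `e_i ↦ r i • e_i - μ i • e_a`. -/
def shearLin (r μ : V → ℂ) (a : V) : (V →₀ ℂ) →ₗ[ℂ] (V →₀ ℂ) :=
  Finsupp.linearCombination ℂ fun i => r i • Finsupp.single i 1 - μ i • Finsupp.single a 1

theorem shearLin_single (r μ : V → ℂ) (a i : V) : shearLin r μ a (Finsupp.single i 1) =
    r i • Finsupp.single i 1 - μ i • Finsupp.single a 1 := by
  simp [shearLin]

theorem lapply_shearLin (r μ : V → ℂ) {a j : V} (hj : j ≠ a) :
    (Finsupp.lapply j : (V →₀ ℂ) →ₗ[ℂ] ℂ).comp (shearLin r μ a) = r j • Finsupp.lapply j := by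
  classical
  ext i
  simp only [LinearMap.comp_apply, Finsupp.lsingle_apply, shearLin_single, Finsupp.lapply_apply,
    Finsupp.sub_apply, Finsupp.smul_apply, LinearMap.smul_apply, Finsupp.single_apply, smul_eq_mul]
  by_cases h : i = j
  · subst h; simp [hj.symm]
  · simp [h, hj.symm]

theorem lapply_shearLin_self {r μ : V → ℂ} {a : V} (hr : r a = 1) {s : Finset V} (ha : a ∉ s)
    (hμ : ∀ i ∉ s, μ i = 0) : (Finsupp.lapply a : (V →₀ ℂ) →ₗ[ℂ] ℂ).comp (shearLin r μ a) =
      Finsupp.lapply a - ∑ i ∈ s, μ i • Finsupp.lapply i := by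
  classical
  ext i
  simp only [LinearMap.comp_apply, Finsupp.lsingle_apply, shearLin_single, Finsupp.lapply_apply,
    Finsupp.sub_apply, Finsupp.smul_apply, LinearMap.sub_apply, LinearMap.sum_apply,
    LinearMap.smul_apply, Finsupp.single_apply, smul_eq_mul]
  by_cases h : i = a
  · subst h
    simp [hr, hμ i ha, ha]
  · simp only [h, if_false, if_true, mul_zero, mul_one, zero_sub, neg_inj]
    by_cases hi : i ∈ s
    · simp [hi]
    · simp [hi, hμ i hi]

/-- The substitution `ψ i ↦ r i • ψ i - μ i • ψ a`, and the same for the `ψbar i`. -/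
def shear (r μ : V → ℂ) (a : V) : Alg V E →ₐ[ℂ] Alg V E :=
  ExteriorAlgebra.map ((shearLin r μ a).prodMap ((shearLin r μ a).prodMap LinearMap.id))

variable {r μ : V → ℂ} {a : V}

theorem shear_psi (i : V) :
    (shear r μ a (psi i) : Alg V E) = r i • psi i - μ i • psi a := by
  simp only [shear, psi, ExteriorAlgebra.map_apply_ι, LinearMap.prodMap_apply, map_zero,
    shearLin_single, ← map_smul, ← map_sub]
  simp

theorem shear_psiBar (i : V) :
    (shear r μ a (psiBar i) : Alg V E) = r i • psiBar i - μ i • psiBar a := by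
  simp only [shear, psiBar, ExteriorAlgebra.map_apply_ι, LinearMap.prodMap_apply, map_zero,
    shearLin_single, ← map_smul, ← map_sub]
  simp

theorem shear_par (m : ParAlg E) : (shear r μ a (par m) : Alg V E) = par m := by
  have : (shear r μ a : Alg V E →ₐ[ℂ] Alg V E).comp par = par := by
    unfold shear par
    rw [ExteriorAlgebra.map_comp_map]
    congr 1
  exact DFunLike.congr_fun this m

theorem body_shear (x : Alg V E) : body (shear r μ a x) = body x := body_map _ _

theorem dPsi_shear {j : V} (hj : j ≠ a) (x : Alg V E) :
    dPsi j (shear r μ a x) = r j • shear r μ a (dPsi j x) := by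
  rw [dPsi_eq, shear, gderiv_map]
  have : (dualPsi j : GenDual (Gen V E)).comp
      ((shearLin r μ a).prodMap ((shearLin r μ a).prodMap LinearMap.id)) = r j • dualPsi j := by
    refine LinearMap.ext fun v => ?_
    exact LinearMap.congr_fun (lapply_shearLin r μ hj) v.2.1
  rw [this]
  simp [gderiv]

theorem dPsiBar_shear {j : V} (hj : j ≠ a) (x : Alg V E) :
    dPsiBar j (shear r μ a x) = r j • shear r μ a (dPsiBar j x) := by
  rw [dPsiBar_eq, shear, gderiv_map]
  have : (dualBar j : GenDual (Gen V E)).comp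
      ((shearLin r μ a).prodMap ((shearLin r μ a).prodMap LinearMap.id)) = r j • dualBar j := by
    refine LinearMap.ext fun v => ?_
    exact LinearMap.congr_fun (lapply_shearLin r μ hj) v.1
  rw [this]
  simp [gderiv]

theorem dPsi_shear_self (hr : r a = 1) {s : Finset V} (ha : a ∉ s)
    (hμ : ∀ i ∉ s, μ i = 0) (x : Alg V E) :
    dPsi a (shear r μ a x) = shear r μ a (dPsi a x - ∑ i ∈ s, μ i • dPsi i x) := by
  rw [dPsi_eq, shear, gderiv_map]
  have : (dualPsi a : GenDual (Gen V E)).comp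
      ((shearLin r μ a).prodMap ((shearLin r μ a).prodMap LinearMap.id)) =
      dualPsi a - ∑ i ∈ s, μ i • dualPsi i := by
    refine LinearMap.ext fun v => ?_
    have := LinearMap.congr_fun (lapply_shearLin_self hr ha hμ) v.2.1
    simpa [LinearMap.sum_apply] using this
  rw [this]
  simp only [gderiv, map_sub, map_sum, map_smul, LinearMap.sub_apply, LinearMap.sum_apply,
    LinearMap.smul_apply]
  rfl

theorem dPsiBar_shear_self (hr : r a = 1) {s : Finset V} (ha : a ∉ s)
    (hμ : ∀ i ∉ s, μ i = 0) (x : Alg V E) :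
    dPsiBar a (shear r μ a x) = shear r μ a (dPsiBar a x - ∑ i ∈ s, μ i • dPsiBar i x) := by
  rw [dPsiBar_eq, shear, gderiv_map]
  have : (dualBar a : GenDual (Gen V E)).comp
      ((shearLin r μ a).prodMap ((shearLin r μ a).prodMap LinearMap.id)) =
      dualBar a - ∑ i ∈ s, μ i • dualBar i := by
    refine LinearMap.ext fun v => ?_
    have := LinearMap.congr_fun (lapply_shearLin_self hr ha hμ) v.1
    simpa [LinearMap.sum_apply] using this
  rw [this]
  simp only [gderiv, map_sub, map_sum, map_smul, LinearMap.sub_apply, LinearMap.sum_apply,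
    LinearMap.smul_apply]
  rfl

theorem dPsi_dPsi_self (j : V) (x : Alg V E) : dPsi j (dPsi j x) = 0 :=
  gderiv_gderiv (F := Gen V E) (dualPsi j) x

theorem dPsiBar_dPsiBar_self (j : V) (x : Alg V E) : dPsiBar j (dPsiBar j x) = 0 :=
  gderiv_gderiv (F := Gen V E) (dualBar j) x

theorem dPsiBar_dPsi_comm (i j : V) (x : Alg V E) :
    dPsiBar i (dPsi j x) = -dPsi j (dPsiBar i x) :=
  gderiv_comm (F := Gen V E) (dualBar i) (dualPsi j) x

variable [LinearOrder V]

theorem berezin_dPsi {s : Finset V} {j : V} (hj : j ∈ s) (x : Alg V E) :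
    berezin s (dPsi j x) = 0 := by
  obtain ⟨t, hjt, rfl⟩ : ∃ t, j ∉ t ∧ s = insert j t :=
    ⟨s.erase j, Finset.notMem_erase j s, (Finset.insert_erase hj).symm⟩
  rw [berezin_insert hjt]
  simp [dPsi_dPsi_self]

theorem berezin_dPsiBar {s : Finset V} {j : V} (hj : j ∈ s) (x : Alg V E) :
    berezin s (dPsiBar j x) = 0 := by
  obtain ⟨t, hjt, rfl⟩ : ∃ t, j ∉ t ∧ s = insert j t :=
    ⟨s.erase j, Finset.notMem_erase j s, (Finset.insert_erase hj).symm⟩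
  rw [berezin_insert hjt]
  have : dPsiBar j (dPsi j (dPsiBar j x)) = 0 := by
    rw [dPsiBar_dPsi_comm, dPsiBar_dPsiBar_self]
    simp
  simp [this]

theorem berezin_shear_of_notMem {s : Finset V} (ha : a ∉ s) (x : Alg V E) :
    berezin s (shear r μ a x) = (∏ i ∈ s, r i ^ 2) • shear r μ a (berezin s x) := by
  induction s using Finset.induction generalizing x with
  | empty => simp [berezin_empty]
  | insert j s hj ih =>
    rw [Finset.mem_insert, not_or] at ha
    rw [berezin_insert hj, Module.End.mul_apply, Module.End.mul_apply, Module.End.mul_apply,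
      Module.End.mul_apply, dPsi_shear (Ne.symm ha.1), map_smul, dPsiBar_shear (Ne.symm ha.1),
      map_smul, map_smul, ih ha.2, Finset.prod_insert hj, smul_smul, smul_smul]
    congr 1
    ring

/-- The change of variables formula for the Berezin integral, for a triangular substitution. -/
theorem berezin_shear (hr : r a = 1) {s : Finset V} (ha : a ∉ s)
    (hμ : ∀ i ∉ s, μ i = 0) (x : Alg V E) :
    berezin (insert a s) (shear r μ a x) =
      (∏ i ∈ s, r i ^ 2) • shear r μ a (berezin (insert a s) x) := by
  rw [berezin_insert ha, Module.End.mul_apply, Module.End.mul_apply, Module.End.mul_apply,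
    Module.End.mul_apply, dPsi_shear_self hr ha hμ, dPsiBar_shear_self hr ha hμ,
    berezin_shear_of_notMem ha]
  congr 2
  simp only [map_sub, map_sum, map_smul]
  have h1 : ∑ i ∈ s, μ i • berezin s (dPsiBar a (dPsi i x)) = 0 := by
    refine Finset.sum_eq_zero fun i hi => ?_
    rw [dPsiBar_dPsi_comm, map_neg, berezin_dPsi hi, neg_zero, smul_zero]
  rw [h1, sub_zero, Finset.sum_eq_zero, sub_zero]
  intro i hi
  simp only [berezin_dPsiBar hi, smul_zero, Finset.sum_const_zero, sub_zero]

end GrassmannSubst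

/-! ### Contraction of a vertex -/

section CompleteSquare

/-- Completing the square in a bilinear form, when `H κ = W`. -/
theorem complete_square {ι R : Type*} [Fintype ι] [Ring R] [Algebra ℂ R] (H : ι → ι → ℂ)
    (hH : ∀ i j, H i j = H j i) (κ W : ι → ℂ) (hκ : ∀ i, ∑ j, H i j * κ j = W i) (x z : ι → R)
    (xa za : R) :
    ∑ i, ∑ j, H i j • ((x i - κ i • xa) * (z j - κ j • za)) =
      ∑ i, ∑ j, H i j • (x i * z j) - ∑ j, W j • (xa * z j) - ∑ i, W i • (x i * za) +
        (∑ i, W i * κ i) • (xa * za) := by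
  have e : ∀ i j, H i j • ((x i - κ i • xa) * (z j - κ j • za)) =
      H i j • (x i * z j) - (H i j * κ i) • (xa * z j) - (H i j * κ j) • (x i * za) +
        (H i j * κ j * κ i) • (xa * za) := by
    intro i j
    simp only [sub_mul, mul_sub, smul_sub, smul_mul_assoc, mul_smul_comm, smul_smul]
    rw [show H i j * κ j * κ i = H i j * (κ j * κ i) by ring]
    abel
  simp only [e, Finset.sum_add_distrib, Finset.sum_sub_distrib, ← Finset.sum_smul,
    ← Finset.sum_mul, hκ]
  congr 2
  congr 1
  rw [Finset.sum_comm]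
  refine Finset.sum_congr rfl fun j _ => ?_
  rw [← Finset.sum_smul, ← hκ]
  congr 1
  exact Finset.sum_congr rfl fun i _ => by rw [hH]

end CompleteSquare

section Contract

variable {V : Type*} [DecidableEq V] {s : Finset V} {a : V}

/-- The inclusion of `s` into `insert a s`. -/
def incl (i : s) : ↥(insert a s) := ⟨i, Finset.mem_insert_of_mem i.2⟩

/-- The new vertex of `insert a s`. -/
def newV : ↥(insert a s) := ⟨a, Finset.mem_insert_self a s⟩

theorem sum_insert_subtype {M : Type*} [AddCommMonoid M] (ha : a ∉ s) (f : ↥(insert a s) → M) :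
    ∑ i, f i = f newV + ∑ i : s, f (incl i) := by
  rw [← (Finset.subtypeInsertEquivOption ha).symm.sum_comp, Fintype.sum_option]
  rfl

theorem prod_insert_subtype {M : Type*} [CommMonoid M] (ha : a ∉ s) (f : ↥(insert a s) → M) :
    ∏ i, f i = f newV * ∏ i : s, f (incl i) := by
  rw [← (Finset.subtypeInsertEquivOption ha).symm.prod_comp, Fintype.prod_option]
  rfl

theorem incl_injective : Function.Injective (incl : s → ↥(insert a s)) := fun _ _ h =>
  Subtype.ext (congrArg (fun k : ↥(insert a s) => (k : V)) h)

theorem incl_ne_newV (ha : a ∉ s) (i : s) : (incl i : ↥(insert a s)) ≠ newV := fun h => by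
  have h' : (i : V) = a := congrArg (fun k : ↥(insert a s) => (k : V)) h
  exact ha (h' ▸ i.2)

/-- Identification of the vertex `a` with `δ`. -/
def contract {R : Type*} [AddCommMonoid R]
    (b : Option ↥(insert a s) → Option ↥(insert a s) → R) : Option s → Option s → R
  | some i, some j => b (some (incl i)) (some (incl j))
  | some i, none => b (some (incl i)) none + b (some (incl i)) (some newV)
  | none, some i => b none (some (incl i)) + b (some newV) (some (incl i))
  | none, none => 0

/-- The points `p'` of the model on `insert a s` and `p` of the contracted model on `s` have the
same variables `β`, `θ` on `s`. -/
structure IsElim (b : Option ↥(insert a s) → Option ↥(insert a s) → ℝ) (p' : Pts (insert a s))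
    (κ : s → ℝ) (p : Pts s) : Prop where
  kappa : ∀ i, ∑ j, Hmat (contract b) (fun i => realBeta b p'.1 (incl i)) i j * κ j =
    b (some (incl i)) (some newV)
  exp : ∀ i, Real.exp (p.1 i) = Real.exp (p'.1 (incl i)) + κ i * (1 - Real.exp (p'.1 newV))
  s : ∀ i, Real.exp (p.1 i) * p.2 i =
    Real.exp (p'.1 (incl i)) * p'.2 (incl i) - κ i * (Real.exp (p'.1 newV) * p'.2 newV)

/-- The parameter of the conditional law of the variables at the removed vertex. -/
def elimC (b : Option ↥(insert a s) → Option ↥(insert a s) → ℝ) (u : ↥(insert a s) → ℝ)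
    (κ : s → ℝ) : ℝ :=
  Real.exp (u newV) * (2 * realBeta b u newV - ∑ i, b (some (incl i)) (some newV) * κ i)

variable {b : Option ↥(insert a s) → Option ↥(insert a s) → ℝ} {p' : Pts (insert a s)}
  {κ : s → ℝ} {p : Pts s}

theorem Hmat_symm {b : Option s → Option s → ℝ} (hs : ∀ i j, b i j = b j i) (β : s → ℝ) (i j : s) :
    Hmat b β i j = Hmat b β j i := by
  unfold Hmat
  rw [hs]
  by_cases h : i = j
  · subst h; rfl
  · rw [if_neg h, if_neg (Ne.symm h)]

theorem contract_symm (hs : ∀ i j, b i j = b j i) (i j : Option s) :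
    contract b i j = contract b j i := by
  cases i <;> cases j <;> simp [contract, hs]

theorem contract_diag (h0 : ∀ i, b i i = 0) (i : Option s) : contract b i i = 0 := by
  cases i <;> simp [contract, h0]

theorem sum_Hmat_incl_mul_exp (ha : a ∉ s) (b : Option ↥(insert a s) → Option ↥(insert a s) → ℝ)
    (u : ↥(insert a s) → ℝ) (i : s) :
    ∑ j, Hmat (contract b) (fun i => realBeta b u (incl i)) i j * Real.exp (u (incl j)) =
      b (some (incl i)) none + b (some (incl i)) (some newV) * Real.exp (u newV) := by
  rw [sum_Hmat_mul, two_mul_realBeta_mul_exp, Fintype.sum_option, sum_insert_subtype ha]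
  simp [contract, mul_comm]
  ring

/-- The variables `β` agree because `e^u` on `s` solves the equation `H e^u = W_δ` for the contracted
weights, where `H` is formed with the `β` of the larger model. -/
theorem IsElim.realBeta_eq (h : IsElim b p' κ p) (ha : a ∉ s) (i : s) :
    realBeta (contract b) p.1 i = realBeta b p'.1 (incl i) := by
  have h1 : ∑ j, Hmat (contract b) (fun i => realBeta b p'.1 (incl i)) i j * Real.exp (p.1 j) =
      contract b (some i) none := by
    simp only [h.exp, mul_add, Finset.sum_add_distrib, sum_Hmat_incl_mul_exp ha, ← mul_assoc,
      ← Finset.sum_mul, h.kappa]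
    simp only [contract]
    ring
  rw [← sum_Hmat_mul_exp (contract b) p.1 i, sum_Hmat_mul, sum_Hmat_mul] at h1
  have := (Real.exp_pos (p.1 i)).ne'
  apply mul_right_cancel₀ this
  linarith

theorem IsElim.realBeta_eq' (h : IsElim b p' κ p) (ha : a ∉ s) :
    realBeta (contract b) p.1 = fun i => realBeta b p'.1 (incl i) :=
  funext fun i => h.realBeta_eq ha i

theorem sum_Hmat_insert (ha : a ∉ s)
    {M : Type*} [AddCommGroup M] [Module ℂ M]
    (β : ↥(insert a s) → ℝ) (v : ↥(insert a s) → M) (i : s) :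
    ∑ j, ((Hmat b β (incl i) j : ℝ) : ℂ) • v j =
      ∑ j, ((Hmat (contract b) (fun i => β (incl i)) i j : ℝ) : ℂ) • v (incl j) -
        ((b (some (incl i)) (some newV) : ℝ) : ℂ) • v newV := by
  rw [sum_insert_subtype ha, add_comm, sub_eq_add_neg, ← neg_smul]
  congr 1
  · refine Finset.sum_congr rfl fun j _ => ?_
    simp [Hmat, contract, incl_injective.eq_iff]
  · simp [Hmat, incl_ne_newV ha]

/-- The bilinear form of the model on `insert a s`, after completing the square. -/
theorem IsElim.sum_sum_Hmat (h : IsElim b p' κ p) (ha : a ∉ s) (hs : ∀ i j, b i j = b j i)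
    (h0 : ∀ i, b i i = 0) {R : Type*} [Ring R] [Algebra ℂ R] (x z : ↥(insert a s) → R) :
    ∑ i, ∑ j, ((Hmat b (realBeta b p'.1) i j : ℝ) : ℂ) • (x i * z j) =
      ∑ i, ∑ j, ((Hmat (contract b) (realBeta (contract b) p.1) i j : ℝ) : ℂ) •
        ((x (incl i) - (κ i : ℂ) • x newV) * (z (incl j) - (κ j : ℂ) • z newV)) +
      ((2 * realBeta b p'.1 newV - ∑ i, b (some (incl i)) (some newV) * κ i : ℝ) : ℂ) •
        (x newV * z newV) := by
  rw [h.realBeta_eq' ha]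
  set β : s → ℝ := fun i => realBeta b p'.1 (incl i)
  rw [complete_square (fun i j => ((Hmat (contract b) β i j : ℝ) : ℂ))
    (fun i j => by rw [Hmat_symm (contract_symm hs)]) (fun i => (κ i : ℂ))
    (fun i => ((b (some (incl i)) (some newV) : ℝ) : ℂ))
    (fun i => by rw [← h.kappa i]; push_cast; rfl)]
  rw [sum_insert_subtype ha]
  have h1 : ∀ i : s, ∑ j, ((Hmat b (realBeta b p'.1) (incl i) j : ℝ) : ℂ) • (x (incl i) * z j) =
      ∑ j, ((Hmat (contract b) β i j : ℝ) : ℂ) • (x (incl i) * z (incl j)) -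
        ((b (some (incl i)) (some newV) : ℝ) : ℂ) • (x (incl i) * z newV) := fun i =>
    sum_Hmat_insert ha (realBeta b p'.1) (fun j => x (incl i) * z j) i
  have h2 : ∑ j, ((Hmat b (realBeta b p'.1) newV j : ℝ) : ℂ) • (x newV * z j) =
      ((2 * realBeta b p'.1 newV : ℝ) : ℂ) • (x newV * z newV) -
        ∑ j, ((b (some (incl j)) (some newV) : ℝ) : ℂ) • (x newV * z (incl j)) := by
    rw [sum_insert_subtype ha, sub_eq_add_neg, ← Finset.sum_neg_distrib]
    congr 1
    · simp [Hmat, h0]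
    · refine Finset.sum_congr rfl fun j _ => ?_
      rw [← neg_smul]
      simp [Hmat, (incl_ne_newV ha j).symm, hs (some newV)]
  simp only [h1, h2, Finset.sum_sub_distrib]
  rw [Complex.ofReal_sub, sub_smul]
  push_cast
  abel

/-- The energy splits into the energy of the contracted model and a function of `u` at the removed
vertex. -/
theorem IsElim.coshEnergy_eq (h : IsElim b p' κ p) (ha : a ∉ s) (hs : ∀ i j, b i j = b j i)
    (h0 : ∀ i, b i i = 0) : coshEnergy b p'.1 =
      coshEnergy (contract b) p.1 + 2 * (elimC b p'.1 κ * (Real.cosh (p'.1 newV) - 1)) := by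
  rw [SusySigma.coshEnergy_eq hs h0, SusySigma.coshEnergy_eq (contract_symm hs) (contract_diag h0),
    h.realBeta_eq' ha, elimC]
  have hβ := two_mul_realBeta_mul_exp b p'.1 newV
  rw [Fintype.sum_option, sum_insert_subtype ha] at hβ
  simp only [ext0_none, ext0_some, Real.exp_zero, one_mul, h0, mul_zero, zero_add] at hβ
  -- testing `H κ = W_a` with `e^u` and using the symmetry of `H`
  have hX : ∑ i : s, b (some (incl i)) (some newV) * Real.exp (p'.1 (incl i)) =
      ∑ i : s, κ i * b (some (incl i)) none + Real.exp (p'.1 newV) *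
        ∑ i : s, b (some (incl i)) (some newV) * κ i := by
    have e1 : ∑ i : s, b (some (incl i)) (some newV) * Real.exp (p'.1 (incl i)) =
        ∑ j : s, κ j * ∑ i, Hmat (contract b) (fun i => realBeta b p'.1 (incl i)) j i *
          Real.exp (p'.1 (incl i)) := by
      simp only [← h.kappa, Finset.sum_mul, Finset.mul_sum]
      rw [Finset.sum_comm]
      refine Finset.sum_congr rfl fun i _ => Finset.sum_congr rfl fun j _ => ?_
      rw [Hmat_symm (contract_symm hs)]
      ring
    rw [e1]
    simp only [sum_Hmat_incl_mul_exp ha, mul_add, Finset.sum_add_distrib, Finset.mul_sum]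
    congr 1
    exact Finset.sum_congr rfl fun i _ => by ring
  have E2 : ∑ j : ↥(insert a s), Real.exp (p'.1 j) * b (some j) none =
      Real.exp (p'.1 newV) * b (some newV) none +
        ∑ j : s, Real.exp (p'.1 (incl j)) * b (some (incl j)) none := sum_insert_subtype ha _
  have E3 : ∑ i : ↥(insert a s), ∑ j : ↥(insert a s), b (some i) (some j) =
      2 * ∑ i : s, b (some (incl i)) (some newV) +
        ∑ i : s, ∑ j : s, contract b (some i) (some j) := by
    simp only [sum_insert_subtype ha, h0, Finset.sum_add_distrib, hs (some newV) (some (incl _)),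
      contract]
    ring
  have E5 : ∑ j : s, Real.exp (p.1 j) * contract b (some j) none =
      ∑ j : s, Real.exp (p'.1 (incl j)) * b (some (incl j)) none +
      ∑ j : s, b (some (incl j)) (some newV) * Real.exp (p'.1 (incl j)) +
      (1 - Real.exp (p'.1 newV)) * (∑ i : s, κ i * b (some (incl i)) none +
        ∑ i : s, b (some (incl i)) (some newV) * κ i) := by
    simp only [h.exp, contract, ← Finset.sum_add_distrib, Finset.mul_sum]
    exact Finset.sum_congr rfl fun j _ => by ring
  have E7 : ∑ j : s, contract b (some j) none =
      ∑ i : s, b (some (incl i)) none + ∑ i : s, b (some (incl i)) (some newV) := by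
    simp only [contract, Finset.sum_add_distrib]
  have hbs : ∑ j : s, Real.exp (p'.1 (incl j)) * b (some newV) (some (incl j)) =
      ∑ j : s, b (some (incl j)) (some newV) * Real.exp (p'.1 (incl j)) :=
    Finset.sum_congr rfl fun j _ => by rw [hs]; ring
  rw [E2, E3, E5, E7, sum_insert_subtype ha fun i => 2 * realBeta b p'.1 i,
    sum_insert_subtype ha fun i => b (some i) none, Real.cosh_eq, Real.exp_neg]
  simp only [hbs] at hβ
  have hPa := (Real.exp_pos (p'.1 newV)).ne'
  rw [hX] at hβ ⊢
  have hβ' : realBeta b p'.1 newV = (b (some newV) none + (∑ i : s, κ i * b (some (incl i)) none +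
      Real.exp (p'.1 newV) * ∑ i : s, b (some (incl i)) (some newV) * κ i)) /
      (2 * Real.exp (p'.1 newV)) := by
    rw [eq_div_iff (by positivity), ← hβ]
    ring
  rw [hβ']
  field_simp
  ring

end Contract

/-! ### Subalgebras which contain the integrand -/

section Membership

variable {V E : Type*} [AddCommGroup E] [Module ℂ E] [LinearOrder V] {s s₀ : Finset V}

theorem soul_mem {S : Subalgebra ℂ (Alg V E)} {x : Alg V E} (hx : x ∈ S) : soul x ∈ S :=
  sub_mem hx (Subalgebra.algebraMap_mem _ _)

theorem evalCoeff_mem {S : Subalgebra ℂ (Alg V E)} (hS : ∀ m, par m ∈ S) {p q : s → Alg V E}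
    (hp : ∀ i, p i ∈ S) (hq : ∀ i, q i ∈ S) (x : (Smooth s) ⊗[ℂ] (ParAlg E)) :
    evalCoeff p q x ∈ S := by
  induction x using TensorProduct.induction_on with
  | zero => rw [map_zero]; exact zero_mem _
  | add x y hx hy => rw [map_add]; exact add_mem hx hy
  | tmul f c =>
    change taylor p q (f : Pts s → ℂ) * par c ∈ S
    refine mul_mem (sum_mem fun k _ => Subalgebra.smul_mem _ (sum_mem fun c _ =>
      Subalgebra.smul_mem _ (list_prod_mem fun y hy => ?_) _) _) (hS c)
    obtain ⟨l, rfl⟩ := (List.mem_ofFn' _ _).1 hy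
    change soul (Sum.elim p q (c l)) ∈ S
    refine soul_mem ?_
    rcases c l with i | i
    exacts [hp i, hq i]

theorem oddProd_mem {S : Subalgebra ℂ (Alg V E)} {v : s → Alg V E} (hv : ∀ i, v i ∈ S)
    (I : Finset s) : oddProd v I ∈ S := by
  refine list_prod_mem fun y hy => ?_
  obtain ⟨i, -, rfl⟩ := List.mem_map.1 hy
  exact hv i

theorem superFun_eval_mem {S : Subalgebra ℂ (Alg V E)} (hS : ∀ m, par m ∈ S) (g : SuperFun s E)
    {p q v v' : s → Alg V E} (hp : ∀ i, p i ∈ S) (hq : ∀ i, q i ∈ S) (hv : ∀ i, v i ∈ S)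
    (hv' : ∀ i, v' i ∈ S) : g.eval p q v v' ∈ S :=
  sum_mem fun I _ => sum_mem fun J _ =>
    mul_mem (mul_mem (evalCoeff_mem hS hp hq _) (oddProd_mem hv I)) (oddProd_mem hv' J)

variable (w : Option s → Option s → ParAlg E)

theorem rho_mem (u t : s → ℝ) : rho w u t ∈ (genAlg (s : Set V) : Subalgebra ℂ (Alg V E)) := by
  have hp := par_mem_genAlg (V := V) (E := E) (s : Set V)
  refine mul_mem (mul_mem (superExp_mem ?_) (superExp_mem ?_)) (superExp_mem ?_)
  · exact neg_mem (Subalgebra.smul_mem _ (sum_mem fun i _ => sum_mem fun j _ =>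
      Subalgebra.smul_mem _ (hp _) _) _)
  · exact neg_mem (sum_mem fun i _ => sum_mem fun j _ =>
      mul_mem (mul_mem (psiBarT_mem_genAlg i) (hp _)) (psiT_mem_genAlg j))
  · exact neg_mem (Subalgebra.smul_mem _ (sum_mem fun i _ => sum_mem fun j _ =>
      Subalgebra.smul_mem _ (hp _) _) _)

theorem tauExp_mem (τ : V → ParAlg E) (u : s → ℝ) :
    tauExp τ u ∈ (genAlg (s : Set V) : Subalgebra ℂ (Alg V E)) :=
  superExp_mem (sum_mem fun i _ => mul_mem (par_mem_genAlg _ _) (Subalgebra.smul_mem _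
    (add_mem (psiBar_mem_genAlg i.2) (Subalgebra.smul_mem _ (psi_mem_genAlg i.2) _)) _))

theorem varpiEval_mem (h : s₀ ⊆ s) (g : SuperFun s₀ E) (u t : s → ℝ) :
    varpiEval h g w u t ∈ (genAlg (s : Set V) : Subalgebra ℂ (Alg V E)) := by
  have hp := par_mem_genAlg (V := V) (E := E) (s : Set V)
  refine superFun_eval_mem hp g (fun i => ?_) (fun i => ?_) (fun i => ?_) fun i => ?_
  · exact Subalgebra.smul_mem _ (sum_mem fun j _ => Subalgebra.smul_mem _ (hp _) _) _
  · exact sum_mem fun j _ => Subalgebra.smul_mem _ (hp _) _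
  · exact sum_mem fun j _ => Subalgebra.smul_mem _
      (mul_mem (hp _) (sub_mem (psiBar_mem_genAlg (h i.2)) (psiBarT_mem_genAlg j))) _
  · exact sum_mem fun j _ => Subalgebra.smul_mem _
      (mul_mem (hp _) (sub_mem (psi_mem_genAlg (h i.2)) (psiT_mem_genAlg j))) _

theorem density_mem_range (h : s₀ ⊆ s) (g : SuperFun s₀ E) (τ : V → ParAlg E) (p : Pts s) :
    density h g τ w p ∈ Set.range (par : ParAlg E → Alg V E) := by
  obtain ⟨m, hm⟩ := berezin_mem_range s (mul_mem (rho_mem w p.1 p.2)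
    (mul_mem (tauExp_mem τ p.1) (varpiEval_mem w h g p.1 p.2)))
  exact ⟨_ • m, by rw [map_smul, hm]; rfl⟩

end Membership

/-! ### The integrand after removal of a vertex -/

section DensityInsert

variable {V E : Type*} [AddCommGroup E] [Module ℂ E] [LinearOrder V] {s s₀ : Finset V} {a : V}

theorem isEven_superExp {F : Type*} [AddCommGroup F] [Module ℂ F] {x : ExteriorAlgebra ℂ F}
    (hx : IsEven x) : IsEven (superExp x) :=
  (IsEven.sum fun k _ => (hx.soul.pow k).smul _).smul _

/-- The Berezin integral over the Grassmann variables of the removed vertex. -/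
theorem dPsiBar_dPsi_gaussian (c d : ℂ) (T : ParAlg E) (hT : IsOdd T) :
    dPsiBar a (dPsi a (superExp (-(c • (psiBar a * psi a : Alg V E))) *
      superExp (par T * (d • (psiBar a + Complex.I • psi a))))) = algebraMap ℂ _ c := by
  have hb := isOdd_psiBar (V := V) (E := E) a
  have hp := isOdd_psi (V := V) (E := E) a
  have h1 : (psiBar a * psi a : Alg V E) * (psiBar a * psi a) = 0 := by
    simpa [pow_two] using hb.mul_mul_self hp
  have h2 : (psiBar a * psi a : Alg V E) * (psiBar a + Complex.I • psi a) = 0 := by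
    rw [mul_add, mul_assoc, hp.mul_swap hb, mul_neg, ← mul_assoc, hb.mul_self, mul_smul_comm,
      mul_assoc, hp.mul_self]
    simp
  have h3 : (psiBar a * psi a : Alg V E) * (par T * (d • (psiBar a + Complex.I • psi a))) = 0 := by
    rw [← mul_assoc, ((hb.mul hp).commute (par T)).eq, mul_assoc, mul_smul_comm, h2]
    simp
  rw [superExp_of_sq (by rw [neg_mul_neg, smul_mul_smul_comm, h1, smul_zero]),
    superExp_of_sq (tauTerm_mul_self hT a d), add_mul, one_mul, mul_add, mul_one, neg_mul,
    smul_mul_assoc, h3, smul_zero, neg_zero, add_zero]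
  have d1 : dPsi a (1 : Alg V E) = 0 := by
    have := (dPsi_par (V := V) (E := E) a 1).2; rwa [map_one] at this
  have d1' : dPsiBar a (1 : Alg V E) = 0 := by
    have := (dPsi_par (V := V) (E := E) a 1).1; rwa [map_one] at this
  have e1 : ∀ y : Alg V E, dPsi a (psi a * y) = y - psi a * dPsi a y := by
    intro y
    rw [dPsi_eq, psi, gderiv_ι_mul (F := Gen V E)]
    simp
  have e2 : ∀ y : Alg V E, dPsi a (psiBar a * y) = - psiBar a * dPsi a y := by
    intro y
    rw [dPsi_eq, psiBar, gderiv_ι_mul (F := Gen V E)]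
    simp
  have e3 : ∀ y : Alg V E, dPsiBar a (psiBar a * y) = y - psiBar a * dPsiBar a y := by
    intro y
    rw [dPsiBar_eq, psiBar, gderiv_ι_mul (F := Gen V E)]
    simp
  have e4 : dPsi a (psi a : Alg V E) = 1 := by simpa [d1] using e1 1
  have e5 : dPsi a (psiBar a : Alg V E) = 0 := by simpa [d1] using e2 1
  have e6 : dPsiBar a (psiBar a : Alg V E) = 1 := by simpa [d1'] using e3 1
  have e7 : dPsiBar a (dPsi a (par T * (d • (psiBar a + Complex.I • psi a)))) = (0 : Alg V E) := by
    rw [dPsiBar_dPsi_mul (s := ∅) (by simp) (par_mem_genAlg ∅ T)]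
    simp [e4, e5, d1']
  rw [map_add, map_add, map_add, map_add, e7, d1, map_zero, map_neg, map_neg, map_smul, map_smul,
    e2, e4, mul_one, map_neg, e6]
  simp [Algebra.algebraMap_eq_smul_one]

/-- Evaluation of a superfunction is compatible with substitutions of the Grassmann variables. -/
theorem map_superFun_eval (σ : Alg V E →ₐ[ℂ] Alg V E) (hσ : ∀ m, σ (par m) = par m)
    (g : SuperFun s₀ E) (p q : s₀ → ℝ) (v v' : s₀ → Alg V E) :
    σ (g.eval (fun i => algebraMap ℂ _ (p i : ℂ)) (fun i => algebraMap ℂ _ (q i : ℂ)) v v') =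
      g.eval (fun i => algebraMap ℂ _ (p i : ℂ)) (fun i => algebraMap ℂ _ (q i : ℂ))
        (fun i => σ (v i)) fun i => σ (v' i) := by
  have h1 : ∀ x, σ (evalCoeff (fun i => algebraMap ℂ _ (p i : ℂ))
      (fun i => algebraMap ℂ _ (q i : ℂ)) x) = evalCoeff (fun i => algebraMap ℂ _ (p i : ℂ))
      (fun i => algebraMap ℂ _ (q i : ℂ)) x := by
    intro x
    induction x using TensorProduct.induction_on with
    | zero => simp
    | add x y hx hy => rw [map_add, map_add, hx, hy]
    | tmul f c =>
      change σ (taylor _ _ (f : Pts s₀ → ℂ) * par c) = taylor _ _ (f : Pts s₀ → ℂ) * par c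
      rw [taylor_algebraMap _ _ (Smooth.contDiff f), map_mul, hσ, AlgHom.commutes]
  simp only [SuperFun.eval, map_sum, map_mul, h1, oddProd, map_list_prod, List.map_map]
  rfl

variable {b : Option ↥(insert a s) → Option ↥(insert a s) → ℝ} {p' : Pts (insert a s)}
  {κ : s → ℝ} {p : Pts s}

/-- The Lebesgue density, up to the Jacobian, of the variables at the removed vertex. -/
def elimKernel (c u t : ℝ) : ℝ :=
  c / (2 * Real.pi) * Real.exp (-(c * (Real.cosh u - 1) + c * Real.exp u * t ^ 2 / 2))

set_option maxHeartbeats 1000000 in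
/-- The integrand on `insert a s`, in the variables on `s` and the two bosonic variables at `a`. The
product of exponentials is the Jacobian of the change of the variables `s`; the change of variables
in the Berezin integral contributes its square, and the factors `e^{-u_i}` contribute its
inverse. -/
theorem IsElim.density_eq (h : IsElim b p' κ p) (ha : a ∉ s) (hs : ∀ i j, b i j = b j i)
    (h0 : ∀ i, b i i = 0) (hs₀ : s₀ ⊆ s) (hs₀' : s₀ ⊆ insert a s) (g : SuperFun s₀ E)
    {τ : V → ParAlg E} (hτ : ∀ i, IsOdd (τ i)) :
    density hs₀' g τ (realW b) p' =
      (((∏ i, Real.exp (p'.1 (incl i) - p.1 i)) *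
        elimKernel (elimC b p'.1 κ) (p'.1 newV) (p'.2 newV) : ℝ) : ℂ) •
      density hs₀ g τ (realW (contract b)) p := by
  set Pa := Real.exp (p'.1 newV) with hPa
  set c := elimC b p'.1 κ with hc
  -- the Grassmann substitution `e^{p.u_i} ψ_i ↦ e^{p'.u_i} ψ_i - κ_i e^{u_a} ψ_a`, the analogue of
  -- `IsElim.exp` and `IsElim.s`, in terms of the `ψ_i` themselves
  let r : V → ℂ := fun i => if hi : i ∈ s then (Real.exp (p'.1 (incl ⟨i, hi⟩) - p.1 ⟨i, hi⟩) : ℂ)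
    else 1
  let μ : V → ℂ := fun i => if hi : i ∈ s then
    ((κ ⟨i, hi⟩ * Pa / Real.exp (p.1 ⟨i, hi⟩) : ℝ) : ℂ) else 0
  have hra : r a = 1 := by simp [r, ha]
  have hμa : μ a = 0 := by simp [μ, ha]
  have hμ : ∀ i ∉ s, μ i = 0 := fun i hi => by simp [μ, hi]
  let σ : Alg V E →ₐ[ℂ] Alg V E := shear r μ a
  have hσp : ∀ m, σ (par m) = par m := shear_par
  have hr1 : ∀ i : s, (Real.exp (p.1 i) : ℂ) * r i = (Real.exp (p'.1 (incl i)) : ℂ) := by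
    intro i
    simp only [r, i.2, dif_pos, Subtype.coe_eta]
    norm_cast
    rw [← Real.exp_add]
    congr 1
    ring
  have hμ1 : ∀ i : s, (Real.exp (p.1 i) : ℂ) * μ i = (κ i : ℂ) * (Pa : ℂ) := by
    intro i
    simp only [μ, i.2, dif_pos, Subtype.coe_eta]
    norm_cast
    field_simp
  have hψ : ∀ i : s, (Real.exp (p.1 i) : ℂ) • σ (psi (i : V)) =
      (Real.exp (p'.1 (incl i)) : ℂ) • psi (i : V) - (κ i : ℂ) • ((Pa : ℂ) • psi a) := by
    intro i
    simp only [σ, shear_psi, smul_sub, smul_smul, hr1, hμ1]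
  have hψ' : ∀ i : s, (Real.exp (p.1 i) : ℂ) • σ (psiBar (i : V)) =
      (Real.exp (p'.1 (incl i)) : ℂ) • psiBar (i : V) - (κ i : ℂ) • ((Pa : ℂ) • psiBar a) := by
    intro i
    simp only [σ, shear_psiBar, smul_sub, smul_smul, hr1, hμ1]
  have hσa : σ (psi a) = psi a := by simp [σ, shear_psi, hra, hμa]
  have hσa' : σ (psiBar a) = psiBar a := by simp [σ, shear_psiBar, hra, hμa]
  have hσe : ∀ x : Alg V E, IsEven x → IsEven (σ x) := fun x hx =>
    IsEven.map (F := Gen V E) hx _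
  have hσx : ∀ x : Alg V E, IsEven x → superExp (σ x) = σ (superExp x) := fun x hx =>
    map_superExp (F := Gen V E) σ body_shear hx
  set Q : Alg V E := ∑ i : s, ∑ j : s,
    ((Hmat (contract b) (realBeta (contract b) p.1) i j : ℝ) : ℂ) •
      (((Real.exp (p.1 i) : ℂ) • (psiBar (i : V) : Alg V E)) *
        ((Real.exp (p.1 j) : ℂ) • (psi (j : V) : Alg V E))) with hQ
  have hQe : IsEven Q := IsEven.sum fun i _ => IsEven.sum fun j _ =>
    (((isOdd_psiBar (V := V) (E := E) _).smul _).mul ((isOdd_psi (V := V) (E := E) _).smul _)).smul _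
  have hcP : (2 * realBeta b p'.1 newV - ∑ i, b (some (incl i)) (some newV) * κ i) * Pa = c := by
    rw [hc, elimC]; ring
  have hqa : IsEven ((((c * Pa : ℝ) : ℂ)) • (psiBar a * psi a) : Alg V E) :=
    ((isOdd_psiBar (V := V) (E := E) a).mul (isOdd_psi a)).smul _
  -- completing the square in the bosonic and the fermionic quadratic forms
  have F3 : (rho (realW b) p'.1 p'.2 : Alg V E) =
      (Real.exp (-(1 / 2) * (∑ i : s, ∑ j : s, Hmat (contract b) (realBeta (contract b) p.1) i j *
        ((Real.exp (p.1 i) * p.2 i) * (Real.exp (p.1 j) * p.2 j)) + coshEnergy (contract b) p.1) -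
        (c * (Real.cosh (p'.1 newV) - 1) + c * Pa * p'.2 newV ^ 2 / 2)) : ℂ) •
      (σ (superExp (-Q)) * superExp (-((((c * Pa : ℝ) : ℂ)) • (psiBar a * psi a : Alg V E)))) := by
    have hq := h.sum_sum_Hmat ha hs h0
      (fun i => (Real.exp (p'.1 i) : ℂ) • (psiBar (i : V) : Alg V E))
      (fun i => (Real.exp (p'.1 i) : ℂ) • (psi (i : V) : Alg V E))
    have hq' := h.sum_sum_Hmat ha hs h0 (R := ℂ)
      (fun i => ((Real.exp (p'.1 i) * p'.2 i : ℝ) : ℂ))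
      (fun i => ((Real.exp (p'.1 i) * p'.2 i : ℝ) : ℂ))
    have e1 : σ Q = ∑ i : s, ∑ j : s,
        ((Hmat (contract b) (realBeta (contract b) p.1) i j : ℝ) : ℂ) •
        (((Real.exp (p'.1 (incl i)) : ℂ) • psiBar (i : V) - (κ i : ℂ) • ((Pa : ℂ) • psiBar a)) *
        ((Real.exp (p'.1 (incl j)) : ℂ) • psi (j : V) - (κ j : ℂ) • ((Pa : ℂ) • psi a))) := by
      simp only [hQ, map_sum, map_smul, map_mul, hψ, hψ']
    have hq2 : ∑ i, ∑ j, ((Hmat b (realBeta b p'.1) i j : ℝ) : ℂ) •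
        (((Real.exp (p'.1 i) : ℂ) • (psiBar (i : V) : Alg V E)) *
          ((Real.exp (p'.1 j) : ℂ) • (psi (j : V) : Alg V E))) =
        σ Q + (((c * Pa : ℝ) : ℂ)) • (psiBar a * psi a) := by
      rw [hq, e1]
      congr 1
      rw [smul_mul_smul_comm, smul_smul]
      congr 1
      rw [← hcP]
      push_cast
      rw [hPa]
      push_cast
      change _ * (Complex.exp _ * Complex.exp _) = _
      ring
    have hq3 : ∑ i, ∑ j, Hmat b (realBeta b p'.1) i j *
        ((Real.exp (p'.1 i) * p'.2 i) * (Real.exp (p'.1 j) * p'.2 j)) =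
        ∑ i : s, ∑ j : s, Hmat (contract b) (realBeta (contract b) p.1) i j *
        ((Real.exp (p.1 i) * p.2 i) * (Real.exp (p.1 j) * p.2 j)) + c * Pa * p'.2 newV ^ 2 := by
      apply Complex.ofReal_injective
      simp only [smul_eq_mul] at hq'
      simp only [h.s, ← hcP]
      push_cast at hq' ⊢
      rw [hq']
      rw [hPa]
      push_cast
      ring
    rw [rho_realW h0, hq2, hq3, h.coshEnergy_eq ha hs h0, neg_add, superExp_add (hσe _ hQe).neg
      hqa.neg, ← map_neg, hσx _ hQe.neg]
    congr 2
    congr 1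
    ring
  have hTe : IsOdd (τ a + ∑ i : s, (κ i : ℂ) • τ i) :=
    (hτ a).add (IsOdd.sum fun i _ => (hτ i).smul _)
  have hte : IsEven ((par (τ a + ∑ i : s, (κ i : ℂ) • τ i) : Alg V E) *
      ((Pa : ℂ) • (psiBar a + Complex.I • psi a))) :=
    hTe.par.mul ((isOdd_psiBar_add (V := V) (E := E) _).smul _)
  have hse : IsEven (∑ i : s, (par (τ i) : Alg V E) *
      ((Real.exp (p.1 i) : ℂ) • (psiBar (i : V) + Complex.I • psi (i : V)))) :=
    IsEven.sum fun i _ => (hτ i).par.mul ((isOdd_psiBar_add (V := V) (E := E) _).smul _)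
  -- in the source term the substitution leaves a source at `a`, with the odd parameter
  -- `τ_a + ∑ κ_i τ_i`
  have F4 : (tauExp τ p'.1 : Alg V E) = σ (tauExp τ p.1) *
      superExp (par (τ a + ∑ i : s, (κ i : ℂ) • τ i) *
        ((Pa : ℂ) • (psiBar a + Complex.I • psi a))) := by
    unfold tauExp
    rw [← hσx _ hse, ← superExp_add (hσe _ hse) hte]
    congr 1
    rw [sum_insert_subtype ha, add_comm, map_sum, map_add, add_mul, ← add_assoc, add_right_comm,
      map_sum, Finset.sum_mul, ← Finset.sum_add_distrib]
    congr 1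
    refine Finset.sum_congr rfl fun i _ => ?_
    change _ = σ _ + _
    have e : σ ((Real.exp (p.1 i) : ℂ) • (psiBar (i : V) + Complex.I • psi (i : V))) =
        ((Real.exp (p'.1 (incl i)) : ℂ) • psiBar (i : V) - (κ i : ℂ) • ((Pa : ℂ) • psiBar a)) +
        Complex.I • ((Real.exp (p'.1 (incl i)) : ℂ) • psi (i : V) -
          (κ i : ℂ) • ((Pa : ℂ) • psi a)) := by
      rw [← hψ', ← hψ, smul_add, map_add, map_smul, map_smul, map_smul, smul_comm Complex.I]
    rw [map_mul, hσp, e, map_smul, smul_mul_assoc, ← mul_smul_comm, ← mul_add]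
    change par (τ i) * ((Real.exp (p'.1 (incl i)) : ℂ) • (psiBar (i : V) +
      Complex.I • psi (i : V))) = _
    congr 1
    module
  -- the variables `β`, `θ` agree, and `φbar`, `φ` are related by the substitution
  have F5 : (varpiEval hs₀' g (realW b) p'.1 p'.2 : Alg V E) =
      σ (varpiEval hs₀ g (realW (contract b)) p.1 p.2) := by
    have hT : ∀ i : s, realTheta b p'.1 p'.2 (incl i) = realTheta (contract b) p.1 p.2 i := by
      intro i
      rw [realTheta_eq, realTheta_eq]
      apply Complex.ofReal_injective
      have := sum_Hmat_insert ha (b := b) (realBeta b p'.1)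
        (fun j => ((Real.exp (p'.1 j) * p'.2 j : ℝ) : ℂ)) i
      simp only [smul_eq_mul] at this
      push_cast at this ⊢
      rw [this]
      have hk := h.kappa i
      rw [← hk, h.realBeta_eq' ha]
      have hs' : ∀ j, (Complex.exp (p.1 j) * p.2 j : ℂ) = Complex.exp (p'.1 (incl j)) *
          p'.2 (incl j) - κ j * (Complex.exp (p'.1 newV) * p'.2 newV) := fun j => by
        exact_mod_cast congrArg (fun x : ℝ => (x : ℂ)) (h.s j)
      simp only [hs', mul_sub, Finset.sum_sub_distrib]
      push_cast
      rw [Finset.sum_mul]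
      congr 1
      exact Finset.sum_congr rfl fun j _ => by ring
    have hB : ∀ i : s, realBeta b p'.1 (incl i) = realBeta (contract b) p.1 i := fun i =>
      (h.realBeta_eq ha i).symm
    have hφ : ∀ i : s, (phi (realW b) p'.1 (incl i) : Alg V E) =
        σ (phi (realW (contract b)) p.1 i) := by
      intro i
      rw [phi_realW, phi_realW, sum_Hmat_insert ha]
      simp only [map_sum, map_smul, hψ, smul_sub, Finset.sum_sub_distrib, h.realBeta_eq' ha]
      congr 1
      rw [← h.kappa i]
      push_cast
      rw [Finset.sum_smul]
      refine Finset.sum_congr rfl fun j _ => ?_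
      rw [mul_smul, hPa]
      push_cast
      rfl
    have hφ' : ∀ i : s, (phiBar (realW b) p'.1 (incl i) : Alg V E) =
        σ (phiBar (realW (contract b)) p.1 i) := by
      intro i
      rw [phiBar_realW, phiBar_realW, sum_Hmat_insert ha]
      simp only [map_sum, map_smul, hψ', smul_sub, Finset.sum_sub_distrib, h.realBeta_eq' ha]
      congr 1
      rw [← h.kappa i]
      push_cast
      rw [Finset.sum_smul]
      refine Finset.sum_congr rfl fun j _ => ?_
      rw [mul_smul, hPa]
      push_cast
      rfl
    rw [varpiEval_realW, varpiEval_realW, map_superFun_eval σ hσp]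
    congr 1
    · funext i; exact congrArg _ (congrArg _ (hB ⟨i, hs₀ i.2⟩))
    · funext i; exact congrArg _ (congrArg _ (hT ⟨i, hs₀ i.2⟩))
    · funext i; exact hφ' ⟨i, hs₀ i.2⟩
    · funext i; exact hφ ⟨i, hs₀ i.2⟩
  set R : Alg V E := superExp (-Q)
  set T : Alg V E := tauExp τ p.1
  set G : Alg V E := varpiEval hs₀ g (realW (contract b)) p.1 p.2
  set Y₁ : Alg V E := superExp (-((((c * Pa : ℝ) : ℂ)) • (psiBar a * psi a : Alg V E)))
  set Y₂ : Alg V E := superExp (par (τ a + ∑ i : s, (κ i : ℂ) • τ i) *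
        ((Pa : ℂ) • (psiBar a + Complex.I • psi a)))
  -- the substitution fixes `ψbar a`, `ψ a`, so that the whole integrand is an image under it
  have hY : σ (Y₁ * Y₂) = Y₁ * Y₂ := by
    rw [map_mul, ← hσx _ hqa.neg, ← hσx _ hte]
    simp only [map_neg, map_smul, map_mul, map_add, hσa, hσa', hσp, Y₁, Y₂]
  have hY₁ : ∀ x, Commute Y₁ x := fun x => (isEven_superExp hqa.neg).commute x
  have hY₂ : ∀ x, Commute Y₂ x := fun x => (isEven_superExp hte).commute x
  have hprod : σ R * Y₁ * (σ T * Y₂ * σ G) = σ (R * (T * G) * (Y₁ * Y₂)) := by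
    rw [map_mul σ _ (Y₁ * Y₂), hY, map_mul, map_mul, mul_assoc (σ T), (hY₂ (σ G)).eq,
      mul_assoc (σ R) Y₁, (hY₁ _).eq, ← mul_assoc (σ T), mul_assoc (σ T * σ G), ← mul_assoc (σ R),
      (hY₂ Y₁).eq]
  have hX : R * (T * G) ∈ genAlg (s : Set V) := by
    refine mul_mem (superExp_mem (neg_mem (sum_mem fun i _ => sum_mem fun j _ =>
      Subalgebra.smul_mem _ (mul_mem (Subalgebra.smul_mem _ (psiBar_mem_genAlg i.2) _)
        (Subalgebra.smul_mem _ (psi_mem_genAlg j.2) _)) _)))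
        (mul_mem (tauExp_mem τ p.1) (varpiEval_mem _ hs₀ g p.1 p.2))
  -- change of variables, then integration over `ψbar a`, `ψ a`: the quadratic term yields `c e^{u_a}`,
  -- and the source at `a`, which is linear in `ψbar a`, `ψ a`, does not contribute
  have hB : berezin (insert a s) (σ (R * (T * G) * (Y₁ * Y₂))) =
      (∏ i ∈ s, r i ^ 2) • ((c * Pa : ℝ) : ℂ) • berezin s (R * (T * G)) := by
    have hG : dPsiBar a (dPsi a (Y₁ * Y₂)) = algebraMap ℂ (Alg V E) ((c * Pa : ℝ) : ℂ) :=
      dPsiBar_dPsi_gaussian ((c * Pa : ℝ) : ℂ) (Pa : ℂ) _ hTe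
    have hD : dPsiBar a (dPsi a (R * (T * G) * (Y₁ * Y₂))) =
        R * (T * G) * dPsiBar a (dPsi a (Y₁ * Y₂)) :=
      dPsiBar_dPsi_mul (s := (s : Set V)) (by exact_mod_cast ha) hX _
    rw [berezin_shear hra ha hμ, berezin_insert ha, Module.End.mul_apply, Module.End.mul_apply,
      hD, hG, ← Algebra.commutes, ← Algebra.smul_def, map_smul, map_smul]
    obtain ⟨m, hm⟩ := berezin_mem_range s hX
    rw [← hm, shear_par]
  have hr2 : ∏ i ∈ s, r i ^ 2 = ((∏ i : s, Real.exp (p'.1 (incl i) - p.1 i) ^ 2 : ℝ) : ℂ) := by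
    rw [← Finset.prod_coe_sort]
    push_cast
    refine Finset.prod_congr rfl fun i _ => ?_
    simp [r]
  -- comparison of the factors `e^{-u_i} / 2π`
  have hpre : ∏ i : ↥(insert a s), Real.exp (-p'.1 i) / (2 * Real.pi) =
      (Pa⁻¹ / (2 * Real.pi)) * ((∏ i : s, (Real.exp (p'.1 (incl i) - p.1 i))⁻¹) *
        ∏ i : s, Real.exp (-p.1 i) / (2 * Real.pi)) := by
    rw [prod_insert_subtype ha, Real.exp_neg, ← Finset.prod_mul_distrib]
    congr 1
    refine Finset.prod_congr rfl fun i _ => ?_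
    rw [← mul_div_assoc, ← Real.exp_neg, ← Real.exp_add]
    congr 2
    ring
  simp only [density]
  rw [F3, F4, F5, rho_realW (contract_diag h0), smul_mul_assoc, hprod, smul_mul_assoc, map_smul,
    map_smul, hB, hr2, hpre]
  simp only [smul_smul]
  congr 1
  norm_cast
  simp only [elimKernel, ← hPa, Finset.prod_pow, Finset.prod_inv_distrib]
  have h1 : (∏ i : s, Real.exp (p'.1 (incl i) - p.1 i)) ≠ 0 :=
    Finset.prod_ne_zero_iff.2 fun i _ => (Real.exp_pos _).ne'
  have h2 : Pa ≠ 0 := (Real.exp_pos _).ne'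
  field_simp
  rw [mul_assoc, ← Real.exp_add]
  congr 2
  ring

end DensityInsert

/-! ### Matrices with nonpositive off-diagonal entries -/

section Mmatrix

variable {ι : Type*} [Fintype ι]

/-- The inverse of a positive definite matrix with nonpositive off-diagonal entries is
entrywise nonnegative. -/
theorem nonneg_of_mul_nonneg_of_posDef {H : ι → ι → ℝ}
    (hpos : ∀ y : ι → ℝ, y ≠ 0 → 0 < ∑ i, ∑ j, y i * H i j * y j)
    (hoff : ∀ i j, i ≠ j → H i j ≤ 0) {y : ι → ℝ} (hy : ∀ i, 0 ≤ ∑ j, H i j * y j) (i : ι) :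
    0 ≤ y i := by
  -- test the inequality with the negative part of `y`
  have hneg : (fun i => max (-y i) 0) = 0 := by
    by_contra hne
    have h1 := hpos _ hne
    have h2 : ∑ i, ∑ j, max (-y i) 0 * H i j * max (-y j) 0 ≤
        -∑ i, max (-y i) 0 * ∑ j, H i j * y j := by
      rw [← Finset.sum_neg_distrib]
      refine Finset.sum_le_sum fun i _ => ?_
      rw [Finset.mul_sum, ← Finset.sum_neg_distrib]
      refine Finset.sum_le_sum fun j _ => ?_
      have hj : max (-y j) 0 = -y j + max (y j) 0 := by
        rcases le_total (y j) 0 with h | h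
        · rw [max_eq_left (by linarith), max_eq_right h, add_zero]
        · rw [max_eq_right (by linarith), max_eq_left h]; ring
      have hle : max (-y i) 0 * H i j * max (y j) 0 ≤ 0 := by
        by_cases hij : i = j
        · subst hij
          rcases le_total (y i) 0 with h | h
          · rw [max_eq_right h, mul_zero]
          · rw [max_eq_right (by linarith : -y i ≤ 0)]; simp
        · exact mul_nonpos_of_nonpos_of_nonneg
            (mul_nonpos_of_nonneg_of_nonpos (le_max_right _ _) (hoff i j hij)) (le_max_right _ _)
      rw [hj]
      linarith
    have h3 : 0 ≤ ∑ i, max (-y i) 0 * ∑ j, H i j * y j :=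
      Finset.sum_nonneg fun i _ => mul_nonneg (le_max_right _ _) (hy i)
    linarith
  have := congrFun hneg i
  have h' : -y i ≤ 0 := by
    have h'' := le_max_left (-y i) 0
    simp only [Pi.zero_apply] at this
    linarith
  linarith

/-- A quadratic lower bound for a symmetric matrix bounds its determinant from below. -/
theorem pow_le_det_of_coercive [DecidableEq ι] {H : Matrix ι ι ℝ} (hH : H.IsHermitian) {r : ℝ}
    (hr : 0 ≤ r) (hc : ∀ y : ι → ℝ, r * ∑ i, y i ^ 2 ≤ ∑ i, ∑ j, y i * H i j * y j) :
    r ^ Fintype.card ι ≤ H.det := by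
  rw [hH.det_eq_prod_eigenvalues]
  have key : ∀ i, r ≤ hH.eigenvalues i := by
    intro i
    have h1 := hH.mulVec_eigenvectorBasis i
    have h2 := hc (hH.eigenvectorBasis i)
    have h3 : ∑ k, (hH.eigenvectorBasis i) k ^ 2 = 1 := by
      have := hH.eigenvectorBasis.orthonormal.1 i
      have h4 := EuclideanSpace.real_norm_sq_eq (hH.eigenvectorBasis i)
      rw [← h4, this]; norm_num
    have h5 : ∑ k, ∑ j, (hH.eigenvectorBasis i) k * H k j * (hH.eigenvectorBasis i) j =
        hH.eigenvalues i * ∑ k, (hH.eigenvectorBasis i) k ^ 2 := by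
      rw [Finset.mul_sum]
      refine Finset.sum_congr rfl fun k _ => ?_
      have h6 := congrFun h1 k
      simp only [Matrix.mulVec, dotProduct, Pi.smul_apply, smul_eq_mul] at h6
      simp only [mul_assoc]
      rw [← Finset.mul_sum, h6]
      ring
    rw [h5, h3, mul_one, mul_one] at h2
    exact h2
  have h7 : r ^ Fintype.card ι = ∏ _i : ι, r := by simp
  rw [h7]
  simp only [RCLike.ofReal_real_eq_id, id_eq]
  exact Finset.prod_le_prod (fun _ _ => hr) fun i _ => key i

end Mmatrix

/-! ### Networks connected to the wired point -/

section Network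

variable {V : Type*} {s : Finset V}

/-- A symmetric matrix of nonnegative weights on `Option s`, bounded from below by the weights
`b₀`, the positive entries of which connect every vertex with `δ`. -/
structure IsNetwork (b₀ b : Option s → Option s → ℝ) : Prop where
  symm : ∀ i j, b i j = b j i
  diag : ∀ i, b i i = 0
  nonneg : ∀ i j, 0 ≤ b₀ i j
  le : ∀ i j, b₀ i j ≤ b i j
  conn : ∀ i, Relation.ReflTransGen (fun i j => 0 < b₀ i j) i none

variable [DecidableEq V] {b₀ b : Option s → Option s → ℝ}

theorem IsNetwork.b_nonneg (h : IsNetwork b₀ b) (i j : Option s) : 0 ≤ b i j :=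
  (h.nonneg i j).trans (h.le i j)

/-- A Poincaré inequality: the Dirichlet form of a network connected to `none` controls the
differences to the value at `none`. -/
theorem exists_poincare (hn : ∀ i j, 0 ≤ b₀ i j)
    (hc : ∀ i, Relation.ReflTransGen (fun i j => 0 < b₀ i j) i none) :
    ∃ C : ℝ, 0 < C ∧ ∀ (v : Option s → ℝ) (i : Option s),
      C * (v i - v none) ^ 2 ≤ ∑ i, ∑ j, b₀ i j * (v i - v j) ^ 2 := by
  have h1 : ∀ i, ∃ C : ℝ, 0 ≤ C ∧ ∀ v : Option s → ℝ,
      (v i - v none) ^ 2 ≤ C * ∑ i, ∑ j, b₀ i j * (v i - v j) ^ 2 := by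
    intro i
    induction hc i using Relation.ReflTransGen.head_induction_on with
    | refl => exact ⟨0, le_rfl, fun v => by simp⟩
    | @head i j hij _ ih =>
      -- move along one edge and use the inequality at its other end
      obtain ⟨C, hC, h⟩ := ih
      refine ⟨2 * (b₀ i j)⁻¹ + 2 * C, by positivity, fun v => ?_⟩
      have h2 : b₀ i j * (v i - v j) ^ 2 ≤ ∑ i, ∑ j, b₀ i j * (v i - v j) ^ 2 :=
        (Finset.single_le_sum (f := fun j => b₀ i j * (v i - v j) ^ 2)
          (fun k _ => mul_nonneg (hn i k) (sq_nonneg _)) (Finset.mem_univ j)).trans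
        (Finset.single_le_sum (f := fun i => ∑ j, b₀ i j * (v i - v j) ^ 2)
          (fun k _ => Finset.sum_nonneg fun l _ => mul_nonneg (hn k l) (sq_nonneg _))
          (Finset.mem_univ i))
      have h3 : (v i - v j) ^ 2 ≤ (b₀ i j)⁻¹ * ∑ i, ∑ j, b₀ i j * (v i - v j) ^ 2 := by
        rw [← div_eq_inv_mul, le_div_iff₀ hij]
        linarith
      have h4 := h v
      nlinarith [sq_nonneg ((v i - v j) - (v j - v none))]
  choose C hC h using h1
  refine ⟨(1 + ∑ i, C i)⁻¹, by have := Finset.sum_nonneg (fun i (_ : i ∈ Finset.univ) => hC i);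
                                positivity, fun v i => ?_⟩
  have hs := Finset.sum_nonneg (fun i (_ : i ∈ Finset.univ) => hC i)
  rw [inv_mul_le_iff₀ (by linarith)]
  refine (h i v).trans (mul_le_mul_of_nonneg_right ?_ ?_)
  · have := Finset.single_le_sum (fun k _ => hC k) (Finset.mem_univ i)
    linarith
  · exact Finset.sum_nonneg fun i _ => Finset.sum_nonneg fun j _ =>
      mul_nonneg (hn i j) (sq_nonneg _)

/-- The quadratic form of the random Schrödinger operator as a Dirichlet form. -/
theorem sum_Hmat_exp_mul (hs : ∀ i j, b i j = b j i) (u v : s → ℝ) :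
    ∑ i, ∑ j, (Real.exp (u i) * v i) * Hmat b (realBeta b u) i j * (Real.exp (u j) * v j) =
      1 / 2 * ∑ i, ∑ j, Real.exp (ext0 u i) * Real.exp (ext0 u j) * b i j *
        (ext0 v i - ext0 v j) ^ 2 := by
  have h1 : ∀ i : s, ∑ j, Hmat b (realBeta b u) i j * (Real.exp (u j) * v j) =
      ∑ j, Real.exp (ext0 u j) * b (some i) j * (ext0 v (some i) - ext0 v j) := by
    intro i
    rw [sum_Hmat_mul, ← mul_assoc, two_mul_realBeta_mul_exp, Finset.sum_mul]
    simp only [Fintype.sum_option, ext0_some, ext0_none, mul_sub, Finset.sum_sub_distrib]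
    rw [Finset.sum_congr rfl fun j _ => show b (some i) (some j) * (Real.exp (u j) * v j) =
      Real.exp (u j) * b (some i) (some j) * v j by ring]
    ring
  have h2 : ∑ i, ∑ j, (Real.exp (u i) * v i) * Hmat b (realBeta b u) i j * (Real.exp (u j) * v j) =
      ∑ i : Option s, ∑ j, Real.exp (ext0 u i) * Real.exp (ext0 u j) * b i j *
        (ext0 v i * (ext0 v i - ext0 v j)) := by
    rw [Fintype.sum_option]
    simp only [ext0_none, zero_mul, mul_zero, Finset.sum_const_zero, zero_add]
    refine Finset.sum_congr rfl fun i _ => ?_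
    simp only [mul_assoc (Real.exp (u i) * v i)]
    rw [← Finset.mul_sum, h1, Finset.mul_sum]
    refine Finset.sum_congr rfl fun j _ => ?_
    simp only [ext0_some]
    ring
  have h3 : ∑ i : Option s, ∑ j, Real.exp (ext0 u i) * Real.exp (ext0 u j) * b i j *
        (ext0 v i * (ext0 v i - ext0 v j)) =
      ∑ i : Option s, ∑ j, Real.exp (ext0 u i) * Real.exp (ext0 u j) * b i j *
        (ext0 v j * (ext0 v j - ext0 v i)) := by
    rw [Finset.sum_comm]
    refine Finset.sum_congr rfl fun i _ => Finset.sum_congr rfl fun j _ => ?_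
    rw [hs j i]
    ring
  rw [h2]
  have h4 := congrArg₂ (· + ·) h2 (h2.trans h3)
  have h5 : ∑ i : Option s, ∑ j, Real.exp (ext0 u i) * Real.exp (ext0 u j) * b i j *
        (ext0 v i * (ext0 v i - ext0 v j)) + ∑ i : Option s, ∑ j, Real.exp (ext0 u i) *
          Real.exp (ext0 u j) * b i j * (ext0 v j * (ext0 v j - ext0 v i)) =
      ∑ i : Option s, ∑ j, Real.exp (ext0 u i) * Real.exp (ext0 u j) * b i j *
        (ext0 v i - ext0 v j) ^ 2 := by
    rw [← Finset.sum_add_distrib]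
    refine Finset.sum_congr rfl fun i _ => ?_
    rw [← Finset.sum_add_distrib]
    exact Finset.sum_congr rfl fun j _ => by ring
  rw [← h5, ← h3]
  ring

/-- Uniform coercivity of the random Schrödinger operator, polynomial in the size of the
variables `e^{±u}`. -/
theorem exists_coercive (hn : ∀ i j, 0 ≤ b₀ i j)
    (hc : ∀ i, Relation.ReflTransGen (fun i j => 0 < b₀ i j) i none) :
    ∃ C : ℝ, 0 < C ∧ ∀ (b : Option s → Option s → ℝ), IsNetwork b₀ b → ∀ (u : s → ℝ) (R : ℝ),
      1 ≤ R → (∀ i, Real.exp |u i| ≤ R) → ∀ y : s → ℝ,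
      C * R⁻¹ ^ 4 * ∑ i, y i ^ 2 ≤ ∑ i, ∑ j, y i * Hmat b (realBeta b u) i j * y j := by
  obtain ⟨C, hC, h⟩ := exists_poincare hn hc
  refine ⟨C / (2 * (Fintype.card s + 1)), by positivity, fun b hb u R hR hu y => ?_⟩
  have hR0 : 0 < R := by linarith
  -- in the variables `v = e^{-u} y` the form is a Dirichlet form
  set v : s → ℝ := fun i => Real.exp (-u i) * y i with hv
  have hyv : ∀ i, y i = Real.exp (u i) * v i := fun i => by
    rw [hv]; simp only; rw [← mul_assoc, ← Real.exp_add]; simp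
  have hlo : ∀ i : Option s, R⁻¹ ≤ Real.exp (ext0 u i) := by
    rintro (_ | i)
    · simpa using inv_le_one_of_one_le₀ hR
    · rw [ext0_some, inv_le_comm₀ hR0 (Real.exp_pos _), ← Real.exp_neg]
      exact (Real.exp_le_exp.2 (neg_le_abs _)).trans (hu i)
  set q := ∑ i, ∑ j, y i * Hmat b (realBeta b u) i j * y j with hq
  have h1 : ∀ i, (C / 2) * R⁻¹ ^ 4 * y i ^ 2 ≤ q := by
    intro i
    have e : q = 1 / 2 * ∑ i, ∑ j, Real.exp (ext0 u i) * Real.exp (ext0 u j) * b i j *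
        (ext0 v i - ext0 v j) ^ 2 := by
      rw [← sum_Hmat_exp_mul hb.symm]
      simp only [hq, hyv]
    have e2 : R⁻¹ ^ 2 * ∑ i, ∑ j, b₀ i j * (ext0 v i - ext0 v j) ^ 2 ≤
        ∑ i, ∑ j, Real.exp (ext0 u i) * Real.exp (ext0 u j) * b i j *
          (ext0 v i - ext0 v j) ^ 2 := by
      rw [Finset.mul_sum]
      refine Finset.sum_le_sum fun i _ => ?_
      rw [Finset.mul_sum]
      refine Finset.sum_le_sum fun j _ => ?_
      rw [← mul_assoc]
      refine mul_le_mul_of_nonneg_right ?_ (sq_nonneg _)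
      rw [sq]
      exact mul_le_mul (mul_le_mul (hlo i) (hlo j) (by positivity) (Real.exp_pos _).le) (hb.le i j)
        (hb.nonneg i j) (by positivity)
    have e3 := h (ext0 v) (some i)
    simp only [ext0_some, ext0_none, sub_zero] at e3
    have e4 : R⁻¹ ^ 2 * y i ^ 2 ≤ v i ^ 2 := by
      rw [← mul_pow]
      refine sq_le_sq.2 ?_
      rw [hv, abs_mul, abs_mul, abs_of_pos (by positivity : 0 < R⁻¹), abs_of_pos (Real.exp_pos _)]
      refine mul_le_mul_of_nonneg_right ?_ (abs_nonneg _)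
      rw [inv_le_comm₀ hR0 (Real.exp_pos _), ← Real.exp_neg, neg_neg]
      exact (Real.exp_le_exp.2 (le_abs_self _)).trans (hu i)
    rw [e]
    calc C / 2 * R⁻¹ ^ 4 * y i ^ 2 = C / 2 * R⁻¹ ^ 2 * (R⁻¹ ^ 2 * y i ^ 2) := by ring
      _ ≤ C / 2 * R⁻¹ ^ 2 * v i ^ 2 := by gcongr
      _ = 1 / 2 * (R⁻¹ ^ 2 * (C * v i ^ 2)) := by ring
      _ ≤ 1 / 2 * (R⁻¹ ^ 2 * ∑ i, ∑ j, b₀ i j * (ext0 v i - ext0 v j) ^ 2) := by gcongr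
      _ ≤ _ := by gcongr
  have hq0 : 0 ≤ q ∨ IsEmpty s := by
    rcases isEmpty_or_nonempty s with he | ⟨⟨i⟩⟩
    · exact Or.inr he
    · exact Or.inl (le_trans (by positivity) (h1 i))
  have hq0 : 0 ≤ q := by
    rcases hq0 with h | h
    · exact h
    · simp [hq]
  have h2 : ∑ i, (C / 2) * R⁻¹ ^ 4 * y i ^ 2 ≤ ∑ _i : s, q := Finset.sum_le_sum fun i _ => h1 i
  rw [← Finset.mul_sum, Finset.sum_const, Finset.card_univ, nsmul_eq_mul] at h2
  rw [div_mul_eq_mul_div, div_mul_eq_mul_div, div_le_iff₀ (by positivity)]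
  nlinarith

/-- The random Schrödinger operator is positive definite at every `u`. -/
theorem IsNetwork.hmat_pos (h : IsNetwork b₀ b) (u : s → ℝ) (y : s → ℝ) (hy : y ≠ 0) :
    0 < ∑ i, ∑ j, y i * Hmat b (realBeta b u) i j * y j := by
  obtain ⟨C, hC, hco⟩ := exists_coercive h.nonneg h.conn
  have h0 : ∀ i ∈ (Finset.univ : Finset s), 0 ≤ Real.exp |u i| := fun i _ => (Real.exp_pos _).le
  refine lt_of_lt_of_le ?_ (hco b h u (1 + ∑ i, Real.exp |u i|) ?_ ?_ y)
  · obtain ⟨i, hi⟩ := Function.ne_iff.1 hy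
    have : 0 < ∑ i, y i ^ 2 := Finset.sum_pos' (fun i _ => sq_nonneg _)
      ⟨i, Finset.mem_univ i, by have : y i ≠ 0 := hi
                                positivity⟩
    have := Finset.sum_nonneg h0
    positivity
  · have := Finset.sum_nonneg h0
    linarith
  · intro i
    have := Finset.single_le_sum h0 (Finset.mem_univ i)
    linarith

theorem hmat_off (hb : ∀ i j, 0 ≤ b i j) (β : s → ℝ) (i j : s) (hij : i ≠ j) :
    Hmat b β i j ≤ 0 := by
  rw [Hmat, if_neg hij]
  have := hb (some i) (some j)
  linarith

/-- The weights left after identification of a vertex with `δ` form a network. -/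
theorem IsNetwork.contract {a : V} {b₀ b : Option ↥(insert a s) → Option ↥(insert a s) → ℝ}
    (h : IsNetwork b₀ b) (ha : a ∉ s) : IsNetwork (contract b₀) (SusySigma.contract b) where
  symm := contract_symm h.symm
  diag := contract_diag h.diag
  nonneg i j := by
    cases i <;> cases j <;> simp only [SusySigma.contract] <;>
      first | exact h.nonneg _ _ | exact add_nonneg (h.nonneg _ _) (h.nonneg _ _) | exact le_rfl
  le i j := by
    cases i <;> cases j <;> simp only [SusySigma.contract] <;>
      first | exact h.le _ _ | exact add_le_add (h.le _ _) (h.le _ _) | exact le_rfl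
  conn := by
    -- the map which identifies `a` with `δ` sends paths to paths
    let f : Option ↥(insert a s) → Option s
      | none => none
      | some i => if hi : (i : V) ∈ s then some ⟨i, hi⟩ else none
    have hf : ∀ i : s, f (some (incl i)) = some i := fun i => by
      simp only [f, incl]
      rw [dif_pos i.2]
    have hf' : f (some newV) = none := by
      simp only [f, newV]
      rw [dif_neg ha]
    have hcase : ∀ k : ↥(insert a s), k = newV ∨ ∃ i : s, k = incl i := by
      rintro ⟨k, hk⟩
      rcases Finset.mem_insert.1 hk with rfl | hk'
      · exact Or.inl rfl
      · exact Or.inr ⟨⟨k, hk'⟩, rfl⟩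
    have key : ∀ i j, 0 < b₀ i j → Relation.ReflTransGen
        (fun i j => 0 < SusySigma.contract b₀ i j) (f i) (f j) := by
      have hfn : f none = none := rfl
      intro i j hij
      rcases i with _ | i <;> rcases j with _ | j
      · exact Relation.ReflTransGen.refl
      · rcases hcase j with rfl | ⟨j, rfl⟩
        · rw [hf']
        · rw [hf, hfn]
          refine Relation.ReflTransGen.single ?_
          simp only [SusySigma.contract]
          have := h.nonneg (some newV) (some (incl j))
          linarith
      · rcases hcase i with rfl | ⟨i, rfl⟩
        · rw [hf']
        · rw [hf, hfn]
          refine Relation.ReflTransGen.single ?_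
          simp only [SusySigma.contract]
          have := h.nonneg (some (incl i)) (some newV)
          linarith
      · rcases hcase i with rfl | ⟨i, rfl⟩ <;> rcases hcase j with rfl | ⟨j, rfl⟩
        · exact Relation.ReflTransGen.refl
        · rw [hf, hf']
          refine Relation.ReflTransGen.single ?_
          simp only [SusySigma.contract]
          have := h.nonneg none (some (incl j))
          linarith
        · rw [hf, hf']
          refine Relation.ReflTransGen.single ?_
          simp only [SusySigma.contract]
          have := h.nonneg (some (incl i)) none
          linarith
        · rw [hf, hf]
          exact Relation.ReflTransGen.single hij
    intro i
    rcases i with _ | i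
    · exact Relation.ReflTransGen.refl
    · have : Relation.ReflTransGen (fun i j => 0 < SusySigma.contract b₀ i j)
          (f (some (incl i))) (f none) :=
        Relation.ReflTransGen.lift' f key _ _ (h.conn (some (incl i)))
      rwa [hf] at this

end Network

open Function (HasTemperateGrowth)
open scoped SchwartzMap

/-! ### Functions of temperate growth and Schwartz functions -/

section Temperate

variable {D E F : Type*} [NormedAddCommGroup D] [NormedSpace ℝ D] [NormedAddCommGroup E]
  [NormedSpace ℝ E] [NormedAddCommGroup F] [NormedSpace ℝ F]

theorem temperate_clm {L : E →L[ℝ] F} {f : D → E} (hf : HasTemperateGrowth f) :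
    HasTemperateGrowth fun x => L (f x) :=
  L.hasTemperateGrowth.comp hf

theorem temperate_prodMk {f : D → E} {g : D → F} (hf : HasTemperateGrowth f)
    (hg : HasTemperateGrowth g) : HasTemperateGrowth fun x => (f x, g x) := by
  have h := (temperate_clm (L := ContinuousLinearMap.inl ℝ E F) hf).add
    (temperate_clm (L := ContinuousLinearMap.inr ℝ E F) hg)
  refine (congrArg HasTemperateGrowth ?_).mp h
  funext x
  simp

theorem temperate_pi {ι : Type*} [Fintype ι] [DecidableEq ι] {f : D → ι → ℝ}
    (hf : ∀ i, HasTemperateGrowth fun x => f x i) : HasTemperateGrowth f := by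
  have h : HasTemperateGrowth fun x => ∑ i, ContinuousLinearMap.single ℝ (fun _ : ι => ℝ) i (f x i) :=
    HasTemperateGrowth.sum fun i _ => temperate_clm (hf i)
  refine (congrArg HasTemperateGrowth ?_).mp h
  funext x k
  simp [Finset.sum_apply, Pi.single_apply]

theorem temperate_prod {ι : Type*} {s : Finset ι} {f : ι → D → ℝ}
    (hf : ∀ i ∈ s, HasTemperateGrowth (f i)) : HasTemperateGrowth fun x => ∏ i ∈ s, f i x := by
  classical
  induction s using Finset.induction_on with
  | empty => simp
  | insert a s ha ih =>
    simp only [Finset.prod_insert ha]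
    exact (hf a (by simp)).fun_mul (ih fun i hi => hf i (by simp [hi]))

/-- Real powers of functions bounded below by `1` have temperate growth. -/
theorem temperate_rpow {f : D → ℝ} (hf : HasTemperateGrowth f) (h1 : ∀ x, 1 ≤ f x) (r : ℝ) :
    HasTemperateGrowth fun x => f x ^ r := by
  have hu : UniqueDiffOn ℝ (Set.Ici (1 : ℝ)) := uniqueDiffOn_Ici 1
  have hd : ContDiffOn ℝ ∞ (fun x : ℝ => x ^ r) (Set.Ici 1) :=
    contDiffOn_fun_id.rpow_const_of_ne fun x hx => (lt_of_lt_of_le zero_lt_one hx).ne'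
  refine HasTemperateGrowth.comp' (g := fun x : ℝ => x ^ r) (t := Set.Ici 1) ?_ hu hd ?_ hf
  · rintro _ ⟨x, rfl⟩
    exact h1 x
  intro N
  obtain ⟨k, hk⟩ := exists_nat_ge r
  refine ⟨k, ∑ k ∈ Finset.range (N + 1), ‖Polynomial.eval r (descPochhammer ℝ k)‖, by positivity,
    fun n hn x hx => ?_⟩
  have hx1 : (1 : ℝ) ≤ x := hx
  have hx0 : 0 < x := lt_of_lt_of_le zero_lt_one hx1
  have hc : ContDiffAt ℝ n (fun x : ℝ => x ^ r) x := Real.contDiffAt_rpow_const (Or.inl hx0.ne')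
  rw [norm_iteratedFDerivWithin_eq_norm_iteratedDerivWithin,
    iteratedDerivWithin_eq_iteratedDeriv hu hc hx, iteratedDeriv_eq_iterate,
    Real.iter_deriv_rpow_const, norm_mul]
  gcongr 1
  · have : n ∈ Finset.range (N + 1) := Finset.mem_range.2 (by omega)
    exact Finset.single_le_sum (f := fun k => ‖Polynomial.eval r (descPochhammer ℝ k)‖)
      (fun _ _ => norm_nonneg _) this
  · rw [Real.norm_of_nonneg (by positivity), Real.norm_of_nonneg hx0.le, ← Real.rpow_natCast]
    refine (Real.rpow_le_rpow_of_exponent_le hx1 (?_ : r - n ≤ k)).trans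
      (Real.rpow_le_rpow hx0.le (by linarith) (by positivity))
    have : (0 : ℝ) ≤ n := by positivity
    linarith

/-- The reciprocal of a function of temperate growth is of temperate growth if it is bounded by
a function of temperate growth. -/
theorem temperate_inv {f g : D → ℝ} (hf : HasTemperateGrowth f) (hg : HasTemperateGrowth g)
    (h : ∀ x, 1 ≤ f x * g x) : HasTemperateGrowth fun x => (f x)⁻¹ := by
  have h1 := hg.fun_mul (temperate_rpow (hf.fun_mul hg) h (-1))
  refine (congrArg HasTemperateGrowth ?_).mp h1
  funext x
  have hx := h x
  rw [Real.rpow_neg_one, mul_inv]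
  have : g x ≠ 0 := by
    rintro h0
    rw [h0] at hx
    norm_num at hx
  field_simp

theorem temperate_sqrt {f : D → ℝ} (hf : HasTemperateGrowth f) (h1 : ∀ x, 1 ≤ f x) :
    HasTemperateGrowth fun x => √(f x) := by
  simpa only [Real.sqrt_eq_rpow] using temperate_rpow hf h1 (1 / 2)

end Temperate

section Gaussian

theorem pow_mul_exp_neg_sq_le (m : ℕ) (x : ℝ) :
    |x| ^ m * Real.exp (-(x ^ 2 / 2)) ≤ m.factorial * Real.exp (1 / 2) := by
  have h1 := Real.pow_div_factorial_le_exp |x| (abs_nonneg x) m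
  rw [div_le_iff₀ (by positivity)] at h1
  calc |x| ^ m * Real.exp (-(x ^ 2 / 2))
      ≤ (Real.exp |x| * m.factorial) * Real.exp (-(x ^ 2 / 2)) := by gcongr
    _ = m.factorial * Real.exp (|x| - x ^ 2 / 2) := by rw [sub_eq_add_neg, Real.exp_add]; ring
    _ ≤ m.factorial * Real.exp (1 / 2) := by
      gcongr
      have := sq_abs x
      nlinarith [sq_nonneg (|x| - 1)]

/-- The Gaussian function. -/
def gaussianSchwartz : 𝓢(ℝ, ℝ) where
  toFun x := Real.exp (-(x ^ 2 / 2))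
  smooth' := by fun_prop
  decay' k n := by
    have hp : ∀ p : Polynomial ℝ, ∃ C : ℝ, ∀ x : ℝ,
        |x| ^ k * (|p.eval x| * Real.exp (-(x ^ 2 / 2))) ≤ C := by
      intro p
      induction p using Polynomial.induction_on' with
      | add p q hp hq =>
        obtain ⟨C, hC⟩ := hp
        obtain ⟨C', hC'⟩ := hq
        refine ⟨C + C', fun x => ?_⟩
        have h1 : |x| ^ k * (|(p + q).eval x| * Real.exp (-(x ^ 2 / 2))) ≤
            |x| ^ k * ((|p.eval x| + |q.eval x|) * Real.exp (-(x ^ 2 / 2))) := by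
          rw [Polynomial.eval_add]
          gcongr
          exact abs_add_le _ _
        have := hC x
        have := hC' x
        nlinarith
      | monomial m c =>
        refine ⟨|c| * ((k + m).factorial * Real.exp (1 / 2)), fun x => ?_⟩
        rw [Polynomial.eval_monomial, abs_mul, abs_pow]
        have := pow_mul_exp_neg_sq_le (k + m) x
        rw [pow_add] at this
        calc |x| ^ k * (|c| * |x| ^ m * Real.exp (-(x ^ 2 / 2)))
            = |c| * (|x| ^ k * |x| ^ m * Real.exp (-(x ^ 2 / 2))) := by ring
          _ ≤ _ := by gcongr
    obtain ⟨C, hC⟩ := hp ((Polynomial.hermite n).map (Int.castRingHom ℝ))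
    refine ⟨C, fun x => ?_⟩
    rw [norm_iteratedFDeriv_eq_norm_iteratedDeriv, iteratedDeriv_eq_iterate,
      Polynomial.deriv_gaussian_eq_hermite_mul_gaussian, norm_mul, norm_mul, norm_pow, norm_neg,
      norm_one, one_pow, one_mul, Real.norm_eq_abs, Real.norm_eq_abs, Real.norm_eq_abs,
      Real.abs_exp]
    refine Eq.trans_le ?_ (hC x)
    rw [Polynomial.aeval_def, Polynomial.eval_map]
    rfl

end Gaussian

section Tensor

variable {E F : Type*} [NormedAddCommGroup E] [NormedSpace ℝ E] [NormedAddCommGroup F]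
  [NormedSpace ℝ F]

theorem norm_iteratedFDeriv_comp_fst_le (f : 𝓢(E, ℂ)) (n : ℕ) (x : E × F) :
    ‖iteratedFDeriv ℝ n (fun x : E × F => f x.1) x‖ ≤ ‖iteratedFDeriv ℝ n f x.1‖ := by
  have h := (ContinuousLinearMap.fst ℝ E F).iteratedFDeriv_comp_right (f.smooth ⊤) x
    (i := n) (by exact_mod_cast le_top)
  have h' : iteratedFDeriv ℝ n (fun x : E × F => f x.1) x = _ := h
  rw [h']
  refine (ContinuousMultilinearMap.norm_compContinuousLinearMap_le _ _).trans ?_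
  refine mul_le_of_le_one_right (norm_nonneg _) ?_
  exact Finset.prod_le_one (fun _ _ => norm_nonneg _)
    fun _ _ => ContinuousLinearMap.norm_fst_le ℝ E F

theorem norm_iteratedFDeriv_comp_snd_le (f : 𝓢(F, ℂ)) (n : ℕ) (x : E × F) :
    ‖iteratedFDeriv ℝ n (fun x : E × F => f x.2) x‖ ≤ ‖iteratedFDeriv ℝ n f x.2‖ := by
  have h := (ContinuousLinearMap.snd ℝ E F).iteratedFDeriv_comp_right (f.smooth ⊤) x
    (i := n) (by exact_mod_cast le_top)
  have h' : iteratedFDeriv ℝ n (fun x : E × F => f x.2) x = _ := h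
  rw [h']
  refine (ContinuousMultilinearMap.norm_compContinuousLinearMap_le _ _).trans ?_
  refine mul_le_of_le_one_right (norm_nonneg _) ?_
  exact Finset.prod_le_one (fun _ _ => norm_nonneg _)
    fun _ _ => ContinuousLinearMap.norm_snd_le ℝ E F

/-- The tensor product of two Schwartz functions. -/
def schwartzTensor (f : 𝓢(E, ℂ)) (g : 𝓢(F, ℂ)) : 𝓢(E × F, ℂ) where
  toFun x := f x.1 * g x.2
  smooth' := by
    have h1 : ContDiff ℝ ∞ fun x : E × F => f x.1 := (f.smooth ⊤).comp contDiff_fst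
    have h2 : ContDiff ℝ ∞ fun x : E × F => g x.2 := (g.smooth ⊤).comp contDiff_snd
    exact h1.mul h2
  decay' k n := by
    refine ⟨∑ i ∈ Finset.range (n + 1), (n.choose i : ℝ) *
      (SchwartzMap.seminorm ℝ k i f * SchwartzMap.seminorm ℝ 0 (n - i) g +
        SchwartzMap.seminorm ℝ 0 i f * SchwartzMap.seminorm ℝ k (n - i) g), fun x => ?_⟩
    have h1 : ContDiff ℝ ∞ fun x : E × F => f x.1 := (f.smooth ⊤).comp contDiff_fst
    have h2 : ContDiff ℝ ∞ fun x : E × F => g x.2 := (g.smooth ⊤).comp contDiff_snd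
    have h3 := norm_iteratedFDeriv_mul_le h1 h2 x (n := n) (by exact_mod_cast le_top)
    refine (mul_le_mul_of_nonneg_left h3 (by positivity)).trans ?_
    rw [Finset.mul_sum]
    refine Finset.sum_le_sum fun i _ => ?_
    have hx : ‖x‖ ^ k ≤ ‖x.1‖ ^ k + ‖x.2‖ ^ k := by
      rw [Prod.norm_def]
      rcases max_choice ‖x.1‖ ‖x.2‖ with h | h <;> rw [h]
      · exact le_add_of_nonneg_right (by positivity)
      · exact le_add_of_nonneg_left (by positivity)
    have a1 := f.le_seminorm ℝ k i x.1
    have a2 := f.le_seminorm ℝ 0 i x.1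
    have a3 := g.le_seminorm ℝ k (n - i) x.2
    have a4 := g.le_seminorm ℝ 0 (n - i) x.2
    rw [pow_zero, one_mul] at a2 a4
    calc ‖x‖ ^ k * ((n.choose i : ℝ) * ‖iteratedFDeriv ℝ i (fun x : E × F => f x.1) x‖ *
          ‖iteratedFDeriv ℝ (n - i) (fun x : E × F => g x.2) x‖)
        ≤ (‖x.1‖ ^ k + ‖x.2‖ ^ k) * ((n.choose i : ℝ) * ‖iteratedFDeriv ℝ i f x.1‖ *
          ‖iteratedFDeriv ℝ (n - i) g x.2‖) := by
          gcongr
          · exact norm_iteratedFDeriv_comp_fst_le f i x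
          · exact norm_iteratedFDeriv_comp_snd_le g (n - i) x
      _ = (n.choose i : ℝ) * ((‖x.1‖ ^ k * ‖iteratedFDeriv ℝ i f x.1‖) *
            ‖iteratedFDeriv ℝ (n - i) g x.2‖ + ‖iteratedFDeriv ℝ i f x.1‖ *
              (‖x.2‖ ^ k * ‖iteratedFDeriv ℝ (n - i) g x.2‖)) := by ring
      _ ≤ _ := by
        gcongr

end Tensor

section Build

variable {D E F : Type*} [NormedAddCommGroup D] [NormedSpace ℝ D] [NormedAddCommGroup E]
  [NormedSpace ℝ E] [NormedAddCommGroup F] [NormedSpace ℝ F]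

/-- The product of a function of temperate growth, of Schwartz functions of `Φ` and `π`, and of
`e^{-q}` is a Schwartz function if `Φ`, `π` and `q` together control the size of the argument. -/
theorem exists_schwartz_of_control {T : D → ℝ} (hT : HasTemperateGrowth T)
    {Φ : D → E} (hΦ : HasTemperateGrowth Φ) {π : D → F} (hπ : HasTemperateGrowth π)
    {q : D → ℝ} (hq : HasTemperateGrowth q) (hq0 : ∀ x, 0 ≤ q x)
    (hctrl : ∃ (k : ℕ) (C : ℝ), ∀ x, ‖x‖ ≤ C * (1 + ‖Φ x‖ + ‖π x‖ + q x) ^ k)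
    (h : 𝓢(E, ℂ)) (χ : 𝓢(F, ℂ)) :
    ∃ G : 𝓢(D, ℂ), ∀ x, G x = ((T x * Real.exp (-q x) : ℝ) : ℂ) * h (Φ x) * χ (π x) := by
  have hQ : HasTemperateGrowth fun x => √(1 + 2 * q x) :=
    temperate_sqrt (by fun_prop) fun x => by linarith [hq0 x]
  let γ : 𝓢(ℝ, ℂ) := SchwartzMap.postcompCLM (𝕜 := ℝ) Complex.ofRealCLM gaussianSchwartz
  have hmap := temperate_prodMk hΦ (temperate_prodMk hπ hQ)
  have hup : ∃ (k : ℕ) (C : ℝ), ∀ x, ‖x‖ ≤ C * (1 + ‖(Φ x, (π x, √(1 + 2 * q x)))‖) ^ k := by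
    obtain ⟨k, C, hC⟩ := hctrl
    refine ⟨2 * k, |C| * 3 ^ k, fun x => (hC x).trans ?_⟩
    set r := ‖(Φ x, (π x, √(1 + 2 * q x)))‖ with hr
    have h1 : ‖Φ x‖ ≤ r := norm_fst_le (Φ x, (π x, √(1 + 2 * q x)))
    have h2 : ‖π x‖ ≤ r := (norm_fst_le _).trans (norm_snd_le (Φ x, (π x, √(1 + 2 * q x))))
    have h3 : √(1 + 2 * q x) ≤ r := by
      refine (le_abs_self _).trans ?_
      rw [← Real.norm_eq_abs]
      exact (norm_snd_le (π x, √(1 + 2 * q x))).trans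
        (norm_snd_le (Φ x, (π x, √(1 + 2 * q x))))
    have h4 : q x ≤ r ^ 2 := by
      have := Real.sq_sqrt (show 0 ≤ 1 + 2 * q x by linarith [hq0 x])
      have h5 := pow_le_pow_left₀ (Real.sqrt_nonneg _) h3 2
      nlinarith [hq0 x]
    have hr0 : 0 ≤ r := norm_nonneg _
    have hle : 1 + ‖Φ x‖ + ‖π x‖ + q x ≤ 3 * (1 + r) ^ 2 := by nlinarith
    calc C * (1 + ‖Φ x‖ + ‖π x‖ + q x) ^ k ≤ |C| * (1 + ‖Φ x‖ + ‖π x‖ + q x) ^ k := by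
          have := hq0 x
          gcongr
          exact le_abs_self C
      _ ≤ |C| * (3 * (1 + r) ^ 2) ^ k := by
          have := hq0 x
          gcongr
      _ = _ := by rw [mul_pow, ← pow_mul]; ring
  have hT' : HasTemperateGrowth fun x => ((T x * Real.exp (1 / 2) : ℝ) : ℂ) :=
    Function.Complex.hasTemperateGrowth_ofReal.comp (by fun_prop :
      HasTemperateGrowth fun x => T x * Real.exp (1 / 2))
  refine ⟨SchwartzMap.smulLeftCLM ℂ (fun x => ((T x * Real.exp (1 / 2) : ℝ) : ℂ))
    (SchwartzMap.compCLM ℂ hmap hup (schwartzTensor h (schwartzTensor χ γ))), fun x => ?_⟩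
  rw [SchwartzMap.smulLeftCLM_apply_apply hT']
  have hγ : γ (√(1 + 2 * q x)) = ((Real.exp (-(1 / 2) - q x) : ℝ) : ℂ) := by
    change ((Real.exp (-(√(1 + 2 * q x) ^ 2 / 2)) : ℝ) : ℂ) = _
    rw [Real.sq_sqrt (by linarith [hq0 x])]
    congr 2
    ring
  change ((T x * Real.exp (1 / 2) : ℝ) : ℂ) * (h (Φ x) * (χ (π x) * γ (√(1 + 2 * q x)))) = _
  rw [hγ]
  have he : Real.exp (-q x) = Real.exp (1 / 2) * Real.exp (-(1 / 2) - q x) := by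
    rw [← Real.exp_add]; congr 1; ring
  rw [he]
  push_cast
  ring

end Build

open MeasureTheory

/-! ### Rapidly decreasing integrands -/

section SinhSchwartz

variable {V E : Type*} [AddCommGroup E] [Module ℂ E] {s : Finset V}

/-- The change of coordinates `u ↦ sinh u`. -/
def sinhPts (p : Pts s) : Pts s := (fun i => Real.sinh (p.1 i), p.2)

theorem continuous_sinhPts : Continuous (sinhPts : Pts s → Pts s) := by
  unfold sinhPts
  refine Continuous.prodMk (continuous_pi fun i => ?_) continuous_snd
  exact Real.continuous_sinh.comp ((continuous_apply i).comp continuous_fst)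

theorem norm_le_norm_sinhPts (p : Pts s) : ‖p‖ ≤ ‖sinhPts p‖ := by
  rw [Prod.norm_def, Prod.norm_def]
  refine max_le_max ?_ le_rfl
  refine (pi_norm_le_iff_of_nonneg (norm_nonneg _)).2 fun i => ?_
  refine le_trans ?_ (norm_le_pi_norm (sinhPts p).1 i)
  change |p.1 i| ≤ |Real.sinh (p.1 i)|
  rw [Real.abs_sinh]
  exact Real.self_le_sinh_iff.2 (abs_nonneg _)

variable {B : Type*} [NormedAddCommGroup B] [NormedSpace ℝ B]

/-- An integrable bound for a Schwartz function in the coordinates `sinh u`. -/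
def decayBound (p : Pts s) : ℝ := (1 + ‖p‖) ^ (-((Module.finrank ℝ (Pts s) + 1 : ℕ) : ℝ))

instance : (volume : Measure (Pts s)).IsAddHaarMeasure :=
  Measure.prod.instIsAddHaarMeasure _ _

theorem integrable_decayBound : Integrable (decayBound : Pts s → ℝ) :=
  integrable_one_add_norm (by push_cast; linarith)

theorem exists_le_decayBound {F : Type*} [NormedAddCommGroup F] [NormedSpace ℝ F]
    (c : 𝓢(B × Pts s, F)) :
    ∃ C : ℝ, ∀ b p, ‖c (b, sinhPts p)‖ ≤ C * decayBound p := by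
  set r := Module.finrank ℝ (Pts s) + 1 with hr
  refine ⟨2 ^ r * (Finset.Iic (r, 0)).sup (fun m => SchwartzMap.seminorm ℝ m.1 m.2) c,
    fun b p => ?_⟩
  have h := SchwartzMap.one_add_le_sup_seminorm_apply (𝕜 := ℝ) (m := (r, 0)) (k := r) (n := 0)
    le_rfl le_rfl c (b, sinhPts p)
  rw [norm_iteratedFDeriv_zero] at h
  have h1 : 1 + ‖p‖ ≤ 1 + ‖(b, sinhPts p)‖ := by
    have := norm_le_norm_sinhPts p
    have := norm_snd_le (b, sinhPts p)
    simp only at this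
    linarith
  have h2 : (1 + ‖p‖) ^ r * ‖c (b, sinhPts p)‖ ≤
      2 ^ r * (Finset.Iic (r, 0)).sup (fun m => SchwartzMap.seminorm ℝ m.1 m.2) c :=
    le_trans (by gcongr) h
  rw [decayBound, Real.rpow_neg (by positivity), Real.rpow_natCast, ← div_eq_mul_inv,
    le_div_iff₀ (by positivity)]
  linarith

theorem integrable_mul_schwartz {m : Pts s → ℂ} (hm : Continuous m) {M : ℝ} (hM : ∀ p, ‖m p‖ ≤ M)
    (c : 𝓢(B × Pts s, ℂ)) (b : B) : Integrable fun p => m p * c (b, sinhPts p) := by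
  obtain ⟨C, hC⟩ := exists_le_decayBound c
  have hcont : Continuous fun p : Pts s => c (b, sinhPts p) :=
    c.continuous.comp (continuous_const.prodMk continuous_sinhPts)
  refine Integrable.mono' ((integrable_decayBound (s := s)).const_mul (M * C))
    (hm.mul hcont).aestronglyMeasurable (Filter.Eventually.of_forall fun p => ?_)
  rw [norm_mul, mul_assoc]
  exact mul_le_mul (hM p) (hC b p) (norm_nonneg _) ((norm_nonneg _).trans (hM p))

/-- The derivative of a Schwartz function in the direction of a parameter. -/
def paramDeriv (v : B) (c : 𝓢(B × Pts s, ℂ)) : 𝓢(B × Pts s, ℂ) :=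
  SchwartzMap.evalCLM ℂ (B × Pts s) ℂ (v, 0) (SchwartzMap.fderivCLM ℂ (B × Pts s) ℂ c)

theorem dirD_param (v : B) (c : 𝓢(B × Pts s, ℂ)) (x : Pts s) :
    dirD v (fun b => c (b, x)) = fun b => paramDeriv v c (b, x) := by
  funext b
  have h : HasFDerivAt (fun b : B => (b, x)) (ContinuousLinearMap.inl ℝ B (Pts s)) b :=
    hasFDerivAt_prodMk_left b x
  exact dirD_comp (φ := c) (c.smooth ⊤) h v

/-- Differentiation under the integral sign. -/
theorem dirD_integral {m : Pts s → ℂ} (hm : Continuous m) {M : ℝ} (hM : ∀ p, ‖m p‖ ≤ M)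
    (v : B) (c : 𝓢(B × Pts s, ℂ)) :
    dirD v (fun b => ∫ p, m p * c (b, sinhPts p)) =
      fun b => ∫ p, m p * paramDeriv v c (b, sinhPts p) := by
  funext b
  set c' := SchwartzMap.fderivCLM ℂ (B × Pts s) ℂ c with hc'
  obtain ⟨C, hC⟩ := exists_le_decayBound c'
  have hcont : ∀ b, Continuous fun p : Pts s => c (b, sinhPts p) := fun b =>
    c.continuous.comp (continuous_const.prodMk continuous_sinhPts)
  have hcont' : Continuous fun p : Pts s => c' (b, sinhPts p) :=
    c'.continuous.comp (continuous_const.prodMk continuous_sinhPts)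
  have hmeas : AEStronglyMeasurable (fun p : Pts s =>
      m p • (c' (b, sinhPts p)).comp (ContinuousLinearMap.inl ℝ B (Pts s))) volume :=
    (hm.smul (hcont'.clm_comp continuous_const)).aestronglyMeasurable
  have hbound : ∀ b p, ‖m p • (c' (b, sinhPts p)).comp (ContinuousLinearMap.inl ℝ B (Pts s))‖ ≤
      M * (C * decayBound p) := by
    intro b p
    have h1 : ‖(c' (b, sinhPts p)).comp (ContinuousLinearMap.inl ℝ B (Pts s))‖ ≤
        ‖c' (b, sinhPts p)‖ :=
      (ContinuousLinearMap.opNorm_comp_le _ _).trans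
        (mul_le_of_le_one_right (norm_nonneg _) (ContinuousLinearMap.norm_inl_le_one ℝ B (Pts s)))
    rw [norm_smul]
    exact mul_le_mul (hM p) (h1.trans (hC b p)) (norm_nonneg _) ((norm_nonneg _).trans (hM p))
  have hint : Integrable fun p : Pts s => M * (C * decayBound p) :=
    (integrable_decayBound.const_mul C).const_mul M
  have key := hasFDerivAt_integral_of_dominated_of_fderiv_le (μ := (volume : Measure (Pts s)))
    (s := Set.univ) (x₀ := b)
    (F := fun b p => m p * c (b, sinhPts p))
    (F' := fun b p => m p • (c' (b, sinhPts p)).comp (ContinuousLinearMap.inl ℝ B (Pts s)))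
    Filter.univ_mem (Filter.Eventually.of_forall fun b => (hm.mul (hcont b)).aestronglyMeasurable)
    (integrable_mul_schwartz hm hM c b) hmeas
    (Filter.Eventually.of_forall fun p b _ => hbound b p) hint
    (Filter.Eventually.of_forall fun p b _ => by
      have h : HasFDerivAt (fun b : B => (b, sinhPts p)) (ContinuousLinearMap.inl ℝ B (Pts s)) b :=
        hasFDerivAt_prodMk_left b _
      exact ((c.differentiable _).hasFDerivAt.comp b h).const_mul (m p))
  rw [dirD, key.fderiv, ContinuousLinearMap.integral_apply
    (hint.mono' hmeas (Filter.Eventually.of_forall fun p => hbound b p))]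
  rfl

/-- Nilpotent substitution can be interchanged with the integral. -/
theorem integral_subst {K : Type*} [Fintype K] [DecidableEq K] {A : Type*} [Ring A] [Algebra ℂ A]
    {n : K → A} (hn : IsNil n) (L : List K) {m : Pts s → ℂ} (hm : Continuous m) {M : ℝ}
    (hM : ∀ p, ‖m p‖ ≤ M) (c : 𝓢((K → ℝ) × Pts s, ℂ)) (a : A) (l : Module.Dual ℂ A) :
    Integrable (fun p => m p * l (subst n L (fun t => c (t, sinhPts p)) * a)) ∧
      ∫ p, m p * l (subst n L (fun t => c (t, sinhPts p)) * a) =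
        l (subst n L (fun t => ∫ p, m p * c (t, sinhPts p)) * a) := by
  induction L generalizing c a with
  | nil =>
    simp only [subst, ← Algebra.smul_def, map_smul, smul_eq_mul, ← mul_assoc]
    exact ⟨(integrable_mul_schwartz hm hM c 0).mul_const _, integral_mul_const _ _⟩
  | cons k L ih =>
    obtain ⟨i1, e1⟩ := ih c a
    obtain ⟨i2, e2⟩ := ih (paramDeriv (Pi.single k 1) c) (n k * a)
    have hk : ∀ φ : (K → ℝ) → ℂ, n k * subst n L φ * a = subst n L φ * (n k * a) := fun φ => by
      rw [(hn.comm k _).eq, mul_assoc]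
    simp only [subst, dirD_param, dirD_integral hm hM, add_mul, hk, map_add, mul_add]
    exact ⟨i1.add i2, by rw [integral_add i1 i2, e1, e2]⟩

/-- The functions of `(u, s)` which are sums of Schwartz functions of `(sinh u, s)` with
coefficients in the Grassmann algebra. -/
def sinhSchwartz (s : Finset V) (A : Type*) [Ring A] [Algebra ℂ A] : Submodule ℂ (Pts s → A) :=
  Submodule.span ℂ {f | ∃ (h : 𝓢(Pts s, ℂ)) (a : A), f = fun p => h (sinhPts p) • a}

theorem subst_mem_sinhSchwartz {K : Type*} [Fintype K] [DecidableEq K] {A : Type*} [Ring A]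
    [Algebra ℂ A] {n : K → A} (hn : IsNil n) (L : List K) (c : 𝓢((K → ℝ) × Pts s, ℂ)) (a : A) :
    (fun p => subst n L (fun t => c (t, sinhPts p)) * a) ∈ sinhSchwartz s A := by
  induction L generalizing c a with
  | nil =>
    have ht : HasTemperateGrowth fun x : Pts s => ((0 : K → ℝ), x) :=
      temperate_prodMk (by fun_prop) (by fun_prop)
    have hup : ∃ (k : ℕ) (C : ℝ), ∀ x : Pts s, ‖x‖ ≤ C * (1 + ‖((0 : K → ℝ), x)‖) ^ k :=
      ⟨1, 1, fun x => by
        have := norm_snd_le ((0 : K → ℝ), x)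
        simp only at this
        linarith⟩
    refine Submodule.subset_span ⟨SchwartzMap.compCLM ℂ ht hup c, a, ?_⟩
    funext p
    simp only [subst, ← Algebra.smul_def]
    rfl
  | cons k L ih =>
    have hk : ∀ φ : (K → ℝ) → ℂ, n k * subst n L φ * a = subst n L φ * (n k * a) := fun φ => by
      rw [(hn.comm k _).eq, mul_assoc]
    simp only [subst, dirD_param, add_mul, hk]
    exact Submodule.add_mem _ (ih c a) (ih _ _)

theorem exists_of_mem_sinhSchwartz {A : Type*} [Ring A] [Algebra ℂ A] {f : Pts s → A}
    (hf : f ∈ sinhSchwartz s A) : ∃ (N : ℕ) (h : Fin N → 𝓢(Pts s, ℂ)) (a : Fin N → A),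
      ∀ p, f p = ∑ i, h i (sinhPts p) • a i := by
  induction hf using Submodule.span_induction with
  | mem f hf =>
    obtain ⟨h, a, rfl⟩ := hf
    exact ⟨1, fun _ => h, fun _ => a, by simp⟩
  | zero => exact ⟨0, fun i => i.elim0, fun i => i.elim0, by simp⟩
  | add f g _ _ hf hg =>
    obtain ⟨N, h, a, e⟩ := hf
    obtain ⟨N', h', a', e'⟩ := hg
    refine ⟨N + N', Fin.append h h', Fin.append a a', fun p => ?_⟩
    simp [Fin.sum_univ_add, e, e']
  | smul r f _ hf =>
    obtain ⟨N, h, a, e⟩ := hf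
    exact ⟨N, h, fun i => r • a i, fun p => by simp [e, Finset.smul_sum, smul_comm r]⟩

end SinhSchwartz

/-! ### The integral over one vertex -/

section OneVertex

theorem hasDerivAt_two_mul_sinh_half (v : ℝ) :
    HasDerivAt (fun v => 2 * Real.sinh (v / 2)) (Real.cosh (v / 2)) v := by
  have h : HasDerivAt (fun v : ℝ => v / 2) (1 / 2) v := (hasDerivAt_id v).div_const 2
  have h2 := (((Real.hasDerivAt_sinh (v / 2)).comp v h).const_mul 2)
  refine h2.congr_deriv ?_
  ring

theorem two_mul_sinh_half_bijective : Function.Bijective fun v => 2 * Real.sinh (v / 2) := by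
  constructor
  · intro x y h
    have := Real.sinh_injective (mul_left_cancel₀ two_ne_zero h)
    linarith
  · intro y
    obtain ⟨x, hx⟩ := Real.sinh_surjective (y / 2)
    exact ⟨2 * x, by simp only; rw [mul_div_cancel_left₀ _ (two_ne_zero' ℝ), hx]; ring⟩

/-- The change of variables `y = 2 sinh (v / 2)` in the Gaussian integral. -/
theorem integral_cosh_gaussian {b : ℝ} (hb : 0 < b) :
    Integrable (fun v => Real.cosh (v / 2) * Real.exp (-(b / 2) * (2 * Real.sinh (v / 2)) ^ 2)) ∧
      ∫ v, Real.cosh (v / 2) * Real.exp (-(b / 2) * (2 * Real.sinh (v / 2)) ^ 2) =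
        √(2 * Real.pi / b) := by
  have hd : ∀ v ∈ Set.univ, HasDerivWithinAt (fun v => 2 * Real.sinh (v / 2))
      (Real.cosh (v / 2)) Set.univ v := fun v _ => (hasDerivAt_two_mul_sinh_half v).hasDerivWithinAt
  have hinj := two_mul_sinh_half_bijective.1.injOn (s := Set.univ)
  have him : (fun v => 2 * Real.sinh (v / 2)) '' Set.univ = Set.univ := by
    rw [Set.image_univ, two_mul_sinh_half_bijective.2.range_eq]
  have h1 := integrableOn_image_iff_integrableOn_abs_deriv_smul MeasurableSet.univ hd hinj
    (fun y => Real.exp (-(b / 2) * y ^ 2))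
  have h2 := integral_image_eq_integral_abs_deriv_smul MeasurableSet.univ hd hinj
    (fun y => Real.exp (-(b / 2) * y ^ 2))
  simp only [him, abs_of_pos (Real.cosh_pos _), smul_eq_mul, integrableOn_univ,
    Measure.restrict_univ] at h1 h2
  refine ⟨h1.1 (integrable_exp_neg_mul_sq (by positivity)), ?_⟩
  rw [← h2, integral_gaussian]
  congr 1
  field_simp

/-- The function `e^{-v / 2}` may be replaced by its even part `cosh (v / 2)`, since the remaining
factor is even. -/
theorem integral_exp_neg_half_gaussian {b : ℝ} (hb : 0 < b) :
    Integrable (fun v => Real.exp (-v / 2) * Real.exp (-(b / 2) * (2 * Real.sinh (v / 2)) ^ 2)) ∧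
      ∫ v, Real.exp (-v / 2) * Real.exp (-(b / 2) * (2 * Real.sinh (v / 2)) ^ 2) =
        √(2 * Real.pi / b) := by
  obtain ⟨hi, he⟩ := integral_cosh_gaussian hb
  have hI : Integrable fun v =>
      Real.exp (-v / 2) * Real.exp (-(b / 2) * (2 * Real.sinh (v / 2)) ^ 2) := by
    refine (hi.const_mul 2).mono' ?_ (Filter.Eventually.of_forall fun v => ?_)
    · exact Continuous.aestronglyMeasurable (by fun_prop)
    · rw [Real.norm_of_nonneg (by positivity), ← mul_assoc]
      refine mul_le_mul_of_nonneg_right ?_ (Real.exp_pos _).le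
      rw [Real.cosh_eq, neg_div]
      have := Real.exp_pos (v / 2)
      linarith
  refine ⟨hI, ?_⟩
  have h1 := integral_neg_eq_self
    (fun v => Real.exp (-v / 2) * Real.exp (-(b / 2) * (2 * Real.sinh (v / 2)) ^ 2)) volume
  have hI' := hI.comp_neg
  have h2 := integral_add hI hI'
  rw [h1] at h2
  have h3 : ∀ v : ℝ, Real.exp (-v / 2) * Real.exp (-(b / 2) * (2 * Real.sinh (v / 2)) ^ 2) +
      Real.exp (- -v / 2) * Real.exp (-(b / 2) * (2 * Real.sinh (-v / 2)) ^ 2) =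
      2 * (Real.cosh (v / 2) * Real.exp (-(b / 2) * (2 * Real.sinh (v / 2)) ^ 2)) := by
    intro v
    rw [neg_neg, neg_div, Real.sinh_neg, Real.cosh_eq, mul_neg, neg_sq]
    ring
  simp only [h3, integral_const_mul, he] at h2
  linarith

/-- The value does not depend on `g`: the translation by `log g` leads to the symmetric case, and
the factors `√g` cancel. -/
theorem integral_shifted_gaussian {c g : ℝ} (hc : 0 < c) (hg : 0 < g) :
    Integrable (fun u => Real.exp (-u / 2) *
        Real.exp (-(c / 2) * (Real.exp (u / 2) * g - Real.exp (-u / 2)) ^ 2)) ∧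
      ∫ u, Real.exp (-u / 2) *
        Real.exp (-(c / 2) * (Real.exp (u / 2) * g - Real.exp (-u / 2)) ^ 2) =
          √(2 * Real.pi / c) := by
  obtain ⟨hi, he⟩ := integral_exp_neg_half_gaussian (mul_pos hc hg)
  have hsg : Real.exp (Real.log g / 2) = √g := by
    rw [Real.sqrt_eq_rpow, Real.rpow_def_of_pos hg]
    congr 1
    ring
  have hss : √g * √g = g := Real.mul_self_sqrt hg.le
  have hs0 : 0 < √g := Real.sqrt_pos.2 hg
  -- the translation by `log g` symmetrizes the exponent
  have key : ∀ v, Real.exp (-(v - Real.log g) / 2) * Real.exp (-(c / 2) *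
      (Real.exp ((v - Real.log g) / 2) * g - Real.exp (-(v - Real.log g) / 2)) ^ 2) =
      √g * (Real.exp (-v / 2) * Real.exp (-((c * g) / 2) * (2 * Real.sinh (v / 2)) ^ 2)) := by
    intro v
    have e1 : Real.exp (-(v - Real.log g) / 2) = √g * Real.exp (-v / 2) := by
      rw [← hsg, ← Real.exp_add]; congr 1; ring
    have e2 : Real.exp ((v - Real.log g) / 2) * g = √g * Real.exp (v / 2) := by
      have : Real.exp ((v - Real.log g) / 2) * √g = Real.exp (v / 2) := by
        rw [← hsg, ← Real.exp_add]; congr 1; ring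
      rw [← this]
      nth_rewrite 2 [← hss]
      ring
    rw [e1, e2, Real.sinh_eq, mul_assoc]
    congr 3
    rw [show -(v / 2) = -v / 2 by ring]
    nth_rewrite 3 [← hss]
    ring
  have hfun : (fun v => (fun u => Real.exp (-u / 2) *
      Real.exp (-(c / 2) * (Real.exp (u / 2) * g - Real.exp (-u / 2)) ^ 2)) (v - Real.log g)) =
      fun v => √g * (Real.exp (-v / 2) *
        Real.exp (-((c * g) / 2) * (2 * Real.sinh (v / 2)) ^ 2)) := funext key
  constructor
  · have h1 := hi.const_mul √g
    rw [← hfun] at h1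
    simpa using h1.comp_add_right (Real.log g)
  · rw [← integral_sub_right_eq_self _ (Real.log g), hfun, integral_const_mul, he,
      ← Real.sqrt_mul hg.le]
    congr 1
    field_simp

theorem elimKernel_nonneg {c : ℝ} (hc : 0 < c) (u t : ℝ) : 0 ≤ elimKernel c u t := by
  rw [elimKernel]
  positivity

/-- The Gaussian integral over the variable `s` at the removed vertex. After it, the source `a` only
enters through the factor `1 - a / c`, which the integral over `u` does not see. -/
theorem integral_elimKernel_right {c : ℝ} (hc : 0 < c) (a u : ℝ) :
    ∫ t : ℝ, (elimKernel c u t : ℂ) *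
      Complex.exp (a * ((Real.exp u - 1) + Complex.I * (Real.exp u * t))) =
      ((√(c / (2 * Real.pi)) * (Real.exp (-u / 2) * Real.exp (-(c / 2) *
        (Real.exp (u / 2) * (1 - a / c) - Real.exp (-u / 2)) ^ 2)) : ℝ) : ℂ) := by
  have hu := Real.exp_pos u
  have hb : 0 < c * Real.exp u / 2 := by positivity
  have h1 : ∀ t : ℝ, (elimKernel c u t : ℂ) *
      Complex.exp (a * ((Real.exp u - 1) + Complex.I * (Real.exp u * t))) =
      ((c / (2 * Real.pi) : ℝ) : ℂ) * Complex.exp (((-(c * Real.exp u / 2) : ℝ) : ℂ) * (t : ℂ) ^ 2 +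
        (Complex.I * ((a * Real.exp u : ℝ) : ℂ)) * t +
          ((a * (Real.exp u - 1) - c * (Real.cosh u - 1) : ℝ) : ℂ)) := by
    intro t
    rw [elimKernel, Complex.ofReal_mul, mul_assoc, Complex.ofReal_exp, ← Complex.exp_add]
    congr 2
    push_cast
    ring
  simp only [h1]
  rw [integral_const_mul, integral_cexp_quadratic (by rw [Complex.ofReal_re]; linarith)]
  have h2 : (((-(c * Real.exp u / 2) : ℝ) : ℂ)) ≠ 0 := by
    rw [Complex.ofReal_ne_zero]; linarith
  have h3 : ((a * (Real.exp u - 1) - c * (Real.cosh u - 1) : ℝ) : ℂ) -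
      (Complex.I * ((a * Real.exp u : ℝ) : ℂ)) ^ 2 / (4 * ((-(c * Real.exp u / 2) : ℝ) : ℂ)) =
      ((-(c / 2) * (Real.exp (u / 2) * (1 - a / c) - Real.exp (-u / 2)) ^ 2 : ℝ) : ℂ) := by
    rw [mul_pow, Complex.I_sq]
    have h4 : a * (Real.exp u - 1) - c * (Real.cosh u - 1) -
        (-1 * (a * Real.exp u) ^ 2) / (4 * (-(c * Real.exp u / 2))) =
        -(c / 2) * (Real.exp (u / 2) * (1 - a / c) - Real.exp (-u / 2)) ^ 2 := by
      rw [Real.cosh_eq]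
      have e1 : Real.exp u = Real.exp (u / 2) ^ 2 := by
        rw [← Real.exp_nat_mul]; congr 1; push_cast; ring
      have e2 : Real.exp (-u / 2) = (Real.exp (u / 2))⁻¹ := by
        rw [← Real.exp_neg]; congr 1; ring
      have e3 : Real.exp (-u) = (Real.exp (u / 2) ^ 2)⁻¹ := by
        rw [← e1, ← Real.exp_neg]
      rw [e1, e2, e3]
      have := (Real.exp_pos (u / 2)).ne'
      field_simp
      ring
    rw [← h4]
    push_cast
    ring
  rw [h3]
  have h5 : ((Real.pi : ℂ) / -((-(c * Real.exp u / 2) : ℝ) : ℂ)) ^ (1 / 2 : ℂ) =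
      ((√(Real.pi / (c * Real.exp u / 2)) : ℝ) : ℂ) := by
    rw [Real.sqrt_eq_rpow, Complex.ofReal_cpow (by positivity)]
    push_cast
    rw [neg_neg]
  rw [h5, ← Complex.ofReal_exp, ← Complex.ofReal_mul, ← Complex.ofReal_mul, ← mul_assoc,
    ← mul_assoc]
  congr 2
  have h6 : Real.exp (-u / 2) = √(1 / Real.exp u) := by
    rw [one_div, ← Real.exp_neg, ← Real.exp_half]
  have h7 : c / (2 * Real.pi) = √((c / (2 * Real.pi)) ^ 2) := by
    rw [Real.sqrt_sq (by positivity)]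
  rw [h6, ← Real.sqrt_mul (by positivity), h7, ← Real.sqrt_mul (by positivity),
    Real.sqrt_sq (by positivity)]
  congr 1
  field_simp

theorem integrable_elimKernel {c : ℝ} (hc : 0 < c) :
    Integrable fun p : ℝ × ℝ => elimKernel c p.1 p.2 := by
  have hcont : Continuous fun p : ℝ × ℝ => elimKernel c p.1 p.2 := by
    unfold elimKernel
    fun_prop
  rw [Measure.volume_eq_prod, integrable_prod_iff hcont.aestronglyMeasurable]
  have hint : ∀ u, Integrable fun t => elimKernel c u t := by
    intro u
    have h := (integrable_exp_neg_mul_sq (b := c * Real.exp u / 2) (by positivity)).const_mul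
      (c / (2 * Real.pi) * Real.exp (-(c * (Real.cosh u - 1))))
    refine h.congr (Filter.Eventually.of_forall fun t => ?_)
    simp only [elimKernel]
    rw [mul_assoc, ← Real.exp_add]
    congr 2
    ring
  refine ⟨Filter.Eventually.of_forall hint, ?_⟩
  have h1 := ((integral_shifted_gaussian hc zero_lt_one).1).const_mul √(c / (2 * Real.pi))
  refine h1.congr (Filter.Eventually.of_forall fun u => ?_)
  have h2 := integral_elimKernel_right hc 0 u
  simp only [Complex.ofReal_zero, zero_mul, Complex.exp_zero, mul_one, zero_div, sub_zero,
    integral_complex_ofReal] at h2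
  simp only [Real.norm_of_nonneg (elimKernel_nonneg hc _ _)]
  have h3 := Complex.ofReal_injective h2
  rw [h3, mul_one]

/-- The kernel which describes the removed vertex, including the source term `a`, has
integral `1`. -/
theorem integral_elimKernel {c : ℝ} (hc : 0 < c) {a : ℝ} (ha : a ≤ 0) :
    ∫ p : ℝ × ℝ, (elimKernel c p.1 p.2 : ℂ) *
      Complex.exp (a * ((Real.exp p.1 - 1) + Complex.I * (Real.exp p.1 * p.2))) = 1 := by
  have hcont : Continuous fun p : ℝ × ℝ => (elimKernel c p.1 p.2 : ℂ) *
      Complex.exp (a * ((Real.exp p.1 - 1) + Complex.I * (Real.exp p.1 * p.2))) := by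
    unfold elimKernel
    fun_prop
  have hint : Integrable fun p : ℝ × ℝ => (elimKernel c p.1 p.2 : ℂ) *
      Complex.exp (a * ((Real.exp p.1 - 1) + Complex.I * (Real.exp p.1 * p.2))) := by
    -- for `a ≤ 0` the source term is bounded by `e^{-a}`
    refine ((integrable_elimKernel hc).const_mul (Real.exp (-a))).mono'
      hcont.aestronglyMeasurable (Filter.Eventually.of_forall fun p => ?_)
    rw [norm_mul, Complex.norm_real, Real.norm_of_nonneg (elimKernel_nonneg hc _ _), mul_comm,
      Complex.norm_exp]
    refine mul_le_mul_of_nonneg_right (Real.exp_le_exp.2 ?_) (elimKernel_nonneg hc _ _)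
    have : ((a : ℂ) * ((Real.exp p.1 - 1) + Complex.I * (Real.exp p.1 * p.2))).re =
        a * (Real.exp p.1 - 1) := by
      simp [Complex.exp_ofReal_re]
    rw [this]
    nlinarith [Real.exp_pos p.1]
  rw [Measure.volume_eq_prod] at hint ⊢
  rw [integral_prod _ hint]
  simp only [integral_elimKernel_right hc a]
  -- the assumption `a ≤ 0` is used again in order that the shift be real
  have hg : 0 < 1 - a / c := by
    have := div_nonpos_of_nonpos_of_nonneg ha hc.le
    linarith
  rw [integral_complex_ofReal, integral_const_mul, (integral_shifted_gaussian hc hg).2,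
    ← Real.sqrt_mul (by positivity)]
  rw [show c / (2 * Real.pi) * (2 * Real.pi / c) = 1 by field_simp, Real.sqrt_one,
    Complex.ofReal_one]

end OneVertex

/-! ### The elimination of a vertex as a map -/

section ElimMap

variable {V : Type*} [DecidableEq V] {s : Finset V} {a : V}

/-- The matrix of the random Schrödinger operator on `s`, in terms of the variables on
`insert a s`. -/
def elimH (b : Option ↥(insert a s) → Option ↥(insert a s) → ℝ) (u : ↥(insert a s) → ℝ) :
    Matrix s s ℝ :=
  Matrix.of (Hmat (contract b) fun i => realBeta b u (incl i))

/-- The Green's function applied to the weights of the edges at the removed vertex. -/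
def elimKappa (b : Option ↥(insert a s) → Option ↥(insert a s) → ℝ) (u : ↥(insert a s) → ℝ) :
    s → ℝ :=
  Matrix.mulVec (elimH b u)⁻¹ fun i => b (some (incl i)) (some newV)

/-- The variables `e^u` on `s`. -/
def elimExp (b : Option ↥(insert a s) → Option ↥(insert a s) → ℝ) (u : ↥(insert a s) → ℝ)
    (i : s) : ℝ :=
  Real.exp (u (incl i)) + elimKappa b u i * (1 - Real.exp (u newV))

/-- The variables `(u, s)` of the model on `s` as functions of those of the model on
`insert a s`. -/
def elimPts (b : Option ↥(insert a s) → Option ↥(insert a s) → ℝ) (p : Pts (insert a s)) : Pts s :=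
  (fun i => Real.log (elimExp b p.1 i),
    fun i => (Real.exp (p.1 (incl i)) * p.2 (incl i) -
      elimKappa b p.1 i * (Real.exp (p.1 newV) * p.2 newV)) * (elimExp b p.1 i)⁻¹)

variable {b₀ b : Option ↥(insert a s) → Option ↥(insert a s) → ℝ}

theorem elimH_apply (β : ↥(insert a s) → ℝ) (i j : s) :
    Hmat (contract b) (fun i => β (incl i)) i j = Hmat b β (incl i) (incl j) := by
  simp only [Hmat, contract]
  by_cases h : i = j
  · subst h; simp
  · rw [if_neg h, if_neg fun h' => h (incl_injective h')]

/-- The extension of a vector on `s` by a value at the new vertex. -/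
def joinV (x : s → ℝ) (r : ℝ) (k : ↥(insert a s)) : ℝ :=
  if h : (k : V) ∈ s then x ⟨k, h⟩ else r

@[simp] theorem joinV_incl (x : s → ℝ) (r : ℝ) (i : s) : (joinV x r (incl i : ↥(insert a s))) = x i :=
  dif_pos i.2

theorem joinV_newV (ha : a ∉ s) (x : s → ℝ) (r : ℝ) : joinV x r (newV : ↥(insert a s)) = r :=
  dif_neg ha

theorem joinV_eta (x : ↥(insert a s) → ℝ) :
    joinV (fun i : s => x (incl i)) (x newV) = x := by
  funext k
  unfold joinV
  split_ifs with h
  · rfl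
  · have : (k : V) = a := by
      rcases Finset.mem_insert.1 k.2 with h' | h'
      · exact h'
      · exact absurd h' h
    congr 1
    exact Subtype.ext this.symm

/-- The quadratic form on `insert a s` restricted to vectors which vanish at the new vertex. -/
theorem sum_elimH (ha : a ∉ s) (u : ↥(insert a s) → ℝ) (y : s → ℝ) :
    ∑ i, ∑ j, y i * elimH b u i j * y j =
      ∑ i, ∑ j, joinV y 0 i * Hmat b (realBeta b u) i j * joinV y 0 j := by
  rw [sum_insert_subtype ha]
  simp only [joinV_newV ha, zero_mul, Finset.sum_const_zero, zero_add]
  refine Finset.sum_congr rfl fun i _ => ?_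
  rw [sum_insert_subtype ha]
  simp only [joinV_newV ha, mul_zero, zero_add, joinV_incl, elimH, Matrix.of_apply, elimH_apply]

theorem IsNetwork.elimH_pos (h : IsNetwork b₀ b) (ha : a ∉ s) (u : ↥(insert a s) → ℝ) (y : s → ℝ)
    (hy : y ≠ 0) : 0 < ∑ i, ∑ j, y i * elimH b u i j * y j := by
  rw [sum_elimH ha]
  refine h.hmat_pos u _ fun h0 => hy ?_
  funext i
  have := congrFun h0 (incl i)
  rwa [joinV_incl] at this

theorem det_ne_zero_of_pos {ι : Type*} [Fintype ι] [DecidableEq ι] {H : Matrix ι ι ℝ}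
    (hpos : ∀ y : ι → ℝ, y ≠ 0 → 0 < ∑ i, ∑ j, y i * H i j * y j) : H.det ≠ 0 := by
  intro h0
  obtain ⟨v, hv, h⟩ := Matrix.exists_mulVec_eq_zero_iff.2 h0
  have h1 := hpos v hv
  have h2 : ∑ i, ∑ j, v i * H i j * v j = ∑ i, v i * (H.mulVec v) i := by
    refine Finset.sum_congr rfl fun i _ => ?_
    simp only [Matrix.mulVec, dotProduct, Finset.mul_sum, mul_assoc]
  rw [h2, h] at h1
  simp at h1

theorem sum_mul_inv_mulVec {ι : Type*} [Fintype ι] [DecidableEq ι] {H : Matrix ι ι ℝ}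
    (hd : H.det ≠ 0) (w : ι → ℝ) (i : ι) : ∑ j, H i j * (H⁻¹.mulVec w) j = w i := by
  have h : H.mulVec (H⁻¹.mulVec w) = w := by
    rw [Matrix.mulVec_mulVec, Matrix.mul_nonsing_inv _ (isUnit_iff_ne_zero.2 hd),
      Matrix.one_mulVec]
  exact congrFun h i

theorem eq_of_sum_mul_eq {ι : Type*} [Fintype ι] [DecidableEq ι] {H : Matrix ι ι ℝ}
    (hd : H.det ≠ 0) {x y : ι → ℝ} (h : ∀ i, ∑ j, H i j * x j = ∑ j, H i j * y j) : x = y := by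
  have h1 : H.mulVec x = H.mulVec y := funext h
  exact Matrix.mulVec_injective_of_isUnit
    ((Matrix.isUnit_iff_isUnit_det _).2 (isUnit_iff_ne_zero.2 hd)) h1

namespace IsNetwork

theorem elimH_det_ne (h : IsNetwork b₀ b) (ha : a ∉ s) (u : ↥(insert a s) → ℝ) :
    (elimH b u).det ≠ 0 := det_ne_zero_of_pos (h.elimH_pos ha u)

theorem sum_elimH_mul_kappa (h : IsNetwork b₀ b) (ha : a ∉ s) (u : ↥(insert a s) → ℝ) (i : s) :
    ∑ j, elimH b u i j * elimKappa b u j = b (some (incl i)) (some newV) :=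
  sum_mul_inv_mulVec (h.elimH_det_ne ha u) _ i

theorem elimH_off (h : IsNetwork b₀ b) (ha : a ∉ s) (u : ↥(insert a s) → ℝ) (i j : s)
    (hij : i ≠ j) : elimH b u i j ≤ 0 :=
  hmat_off (h.contract ha).b_nonneg (fun i => realBeta b u (incl i)) i j hij

theorem kappa_nonneg (h : IsNetwork b₀ b) (ha : a ∉ s) (u : ↥(insert a s) → ℝ) (i : s) :
    0 ≤ elimKappa b u i :=
  nonneg_of_mul_nonneg_of_posDef (h.elimH_pos ha u) (h.elimH_off ha u)
    (fun i => by rw [h.sum_elimH_mul_kappa ha]; exact h.b_nonneg _ _) i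

theorem kappa_mul_le (h : IsNetwork b₀ b) (ha : a ∉ s) (u : ↥(insert a s) → ℝ) (i : s) :
    elimKappa b u i * Real.exp (u newV) ≤ Real.exp (u (incl i)) := by
  have := nonneg_of_mul_nonneg_of_posDef (h.elimH_pos ha u) (h.elimH_off ha u)
    (y := fun i => Real.exp (u (incl i)) - elimKappa b u i * Real.exp (u newV)) (fun i => by
      simp only [mul_sub, Finset.sum_sub_distrib, ← mul_assoc, ← Finset.sum_mul]
      rw [h.sum_elimH_mul_kappa ha]
      have := sum_Hmat_incl_mul_exp ha b u i
      change ∑ j, elimH b u i j * Real.exp (u (incl j)) = _ at this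
      rw [this]
      have := h.b_nonneg (some (incl i)) none
      linarith) i
  linarith

theorem exp_le_elimExp (h : IsNetwork b₀ b) (ha : a ∉ s) (u : ↥(insert a s) → ℝ) (i : s) :
    Real.exp (u (incl i)) ≤ (1 + Real.exp (u newV)) * elimExp b u i := by
  have h1 := h.kappa_nonneg ha u i
  have h2 := h.kappa_mul_le ha u i
  have h3 := Real.exp_pos (u newV)
  rw [elimExp]
  nlinarith [mul_nonneg h3.le (sub_nonneg.2 h2)]

theorem elimExp_le (h : IsNetwork b₀ b) (ha : a ∉ s) (u : ↥(insert a s) → ℝ) (i : s) :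
    Real.exp (u newV) * elimExp b u i ≤ (1 + Real.exp (u newV)) * Real.exp (u (incl i)) := by
  have h1 := h.kappa_nonneg ha u i
  have h2 := h.kappa_mul_le ha u i
  have h3 := Real.exp_pos (u newV)
  rw [elimExp]
  nlinarith [mul_nonneg h3.le (sub_nonneg.2 h2), mul_nonneg h1 h3.le]

theorem elimExp_pos (h : IsNetwork b₀ b) (ha : a ∉ s) (u : ↥(insert a s) → ℝ) (i : s) :
    0 < elimExp b u i := by
  have h1 := h.exp_le_elimExp ha u i
  have h2 := Real.exp_pos (u (incl i))
  have h3 := Real.exp_pos (u newV)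
  by_contra h4
  nlinarith

theorem isElim (h : IsNetwork b₀ b) (ha : a ∉ s) (p : Pts (insert a s)) :
    IsElim b p (elimKappa b p.1) (elimPts b p) where
  kappa := h.sum_elimH_mul_kappa ha p.1
  exp i := by
    rw [elimPts, Real.exp_log (h.elimExp_pos ha p.1 i), elimExp]
  s i := by
    have := (h.elimExp_pos ha p.1 i).ne'
    simp only [elimPts]
    rw [Real.exp_log (h.elimExp_pos ha p.1 i)]
    field_simp

theorem elimKappa_eq (h : IsNetwork b₀ b) (ha : a ∉ s) (u : ↥(insert a s) → ℝ) {κ : s → ℝ}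
    (hκ : ∀ i, ∑ j, elimH b u i j * κ j = b (some (incl i)) (some newV)) : elimKappa b u = κ :=
  eq_of_sum_mul_eq (h.elimH_det_ne ha u) fun i => by rw [h.sum_elimH_mul_kappa ha, hκ]

/-- The coefficient of the kernel as a value of the quadratic form: a Schur complement. -/
theorem elimC_eq (h : IsNetwork b₀ b) (ha : a ∉ s) (u : ↥(insert a s) → ℝ) :
    elimC b u (elimKappa b u) = Real.exp (u newV) *
      ∑ i, ∑ j, joinV (elimKappa b u) 1 i * Hmat b (realBeta b u) i j *
        joinV (elimKappa b u) 1 j := by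
  rw [elimC]
  congr 1
  have h1 : ∀ i : s, ∑ j, Hmat b (realBeta b u) (incl i) j * joinV (elimKappa b u) 1 j = 0 := by
    intro i
    rw [sum_insert_subtype ha]
    simp only [joinV_newV ha, joinV_incl, mul_one, ← elimH_apply]
    have := h.sum_elimH_mul_kappa ha u i
    simp only [elimH, Matrix.of_apply] at this
    rw [this, Hmat, if_neg (incl_ne_newV ha i)]
    ring
  have h2 : ∑ j, Hmat b (realBeta b u) newV j * joinV (elimKappa b u) 1 j =
      2 * realBeta b u newV - ∑ i, b (some (incl i)) (some newV) * elimKappa b u i := by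
    rw [sum_insert_subtype ha]
    simp only [joinV_newV ha, joinV_incl, mul_one, Hmat, if_true, h.diag, sub_zero]
    rw [sub_eq_add_neg, ← Finset.sum_neg_distrib]
    congr 1
    refine Finset.sum_congr rfl fun i _ => ?_
    rw [if_neg (incl_ne_newV ha i).symm, h.symm]
    ring
  simp only [mul_assoc, ← Finset.mul_sum]
  rw [sum_insert_subtype ha]
  simp only [h1, h2, joinV_newV ha]
  simp

/-- The coefficient of the kernel is positive, as a value of a positive definite form. -/
theorem elimC_pos (h : IsNetwork b₀ b) (ha : a ∉ s) (u : ↥(insert a s) → ℝ) :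
    0 < elimC b u (elimKappa b u) := by
  rw [h.elimC_eq ha]
  refine mul_pos (Real.exp_pos _) (h.hmat_pos u _ fun h0 => ?_)
  have := congrFun h0 newV
  rw [joinV_newV ha] at this
  exact one_ne_zero this

/-- The variables at the new vertex can be changed without changing those on `s`. -/
theorem exists_elimExp_eq (h : IsNetwork b₀ b) (ha : a ∉ s) (u : s → ℝ) (r : ℝ) :
    ∃ u' : ↥(insert a s) → ℝ, u' newV = r ∧ (∀ i, realBeta b u' (incl i) =
      realBeta (SusySigma.contract b) u i) ∧ ∀ i, elimExp b u' i = Real.exp (u i) := by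
  have hc := h.contract ha
  set H : Matrix s s ℝ := Matrix.of (Hmat (SusySigma.contract b) (realBeta (SusySigma.contract b) u))
    with hH
  have hpos : ∀ y : s → ℝ, y ≠ 0 → 0 < ∑ i, ∑ j, y i * H i j * y j := hc.hmat_pos u
  have hoff : ∀ i j, i ≠ j → H i j ≤ 0 := hmat_off hc.b_nonneg _
  have hd := det_ne_zero_of_pos hpos
  set κ := H⁻¹.mulVec (fun i => b (some (incl i)) (some newV)) with hκ
  have hκ1 : ∀ i, ∑ j, H i j * κ j = b (some (incl i)) (some newV) := sum_mul_inv_mulVec hd _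
  have hp1 : ∀ i, ∑ j, H i j * Real.exp (u j) =
      b (some (incl i)) none + b (some (incl i)) (some newV) := sum_Hmat_mul_exp _ u
  have hκ0 : ∀ i, 0 ≤ κ i := nonneg_of_mul_nonneg_of_posDef hpos hoff
    fun i => by rw [hκ1]; exact h.b_nonneg _ _
  -- `κ ≤ e^u` entrywise, because `H (e^u - κ)` is the nonnegative vector of weights to `δ`
  have hm0 : ∀ i, 0 ≤ Real.exp (u i) - κ i := nonneg_of_mul_nonneg_of_posDef hpos hoff
    (y := fun i => Real.exp (u i) - κ i)
    fun i => by
      simp only [mul_sub, Finset.sum_sub_distrib, hκ1, hp1]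
      have := h.b_nonneg (some (incl i)) none
      linarith
  have hP : ∀ i, 0 < Real.exp (u i) - κ i * (1 - Real.exp r) := by
    intro i
    have h1 := hκ0 i
    have h2 := hm0 i
    have h3 := Real.exp_pos (u i)
    have h4 := Real.exp_pos r
    rcases h1.eq_or_lt with h5 | h5
    · rw [← h5]; linarith
    · nlinarith [mul_pos h5 h4]
  -- solve the defining equation of the elimination map for `e^{u_i}`
  set u' : ↥(insert a s) → ℝ :=
    joinV (fun i => Real.log (Real.exp (u i) - κ i * (1 - Real.exp r))) r with hu'
  have hn : u' newV = r := joinV_newV ha _ _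
  have hi : ∀ i : s, Real.exp (u' (incl i)) = Real.exp (u i) - κ i * (1 - Real.exp r) := by
    intro i
    rw [hu', joinV_incl, Real.exp_log (hP i)]
  have hβ : ∀ i, realBeta b u' (incl i) = realBeta (SusySigma.contract b) u i := by
    intro i
    have h1 := two_mul_realBeta_mul_exp b u' (incl i)
    rw [Fintype.sum_option, sum_insert_subtype ha] at h1
    simp only [ext0_none, ext0_some, Real.exp_zero, one_mul, hn, hi] at h1
    have h2 : ∑ j, H i j * (Real.exp (u j) - κ j * (1 - Real.exp r)) =
        b (some (incl i)) none + b (some (incl i)) (some newV) * Real.exp r := by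
      simp only [mul_sub, ← mul_assoc, Finset.sum_sub_distrib, ← Finset.sum_mul, hκ1, hp1, mul_one]
      ring
    have h3 := sum_Hmat_mul (SusySigma.contract b) (realBeta (SusySigma.contract b) u) i
      (fun j => Real.exp (u j) - κ j * (1 - Real.exp r))
    change ∑ j, H i j * (Real.exp (u j) - κ j * (1 - Real.exp r)) = _ at h3
    rw [h2] at h3
    simp only [SusySigma.contract] at h3
    have h4 : ∑ x : s, (Real.exp (u x) - κ x * (1 - Real.exp r)) * b (some (incl i)) (some (incl x)) =
        ∑ x : s, b (some (incl i)) (some (incl x)) * (Real.exp (u x) - κ x * (1 - Real.exp r)) :=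
      Finset.sum_congr rfl fun x _ => mul_comm _ _
    rw [h4] at h1
    have h5 : (realBeta b u' (incl i) - realBeta (SusySigma.contract b) u i) *
        (Real.exp (u i) - κ i * (1 - Real.exp r)) = 0 := by linarith
    rcases mul_eq_zero.1 h5 with h6 | h6
    · linarith
    · exact absurd h6 (hP i).ne'
  have hκ' : elimKappa b u' = κ := by
    refine h.elimKappa_eq ha u' fun i => ?_
    have : elimH b u' = H := by
      rw [elimH, hH, funext hβ]
    rw [this, hκ1]
  refine ⟨u', hn, hβ, fun i => ?_⟩
  rw [elimExp, hi, hn, hκ']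
  ring

end IsNetwork

end ElimMap

/-! ### Polynomial bounds for the elimination map -/

section ElimTemperate

variable {V : Type*} [DecidableEq V] {s : Finset V} {a : V}
  {B : Type*} [NormedAddCommGroup B] [NormedSpace ℝ B]

/-- The inverse of `sinhPts`. -/
def arsinhPts (x : Pts s) : Pts s := (fun i => Real.arsinh (x.1 i), x.2)

@[simp] theorem sinhPts_arsinhPts (x : Pts s) : sinhPts (arsinhPts x) = x := by
  simp [sinhPts, arsinhPts]

@[simp] theorem arsinhPts_sinhPts (x : Pts s) : arsinhPts (sinhPts x) = x := by
  simp [sinhPts, arsinhPts]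

theorem temperate_coord_fst (i : s) : HasTemperateGrowth fun z : B × Pts s => z.2.1 i :=
  ((ContinuousLinearMap.proj i).comp ((ContinuousLinearMap.fst ℝ (s → ℝ) (s → ℝ)).comp
    (ContinuousLinearMap.snd ℝ B (Pts s)))).hasTemperateGrowth

theorem temperate_coord_snd (i : s) : HasTemperateGrowth fun z : B × Pts s => z.2.2 i :=
  ((ContinuousLinearMap.proj i).comp ((ContinuousLinearMap.snd ℝ (s → ℝ) (s → ℝ)).comp
    (ContinuousLinearMap.snd ℝ B (Pts s)))).hasTemperateGrowth

theorem temperate_fst : HasTemperateGrowth fun z : B × Pts s => z.1 :=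
  (ContinuousLinearMap.fst ℝ B (Pts s)).hasTemperateGrowth

theorem temperate_exp_arsinh (i : s) :
    HasTemperateGrowth fun z : B × Pts s => Real.exp ((arsinhPts z.2).1 i) := by
  have h := temperate_coord_fst (B := B) i
  have h2 : HasTemperateGrowth fun z : B × Pts s => √(1 + z.2.1 i ^ 2) :=
    temperate_sqrt (by fun_prop) fun z => by nlinarith [sq_nonneg (z.2.1 i)]
  simp only [arsinhPts, Real.exp_arsinh]
  fun_prop

theorem temperate_exp_neg_arsinh (i : s) :
    HasTemperateGrowth fun z : B × Pts s => Real.exp (-(arsinhPts z.2).1 i) := by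
  have h := temperate_coord_fst (B := B) i
  have h2 : HasTemperateGrowth fun z : B × Pts s => √(1 + z.2.1 i ^ 2) :=
    temperate_sqrt (by fun_prop) fun z => by nlinarith [sq_nonneg (z.2.1 i)]
  simp only [arsinhPts, ← Real.arsinh_neg, Real.exp_arsinh, neg_sq]
  fun_prop

theorem temperate_exp_ext0 (i : Option s) :
    HasTemperateGrowth fun z : B × Pts s => Real.exp (ext0 (arsinhPts z.2).1 i) := by
  cases i with
  | none => simp
  | some i => exact temperate_exp_arsinh i

theorem temperate_det {D ι : Type*} [NormedAddCommGroup D] [NormedSpace ℝ D] [Fintype ι]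
    [DecidableEq ι] {H : D → Matrix ι ι ℝ} (h : ∀ i j, HasTemperateGrowth fun z => H z i j) :
    HasTemperateGrowth fun z => (H z).det := by
  simp only [Matrix.det_apply]
  refine HasTemperateGrowth.sum fun σ _ => ?_
  have h1 := temperate_prod (s := Finset.univ) (f := fun i z => H z (σ i) i) fun i _ => h (σ i) i
  have h2 := (HasTemperateGrowth.const (E := D) (((Equiv.Perm.sign σ : ℤ) : ℝ))).fun_mul h1
  refine (congrArg HasTemperateGrowth (funext fun z => ?_)).mp h2
  rw [Units.smul_def, zsmul_eq_mul]

theorem temperate_adjugate {D ι : Type*} [NormedAddCommGroup D] [NormedSpace ℝ D] [Fintype ι]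
    [DecidableEq ι] {H : D → Matrix ι ι ℝ} (h : ∀ i j, HasTemperateGrowth fun z => H z i j)
    (i j : ι) : HasTemperateGrowth fun z => (H z).adjugate i j := by
  simp only [Matrix.adjugate_apply]
  refine temperate_det fun k l => ?_
  by_cases hk : k = j
  · subst hk
    simp
  · simp only [Matrix.updateRow_ne hk]
    exact h k l

variable {b₀ : Option ↥(insert a s) → Option ↥(insert a s) → ℝ}
  {b : B → Option ↥(insert a s) → Option ↥(insert a s) → ℝ}

theorem temperate_weight (hb : ∀ i j, HasTemperateGrowth fun t => b t i j)
    (i j : Option ↥(insert a s)) :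
    HasTemperateGrowth fun z : B × Pts (insert a s) => b z.1 i j :=
  (hb i j).comp temperate_fst

theorem temperate_realBeta (hb : ∀ i j, HasTemperateGrowth fun t => b t i j) (i : ↥(insert a s)) :
    HasTemperateGrowth fun z : B × Pts (insert a s) => realBeta (b z.1) (arsinhPts z.2).1 i := by
  have h1 := temperate_exp_neg_arsinh (B := B) i
  have h2 := fun j => temperate_exp_ext0 (B := B) (s := insert a s) j
  have h3 := fun j => temperate_weight hb (some i) j
  simp only [realBeta, sub_eq_add_neg, Real.exp_add]
  refine (HasTemperateGrowth.const _).fun_mul (HasTemperateGrowth.sum fun j _ => ?_)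
  exact (((h2 j).fun_mul h1).fun_mul (h3 j))

theorem temperate_elimH (hb : ∀ i j, HasTemperateGrowth fun t => b t i j) (i j : s) :
    HasTemperateGrowth fun z : B × Pts (insert a s) => elimH (b z.1) (arsinhPts z.2).1 i j := by
  have h1 := temperate_weight hb (some (incl i)) (some (incl j))
  have h2 := temperate_realBeta hb (incl i)
  simp only [elimH, Matrix.of_apply, Hmat, contract]
  by_cases h : i = j
  · simp only [h, if_true] at h1 h2 ⊢
    exact ((HasTemperateGrowth.const 2).fun_mul h2).fun_sub h1
  · simp only [h, if_false]
    exact (HasTemperateGrowth.const 0).fun_sub h1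

theorem exp_abs_le (x : ℝ) : Real.exp |x| ≤ Real.exp x + Real.exp (-x) := by
  rcases abs_choice x with h | h <;> rw [h]
  · linarith [Real.exp_pos (-x)]
  · linarith [Real.exp_pos x]

/-- A bound for the size of the variables `e^{±u}`. -/
def expSize (u : s → ℝ) : ℝ := 1 + ∑ i, (Real.exp (u i) + Real.exp (-u i))

theorem one_le_expSize (u : s → ℝ) : 1 ≤ expSize u :=
  le_add_of_nonneg_right (Finset.sum_nonneg fun _ _ => by positivity)

theorem exp_abs_le_expSize (u : s → ℝ) (i : s) : Real.exp |u i| ≤ expSize u := by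
  have h : Real.exp (u i) + Real.exp (-u i) ≤ ∑ i, (Real.exp (u i) + Real.exp (-u i)) :=
    Finset.single_le_sum (f := fun i => Real.exp (u i) + Real.exp (-u i))
      (fun _ _ => by positivity) (Finset.mem_univ i)
  rw [expSize]
  linarith [exp_abs_le (u i)]

theorem temperate_expSize :
    HasTemperateGrowth fun z : B × Pts s => expSize (arsinhPts z.2).1 := by
  have h1 := fun i => temperate_exp_arsinh (B := B) (s := s) i
  have h2 := fun i => temperate_exp_neg_arsinh (B := B) (s := s) i
  simp only [expSize]
  exact (HasTemperateGrowth.const 1).fun_add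
    (HasTemperateGrowth.sum fun i _ => (h1 i).fun_add (h2 i))

theorem elimH_isHermitian {b : Option ↥(insert a s) → Option ↥(insert a s) → ℝ}
    (hs : ∀ i j, b i j = b j i) (u : ↥(insert a s) → ℝ) : (elimH b u).IsHermitian := by
  ext i j
  simp only [Matrix.conjTranspose_apply, star_trivial, elimH, Matrix.of_apply]
  exact Hmat_symm (contract_symm hs) _ _ _

theorem exists_le_det (h : IsNetwork b₀ b₀) (ha : a ∉ s) : ∃ C : ℝ, 0 < C ∧
    ∀ b : Option ↥(insert a s) → Option ↥(insert a s) → ℝ, IsNetwork b₀ b → ∀ u,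
      (C * (expSize u)⁻¹ ^ 4) ^ Fintype.card s ≤ (elimH b u).det := by
  obtain ⟨C, hC, hco⟩ := exists_coercive h.nonneg h.conn
  refine ⟨C, hC, fun b hb u => pow_le_det_of_coercive (elimH_isHermitian hb.symm u)
    (by have := one_le_expSize u; positivity) fun y => ?_⟩
  rw [sum_elimH ha]
  refine le_trans (le_of_eq ?_) (hco b hb u _ (one_le_expSize u) (exp_abs_le_expSize u) (joinV y 0))
  rw [sum_insert_subtype ha]
  simp [joinV_newV ha]

theorem temperate_inv_det (ha : a ∉ s) (h₀ : IsNetwork b₀ b₀)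
    (hb : ∀ i j, HasTemperateGrowth fun t => b t i j) (hn : ∀ t, IsNetwork b₀ (b t)) :
    HasTemperateGrowth fun z : B × Pts (insert a s) =>
      ((elimH (b z.1) (arsinhPts z.2).1).det)⁻¹ := by
  obtain ⟨C, hC, hdet⟩ := exists_le_det h₀ ha
  have h1 : HasTemperateGrowth fun z : B × Pts (insert a s) =>
      (C⁻¹ * (expSize (arsinhPts z.2).1) ^ 4) ^ Fintype.card s :=
    ((HasTemperateGrowth.const C⁻¹).fun_mul (temperate_expSize.fun_pow 4)).fun_pow _
  refine temperate_inv (temperate_det (temperate_elimH hb)) h1 fun z => ?_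
  have h2 := hdet _ (hn z.1) (arsinhPts z.2).1
  have h3 := one_le_expSize (arsinhPts z.2).1
  calc (1 : ℝ) = (C * (expSize (arsinhPts z.2).1)⁻¹ ^ 4) ^ Fintype.card s *
        (C⁻¹ * (expSize (arsinhPts z.2).1) ^ 4) ^ Fintype.card s := by
        rw [← mul_pow]
        have : C * (expSize (arsinhPts z.2).1)⁻¹ ^ 4 * (C⁻¹ * expSize (arsinhPts z.2).1 ^ 4) = 1 := by
          field_simp
        rw [this, one_pow]
    _ ≤ _ := by
        gcongr

theorem temperate_elimKappa (ha : a ∉ s) (h₀ : IsNetwork b₀ b₀)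
    (hb : ∀ i j, HasTemperateGrowth fun t => b t i j) (hn : ∀ t, IsNetwork b₀ (b t)) (i : s) :
    HasTemperateGrowth fun z : B × Pts (insert a s) =>
      elimKappa (b z.1) (arsinhPts z.2).1 i := by
  have h1 := temperate_inv_det ha h₀ hb hn
  have h2 := fun j => temperate_adjugate (temperate_elimH hb) i j
  have h3 := fun j : s => temperate_weight hb (some (incl j)) (some newV)
  simp only [elimKappa, Matrix.inv_def, Ring.inverse_eq_inv', Matrix.mulVec, dotProduct,
    Matrix.smul_apply, smul_eq_mul]
  exact HasTemperateGrowth.sum fun j _ => (h1.fun_mul (h2 j)).fun_mul (h3 j)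

theorem temperate_elimExp (ha : a ∉ s) (h₀ : IsNetwork b₀ b₀)
    (hb : ∀ i j, HasTemperateGrowth fun t => b t i j) (hn : ∀ t, IsNetwork b₀ (b t)) (i : s) :
    HasTemperateGrowth fun z : B × Pts (insert a s) =>
      elimExp (b z.1) (arsinhPts z.2).1 i := by
  have h1 := temperate_elimKappa ha h₀ hb hn i
  have h2 := temperate_exp_arsinh (B := B) (s := insert a s) (incl i)
  have h3 := temperate_exp_arsinh (B := B) (s := insert a s) newV
  exact h2.fun_add (h1.fun_mul ((HasTemperateGrowth.const 1).fun_sub h3))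

theorem temperate_inv_elimExp (ha : a ∉ s) (h₀ : IsNetwork b₀ b₀)
    (hb : ∀ i j, HasTemperateGrowth fun t => b t i j) (hn : ∀ t, IsNetwork b₀ (b t)) (i : s) :
    HasTemperateGrowth fun z : B × Pts (insert a s) =>
      (elimExp (b z.1) (arsinhPts z.2).1 i)⁻¹ := by
  have h2 := temperate_exp_neg_arsinh (B := B) (s := insert a s) (incl i)
  have h3 := temperate_exp_arsinh (B := B) (s := insert a s) newV
  refine temperate_inv (temperate_elimExp ha h₀ hb hn i)
    (h2.fun_mul ((HasTemperateGrowth.const 1).fun_add h3)) fun z => ?_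
  have h4 := (hn z.1).exp_le_elimExp ha (arsinhPts z.2).1 i
  have h5 := Real.exp_pos (-(arsinhPts z.2).1 (incl i))
  have h6 : Real.exp ((arsinhPts z.2).1 (incl i)) * Real.exp (-(arsinhPts z.2).1 (incl i)) = 1 := by
    rw [← Real.exp_add]; simp
  nlinarith [mul_le_mul_of_nonneg_right h4 h5.le]

theorem temperate_elimC (ha : a ∉ s) (h₀ : IsNetwork b₀ b₀)
    (hb : ∀ i j, HasTemperateGrowth fun t => b t i j) (hn : ∀ t, IsNetwork b₀ (b t)) :
    HasTemperateGrowth fun z : B × Pts (insert a s) =>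
      elimC (b z.1) (arsinhPts z.2).1 (elimKappa (b z.1) (arsinhPts z.2).1) := by
  have h1 := fun i => temperate_elimKappa ha h₀ hb hn i
  have h2 := temperate_realBeta hb newV
  have h3 := temperate_exp_arsinh (B := B) (s := insert a s) newV
  have h4 := fun j : s => temperate_weight hb (some (incl j)) (some newV)
  exact h3.fun_mul (((HasTemperateGrowth.const 2).fun_mul h2).fun_sub
    (HasTemperateGrowth.sum fun i _ => (h4 i).fun_mul (h1 i)))

theorem sinh_log {x : ℝ} (hx : 0 < x) : Real.sinh (Real.log x) = (x - x⁻¹) / 2 := by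
  rw [Real.sinh_eq, Real.exp_neg, Real.exp_log hx]

theorem temperate_elimPts (ha : a ∉ s) (h₀ : IsNetwork b₀ b₀)
    (hb : ∀ i j, HasTemperateGrowth fun t => b t i j) (hn : ∀ t, IsNetwork b₀ (b t)) :
    HasTemperateGrowth fun z : B × Pts (insert a s) =>
      sinhPts (elimPts (b z.1) (arsinhPts z.2)) := by
  have h1 := fun i => temperate_elimKappa ha h₀ hb hn i
  have h2 := fun i => temperate_elimExp ha h₀ hb hn i
  have h3 := fun i => temperate_inv_elimExp ha h₀ hb hn i
  have h4 := fun i => temperate_exp_arsinh (B := B) (s := insert a s) i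
  have h5 := fun i => temperate_coord_snd (B := B) (s := insert a s) i
  refine temperate_prodMk (temperate_pi fun i => ?_) (temperate_pi fun i => ?_)
  · have e : (fun z : B × Pts (insert a s) =>
        Real.sinh (Real.log (elimExp (b z.1) (arsinhPts z.2).1 i))) =
        fun z => (1 / 2) * (elimExp (b z.1) (arsinhPts z.2).1 i -
          (elimExp (b z.1) (arsinhPts z.2).1 i)⁻¹) := by
      funext z
      rw [sinh_log ((hn z.1).elimExp_pos ha _ i)]
      ring
    change HasTemperateGrowth fun z : B × Pts (insert a s) =>
        Real.sinh (Real.log (elimExp (b z.1) (arsinhPts z.2).1 i))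
    rw [e]
    exact (HasTemperateGrowth.const _).fun_mul ((h2 i).fun_sub (h3 i))
  · exact ((((h4 (incl i)).fun_mul (h5 (incl i))).fun_sub
      ((h1 i).fun_mul ((h4 newV).fun_mul (h5 newV)))).fun_mul (h3 i))

/-- The exponent of the kernel of the removed vertex. -/
def elimEnergy (c u t : ℝ) : ℝ := c * (Real.cosh u - 1) + c * Real.exp u * t ^ 2 / 2

theorem elimKernel_eq (c u t : ℝ) :
    elimKernel c u t = c / (2 * Real.pi) * Real.exp (-elimEnergy c u t) := rfl

theorem elimEnergy_nonneg {c : ℝ} (hc : 0 < c) (u t : ℝ) : 0 ≤ elimEnergy c u t := by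
  have h := Real.one_le_cosh u
  have : 0 ≤ c * (Real.cosh u - 1) := mul_nonneg hc.le (by linarith)
  rw [elimEnergy]
  positivity

theorem temperate_elimEnergy (ha : a ∉ s) (h₀ : IsNetwork b₀ b₀)
    (hb : ∀ i j, HasTemperateGrowth fun t => b t i j) (hn : ∀ t, IsNetwork b₀ (b t)) :
    HasTemperateGrowth fun z : B × Pts (insert a s) =>
      elimEnergy (elimC (b z.1) (arsinhPts z.2).1 (elimKappa (b z.1) (arsinhPts z.2).1))
        ((arsinhPts z.2).1 newV) ((arsinhPts z.2).2 newV) := by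
  have h1 := temperate_elimC ha h₀ hb hn
  have h2 := temperate_exp_arsinh (B := B) (s := insert a s) newV
  have h3 := temperate_exp_neg_arsinh (B := B) (s := insert a s) newV
  have h4 : HasTemperateGrowth fun z : B × Pts (insert a s) => (arsinhPts z.2).2 newV :=
    temperate_coord_snd (B := B) (s := insert a s) newV
  simp only [elimEnergy, Real.cosh_eq, div_eq_mul_inv]
  fun_prop

/-- The size of the variables of the model on `s` and the exponent of the kernel control the
size of the variables of the model on `insert a s`. -/
theorem elim_control_aux {L Y p c u r S S' P κ : ℝ} (hL : 1 ≤ L) (hY : 1 ≤ Y)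
    (hc : Y⁻¹ ^ 4 ≤ L * c) (hq : elimEnergy c u r ≤ Y) (hp0 : 0 < p) (hp : p ≤ Y) (hp' : p⁻¹ ≤ Y)
    (hS : |S| ≤ Y) (hP0 : 0 < P) (h1 : P ≤ (1 + Real.exp u) * p)
    (h2 : Real.exp u * p ≤ (1 + Real.exp u) * P) (hκ0 : 0 ≤ κ) (hκ : κ * Real.exp u ≤ P)
    (hS' : P * S' = p * S + κ * (Real.exp u * r)) :
    |Real.sinh u| ≤ 4 * L * Y ^ 5 ∧ |r| ≤ 9 * L ^ 2 * Y ^ 10 ∧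
      P ≤ 5 * L * Y ^ 6 ∧ P⁻¹ ≤ 5 * L * Y ^ 6 ∧ |S'| ≤ 14 * L ^ 2 * Y ^ 10 := by
  have hY0 : 0 < Y := by linarith
  have hL0 : 0 < L := by linarith
  have hc0 : 0 < c := by
    by_contra h
    have : 0 < Y⁻¹ ^ 4 := by positivity
    nlinarith
  have hx := Real.exp_pos u
  have hch := Real.one_le_cosh u
  have hcY : 1 ≤ L * Y ^ 4 * c := by
    have : Y⁻¹ ^ 4 * Y ^ 4 = 1 := by rw [← mul_pow, inv_mul_cancel₀ hY0.ne', one_pow]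
    nlinarith [mul_le_mul_of_nonneg_right hc (by positivity : 0 ≤ Y ^ 4)]
  rw [elimEnergy] at hq
  have hterm : 0 ≤ c * Real.exp u * r ^ 2 / 2 := by positivity
  have hterm' : 0 ≤ c * (Real.cosh u - 1) := mul_nonneg hc0.le (by linarith)
  have hYp : ∀ m n : ℕ, m ≤ n → Y ^ m ≤ Y ^ n := fun m n h => pow_le_pow_right₀ hY h
  have hLY : 1 ≤ L * Y ^ 5 := one_le_mul_of_one_le_of_one_le hL (one_le_pow₀ hY)
  -- the exponent controls `cosh u`, hence `e^u` and `e^{-u}`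
  have hcosh : Real.cosh u ≤ 2 * L * Y ^ 5 := by
    have h3 : Real.cosh u - 1 ≤ L * Y ^ 4 * Y := by
      calc Real.cosh u - 1 ≤ (L * Y ^ 4 * c) * (Real.cosh u - 1) :=
            le_mul_of_one_le_left (by linarith) hcY
        _ = L * Y ^ 4 * (c * (Real.cosh u - 1)) := by ring
        _ ≤ L * Y ^ 4 * Y := by gcongr; linarith
    nlinarith
  have hexp : Real.exp u ≤ 4 * L * Y ^ 5 := by
    have := Real.cosh_eq u
    have := Real.exp_pos (-u)
    nlinarith
  have hexp' : Real.exp (-u) ≤ 4 * L * Y ^ 5 := by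
    have := Real.cosh_eq u
    nlinarith
  have hee : Real.exp u * Real.exp (-u) = 1 := by rw [← Real.exp_add]; simp
  have hsinh : |Real.sinh u| ≤ 4 * L * Y ^ 5 := by
    rw [Real.sinh_eq, abs_le]
    constructor <;> nlinarith [Real.exp_pos (-u)]
  -- and then `r`
  have hr2 : r ^ 2 ≤ 8 * L ^ 2 * Y ^ 10 := by
    have h3 : c * Real.exp u * r ^ 2 ≤ 2 * Y := by linarith
    calc r ^ 2 ≤ (L * Y ^ 4 * c) * r ^ 2 := le_mul_of_one_le_left (sq_nonneg r) hcY
      _ = L * Y ^ 4 * Real.exp (-u) * (c * Real.exp u * r ^ 2) := by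
        linear_combination (-(L * Y ^ 4 * c * r ^ 2)) * hee
      _ ≤ L * Y ^ 4 * (4 * L * Y ^ 5) * (2 * Y) := by gcongr
      _ = _ := by ring
  have hr : |r| ≤ 9 * L ^ 2 * Y ^ 10 := by
    have h3 : |r| ≤ 1 + r ^ 2 := by
      have := sq_abs r
      nlinarith [sq_nonneg (|r| - 1)]
    have h4 : 1 ≤ L ^ 2 * Y ^ 10 := by
      calc (1 : ℝ) ≤ (L * Y ^ 5) ^ 2 := one_le_pow₀ hLY
        _ = _ := by ring
    linarith
  -- the remaining variables differ by bounded factors `1 + e^{±u}`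
  have hPu : P ≤ 5 * L * Y ^ 6 := by
    calc P ≤ (1 + Real.exp u) * p := h1
      _ ≤ (L * Y ^ 5 + 4 * L * Y ^ 5) * Y := by gcongr
      _ = _ := by ring
  have hpP : p ≤ (1 + Real.exp (-u)) * P := by
    have := mul_le_mul_of_nonneg_left h2 (Real.exp_pos (-u)).le
    have e1 : Real.exp (-u) * (Real.exp u * p) = p := by
      rw [← mul_assoc, mul_comm (Real.exp (-u)), hee, one_mul]
    have e2 : Real.exp (-u) * ((1 + Real.exp u) * P) = (1 + Real.exp (-u)) * P := by
      linear_combination P * hee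
    linarith
  have hPi : P⁻¹ ≤ 5 * L * Y ^ 6 := by
    have h3 : P⁻¹ ≤ (1 + Real.exp (-u)) * p⁻¹ := by
      rw [← div_eq_mul_inv, le_div_iff₀ hp0, ← div_eq_inv_mul, div_le_iff₀ hP0]
      exact hpP
    calc P⁻¹ ≤ (1 + Real.exp (-u)) * p⁻¹ := h3
      _ ≤ (L * Y ^ 5 + 4 * L * Y ^ 5) * Y := by
        gcongr
      _ = _ := by ring
  refine ⟨hsinh, hr, hPu, hPi, ?_⟩
  have h5 : |S'| ≤ (1 + Real.exp (-u)) * |S| + |r| := by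
    have h6 : P * |S'| ≤ P * ((1 + Real.exp (-u)) * |S| + |r|) := by
      rw [← abs_of_pos hP0, ← abs_mul, hS', abs_of_pos hP0]
      calc |p * S + κ * (Real.exp u * r)| ≤ |p * S| + |κ * (Real.exp u * r)| := abs_add_le _ _
        _ = p * |S| + (κ * Real.exp u) * |r| := by
          rw [abs_mul, abs_mul, abs_mul, abs_of_pos hp0, abs_of_nonneg hκ0, abs_of_pos hx]
          ring
        _ ≤ ((1 + Real.exp (-u)) * P) * |S| + P * |r| := by gcongr
        _ = _ := by ring
    exact le_of_mul_le_mul_left h6 hP0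
  calc |S'| ≤ (1 + Real.exp (-u)) * |S| + |r| := h5
    _ ≤ (L * Y ^ 5 + 4 * L * Y ^ 5) * Y + 9 * L ^ 2 * Y ^ 10 := by gcongr
    _ ≤ 14 * L ^ 2 * Y ^ 10 := by
      have : L * Y ^ 6 ≤ L ^ 2 * Y ^ 10 := by
        have h7 : L ≤ L ^ 2 := by nlinarith
        have h8 : Y ^ 6 ≤ Y ^ 10 := hYp 6 10 (by norm_num)
        gcongr
      nlinarith

end ElimTemperate

section ElimSchwartz

variable {V : Type*} [DecidableEq V] {s : Finset V} {a : V}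

theorem eq_newV_or_incl (k : ↥(insert a s)) : k = newV ∨ ∃ i : s, k = incl i := by
  obtain ⟨k, hk⟩ := k
  rcases Finset.mem_insert.1 hk with rfl | hk'
  · exact Or.inl rfl
  · exact Or.inr ⟨⟨k, hk'⟩, rfl⟩

section Real

variable {b₀ b : Option ↥(insert a s) → Option ↥(insert a s) → ℝ}

theorem realBeta_joinV_zero (ha : a ∉ s) (b : Option ↥(insert a s) → Option ↥(insert a s) → ℝ)
    (u : s → ℝ) (i : s) : realBeta b (joinV u 0) (incl i) = realBeta (contract b) u i := by
  simp only [realBeta, Fintype.sum_option, sum_insert_subtype ha, ext0_some, ext0_none, contract,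
    joinV_incl, joinV_newV ha]
  ring

theorem elimC_eq_sum (ha : a ∉ s) (hs : ∀ i j, b i j = b j i) (h0 : ∀ i, b i i = 0)
    (u : ↥(insert a s) → ℝ) (κ : s → ℝ) :
    elimC b u κ = b (some newV) none + ∑ i, b (some (incl i)) (some newV) *
      (Real.exp (u (incl i)) - κ i * Real.exp (u newV)) := by
  have h := two_mul_realBeta_mul_exp b u newV
  rw [Fintype.sum_option, sum_insert_subtype ha] at h
  simp only [ext0_none, ext0_some, Real.exp_zero, one_mul, h0, mul_zero, zero_add] at h
  rw [elimC, mul_sub, mul_comm, h, Finset.mul_sum, add_sub_assoc, ← Finset.sum_sub_distrib]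
  congr 1
  refine Finset.sum_congr rfl fun i _ => ?_
  rw [hs (some newV) (some (incl i))]
  ring

namespace IsNetwork

theorem elimH_joinV (h : IsNetwork b₀ b) (ha : a ∉ s) (p : Pts (insert a s)) :
    elimH b (joinV (elimPts b p).1 0) = elimH b p.1 := by
  rw [elimH, elimH]
  congr 2
  funext i
  rw [realBeta_joinV_zero ha, (h.isElim ha p).realBeta_eq ha]

theorem elimKappa_joinV (h : IsNetwork b₀ b) (ha : a ∉ s) (p : Pts (insert a s)) :
    elimKappa b (joinV (elimPts b p).1 0) = elimKappa b p.1 := by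
  rw [elimKappa, elimKappa, h.elimH_joinV ha]

/-- The coefficient of the kernel only depends on the eliminated variables; `0` is an arbitrary
value of `u` at the removed vertex. -/
theorem elimC_joinV (h : IsNetwork b₀ b) (ha : a ∉ s) (p : Pts (insert a s)) :
    elimC b (joinV (elimPts b p).1 0) (elimKappa b (joinV (elimPts b p).1 0)) =
      elimC b p.1 (elimKappa b p.1) := by
  rw [elimC_eq_sum ha h.symm h.diag, elimC_eq_sum ha h.symm h.diag, h.elimKappa_joinV ha]
  congr 1
  refine Finset.sum_congr rfl fun i _ => ?_
  rw [joinV_incl, joinV_newV ha, (h.isElim ha p).exp, Real.exp_zero]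
  ring

end IsNetwork

/-- A lower bound for the coefficient of the kernel in terms of the variables on `s` only. -/
theorem exists_le_elimC (h : IsNetwork b₀ b₀) (ha : a ∉ s) : ∃ C : ℝ, 0 < C ∧
    ∀ b : Option ↥(insert a s) → Option ↥(insert a s) → ℝ, IsNetwork b₀ b →
      ∀ (p : Pts (insert a s)) (Y : ℝ), 1 ≤ Y → (∀ i, Real.exp |(elimPts b p).1 i| ≤ Y) →
        C * Y⁻¹ ^ 4 ≤ elimC b p.1 (elimKappa b p.1) := by
  obtain ⟨C, hC, hco⟩ := exists_coercive h.nonneg h.conn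
  refine ⟨C, hC, fun b hb p Y hY hp => ?_⟩
  rw [← hb.elimC_joinV ha, hb.elimC_eq ha, joinV_newV ha, Real.exp_zero, one_mul]
  refine le_trans ?_ (hco b hb (joinV (elimPts b p).1 0) Y hY (fun k => ?_) _)
  · refine le_mul_of_one_le_right (by positivity) ?_
    rw [sum_insert_subtype ha, joinV_newV ha, one_pow]
    exact le_add_of_nonneg_right (Finset.sum_nonneg fun _ _ => sq_nonneg _)
  · rcases eq_newV_or_incl k with rfl | ⟨i, rfl⟩
    · rw [joinV_newV ha, abs_zero, Real.exp_zero]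
      exact hY
    · rw [joinV_incl]
      exact hp i

end Real

variable {B : Type*} [NormedAddCommGroup B] [NormedSpace ℝ B]
  {b₀ : Option ↥(insert a s) → Option ↥(insert a s) → ℝ}
  {b : B → Option ↥(insert a s) → Option ↥(insert a s) → ℝ}

theorem exp_abs_le_sinh (x : ℝ) : Real.exp |x| ≤ 1 + 2 * |Real.sinh x| := by
  rw [Real.abs_sinh, Real.sinh_eq]
  have : Real.exp (-|x|) ≤ 1 := Real.exp_le_one_iff.2 (neg_nonpos.2 (abs_nonneg x))
  linarith

/-- The size of all variables on `insert a s` is polynomially bounded by a common bound `Y` for the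
variables on `s` and the exponent of the kernel. -/
theorem norm_sinhPts_le_of_elim {b₀ b : Option ↥(insert a s) → Option ↥(insert a s) → ℝ}
    (hn : IsNetwork b₀ b) (ha : a ∉ s) (p' : Pts (insert a s)) {L Y : ℝ} (hL : 1 ≤ L) (hY : 1 ≤ Y)
    (hc : Y⁻¹ ^ 4 ≤ L * elimC b p'.1 (elimKappa b p'.1))
    (hq : elimEnergy (elimC b p'.1 (elimKappa b p'.1)) (p'.1 newV) (p'.2 newV) ≤ Y)
    (hu : ∀ i, Real.exp |(elimPts b p').1 i| ≤ Y) (ht : ∀ i, |(elimPts b p').2 i| ≤ Y) :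
    ‖sinhPts p'‖ ≤ 14 * L ^ 2 * Y ^ 10 := by
  have hY0 : 0 < Y := by linarith
  have hLL : L ≤ L ^ 2 := by nlinarith
  have hbig : ∀ m ≤ 10, ∀ r : ℝ, 0 ≤ r → r ≤ 14 → r * L * Y ^ m ≤ 14 * L ^ 2 * Y ^ 10 := by
    intro m hm r hr hr'
    have h1 := pow_le_pow_right₀ hY hm
    have h2 : r * L ≤ 14 * L ^ 2 := by nlinarith
    exact mul_le_mul h2 h1 (by positivity) (by positivity)
  have hE := hn.isElim ha p'
  have main : ∀ i, _ := fun i => elim_control_aux (S := (elimPts b p').2 i)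
    (S' := p'.2 (incl i)) (κ := elimKappa b p'.1 i) (P := Real.exp (p'.1 (incl i))) hL hY hc hq
    (Real.exp_pos ((elimPts b p').1 i)) ((Real.exp_le_exp.2 (le_abs_self _)).trans (hu i))
    ((Real.exp_neg _).symm.trans_le ((Real.exp_le_exp.2 (neg_le_abs _)).trans (hu i)))
    (ht i) (Real.exp_pos (p'.1 (incl i)))
    ((hn.exp_le_elimExp ha p'.1 i).trans_eq (by rw [hE.exp, elimExp]))
    (le_of_eq_of_le (by rw [hE.exp, elimExp]) (hn.elimExp_le ha p'.1 i))
    (hn.kappa_nonneg ha _ i) (hn.kappa_mul_le ha _ i)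
    (eq_add_of_sub_eq (hE.s i).symm)
  have hx := Real.exp_pos (p'.1 newV)
  -- for the variables at `a` itself the remaining data are irrelevant
  have mainA := elim_control_aux (S := 0) (S' := 0) (κ := 0) (P := 1) hL hY hc hq one_pos hY
    (inv_one.trans_le hY) (abs_zero.trans_le hY0.le) one_pos (by linarith) (by linarith) le_rfl
    (by rw [zero_mul]; exact zero_le_one) (by ring)
  have h0 : 0 ≤ 14 * L ^ 2 * Y ^ 10 := by positivity
  rw [Prod.norm_def]
  refine max_le ((pi_norm_le_iff_of_nonneg h0).2 fun k => ?_)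
    ((pi_norm_le_iff_of_nonneg h0).2 fun k => ?_)
  · rw [Real.norm_eq_abs]
    rcases eq_newV_or_incl k with rfl | ⟨i, rfl⟩
    · exact mainA.1.trans (hbig 5 (by norm_num) 4 (by norm_num) (by norm_num))
    · obtain ⟨-, -, h1, h2, -⟩ := main i
      rw [← Real.exp_neg] at h2
      refine le_trans ?_ (hbig 6 (by norm_num) 5 (by norm_num) (by norm_num))
      change |Real.sinh (p'.1 (incl i))| ≤ _
      rw [Real.sinh_eq, abs_le]
      have := Real.exp_pos (p'.1 (incl i))
      have := Real.exp_pos (-p'.1 (incl i))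
      constructor <;> linarith
  · rw [Real.norm_eq_abs]
    rcases eq_newV_or_incl k with rfl | ⟨i, rfl⟩
    · refine mainA.2.1.trans ?_
      have : 0 ≤ L ^ 2 * Y ^ 10 := by positivity
      linarith
    · exact (main i).2.2.2.2

/-- The elimination map is proper in a quantitative sense: the variables before the elimination are
polynomially bounded by the variables after it, the parameters and the exponent of the kernel. -/
theorem elim_control (ha : a ∉ s) (h₀ : IsNetwork b₀ b₀) (hn : ∀ t, IsNetwork b₀ (b t)) :
    ∃ (k : ℕ) (C : ℝ), ∀ z : B × Pts (insert a s),
      ‖z‖ ≤ C * (1 + ‖sinhPts (elimPts (b z.1) (arsinhPts z.2))‖ + ‖z.1‖ +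
        elimEnergy (elimC (b z.1) (arsinhPts z.2).1 (elimKappa (b z.1) (arsinhPts z.2).1))
          ((arsinhPts z.2).1 newV) ((arsinhPts z.2).2 newV)) ^ k := by
  obtain ⟨C, hC, hc⟩ := exists_le_elimC h₀ ha
  obtain ⟨L, hL1, hLC⟩ : ∃ L : ℝ, 1 ≤ L ∧ 1 ≤ L * C :=
    ⟨max 1 C⁻¹, le_max_left _ _, (inv_mul_cancel₀ hC.ne').symm.trans_le
      (mul_le_mul_of_nonneg_right (le_max_right _ _) hC.le)⟩
  refine ⟨10, 14 * L ^ 2 * 3 ^ 10, fun z => ?_⟩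
  obtain ⟨t, x⟩ := z
  obtain ⟨p', rfl⟩ : ∃ p', x = sinhPts p' := ⟨arsinhPts x, (sinhPts_arsinhPts x).symm⟩
  simp only [arsinhPts_sinhPts]
  have hq0 := elimEnergy_nonneg ((hn t).elimC_pos ha p'.1) (p'.1 newV) (p'.2 newV)
  have hΦ0 := norm_nonneg (sinhPts (elimPts (b t) p'))
  have ht0 := norm_nonneg t
  generalize hYdef : 1 + ‖sinhPts (elimPts (b t) p')‖ + ‖t‖ +
    elimEnergy (elimC (b t) p'.1 (elimKappa (b t) p'.1)) (p'.1 newV) (p'.2 newV) = Z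
  have hY1 : 1 ≤ 3 * Z := by linarith
  have hu : ∀ i, Real.exp |(elimPts (b t) p').1 i| ≤ 3 * Z := by
    intro i
    have h1 : |Real.sinh ((elimPts (b t) p').1 i)| ≤ ‖sinhPts (elimPts (b t) p')‖ :=
      (norm_le_pi_norm (sinhPts (elimPts (b t) p')).1 i).trans (norm_fst_le _)
    have := exp_abs_le_sinh ((elimPts (b t) p').1 i)
    linarith
  have ht : ∀ i, |(elimPts (b t) p').2 i| ≤ 3 * Z := by
    intro i
    have h1 : |(elimPts (b t) p').2 i| ≤ ‖sinhPts (elimPts (b t) p')‖ :=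
      (norm_le_pi_norm (sinhPts (elimPts (b t) p')).2 i).trans (norm_snd_le _)
    linarith
  have hcl : (3 * Z)⁻¹ ^ 4 ≤ L * elimC (b t) p'.1 (elimKappa (b t) p'.1) := by
    have h1 := hc (b t) (hn t) p' (3 * Z) hY1 hu
    calc (3 * Z)⁻¹ ^ 4 ≤ L * C * (3 * Z)⁻¹ ^ 4 := le_mul_of_one_le_left (by positivity) hLC
      _ = L * (C * (3 * Z)⁻¹ ^ 4) := by ring
      _ ≤ _ := mul_le_mul_of_nonneg_left h1 (by linarith)
  have main := norm_sinhPts_le_of_elim (hn t) ha p' hL1 hY1 hcl (by linarith) hu ht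
  have e : 14 * L ^ 2 * 3 ^ 10 * Z ^ 10 = 14 * L ^ 2 * (3 * Z) ^ 10 := by
    rw [mul_pow]; ring
  rw [e, Prod.norm_def]
  refine max_le ?_ main
  have h1 : ‖t‖ ≤ 3 * Z := by linarith
  have h2 : 3 * Z ≤ (3 * Z) ^ 10 := le_self_pow₀ hY1 (by norm_num)
  have h3 : 1 ≤ 14 * L ^ 2 := by nlinarith
  exact (h1.trans h2).trans (le_mul_of_one_le_left (by positivity) h3)

/-- The density of the model on `insert a s` relative to that of the model on `s`. -/
def elimWeight (b : Option ↥(insert a s) → Option ↥(insert a s) → ℝ) (p : Pts (insert a s)) : ℝ :=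
  (∏ i, Real.exp (p.1 (incl i) - (elimPts b p).1 i)) *
    elimKernel (elimC b p.1 (elimKappa b p.1)) (p.1 newV) (p.2 newV)

/-- The pullback of a Schwartz function under the elimination map, times the kernel, is a Schwartz
function of all variables jointly with the parameters. -/
theorem exists_schwartz_elim (ha : a ∉ s) (h₀ : IsNetwork b₀ b₀)
    (hb : ∀ i j, HasTemperateGrowth fun t => b t i j) (hn : ∀ t, IsNetwork b₀ (b t))
    (h : 𝓢(Pts s, ℂ)) (χ : 𝓢(B, ℂ)) :
    ∃ G : 𝓢(B × Pts (insert a s), ℂ), ∀ t p, G (t, sinhPts p) =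
      (elimWeight (b t) p : ℂ) * h (sinhPts (elimPts (b t) p)) * χ t := by
  have hT : HasTemperateGrowth fun z : B × Pts (insert a s) =>
      (∏ i : s, Real.exp ((arsinhPts z.2).1 (incl i)) *
        (elimExp (b z.1) (arsinhPts z.2).1 i)⁻¹) *
          (elimC (b z.1) (arsinhPts z.2).1 (elimKappa (b z.1) (arsinhPts z.2).1) *
            (2 * Real.pi)⁻¹) :=
    (temperate_prod fun i _ => (temperate_exp_arsinh (incl i)).fun_mul
      (temperate_inv_elimExp ha h₀ hb hn i)).fun_mul
        ((temperate_elimC ha h₀ hb hn).fun_mul (HasTemperateGrowth.const _))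
  obtain ⟨G, hG⟩ := exists_schwartz_of_control hT (temperate_elimPts ha h₀ hb hn) temperate_fst
    (temperate_elimEnergy ha h₀ hb hn)
    (fun z => elimEnergy_nonneg ((hn z.1).elimC_pos ha _) _ _) (elim_control ha h₀ hn) h χ
  refine ⟨G, fun t p => ?_⟩
  rw [hG]
  simp only [arsinhPts_sinhPts]
  have e : ∏ i : s, Real.exp (p.1 (incl i)) * (elimExp (b t) p.1 i)⁻¹ =
      ∏ i, Real.exp (p.1 (incl i) - (elimPts (b t) p).1 i) :=
    Finset.prod_congr rfl fun i _ => by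
      rw [Real.exp_sub, ((hn t).isElim ha p).exp]
      rfl
  have e2 : ∀ x c k : ℝ, x * (c * (2 * Real.pi)⁻¹) * k = x * (c / (2 * Real.pi) * k) :=
    fun x c k => by ring
  rw [e, elimWeight, elimKernel_eq, e2]

theorem contDiff_sinhPts : ContDiff ℝ ∞ (sinhPts : Pts s → Pts s) := by
  refine ContDiff.prodMk (contDiff_pi.2 fun i => ?_) contDiff_snd
  exact Real.contDiff_sinh.comp ((contDiff_apply ℝ ℝ i).comp contDiff_fst)

theorem contDiff_arsinhPts : ContDiff ℝ ∞ (arsinhPts : Pts s → Pts s) := by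
  refine ContDiff.prodMk (contDiff_pi.2 fun i => ?_) contDiff_snd
  exact Real.contDiff_arsinh.comp ((contDiff_apply ℝ ℝ i).comp contDiff_fst)

theorem contDiff_elimPts (ha : a ∉ s) (h₀ : IsNetwork b₀ b₀)
    (hb : ∀ i j, HasTemperateGrowth fun t => b t i j) (hn : ∀ t, IsNetwork b₀ (b t)) :
    ContDiff ℝ ∞ fun z : B × Pts (insert a s) => elimPts (b z.1) z.2 := by
  have h1 : ContDiff ℝ ∞ fun z : B × Pts (insert a s) => (z.1, sinhPts z.2) :=
    contDiff_fst.prodMk (contDiff_sinhPts.comp contDiff_snd)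
  have h := contDiff_arsinhPts.comp ((temperate_elimPts ha h₀ hb hn).1.comp h1)
  simpa [Function.comp_def] using h

theorem contDiff_elimKappa (ha : a ∉ s) (h₀ : IsNetwork b₀ b₀)
    (hb : ∀ i j, HasTemperateGrowth fun t => b t i j) (hn : ∀ t, IsNetwork b₀ (b t)) (i : s) :
    ContDiff ℝ ∞ fun z : B × Pts (insert a s) => elimKappa (b z.1) z.2.1 i := by
  have h1 : ContDiff ℝ ∞ fun z : B × Pts (insert a s) => (z.1, sinhPts z.2) :=
    contDiff_fst.prodMk (contDiff_sinhPts.comp contDiff_snd)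
  have h := (temperate_elimKappa ha h₀ hb hn i).1.comp h1
  simpa [Function.comp_def] using h

theorem contDiff_elimWeight (ha : a ∉ s) (h₀ : IsNetwork b₀ b₀)
    (hb : ∀ i j, HasTemperateGrowth fun t => b t i j) (hn : ∀ t, IsNetwork b₀ (b t)) :
    ContDiff ℝ ∞ fun z : B × Pts (insert a s) => elimWeight (b z.1) z.2 := by
  have h1 : ContDiff ℝ ∞ fun z : B × Pts (insert a s) => (z.1, sinhPts z.2) :=
    contDiff_fst.prodMk (contDiff_sinhPts.comp contDiff_snd)
  have h2 := (temperate_elimC ha h₀ hb hn).1.comp h1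
  have h3 := contDiff_elimPts ha h₀ hb hn
  have hu : ∀ k, ContDiff ℝ ∞ fun z : B × Pts (insert a s) => z.2.1 k := fun k =>
    (contDiff_apply ℝ ℝ k).comp (contDiff_fst.comp contDiff_snd)
  have ht : ∀ k, ContDiff ℝ ∞ fun z : B × Pts (insert a s) => z.2.2 k := fun k =>
    (contDiff_apply ℝ ℝ k).comp (contDiff_snd.comp contDiff_snd)
  have hp : ∀ k, ContDiff ℝ ∞ fun z : B × Pts (insert a s) => (elimPts (b z.1) z.2).1 k := fun k =>
    (contDiff_apply ℝ ℝ k).comp (contDiff_fst.comp h3)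
  simp only [Function.comp_def, arsinhPts_sinhPts] at h2
  have hcosh : ContDiff ℝ ∞ fun z : B × Pts (insert a s) => Real.cosh (z.2.1 newV) :=
    Real.contDiff_cosh.comp (hu newV)
  refine (contDiff_prod fun i _ => ((hu (incl i)).sub (hp i)).exp).mul ?_
  simp only [elimKernel, div_eq_mul_inv]
  refine (h2.mul contDiff_const).mul (ContDiff.exp (ContDiff.neg ?_))
  exact (h2.mul (hcosh.sub contDiff_const)).add
    (((h2.mul (hu newV).exp).mul ((ht newV).pow 2)).mul contDiff_const)

end ElimSchwartz

open scoped ENNReal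

/-! ### The change of variables -/

section BetaJacobian

variable {V : Type*} [DecidableEq V] {s : Finset V}

/-- The Jacobian matrix of the map `u ↦ β`. -/
def betaJac (w : Option s → Option s → ℝ) (x : s → ℝ) : Matrix s s ℝ :=
  (-(1 / 2) : ℝ) • (Matrix.diagonal (fun i => Real.exp (-x i)) *
    Matrix.of (Hmat w (realBeta w x)) * Matrix.diagonal fun i => Real.exp (x i))

theorem det_betaJac (w : Option s → Option s → ℝ) (x : s → ℝ) :
    (betaJac w x).det = (-(1 / 2) : ℝ) ^ Fintype.card s * (Matrix.of (Hmat w (realBeta w x))).det := by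
  rw [betaJac, Matrix.det_smul, Matrix.det_mul, Matrix.det_mul, Matrix.det_diagonal,
    Matrix.det_diagonal]
  have : (∏ i, Real.exp (-x i)) * ∏ i, Real.exp (x i) = 1 := by
    rw [← Finset.prod_mul_distrib]
    refine Finset.prod_eq_one fun i _ => ?_
    rw [← Real.exp_add]; simp
  rw [mul_right_comm, this, one_mul]

/-- The derivative of `u ↦ β`. -/
theorem hasFDerivAt_realBeta (w : Option s → Option s → ℝ) (x : s → ℝ) :
    HasFDerivAt (fun x => realBeta w x)
      (LinearMap.toContinuousLinearMap (Matrix.toLin' (betaJac w x))) x := by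
  refine hasFDerivAt_pi'.2 fun i => ?_
  let e : Option s → ((s → ℝ) →L[ℝ] ℝ)
    | none => 0
    | some j => ContinuousLinearMap.proj j
  have he : ∀ j, HasFDerivAt (fun x : s → ℝ => ext0 x j) (e j) x := by
    rintro (_ | j)
    · exact hasFDerivAt_const (0 : ℝ) x
    · exact (ContinuousLinearMap.proj (R := ℝ) (φ := fun _ : s => ℝ) j).hasFDerivAt
  have hi : HasFDerivAt (fun x : s → ℝ => x i)
      (ContinuousLinearMap.proj (R := ℝ) (φ := fun _ : s => ℝ) i) x :=
    (ContinuousLinearMap.proj (R := ℝ) (φ := fun _ : s => ℝ) i).hasFDerivAt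
  have h := (HasFDerivAt.fun_sum (u := Finset.univ) fun j _ =>
    (((he j).fun_sub hi).exp.mul_const (w (some i) j))).const_mul (1 / 2)
  refine h.congr_fderiv ?_
  ext y
  have hy : ∀ j, e j y = ext0 y j := by
    rintro (_ | j) <;> rfl
  have h1 := two_mul_realBeta_mul_exp w x i
  have h2 := sum_Hmat_mul w (realBeta w x) i fun j => Real.exp (x j) * y j
  have h3 : ((LinearMap.toContinuousLinearMap (Matrix.toLin' (betaJac w x))) y) i =
      -(1 / 2) * (Real.exp (-x i) *
        ∑ j, Hmat w (realBeta w x) i j * (Real.exp (x j) * y j)) := by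
    simp only [LinearMap.coe_toContinuousLinearMap', Matrix.toLin'_apply, betaJac,
      Matrix.smul_apply, smul_eq_mul, Matrix.mulVec, dotProduct,
      Matrix.mul_diagonal, Matrix.diagonal_mul, Matrix.of_apply, Finset.mul_sum]
    exact Finset.sum_congr rfl fun j _ => by ring
  have h4 : (((ContinuousLinearMap.proj (R := ℝ) (φ := fun _ : s => ℝ) i).comp
      (LinearMap.toContinuousLinearMap (Matrix.toLin' (betaJac w x)))) y) =
      ((LinearMap.toContinuousLinearMap (Matrix.toLin' (betaJac w x))) y) i := rfl
  rw [h4, h3, h2, ← mul_assoc (2 * realBeta w x i), h1]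
  simp only [_root_.smul_apply, _root_.sum_apply, _root_.sub_apply, smul_eq_mul, hy,
    ContinuousLinearMap.proj_apply]
  rw [Fintype.sum_option, Fintype.sum_option]
  simp only [ext0_none, ext0_some, Real.exp_zero, Real.exp_sub]
  have e3 : ∑ j : s, w (some i) (some j) *
      (Real.exp (x j) / Real.exp (x i) * (y j - y i)) = (Real.exp (x i))⁻¹ *
        (∑ j, w (some i) (some j) * (Real.exp (x j) * y j) -
          (∑ j, Real.exp (x j) * w (some i) (some j)) * y i) := by
    rw [mul_sub, Finset.sum_mul, Finset.mul_sum, Finset.mul_sum, ← Finset.sum_sub_distrib]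
    exact Finset.sum_congr rfl fun j _ => by ring
  rw [e3, Real.exp_neg]
  ring

end BetaJacobian

section Split

variable {V : Type*} [DecidableEq V] {s : Finset V} {a : V}

/-- Lebesgue measure on `insert a s` is a product. -/
theorem measurePreserving_joinV (ha : a ∉ s) :
    MeasurePreserving (fun q : (s → ℝ) × ℝ => (joinV q.1 q.2 : ↥(insert a s) → ℝ)) := by
  have hm : Measurable fun q : (s → ℝ) × ℝ => (joinV q.1 q.2 : ↥(insert a s) → ℝ) := by
    refine measurable_pi_lambda _ fun k => ?_
    rcases eq_newV_or_incl k with rfl | ⟨i, rfl⟩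
    · simpa only [joinV_newV ha] using measurable_snd
    · simp only [joinV_incl]
      exact (measurable_pi_apply i).comp measurable_fst
  refine ⟨hm, ?_⟩
  refine (Measure.pi_eq fun S hS => ?_).symm
  rw [Measure.map_apply hm (MeasurableSet.univ_pi hS)]
  have : (fun q : (s → ℝ) × ℝ => (joinV q.1 q.2 : ↥(insert a s) → ℝ)) ⁻¹' Set.univ.pi S =
      (Set.univ.pi fun i : s => S (incl i)) ×ˢ S newV := by
    ext q
    simp only [Set.mem_preimage, Set.mem_univ_pi, Set.mem_prod]
    constructor
    · intro h
      refine ⟨fun i => ?_, ?_⟩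
      · have := h (incl i); rwa [joinV_incl] at this
      · have := h newV; rwa [joinV_newV ha] at this
    · rintro ⟨h1, h2⟩ k
      rcases eq_newV_or_incl k with rfl | ⟨i, rfl⟩
      · rwa [joinV_newV ha]
      · rw [joinV_incl]; exact h1 i
  rw [this, Measure.volume_eq_prod, Measure.prod_prod, volume_pi_pi, prod_insert_subtype ha,
    mul_comm]

theorem lintegral_insert (ha : a ∉ s) (f : Pts (insert a s) → ℝ≥0∞) (hf : Measurable f) :
    ∫⁻ p, f p = ∫⁻ r, ∫⁻ x, ∫⁻ σ, ∫⁻ y, f (joinV (s := s) x r, joinV y σ) := by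
  have hj := measurePreserving_joinV (s := s) ha
  have h1 : ∫⁻ q : ((s → ℝ) × ℝ) × ((s → ℝ) × ℝ), f (joinV q.1.1 q.1.2, joinV q.2.1 q.2.2) =
      ∫⁻ p, f p := (hj.prod hj).lintegral_comp hf
  rw [← h1]
  have hm : Measurable fun q : ((s → ℝ) × ℝ) × ((s → ℝ) × ℝ) =>
      f (joinV q.1.1 q.1.2, joinV q.2.1 q.2.2) := hf.comp (hj.prod hj).measurable
  rw [Measure.volume_eq_prod, lintegral_prod _ hm.aemeasurable, Measure.volume_eq_prod,
    lintegral_prod_symm _ (hm.lintegral_prod_right').aemeasurable]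
  refine lintegral_congr fun r => lintegral_congr fun x => ?_
  exact lintegral_prod_symm (fun q : (s → ℝ) × ℝ => f (joinV x r, joinV q.1 q.2))
    (hm.comp (measurable_prodMk_left (x := (x, r)))).aemeasurable

end Split

section ElimMeasure

variable {V : Type*} [DecidableEq V] {s : Finset V} {a : V}
  {b₀ b : Option ↥(insert a s) → Option ↥(insert a s) → ℝ}

/-- The variables `u` on `s`, for a fixed value at the new vertex. -/
def elimU (b : Option ↥(insert a s) → Option ↥(insert a s) → ℝ) (r : ℝ) (x : s → ℝ) : s → ℝ :=
  (elimPts b (joinV x r, 0)).1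

theorem contDiff_joinV (ha : a ∉ s) :
    ContDiff ℝ ∞ fun q : (s → ℝ) × ℝ => (joinV q.1 q.2 : ↥(insert a s) → ℝ) := by
  refine contDiff_pi.2 fun k => ?_
  rcases eq_newV_or_incl k with rfl | ⟨i, rfl⟩
  · simpa only [joinV_newV ha] using contDiff_snd
  · simp only [joinV_incl]
    exact (contDiff_apply ℝ ℝ i).comp contDiff_fst

theorem contDiff_elimPts_real (ha : a ∉ s) (h₀ : IsNetwork b₀ b₀) (h : IsNetwork b₀ b) :
    ContDiff ℝ ∞ fun p : Pts (insert a s) => elimPts b p :=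
  (contDiff_elimPts (B := ℝ) (b := fun _ => b) ha h₀
    (fun _ _ => Function.HasTemperateGrowth.const _) fun _ => h).comp
      (contDiff_const (c := (0 : ℝ)).prodMk contDiff_id)

theorem contDiff_elimU (ha : a ∉ s) (h₀ : IsNetwork b₀ b₀) (h : IsNetwork b₀ b) (r : ℝ) :
    ContDiff ℝ ∞ (elimU b r) := by
  refine contDiff_fst.comp ((contDiff_elimPts_real ha h₀ h).comp ?_)
  exact ((contDiff_joinV ha).comp (contDiff_id.prodMk contDiff_const)).prodMk contDiff_const

/-- The weights on `s` which arise if `u` has the value `r` at the new vertex. -/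
def fixWeight (b : Option ↥(insert a s) → Option ↥(insert a s) → ℝ) (r : ℝ) :
    Option s → Option s → ℝ
  | some i, some j => b (some (incl i)) (some (incl j))
  | some i, none => b (some (incl i)) none + b (some (incl i)) (some newV) * Real.exp r
  | none, _ => 0

theorem realBeta_joinV (ha : a ∉ s) (r : ℝ) (x : s → ℝ) (i : s) :
    realBeta b (joinV x r) (incl i) = realBeta (fixWeight b r) x i := by
  simp only [realBeta, Fintype.sum_option, sum_insert_subtype ha, ext0_some, ext0_none, fixWeight,
    joinV_incl, joinV_newV ha, Real.exp_sub, Real.exp_zero]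
  ring

theorem realBeta_elimU (ha : a ∉ s) (h : IsNetwork b₀ b) (r : ℝ) (x : s → ℝ) :
    realBeta (contract b) (elimU b r x) = realBeta (fixWeight b r) x := by
  funext i
  rw [elimU, (h.isElim ha (joinV x r, 0)).realBeta_eq ha]
  exact realBeta_joinV ha r x i

/-- Injectivity holds because the image determines `β`, hence `κ`, hence `e^u`;
surjectivity is `IsNetwork.exists_elimExp_eq`. -/
theorem elimU_bijective (ha : a ∉ s) (h : IsNetwork b₀ b) (r : ℝ) :
    Function.Bijective (elimU b r : (s → ℝ) → s → ℝ) := by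
  constructor
  · intro x y hxy
    have hβ : realBeta (fixWeight b r) x = realBeta (fixWeight b r) y := by
      rw [← realBeta_elimU ha h, ← realBeta_elimU ha h, hxy]
    have hH : elimH b (joinV x r) = elimH b (joinV y r) := by
      rw [elimH, elimH]
      congr 2
      funext i
      rw [realBeta_joinV ha, realBeta_joinV ha, hβ]
    have hκ : elimKappa b (joinV x r) = elimKappa b (joinV y r) := by
      rw [elimKappa, elimKappa, hH]
    funext i
    have hi := congrFun hxy i
    simp only [elimU, elimPts] at hi
    have h1 := Real.log_injOn_pos (h.elimExp_pos ha (joinV x r) i)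
      (h.elimExp_pos ha (joinV y r) i) hi
    simp only [elimExp, hκ, joinV_newV ha, joinV_incl] at h1
    exact Real.exp_injective (add_right_cancel h1)
  · intro u
    obtain ⟨u', h1, -, h2⟩ := h.exists_elimExp_eq ha u r
    refine ⟨fun i => u' (incl i), ?_⟩
    have h3 : joinV (fun i => u' (incl i)) r = u' := by
      rw [← h1]
      exact joinV_eta u'
    funext i
    simp only [elimU, elimPts, h3, h2, Real.log_exp]

/-- By `realBeta_elimU` the map is `u ↦ β` for the weights `fixWeight b r`, followed by the inverse of
`u ↦ β` for the contracted weights. The two Jacobian determinants are given by that of the same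
matrix `Hmat`, since the weights only differ at `none`. -/
theorem measurePreserving_elimU (ha : a ∉ s) (h₀ : IsNetwork b₀ b₀) (h : IsNetwork b₀ b) (r : ℝ) :
    MeasurePreserving (elimU b r : (s → ℝ) → s → ℝ) := by
  have hc := contDiff_elimU ha h₀ h r
  have hd : ∀ x, HasFDerivAt (elimU b r) (fderiv ℝ (elimU b r) x) x := fun x =>
    (hc.differentiable (by simp) x).hasFDerivAt
  have hdet : ∀ x, (fderiv ℝ (elimU b r) x).det = 1 := by
    intro x
    have h1 := (hasFDerivAt_realBeta (contract b) (elimU b r x)).comp x (hd x)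
    have h2 := hasFDerivAt_realBeta (fixWeight b r) x
    have he : (fun u => realBeta (contract b) u) ∘ elimU b r =
        fun x => realBeta (fixWeight b r) x := funext fun x => realBeta_elimU ha h r x
    rw [he] at h1
    -- chain rule
    have h3 := congrArg ContinuousLinearMap.det (h1.unique h2)
    have hH : (Matrix.of (Hmat (contract b) (realBeta (contract b) (elimU b r x))) :
        Matrix s s ℝ) = Matrix.of (Hmat (fixWeight b r) (realBeta (fixWeight b r) x)) := by
      rw [realBeta_elimU ha h]
      rfl
    have h4 : (betaJac (contract b) (elimU b r x)).det = (betaJac (fixWeight b r) x).det := by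
      rw [det_betaJac, det_betaJac, hH]
    have h5 : (betaJac (contract b) (elimU b r x)).det ≠ 0 := by
      rw [det_betaJac]
      refine mul_ne_zero (pow_ne_zero _ (by norm_num)) ?_
      exact det_ne_zero_of_pos ((h.contract ha).hmat_pos _)
    have h6 : (betaJac (contract b) (elimU b r x)).det * (fderiv ℝ (elimU b r) x).det =
        (betaJac (contract b) (elimU b r x)).det := by
      have e1 : ((LinearMap.toContinuousLinearMap
          (Matrix.toLin' (betaJac (contract b) (elimU b r x)))).comp
            (fderiv ℝ (elimU b r) x)).det =
          (betaJac (contract b) (elimU b r x)).det * (fderiv ℝ (elimU b r) x).det := by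
        rw [ContinuousLinearMap.det, ContinuousLinearMap.toLinearMap_comp, LinearMap.det_comp]
        congr 1
        exact LinearMap.det_toLin' _
      rw [← e1, h3, h4]
      exact LinearMap.det_toLin' _
    exact mul_left_cancel₀ h5 (h6.trans (mul_one _).symm)
  refine ⟨hc.continuous.measurable, ?_⟩
  have h1 := map_withDensity_abs_det_fderiv_eq_addHaar (volume : Measure (s → ℝ))
    MeasurableSet.univ (fun x _ => (hd x).hasFDerivWithinAt) (elimU_bijective ha h r).1.injOn
  have him : elimU b r '' (Set.univ : Set (s → ℝ)) = Set.univ :=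
    Set.image_univ_of_surjective (elimU_bijective ha h r).2
  simp only [hdet, abs_one, ENNReal.ofReal_one] at h1
  have hone : ((volume : Measure (s → ℝ)).restrict Set.univ).withDensity (fun _ => 1) = volume :=
    withDensity_one.trans Measure.restrict_univ
  exact (congrArg (Measure.map (elimU b r)) hone).symm.trans
    (h1.trans ((congrArg volume.restrict him).trans Measure.restrict_univ))

/-- Affine change of variables with a diagonal linear part. -/
theorem lintegral_diagonal {D c : s → ℝ} (hD : ∀ i, 0 < D i) {g : (s → ℝ) → ℝ≥0∞}
    (hg : Measurable g) :
    ∫⁻ y : s → ℝ, ENNReal.ofReal (∏ i, D i) * g (fun i => D i * y i - c i) = ∫⁻ y, g y := by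
  have hdet : (Matrix.diagonal D).det = ∏ i, D i := Matrix.det_diagonal
  have hpos : 0 < ∏ i, D i := Finset.prod_pos fun i _ => hD i
  have h1 := Real.smul_map_diagonal_volume_pi (D := D) (by rw [hdet]; exact hpos.ne')
  rw [hdet, abs_of_pos hpos] at h1
  have hm : Measurable fun y : s → ℝ => g (fun i => y i - c i) :=
    hg.comp (measurable_pi_lambda _ fun i => (measurable_pi_apply i).sub_const _)
  have hlin : Measurable (Matrix.toLin' (Matrix.diagonal D)) :=
    (LinearMap.continuous_of_finiteDimensional _).measurable
  have h2 : ∫⁻ y : s → ℝ, g (fun i => y i - c i) = ∫⁻ y, g y := lintegral_sub_right_eq_self g c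
  rw [← h2]
  conv_rhs => rw [← h1]
  rw [lintegral_smul_measure, lintegral_map hm hlin, lintegral_const_mul' _ _ ENNReal.ofReal_ne_top,
    smul_eq_mul]
  congr 1
  refine lintegral_congr fun y => ?_
  congr 1
  funext i
  simp [Matrix.mulVec_diagonal]

/-- The Jacobian of the elimination map. -/
def elimJac (b : Option ↥(insert a s) → Option ↥(insert a s) → ℝ) (p : Pts (insert a s)) : ℝ :=
  ∏ i : s, Real.exp (p.1 (incl i) - (elimPts b p).1 i)

/-- The elimination map, together with the variables at the removed vertex. -/
def elimSplit (b : Option ↥(insert a s) → Option ↥(insert a s) → ℝ) (p : Pts (insert a s)) :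
    Pts s × (ℝ × ℝ) :=
  (elimPts b p, (p.1 newV, p.2 newV))

theorem continuous_elimSplit (ha : a ∉ s) (h₀ : IsNetwork b₀ b₀) (h : IsNetwork b₀ b) :
    Continuous (elimSplit b : Pts (insert a s) → Pts s × (ℝ × ℝ)) :=
  (contDiff_elimPts_real ha h₀ h).continuous.prodMk
    (((continuous_apply _).comp continuous_fst).prodMk ((continuous_apply _).comp continuous_snd))

theorem continuous_elimJac (ha : a ∉ s) (h₀ : IsNetwork b₀ b₀) (h : IsNetwork b₀ b) :
    Continuous (elimJac b : Pts (insert a s) → ℝ) :=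
  continuous_finsetProd _ fun i _ => Real.continuous_exp.comp
    (((continuous_apply _).comp continuous_fst).sub
      ((continuous_apply i).comp (continuous_fst.comp (contDiff_elimPts_real ha h₀ h).continuous)))

/-- The change of variables formula for the elimination map, together with the variables at the
removed vertex: the variables `s` are changed by a diagonal affine map, for fixed `u`, and the
variables `u` by a map which preserves Lebesgue measure. -/
theorem lintegral_elim (ha : a ∉ s) (h₀ : IsNetwork b₀ b₀) (h : IsNetwork b₀ b)
    {f : Pts s × (ℝ × ℝ) → ℝ≥0∞} (hf : Measurable f) :
    ∫⁻ p, ENNReal.ofReal (elimJac b p) * f (elimSplit b p) = ∫⁻ z, f z := by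
  have hm : Measurable fun p => ENNReal.ofReal (elimJac b p) * f (elimSplit b p) :=
    (continuous_elimJac ha h₀ h).measurable.ennreal_ofReal.mul
      (hf.comp (continuous_elimSplit ha h₀ h).measurable)
  rw [lintegral_insert ha _ hm]
  have hin : ∀ (r : ℝ) (x : s → ℝ) (σ : ℝ),
      ∫⁻ y, ENNReal.ofReal (elimJac b (joinV x r, joinV y σ)) *
        f (elimSplit b (joinV x r, joinV y σ)) = ∫⁻ y, f ((elimU b r x, y), (r, σ)) := by
    intro r x σ
    have hg : Measurable fun y : s → ℝ => f ((elimU b r x, y), (r, σ)) :=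
      hf.comp (by fun_prop)
    rw [← lintegral_diagonal (D := fun i => Real.exp (x i - elimU b r x i))
      (c := fun i => elimKappa b (joinV x r) i * (Real.exp r * σ) *
        (elimExp b (joinV x r) i)⁻¹) (fun i => Real.exp_pos _) hg]
    refine lintegral_congr fun y => ?_
    congr 1
    · simp only [elimJac, joinV_incl]
      rfl
    · congr 1
      simp only [elimSplit, joinV_newV ha]
      refine Prod.ext (Prod.ext rfl (funext fun i => ?_)) rfl
      simp only [elimPts, elimU, joinV_incl, joinV_newV ha, Real.exp_sub]
      rw [Real.exp_log (h.elimExp_pos ha (joinV x r) i)]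
      ring
  simp only [hin]
  have hG : ∀ r : ℝ, Measurable fun x : s → ℝ => ∫⁻ σ, ∫⁻ y, f ((x, y), (r, σ)) := by
    intro r
    refine Measurable.lintegral_prod_right' (f := fun q : (s → ℝ) × ℝ =>
      ∫⁻ y, f ((q.1, y), (r, q.2))) ?_
    exact Measurable.lintegral_prod_right' (f := fun q : ((s → ℝ) × ℝ) × (s → ℝ) =>
      f ((q.1.1, q.2), (r, q.1.2))) (hf.comp (by fun_prop))
  have h1 : ∀ r : ℝ, ∫⁻ x, ∫⁻ σ, ∫⁻ y, f ((elimU b r x, y), (r, σ)) =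
      ∫⁻ x, ∫⁻ σ, ∫⁻ y, f ((x, y), (r, σ)) := fun r =>
    (measurePreserving_elimU ha h₀ h r).lintegral_comp (hG r)
  simp only [h1]
  rw [Measure.volume_eq_prod (Pts s) (ℝ × ℝ), lintegral_prod_symm _ hf.aemeasurable,
    Measure.volume_eq_prod ℝ ℝ, lintegral_prod _ hf.lintegral_prod_left'.aemeasurable]
  refine lintegral_congr fun r => ?_
  rw [lintegral_lintegral_swap]
  · refine lintegral_congr fun σ => ?_
    rw [Measure.volume_eq_prod (s → ℝ) (s → ℝ)]
    exact (lintegral_prod (fun q : Pts s => f (q, (r, σ)))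
      (hf.comp measurable_prodMk_right).aemeasurable).symm
  · exact (Measurable.lintegral_prod_right' (f := fun q : ((s → ℝ) × ℝ) × (s → ℝ) =>
      f ((q.1.1, q.2), (r, q.1.2))) (hf.comp (by fun_prop))).aemeasurable

theorem elimJac_nonneg (p : Pts (insert a s)) : 0 ≤ elimJac b p :=
  Finset.prod_nonneg fun _ _ => (Real.exp_pos _).le

/-- The change of variables as an equality of measures. -/
theorem map_elimSplit (ha : a ∉ s) (h₀ : IsNetwork b₀ b₀) (h : IsNetwork b₀ b) :
    ((volume : Measure (Pts (insert a s))).withDensity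
      fun p => ENNReal.ofReal (elimJac b p)).map (elimSplit b) = volume := by
  refine Measure.ext_of_lintegral _ fun f hf => ?_
  rw [lintegral_map hf (continuous_elimSplit ha h₀ h).measurable]
  refine (lintegral_withDensity_eq_lintegral_mul _
    (continuous_elimJac ha h₀ h).measurable.ennreal_ofReal
      (hf.comp (continuous_elimSplit ha h₀ h).measurable)).trans ?_
  exact lintegral_elim ha h₀ h hf

/-- Integrability is part of the conclusion, as Fubini is applied to `g` afterwards. -/
theorem integral_elimSplit (ha : a ∉ s) (h₀ : IsNetwork b₀ b₀) (h : IsNetwork b₀ b)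
    {g : Pts s × (ℝ × ℝ) → ℂ} (hg : Continuous g)
    (hi : Integrable fun p => (elimJac b p : ℂ) * g (elimSplit b p)) :
    Integrable g ∧ ∫ p, (elimJac b p : ℂ) * g (elimSplit b p) = ∫ z, g z := by
  have hm := (continuous_elimSplit ha h₀ h).measurable
  have hJ : Measurable fun p => (elimJac b p).toNNReal :=
    (continuous_elimJac ha h₀ h).measurable.real_toNNReal
  have hmap := map_elimSplit ha h₀ h
  have hsm : ∀ p, (elimJac b p).toNNReal • g (elimSplit b p) =
      (elimJac b p : ℂ) * g (elimSplit b p) := fun p => by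
    rw [NNReal.smul_def, Real.coe_toNNReal _ (elimJac_nonneg p), Complex.real_smul]
  constructor
  · rw [← hmap, integrable_map_measure (hg.aestronglyMeasurable) hm.aemeasurable]
    refine (integrable_withDensity_iff_integrable_smul hJ).2 ?_
    exact hi.congr (Filter.Eventually.of_forall fun p => (hsm p).symm)
  · rw [← hmap, integral_map hm.aemeasurable hg.aestronglyMeasurable]
    refine Eq.trans ?_ (integral_withDensity_eq_integral_smul hJ _).symm
    exact integral_congr_ae (Filter.Eventually.of_forall fun p => (hsm p).symm)

/-- Integration over the variables of the removed vertex. -/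
theorem integral_elim (ha : a ∉ s) (h₀ : IsNetwork b₀ b₀) (h : IsNetwork b₀ b)
    {e : Pts s → ℝ} (he : Continuous e) (he0 : ∀ p, e p ≤ 0) {F : Pts s → ℂ} (hF : Continuous F)
    (hi : Integrable fun p => (elimWeight b p : ℂ) * (Complex.exp (e (elimPts b p) *
      ((Real.exp (p.1 newV) - 1) + Complex.I * (Real.exp (p.1 newV) * p.2 newV))) *
        F (elimPts b p))) :
    ∫ p, (elimWeight b p : ℂ) * (Complex.exp (e (elimPts b p) *
      ((Real.exp (p.1 newV) - 1) + Complex.I * (Real.exp (p.1 newV) * p.2 newV))) *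
        F (elimPts b p)) = ∫ p, F p := by
  -- the coefficient of the kernel as a function on the model on `s`, by `elimC_joinV`
  set c : Pts s → ℝ := fun p => elimC b (joinV p.1 0) (elimKappa b (joinV p.1 0)) with hc
  have hcont : Continuous c := by
    have h1 := (temperate_elimC (B := ℝ) (b := fun _ => b) ha h₀
      (fun _ _ => Function.HasTemperateGrowth.const _) fun _ => h).1.continuous
    have h2 : Continuous fun p : Pts s => ((0 : ℝ), sinhPts
        ((joinV p.1 0, 0) : Pts (insert a s))) :=
      continuous_const.prodMk (continuous_sinhPts.comp
        (((contDiff_joinV ha).continuous.comp (continuous_fst.prodMk continuous_const)).prodMk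
          continuous_const))
    have h3 := h1.comp h2
    simpa only [Function.comp_def, arsinhPts_sinhPts] using h3
  have hcpos : ∀ p, 0 < c p := fun p => h.elimC_pos ha _
  set g : Pts s × (ℝ × ℝ) → ℂ := fun z => F z.1 * ((elimKernel (c z.1) z.2.1 z.2.2 : ℂ) *
    Complex.exp (e z.1 * ((Real.exp z.2.1 - 1) + Complex.I * (Real.exp z.2.1 * z.2.2)))) with hg
  have hgc : Continuous g := by
    rw [hg]
    unfold elimKernel
    fun_prop
  have hEq : ∀ p, (elimWeight b p : ℂ) * (Complex.exp (e (elimPts b p) *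
      ((Real.exp (p.1 newV) - 1) + Complex.I * (Real.exp (p.1 newV) * p.2 newV))) *
        F (elimPts b p)) = (elimJac b p : ℂ) * g (elimSplit b p) := by
    intro p
    simp only [hg, elimSplit, elimWeight, hc, h.elimC_joinV ha]
    push_cast [elimJac]
    ring
  simp only [hEq] at hi ⊢
  obtain ⟨h1, h2⟩ := integral_elimSplit ha h₀ h hgc hi
  rw [h2]
  rw [Measure.volume_eq_prod] at h1 ⊢
  rw [integral_prod _ h1]
  refine integral_congr_ae (Filter.Eventually.of_forall fun p => ?_)
  simp only [hg]
  rw [integral_const_mul, integral_elimKernel (hcpos p) (he0 p), mul_one]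

end ElimMeasure

/-! ### Test functions have rapidly decreasing densities -/

section SinhClosure

variable {V : Type*} {s : Finset V} {A : Type*} [Ring A] [Algebra ℂ A]

theorem smul_mem_sinhSchwartz [DecidableEq V] {φ : Pts s → ℝ} (hφ : HasTemperateGrowth fun x => φ (arsinhPts x))
    {f : Pts s → A} (hf : f ∈ sinhSchwartz s A) :
    (fun p => (φ p : ℂ) • f p) ∈ sinhSchwartz s A := by
  have hc : HasTemperateGrowth fun x : Pts s => (φ (arsinhPts x) : ℂ) :=
    Function.Complex.hasTemperateGrowth_ofReal.comp hφ
  obtain ⟨N, h, a, e⟩ := exists_of_mem_sinhSchwartz hf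
  have : (fun p => (φ p : ℂ) • f p) = ∑ i, fun p => (φ p : ℂ) • h i (sinhPts p) • a i := by
    funext p
    simp [e, Finset.smul_sum]
  rw [this]
  refine Submodule.sum_mem _ fun i _ => Submodule.subset_span
    ⟨SchwartzMap.smulLeftCLM ℂ (fun x : Pts s => (φ (arsinhPts x) : ℂ)) (h i), a i, ?_⟩
  funext p
  rw [SchwartzMap.smulLeftCLM_apply_apply hc, arsinhPts_sinhPts, smul_smul, smul_eq_mul]

theorem map_mem_sinhSchwartz (Λ : A →ₗ[ℂ] A) {f : Pts s → A} (hf : f ∈ sinhSchwartz s A) :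
    (fun p => Λ (f p)) ∈ sinhSchwartz s A := by
  obtain ⟨N, h, a, e⟩ := exists_of_mem_sinhSchwartz hf
  have : (fun p => Λ (f p)) = ∑ i, fun p => h i (sinhPts p) • Λ (a i) := by
    funext p
    simp [e]
  rw [this]
  exact Submodule.sum_mem _ fun i _ => Submodule.subset_span ⟨h i, _, rfl⟩

theorem const_mul_mem_sinhSchwartz (a : A) {f : Pts s → A} (hf : f ∈ sinhSchwartz s A) :
    (fun p => a * f p) ∈ sinhSchwartz s A :=
  map_mem_sinhSchwartz (LinearMap.mulLeft ℂ a) hf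

theorem mul_const_mem_sinhSchwartz (a : A) {f : Pts s → A} (hf : f ∈ sinhSchwartz s A) :
    (fun p => f p * a) ∈ sinhSchwartz s A :=
  map_mem_sinhSchwartz (LinearMap.mulRight ℂ a) hf

variable [DecidableEq V]

theorem temperate_exp_coord (i : s) :
    HasTemperateGrowth fun x : Pts s => Real.exp ((arsinhPts x).1 i) :=
  (temperate_exp_arsinh (B := ℝ) i).comp
    (temperate_prodMk (f := fun _ : Pts s => (0 : ℝ)) (g := fun x => x) (by fun_prop) (by fun_prop))

theorem temperate_exp_neg_coord (i : s) :
    HasTemperateGrowth fun x : Pts s => Real.exp (-(arsinhPts x).1 i) :=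
  (temperate_exp_neg_arsinh (B := ℝ) i).comp
    (temperate_prodMk (f := fun _ : Pts s => (0 : ℝ)) (g := fun x => x) (by fun_prop) (by fun_prop))

/-- The bodies of the cartesian coordinates. -/
def cartPts (p : Pts s) : Pts s :=
  (fun i => Real.sinh (p.1 i) - Real.exp (p.1 i) * (p.2 i ^ 2 / 2),
    fun i => p.2 i * Real.exp (p.1 i))

theorem temperate_cartPts : HasTemperateGrowth fun x : Pts s => cartPts (arsinhPts x) := by
  have hx : ∀ i : s, HasTemperateGrowth fun x : Pts s => x.1 i := fun i =>
    ((ContinuousLinearMap.proj i).comp (ContinuousLinearMap.fst ℝ (s → ℝ) (s → ℝ))).hasTemperateGrowth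
  have hy : ∀ i : s, HasTemperateGrowth fun x : Pts s => x.2 i := fun i =>
    ((ContinuousLinearMap.proj i).comp (ContinuousLinearMap.snd ℝ (s → ℝ) (s → ℝ))).hasTemperateGrowth
  refine temperate_prodMk (temperate_pi fun i => ?_) (temperate_pi fun i => ?_)
  · have h := temperate_exp_coord i
    have h1 := hx i
    have h2 := hy i
    simp only [arsinhPts, Real.sinh_arsinh, div_eq_mul_inv] at h ⊢
    fun_prop
  · exact (hy i).fun_mul (temperate_exp_coord i)

/-- The map from the coordinates `sinh u, s` to the cartesian coordinates is proper, with a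
polynomial bound: `cosh u ≤ z ≤ 1 + |x| + |y|` on the hyperboloid, and `s = y * exp (-u)`. -/
theorem norm_le_cartPts (x : Pts s) : ‖x‖ ≤ 8 * (1 + ‖cartPts (arsinhPts x)‖) ^ 2 := by
  obtain ⟨p, rfl⟩ : ∃ p, x = sinhPts p := ⟨arsinhPts x, by simp⟩
  rw [arsinhPts_sinhPts]
  set R := ‖cartPts p‖ with hR
  have hR0 : 0 ≤ R := norm_nonneg _
  have hz : ∀ i, Real.cosh (p.1 i) ≤ 1 + 2 * R := by
    intro i
    have h1 : |(cartPts p).1 i| ≤ R := (norm_le_pi_norm (cartPts p).1 i).trans (norm_fst_le _)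
    have h2 : |(cartPts p).2 i| ≤ R := (norm_le_pi_norm (cartPts p).2 i).trans (norm_snd_le _)
    have h3 : (Real.cosh (p.1 i) + Real.exp (p.1 i) * (p.2 i ^ 2 / 2)) ^ 2 =
        1 + (cartPts p).1 i ^ 2 + (cartPts p).2 i ^ 2 := by
      have h4 := Real.cosh_sq (p.1 i)
      have h5 := Real.cosh_add_sinh (p.1 i)
      simp only [cartPts]
      rw [← h5]
      linear_combination h4
    have h4 : 0 ≤ Real.exp (p.1 i) * (p.2 i ^ 2 / 2) := by positivity
    refine le_trans (le_add_of_nonneg_right h4) (abs_le_of_sq_le_sq' ?_ (by positivity)).2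
    rw [h3]
    nlinarith [sq_le_sq' (abs_le.1 h1).1 (abs_le.1 h1).2, sq_le_sq' (abs_le.1 h2).1 (abs_le.1 h2).2]
  rw [Prod.norm_def]
  refine max_le ((pi_norm_le_iff_of_nonneg (by positivity)).2 fun i => ?_)
    ((pi_norm_le_iff_of_nonneg (by positivity)).2 fun i => ?_)
  · change |Real.sinh (p.1 i)| ≤ _
    have h1 := hz i
    have h2 := Real.sinh_lt_cosh |p.1 i|
    rw [Real.cosh_abs] at h2
    rw [Real.abs_sinh]
    nlinarith
  · change |p.2 i| ≤ _
    have h2 : |(cartPts p).2 i| ≤ R := (norm_le_pi_norm (cartPts p).2 i).trans (norm_snd_le _)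
    have h3 : p.2 i = (cartPts p).2 i * Real.exp (-p.1 i) := by
      simp [cartPts, mul_assoc, ← Real.exp_add]
    have h4 : Real.exp (-p.1 i) ≤ 2 * (1 + 2 * R) := by
      have h5 := Real.cosh_eq (p.1 i)
      nlinarith [hz i, Real.exp_pos (p.1 i)]
    rw [h3, abs_mul, abs_of_pos (Real.exp_pos _)]
    calc |(cartPts p).2 i| * Real.exp (-p.1 i) ≤ R * (2 * (1 + 2 * R)) :=
          mul_le_mul h2 h4 (Real.exp_pos _).le hR0
      _ ≤ _ := by nlinarith

theorem taylorPart_mem_sinhSchwartz {C : Type*} [Fintype C] (e : C → Pts s) {N : Pts s → C → A}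
    {r : C → Pts s → ℝ} (hr : ∀ c, HasTemperateGrowth fun x => r c (arsinhPts x)) {b : C → A}
    (hN : ∀ p c, N p c = (r c p : ℂ) • b c) (j : ℕ) (h : 𝓢(Pts s, ℂ)) :
    (fun p => taylorPart e (N p) (cartPts p) j h) ∈ sinhSchwartz s A := by
  induction j generalizing h with
  | zero =>
    have hup : ∃ (k : ℕ) (C : ℝ), ∀ x : Pts s, ‖x‖ ≤ C * (1 + ‖cartPts (arsinhPts x)‖) ^ k :=
      ⟨2, 8, norm_le_cartPts⟩
    refine Submodule.subset_span ⟨SchwartzMap.compCLM ℂ temperate_cartPts hup h, 1, ?_⟩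
    funext p
    change algebraMap ℂ A (h (cartPts p)) = h (cartPts (arsinhPts (sinhPts p))) • (1 : A)
    rw [arsinhPts_sinhPts, Algebra.algebraMap_eq_smul_one]
  | succ j ih =>
    have : (fun p => taylorPart e (N p) (cartPts p) (j + 1) h) = ∑ c, fun p =>
        (r c p : ℂ) • (taylorPart e (N p) (cartPts p) j
          (SchwartzMap.evalCLM ℂ (Pts s) ℂ (e c) (SchwartzMap.fderivCLM ℂ (Pts s) ℂ h)) * b c) := by
      funext p
      rw [Finset.sum_apply]
      refine Finset.sum_congr rfl fun c _ => ?_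
      rw [hN p c, mul_smul_comm]
      rfl
    rw [this]
    exact Submodule.sum_mem _ fun c _ =>
      smul_mem_sinhSchwartz (hr c) (mul_const_mem_sinhSchwartz _ (ih _))

end SinhClosure

section TestDensity

variable {V E : Type*} [AddCommGroup E] [Module ℂ E] [LinearOrder V] {s : Finset V}

theorem isOdd_psiBar_mul_psi_body (i : V) : body (psiBar i * psi i : Alg V E) = 0 := by
  have h : body (psiBar i * psi i : Alg V E) = body (psiBar i : Alg V E) * body (psi i : Alg V E) :=
    map_mul (ExteriorAlgebra.algebraMapInv (R := ℂ) (M := Gen V E)) _ _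
  rw [h, (isOdd_psi (E := E) i).body_eq_zero, mul_zero]

theorem psiBar_mul_psi_sq (i : V) : (psiBar i * psi i : Alg V E) * (psiBar i * psi i) = 0 := by
  simpa [pow_two] using (isOdd_psiBar (E := E) i).mul_mul_self (isOdd_psi i)

theorem cartX_some (u t : s → ℝ) (i : s) : (cartX u t (some i) : Alg V E) =
    algebraMap ℂ _ (((cartPts (u, t)).1 i : ℝ) : ℂ) +
      ((-Real.exp (u i) : ℝ) : ℂ) • (psiBar (i : V) * psi (i : V)) := by
  simp only [cartX, cartPts, ext0_some, psiBarT, psiT, smul_add, Complex.ofReal_sub,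
    Complex.ofReal_mul, map_sub, map_mul, Complex.ofReal_neg, neg_smul]
  rw [← Algebra.smul_def]
  abel

/-- A Schwartz function of the superfunctions `x_i`, `y_i` is a finite sum of its derivatives at the
bodies times nilpotent elements, and the coefficients have temperate growth. -/
theorem taylor_cart_mem (h : 𝓢(Pts s, ℂ)) :
    (fun p : Pts s => taylor (fun i => (cartX p.1 p.2 (some i) : Alg V E))
      (fun i => cartY p.1 p.2 (some i)) h) ∈ sinhSchwartz s (Alg V E) := by
  set b : s ⊕ s → Alg V E := Sum.elim (fun i => psiBar (i : V) * psi (i : V)) fun _ => 0 with hb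
  set r : s ⊕ s → Pts s → ℝ := Sum.elim (fun i p => -Real.exp (p.1 i)) fun _ _ => 0 with hr
  have hsoul : ∀ p : Pts s, ∀ c, soul (Sum.elim (fun i => (cartX p.1 p.2 (some i) : Alg V E))
      (fun i => cartY p.1 p.2 (some i)) c) = (r c p : ℂ) • b c := by
    rintro p (i | i)
    · simp only [Sum.elim_inl, cartX_some, soul_add, soul_algebraMap, zero_add, hb, hr]
      refine soul_eq_self ?_
      have := (ExteriorAlgebra.algebraMapInv (R := ℂ) (M := Gen V E)).toLinearMap.map_smul
        ((-Real.exp (p.1 i) : ℝ) : ℂ) (psiBar (i : V) * psi (i : V))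
      refine this.trans ?_
      have h0 := isOdd_psiBar_mul_psi_body (E := E) (i : V)
      simp only [AlgHom.toLinearMap_apply]
      rw [show ExteriorAlgebra.algebraMapInv (psiBar (i : V) * psi (i : V) : Alg V E) = 0 from h0,
        smul_zero]
    · simp only [Sum.elim_inr, cartY, soul_algebraMap, hb, smul_zero]
  have hbody : ∀ p : Pts s, ((fun i => (body (cartX p.1 p.2 (some i) : Alg V E)).re,
      fun i => (body (cartY p.1 p.2 (some i) : Alg V E)).re) : Pts s) = cartPts p := by
    intro p
    have hX : ∀ i : s, body (cartX p.1 p.2 (some i) : Alg V E) = ((cartPts p).1 i : ℝ) := by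
      intro i
      have h1 := congrArg (fun z => cartX p.1 p.2 (some i) - z) (hsoul p (.inl i))
      simp only [Sum.elim_inl, hb, hr] at h1
      rw [soul, sub_sub_cancel, cartX_some, add_sub_cancel_right, ← cartX_some] at h1
      exact (algebraMap ℂ (Alg V E)).injective h1
    refine Prod.ext (funext fun i => ?_) (funext fun i => ?_)
    · simp only [hX, Complex.ofReal_re]
    · simp only [cartY, cartPts, ext0_some, body_algebraMap, Complex.ofReal_re]
  -- the nilpotent parts are multiples of the finitely many elements `ψbar i * ψ i` with square zero
  have hM : ∀ p : Pts s, ∀ k, 2 * Fintype.card s < k → ∀ c : Fin k → s ⊕ s,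
      (List.ofFn fun l => soul (Sum.elim (fun i => (cartX p.1 p.2 (some i) : Alg V E))
        (fun i => cartY p.1 p.2 (some i)) (c l))).prod = 0 := by
    intro p k hk c
    refine list_prod_eq_zero_of_sqZero
      (Finset.univ.toList.map fun i : s => (psiBar (i : V) * psi (i : V) : Alg V E))
      ?_ ?_ _ ?_ (by simpa using hk)
    · intro m hm
      obtain ⟨i, -, rfl⟩ := List.mem_map.1 hm
      exact ((isOdd_psiBar (E := E) (i : V)).mul (isOdd_psi (i : V))).commute
    · intro m hm
      obtain ⟨i, -, rfl⟩ := List.mem_map.1 hm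
      exact psiBar_mul_psi_sq (i : V)
    · intro m hm
      obtain ⟨l, rfl⟩ := (List.mem_ofFn' _ _).1 hm
      change soul (Sum.elim _ _ (c l)) ∈ _
      rw [hsoul]
      refine Submodule.smul_mem _ _ ?_
      rcases c l with i | i
      · exact Submodule.subset_span (List.mem_map.2 ⟨i, Finset.mem_toList.2 (Finset.mem_univ i), rfl⟩)
      · exact Submodule.zero_mem _
  simp only [taylor_eq_sum _ _ (h.smooth ⊤) (hM _)]
  simp only [hbody]
  have hsum : ∀ (f : ℕ → Pts s → Alg V E) (n : ℕ), (∀ j, f j ∈ sinhSchwartz s (Alg V E)) →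
      (fun p => ∑ j ∈ Finset.range n, ((j.factorial : ℂ)⁻¹) • f j p) ∈
        sinhSchwartz s (Alg V E) := by
    intro f n hf
    have := Submodule.sum_mem (sinhSchwartz s (Alg V E)) fun j (_ : j ∈ Finset.range n) =>
      Submodule.smul_mem _ ((j.factorial : ℂ)⁻¹) (hf j)
    refine (congrArg (· ∈ sinhSchwartz s (Alg V E)) (funext fun p => ?_)).mp this
    simp
  refine hsum (fun j p => taylorPart basisVec _ (cartPts p) j h) _ fun j =>
    taylorPart_mem_sinhSchwartz basisVec (r := r) (b := b) ?_ hsoul j h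
  rintro (i | i)
  · exact (temperate_exp_coord i).fun_neg
  · exact HasTemperateGrowth.const 0

/-- Products of the variables `e^u ψbar`, `e^u ψ` only contribute coefficients of temperate growth. -/
theorem mul_oddProd_mem {f : Pts s → Alg V E} (hf : f ∈ sinhSchwartz s (Alg V E))
    (c : s → Alg V E) (I : Finset s) :
    (fun p => f p * oddProd (fun i => (Real.exp (p.1 i) : ℂ) • c i) I) ∈
      sinhSchwartz s (Alg V E) := by
  unfold oddProd
  induction I.sort (· ≤ ·) generalizing f with
  | nil => simpa using hf
  | cons i l ih =>
    simp only [List.map_cons, List.prod_cons, ← mul_assoc]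
    refine ih ?_
    simp only [mul_smul_comm]
    exact smul_mem_sinhSchwartz (temperate_exp_coord i) (mul_const_mem_sinhSchwartz _ hf)

/-- A Schwartz superfunction in horospherical coordinates. -/
theorem SuperFun.IsSchwartz.hor_mem {F : SuperFun s E} (hF : F.IsSchwartz) :
    (fun p : Pts s => F.hor p.1 p.2) ∈ sinhSchwartz s (Alg V E) := by
  have hc : ∀ I J, (fun p : Pts s => evalCoeff (fun i => (cartX p.1 p.2 (some i) : Alg V E))
      (fun i => cartY p.1 p.2 (some i)) (F I J)) ∈ sinhSchwartz s (Alg V E) := by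
    intro I J
    obtain ⟨T, hT⟩ := hF I J
    rw [← hT]
    clear hT
    induction T using TensorProduct.induction_on with
    | zero =>
      simp only [map_zero]
      exact Submodule.zero_mem _
    | add x y hx hy =>
      simp only [map_add]
      exact Submodule.add_mem _ hx hy
    | tmul h c => exact mul_const_mem_sinhSchwartz (par c) (taylor_cart_mem h)
  have := Submodule.sum_mem (sinhSchwartz s (Alg V E)) fun I (_ : I ∈ Finset.univ) =>
    Submodule.sum_mem (sinhSchwartz s (Alg V E)) fun J (_ : J ∈ Finset.univ) =>
      mul_oddProd_mem (mul_oddProd_mem (hc I J) (fun i => psiBar (i : V)) I)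
        (fun i => psi (i : V)) J
  refine (congrArg (· ∈ sinhSchwartz s (Alg V E)) (funext fun p => ?_)).mp this
  simp only [Finset.sum_apply]
  rfl

/-- The source term is a polynomial in the `e^{u_i}` with nilpotent coefficients. -/
theorem tauExp_mul_mem {τ : V → ParAlg E} (hτ : ∀ i, IsOdd (τ i)) {f : Pts s → Alg V E}
    (hf : f ∈ sinhSchwartz s (Alg V E)) :
    (fun p => tauExp τ p.1 * f p) ∈ sinhSchwartz s (Alg V E) := by
  unfold tauExp
  induction (Finset.univ : Finset s) using Finset.induction with
  | empty => simpa [superExp_of_sq] using hf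
  | insert i I hi ih =>
    have he : ∀ (p : Pts s) (j : s), IsEven ((par (τ j) : Alg V E) *
        ((Real.exp (p.1 j) : ℂ) • (psiBar (j : V) + Complex.I • psi (j : V)))) := fun p j =>
      (hτ j).par.mul ((isOdd_psiBar_add _).smul _)
    simp only [Finset.sum_insert hi]
    -- `exp (x + y) f = exp y f + x exp y f` for a summand `x` with square zero
    have e : ∀ p : Pts s, superExp ((par (τ i) : Alg V E) *
        ((Real.exp (p.1 i) : ℂ) • (psiBar (i : V) + Complex.I • psi (i : V))) +
        ∑ j ∈ I, (par (τ j) : Alg V E) *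
          ((Real.exp (p.1 j) : ℂ) • (psiBar (j : V) + Complex.I • psi (j : V)))) * f p =
        superExp (∑ j ∈ I, (par (τ j) : Alg V E) *
          ((Real.exp (p.1 j) : ℂ) • (psiBar (j : V) + Complex.I • psi (j : V)))) * f p +
        (Real.exp (p.1 i) : ℂ) • ((par (τ i) * (psiBar (i : V) + Complex.I • psi (i : V))) *
          (superExp (∑ j ∈ I, (par (τ j) : Alg V E) *
            ((Real.exp (p.1 j) : ℂ) • (psiBar (j : V) + Complex.I • psi (j : V)))) * f p)) := by
      intro p
      rw [superExp_add (he p i) (IsEven.sum fun j _ => he p j),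
        superExp_of_sq (tauTerm_mul_self (hτ i) _ _), mul_smul_comm, add_mul, one_mul, add_mul,
        smul_mul_assoc, smul_mul_assoc, mul_assoc]
    simp only [e]
    exact Submodule.add_mem _ ih (smul_mem_sinhSchwartz (temperate_exp_coord i)
      (const_mul_mem_sinhSchwartz _ ih))

/-- In horospherical coordinates the superdensity is the exponential of the action. -/
theorem rho_eq_superExp_actionCart {w : Option s → Option s → ParAlg E}
    (hs : ∀ i j, w i j = w j i) (h0 : ∀ i, w i i = 0) (he : ∀ i j, IsEven (w i j))
    (u t : s → ℝ) : rho w u t = superExp (actionCart w u t) := by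
  have hodd : ∀ i j : Option s, IsEven ((psiBarT i - psiBarT j) * (psiT i - psiT j) : Alg V E) :=
    fun i j => IsOdd.mul (Submodule.sub_mem _ (isOdd_psiBarT i) (isOdd_psiBarT j))
      (Submodule.sub_mem _ (isOdd_psiT i) (isOdd_psiT j))
  have e1 : ∀ c : Option s → Option s → ℝ,
      IsEven (∑ i, ∑ j, (c i j : ℂ) • (par (w i j) : Alg V E)) := fun c =>
    IsEven.sum fun i _ => IsEven.sum fun j _ => (he i j).par.smul _
  have e2 : ∀ c : Option s → Option s → ℝ, IsEven (∑ i, ∑ j, (c i j : ℂ) •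
      ((par (w i j) : Alg V E) * ((psiBarT i - psiBarT j) * (psiT i - psiT j)))) := fun c =>
    IsEven.sum fun i _ => IsEven.sum fun j _ => ((he i j).par.mul (hodd i j)).smul _
  rw [rho_eq hs h0 he, ← superExp_add (e1 _) (e2 _), ← superExp_add ((e1 _).add (e2 _)) (e1 _)]
  congr 1
  rw [actionCart, ← neg_smul]
  simp only [← Finset.sum_add_distrib, Finset.smul_sum]
  refine Finset.sum_congr rfl fun i _ => Finset.sum_congr rfl fun j _ => ?_
  have key : (-1 - cartX u t i * cartX u t j - cartY u t i * cartY u t j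
      + cartZ u t i * cartZ u t j - cartXi u i * cartEta u j + cartEta u i * cartXi u j :
        Alg V E) =
      algebraMap ℂ _ ((Real.cosh (ext0 u i - ext0 u j) - 1 +
        Real.exp (ext0 u i + ext0 u j) * ((ext0 t i - ext0 t j) ^ 2 / 2) : ℝ) : ℂ) +
      ((Real.exp (ext0 u i + ext0 u j) : ℝ) : ℂ) •
        ((psiBarT i - psiBarT j) * (psiT i - psiT j)) := by
    have hsw : (psiT i * psiBarT j : Alg V E) = -(psiBarT j * psiT i) :=
      (isOdd_psiT i).mul_swap (isOdd_psiBarT j)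
    rw [Real.exp_add]
    simp only [cartX, cartY, cartZ, cartXi, cartEta, Algebra.algebraMap_eq_smul_one, sub_mul,
      mul_sub, add_mul, mul_add, smul_mul_assoc, mul_smul_comm, one_mul, mul_one, smul_add,
      smul_sub, hsw, Real.cosh_sub, ← Real.cosh_add_sinh]
    generalize Real.cosh (ext0 u i) = C₁
    generalize Real.cosh (ext0 u j) = C₂
    generalize Real.sinh (ext0 u i) = S₁
    generalize Real.sinh (ext0 u j) = S₂
    match_scalars <;> ring
  rw [key, mul_add, ← Algebra.commutes, ← Algebra.smul_def, mul_smul_comm]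
  generalize (par (w i j) : Alg V E) * _ = z
  match_scalars <;> ring

/-- The density of an admissible superfunction is rapidly decreasing. -/
theorem IsTest.density_mem {w : Option s → Option s → ParAlg E}
    (hs : ∀ i j, w i j = w j i) (h0 : ∀ i, w i i = 0) (he : ∀ i j, IsEven (w i j))
    {g : SuperFun s E} (hg : IsTest w (varpiEval subset_rfl g w)) {τ : V → ParAlg E}
    (hτ : ∀ i, IsOdd (τ i)) : density subset_rfl g τ w ∈ sinhSchwartz s (Alg V E) := by
  obtain ⟨F, hF, hFg⟩ := hg
  have h1 := map_mem_sinhSchwartz (berezin s) (tauExp_mul_mem hτ hF.hor_mem)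
  have hT : HasTemperateGrowth fun x : Pts s =>
      ∏ i, Real.exp (-(arsinhPts x).1 i) / (2 * Real.pi) := by
    refine temperate_prod fun i _ => ?_
    simp only [div_eq_mul_inv]
    exact (temperate_exp_neg_coord i).fun_mul (HasTemperateGrowth.const _)
  have h2 := smul_mem_sinhSchwartz (φ := fun p => ∏ i, Real.exp (-p.1 i) / (2 * Real.pi)) hT h1
  refine (congrArg (· ∈ sinhSchwartz s (Alg V E)) (funext fun p => ?_)).mp h2
  have hev : IsEven (tauExp τ p.1 : Alg V E) := isEven_superExp
    (IsEven.sum fun i _ => (hτ i).par.mul ((isOdd_psiBar_add _).smul _))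
  rw [density, ← hFg, ← rho_eq_superExp_actionCart hs h0 he, ← mul_assoc, ← mul_assoc,
    (hev.commute _).eq]

end TestDensity

open Filter Topology

/-! ### Positive weights as values of affine families of networks -/

/-- Symmetric even weights with real positive bodies on the edges of a connected graph. -/
structure IsPosWeight {V E : Type*} [AddCommGroup E] [Module ℂ E] {s : Finset V}
    (w : Option s → Option s → ParAlg E) : Prop where
  symm : ∀ i j, w i j = w j i
  diag : ∀ i, w i i = 0
  even : ∀ i j, IsEven (w i j)
  pos : ∀ i j, w i j = 0 ∨ ∃ r : ℝ, 0 < r ∧ body (w i j) = r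
  conn : ∀ i, Relation.ReflTransGen (fun i j => w i j ≠ 0) i none

section Families

universe v
variable {V : Type v} {E : Type*} [AddCommGroup E] [Module ℂ E] {s : Finset V}

open Classical in
/-- The parameters are the elements with square zero into which the nilpotent parts of the weights
decompose. -/
theorem IsPosWeight.exists_family {w : Option s → Option s → ParAlg E} (h : IsPosWeight w) :
    ∃ (K : Type v) (_ : Fintype K) (_ : DecidableEq K) (m : K → ParAlg E) (L : List K)
      (b : Option s → Option s → ℝ) (Λ : Option s → Option s → K → ℝ), IsFamily m L b Λ w ∧
        ∀ i j, (w i j = 0 → Λ i j = 0) ∧ body (w i j) = b i j := by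
  have hl : ∀ i j, ∃ l : List (ParAlg E), (∀ m ∈ l, IsEven m ∧ m * m = 0) ∧
      soul (w i j) = l.sum ∧ (w i j = 0 → l = []) := by
    intro i j
    by_cases h0 : w i j = 0
    · refine ⟨[], by simp, ?_, fun _ => rfl⟩
      rw [h0]
      simpa using soul_algebraMap (F := E) 0
    · obtain ⟨l, h1, h2⟩ := (h.even i j).exists_sqZero
      exact ⟨l, h1, h2, fun h => absurd h h0⟩
  choose l hl1 hl2 hl3 using hl
  have hb : ∀ i j, body (w i j) = ((body (w i j)).re : ℝ) := by
    intro i j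
    rcases h.pos i j with h0 | ⟨r, -, hr⟩
    · simp [h0, body_zero]
    · simp [hr]
  let K := Σ q : Option s × Option s, Fin (l q.1 q.2).length
  let m : K → ParAlg E := fun k => (l k.1.1 k.1.2).get k.2
  -- each unordered pair carries the parameters of both of its orders, with coefficient `1 / 2`
  let Λ : Option s → Option s → K → ℝ := fun i j k =>
    1 / 2 * ((if (i, j) = k.1 then 1 else 0) + if (j, i) = k.1 then 1 else 0)
  have hsum : ∀ i j : Option s, (∑ k : K, (if (i, j) = k.1 then (1 : ℂ) else 0) • m k) =
      soul (w i j) := by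
    intro i j
    rw [Fintype.sum_sigma, Finset.sum_eq_single (i, j)]
    · simp only [if_true, one_smul, m]
      rw [hl2, ← List.sum_ofFn]
      congr 1
      exact List.ofFn_get _
    · intro q _ hq
      exact Finset.sum_eq_zero fun k _ => by rw [if_neg (Ne.symm hq), zero_smul]
    · simp
  have hzero : ∀ i j, w i j = 0 → Λ i j = 0 := by
    intro i j h0
    have h0' : w j i = 0 := h.symm j i ▸ h0
    funext k
    have h1 : ∀ i j, w i j = 0 → (i, j) ≠ k.1 := by
      rintro i j h0 he
      have hk := k.2.2
      have : l k.1.1 k.1.2 = [] := by rw [← he]; exact hl3 i j h0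
      simp [this] at hk
    simp [Λ, h1 i j h0, h1 j i h0']
  refine ⟨K, inferInstance, Classical.decEq _, m, Finset.univ.toList,
    fun i j => (body (w i j)).re, Λ, ⟨fun k => (hl1 _ _ _ (List.get_mem _ _)).1,
      fun k => (hl1 _ _ _ (List.get_mem _ _)).2, fun i j => ?_, fun i j => by rw [h.symm],
      fun i => ?_, fun i j => ?_, fun i => hzero i i (h.diag i)⟩,
    fun i j => ⟨hzero i j, hb i j⟩⟩
  · have h1 : (Finset.univ.toList.map fun k : K => (Λ i j k : ℂ) • m k).sum =
        ∑ k : K, (Λ i j k : ℂ) • m k := by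
      rw [Finset.sum_map_toList]
    have h2 : (∑ k : K, (Λ i j k : ℂ) • m k) = (1 / 2 : ℂ) • (soul (w i j) + soul (w j i)) := by
      rw [← hsum, ← hsum, ← Finset.sum_add_distrib, Finset.smul_sum]
      refine Finset.sum_congr rfl fun k _ => ?_
      rw [← add_smul, smul_smul]
      congr 1
      simp only [Λ]
      split_ifs <;> simp
    have h3 : (1 / 2 : ℂ) • (soul (w i j) + soul (w j i)) = soul (w i j) := by
      rw [h.symm j i]
      module
    rw [h1, h2, h3, ← hb]
    exact (algebraMap_body_add_soul _).symm
  · rw [h.diag, body_zero, Complex.zero_re]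
  · funext k
    simp only [Λ]
    ring

variable {K : Type*} [Fintype K] [DecidableEq K] {m : K → ParAlg E} {L : List K}
  {b : Option s → Option s → ℝ} {Λ : Option s → Option s → K → ℝ}
  {w : Option s → Option s → ParAlg E}

/-- Near the parameter `0`, the weights of an affine family are at least half of those at `0`. -/
theorem IsPosWeight.eventually_isNetwork (h : IsPosWeight w) (hf : IsFamily m L b Λ w)
    (hb : ∀ i j, (w i j = 0 → Λ i j = 0) ∧ body (w i j) = b i j) :
    (∀ᶠ t in 𝓝 (0 : K → ℝ), IsNetwork (fun i j => b i j / 2) (affW b Λ t)) ∧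
      IsNetwork (fun i j => b i j / 2) fun i j => b i j / 2 := by
  have hpos : ∀ i j, w i j ≠ 0 → 0 < b i j := by
    intro i j h0
    rcases h.pos i j with h1 | ⟨r, hr, h1⟩
    · exact absurd h1 h0
    · have := (hb i j).2.symm.trans h1
      rwa [Complex.ofReal_inj.1 this]
  have hzero : ∀ i j, w i j = 0 → b i j = 0 := by
    intro i j h0
    have h1 := (hb i j).2
    rw [h0] at h1
    exact_mod_cast h1.symm.trans body_zero
  have hn : ∀ i j, 0 ≤ b i j / 2 := by
    intro i j
    by_cases h0 : w i j = 0
    · simp [hzero i j h0]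
    · have := hpos i j h0; positivity
  have hconn : ∀ i, Relation.ReflTransGen (fun i j => 0 < b i j / 2) i none := fun i =>
    Relation.ReflTransGen.mono (fun i j hij => half_pos (hpos i j hij)) _ _ (h.conn i)
  refine ⟨?_, ⟨fun i j => by rw [hf.b_symm], fun i => by rw [hf.b_diag]; simp, hn,
    fun _ _ => le_rfl, hconn⟩⟩
  have hle : ∀ i j, ∀ᶠ t in 𝓝 (0 : K → ℝ), b i j / 2 ≤ affW b Λ t i j := by
    intro i j
    by_cases h0 : w i j = 0
    · refine Eventually.of_forall fun t => ?_
      simp [affW, hzero i j h0, (hb i j).1 h0]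
    · have hc : Continuous fun t : K → ℝ => affW b Λ t i j := by
        unfold affW
        fun_prop
      have h1 : b i j / 2 < affW b Λ 0 i j := by
        simp only [affW, Pi.zero_apply, mul_zero, Finset.sum_const_zero, add_zero]
        exact half_lt_self (hpos i j h0)
      exact ((hc.tendsto 0).eventually (lt_mem_nhds h1)).mono fun t ht => ht.le
  filter_upwards [eventually_all.2 fun i => eventually_all.2 (hle i)] with t ht
  exact ⟨hf.affW_symm t, hf.affW_diag t, hn, ht, hconn⟩

/-- A family which is bounded below by a connected network near the parameter `0` can be modified
away from `0` such that it is so everywhere. -/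
theorem exists_temperate_cutoff {b₀ : Option s → Option s → ℝ}
    (h : ∀ᶠ t in 𝓝 (0 : K → ℝ), IsNetwork b₀ (affW b Λ t)) :
    ∃ (B : (K → ℝ) → Option s → Option s → ℝ) (χ : 𝓢(K → ℝ, ℂ)),
      (∀ i j, HasTemperateGrowth fun t => B t i j) ∧ (∀ t, IsNetwork b₀ (B t)) ∧
        ∀ᶠ t in 𝓝 (0 : K → ℝ), B t = affW b Λ t ∧ χ t = 1 := by
  obtain ⟨ε, hε, hball⟩ := Metric.eventually_nhds_iff_ball.1 h
  -- replace the parameter `t` by `φ t • t`, which stays in the ball of radius `ε` and agrees with `t`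
  -- near `0`
  let φ : ContDiffBump (0 : K → ℝ) := ⟨ε / 4, ε / 2, by positivity, by linarith⟩
  have hφ : ContDiff ℝ ∞ φ := φ.contDiff
  have hσ : ContDiff ℝ ∞ fun t : K → ℝ => φ t • t := hφ.smul contDiff_id
  have hσc : HasCompactSupport fun t : K → ℝ => φ t • t := φ.hasCompactSupport.smul_right
  have hσt := hσc.hasTemperateGrowth hσ
  have hχ : ContDiff ℝ ∞ fun t : K → ℝ => (φ t : ℂ) := contDiff_ofReal hφ
  have hχc : HasCompactSupport fun t : K → ℝ => (φ t : ℂ) :=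
    φ.hasCompactSupport.comp_left (g := fun r : ℝ => (r : ℂ)) Complex.ofReal_zero
  refine ⟨fun t => affW b Λ (φ t • t), hχc.toSchwartzMap hχ, fun i j => ?_, fun t => ?_, ?_⟩
  · have hk : ∀ k, HasTemperateGrowth fun t : K → ℝ => (φ t • t) k := fun k =>
      (ContinuousLinearMap.proj (R := ℝ) (φ := fun _ : K => ℝ) k).hasTemperateGrowth.comp hσt
    exact (HasTemperateGrowth.const _).fun_add (HasTemperateGrowth.sum fun k _ =>
      (HasTemperateGrowth.const _).fun_mul (hk k))
  · refine hball _ ?_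
    rw [mem_ball_zero_iff, norm_smul, Real.norm_of_nonneg φ.nonneg]
    by_cases ht : t ∈ Metric.ball (0 : K → ℝ) (ε / 2)
    · rw [mem_ball_zero_iff] at ht
      calc φ t * ‖t‖ ≤ 1 * ‖t‖ := mul_le_mul_of_nonneg_right φ.le_one (norm_nonneg _)
        _ < ε := by linarith
    · have : φ t = 0 := φ.zero_of_le_dist (by simpa [Metric.mem_ball] using ht)
      rw [this, zero_mul]
      exact hε
  · filter_upwards [φ.eventuallyEq_one] with t ht
    have ht' : φ t = 1 := ht
    exact ⟨by rw [ht', one_smul], by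
      change ((φ t : ℝ) : ℂ) = 1
      rw [ht', Complex.ofReal_one]⟩

variable [DecidableEq V] {a : V}

/-- Contraction is linear in the weights, so it acts on the bodies and the coefficients of a family
separately. -/
theorem IsFamily.contract {b : Option ↥(insert a s) → Option ↥(insert a s) → ℝ}
    {Λ : Option ↥(insert a s) → Option ↥(insert a s) → K → ℝ}
    {w : Option ↥(insert a s) → Option ↥(insert a s) → ParAlg E} (h : IsFamily m L b Λ w) :
    IsFamily m L (SusySigma.contract b) (SusySigma.contract Λ) (SusySigma.contract w) where
  even := h.even
  sq := h.sq
  b_symm := contract_symm h.b_symm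
  b_diag := contract_diag h.b_diag
  Λ_symm i j := by cases i <;> cases j <;> simp [SusySigma.contract, h.Λ_symm]
  Λ_diag i := by cases i <;> simp [SusySigma.contract, h.Λ_diag]
  eq i j := by
    have hadd : ∀ (x y : ℝ) (f g : K → ℝ),
        (algebraMap ℂ (ParAlg E) (x : ℂ) + (L.map fun k => (f k : ℂ) • m k).sum) +
          (algebraMap ℂ (ParAlg E) (y : ℂ) + (L.map fun k => (g k : ℂ) • m k).sum) =
        algebraMap ℂ (ParAlg E) ((x + y : ℝ) : ℂ) +
          (L.map fun k => (((f + g) k : ℝ) : ℂ) • m k).sum := by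
      intro x y f g
      have : (fun k => (((f + g) k : ℝ) : ℂ) • m k) =
          fun k => (f k : ℂ) • m k + (g k : ℂ) • m k := by
        funext k
        simp [add_smul, -Complex.coe_smul]
      rw [this, List.sum_map_add, Complex.ofReal_add, map_add]
      abel
    rcases i with _ | i <;> rcases j with _ | j <;> simp only [SusySigma.contract]
    · simp
    · rw [h.eq, h.eq, hadd]
    · rw [h.eq, h.eq, hadd]
    · exact h.eq _ _

theorem affW_contract (b : Option ↥(insert a s) → Option ↥(insert a s) → ℝ)
    (Λ : Option ↥(insert a s) → Option ↥(insert a s) → K → ℝ) (t : K → ℝ) :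
    affW (contract b) (contract Λ) t = contract (affW b Λ t) := by
  funext i j
  rcases i with _ | i <;> rcases j with _ | j <;>
    simp only [contract, affW, Pi.add_apply, Pi.zero_apply, add_mul, zero_mul,
      Finset.sum_add_distrib, Finset.sum_const_zero] <;> ring

end Families

/-! ### Wired boundary conditions and contraction -/

section WeakSum

variable {F : Type*} [AddCommGroup F] [Module ℂ F] {ι : Type*}

theorem eq_of_forall_dual {x y : ExteriorAlgebra ℂ F}
    (h : ∀ l : Module.Dual ℂ (ExteriorAlgebra ℂ F), l x = l y) : x = y := by
  rw [← sub_eq_zero, ← Module.forall_dual_apply_eq_zero_iff ℂ]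
  intro l
  rw [map_sub, h, sub_self]

theorem HasWeakSum.weakSum_eq {f : ι → ExteriorAlgebra ℂ F} {x : ExteriorAlgebra ℂ F}
    (h : HasWeakSum f x) : weakSum f = x := by
  have hx : ∃ x, HasWeakSum f x := ⟨x, h⟩
  rw [weakSum, dif_pos hx]
  exact eq_of_forall_dual fun l => (hx.choose_spec l).unique (h l)

theorem HasWeakSum.compl {f : ι → ExteriorAlgebra ℂ F} {x : ExteriorAlgebra ℂ F}
    (h : HasWeakSum f x) (s : Finset ι) :
    HasWeakSum (fun j : {j : ι // j ∉ s} => f j) (x - ∑ j ∈ s, f j) := by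
  intro l
  refine (s.hasSum_compl_iff (f := fun j => l (f j))).2 ?_
  simpa using h l

end WeakSum

section Wired

variable {V E : Type*} [AddCommGroup E] [Module ℂ E] [DecidableEq V] {G : SimpleGraph V}
  {W : V → V → ParAlg E} {x : V → ParAlg E}

theorem wiredWeight_none (hx : ∀ i, HasWeakSum (W i) (x i)) (s : Finset V) (i : s) :
    wiredWeight W s (some i) none = x i - ∑ j ∈ s, W i j :=
  ((hx i).compl s).weakSum_eq

/-- Identifying a vertex with `δ` turns the wired weights on `insert a s` into those on `s`. -/
theorem contract_wiredWeight (hx : ∀ i, HasWeakSum (W i) (x i)) (hs : ∀ i j, W i j = W j i)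
    {s : Finset V} {a : V} (ha : a ∉ s) :
    contract (wiredWeight W (insert a s)) = wiredWeight W s := by
  have h : ∀ i : s, contract (wiredWeight W (insert a s)) (some i) none =
      wiredWeight W s (some i) none := by
    intro i
    have h1 := wiredWeight_none hx (insert a s) (incl i)
    rw [wiredWeight_none hx, contract, h1, Finset.sum_insert ha]
    change x i - (W i a + ∑ j ∈ s, W i j) + W i a = _
    abel
  funext i j
  rcases i with _ | i <;> rcases j with _ | j
  · rfl
  · refine Eq.trans ?_ (h j)
    change _ + W a j = _ + W j a
    rw [hs a j]
    rfl
  · exact h i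
  · rfl

/-- The source at `δ` collects the sources of all vertices outside. -/
theorem contract_wiredAlpha (α : V →₀ ℝ) {s : Finset V} {a : V} (ha : a ∉ s) :
    wiredAlpha α (insert a s) none + α a = wiredAlpha α s none := by
  simp only [wiredAlpha, Finset.sdiff_insert]
  by_cases h : a ∈ α.support \ s
  · exact Finset.sum_erase_add _ _ h
  · have h0 : α a = 0 := by
      by_contra h0
      exact h (Finset.mem_sdiff.2 ⟨Finsupp.mem_support_iff.2 h0, ha⟩)
    rw [Finset.erase_eq_of_notMem h, h0, add_zero]

theorem wiredAlpha_nonpos {α : V →₀ ℝ} (hα : ∀ i, α i ≤ 0) (s : Finset V) (j : Option s) :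
    wiredAlpha α s j ≤ 0 := by
  cases j with
  | none => exact Finset.sum_nonpos fun i _ => hα i
  | some i => exact hα i

/-- The weight of the edge from `i` to `δ` has positive body if `i` is adjacent to an outer vertex,
and vanishes otherwise. -/
theorem wiredWeight_cases (hW_pos : ∀ i j, G.Adj i j → ∃ r : ℝ, 0 < r ∧ body (W i j) = r)
    (hW_zero : ∀ i j, ¬ G.Adj i j → W i j = 0) (hx : ∀ i, HasWeakSum (W i) (x i))
    (s : Finset V) (i : s) :
    ((∃ j ∉ s, G.Adj i j) → ∃ r : ℝ, 0 < r ∧ body (wiredWeight W s (some i) none) = r) ∧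
      ((¬ ∃ j ∉ s, G.Adj i j) → wiredWeight W s (some i) none = 0) := by
  have hsum := (hx i).compl s
  rw [← wiredWeight_none hx s i] at hsum
  constructor
  · rintro ⟨j, hj, hij⟩
    have h1 := hsum (ExteriorAlgebra.algebraMapInv (R := ℂ) (M := E)).toLinearMap
    change HasSum (fun j : {j : V // j ∉ s} => body (W i j))
      (body (wiredWeight W s (some i) none)) at h1
    have hre : ∀ j, body (W i j) = ((body (W i j)).re : ℝ) ∧ 0 ≤ (body (W i j)).re := by
      intro j
      by_cases h : G.Adj i j
      · obtain ⟨r, hr, e⟩ := hW_pos i j h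
        simp [e, hr.le]
      · have h0 : body (W i j) = 0 := by
          rw [hW_zero i j h, body_zero]
        simp [h0]
    have h2 := Complex.hasSum_re h1
    have h3 := Complex.hasSum_im h1
    have h4 : (body (wiredWeight W s (some i) none)).im = 0 := by
      refine h3.unique ?_
      have : (fun j : {j : V // j ∉ s} => (body (W i j)).im) = fun _ => 0 := by
        funext j
        rw [(hre j).1, Complex.ofReal_im]
      rw [this]
      exact hasSum_zero
    obtain ⟨r, hr, e⟩ := hW_pos i j hij
    refine ⟨(body (wiredWeight W s (some i) none)).re, ?_, Complex.ext rfl (by simp [h4])⟩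
    refine lt_of_lt_of_le hr ?_
    have h5 := le_hasSum h2 ⟨j, hj⟩ fun k _ => (hre k).2
    simpa [e] using h5
  · intro h
    have h0 : HasWeakSum (fun j : {j : V // j ∉ s} => W i j) 0 := by
      intro l
      have : (fun j : {j : V // j ∉ s} => l (W i j)) = fun _ => 0 := funext fun j => by
        rw [hW_zero _ _ fun hij => h ⟨j, j.2, hij⟩, map_zero]
      rw [this, map_zero]
      exact hasSum_zero
    exact h0.weakSum_eq

/-- A path to `δ` for a larger set, stopped when it leaves the smaller set, is a path to `δ` for the
smaller set. -/
theorem reflTransGen_wiredGraph {s s' : Finset V} (hs : s ⊆ s') {i : Option s'}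
    (h : Relation.ReflTransGen (wiredGraph G s').Adj i none) :
    ∀ j : s, i = some ⟨j, hs j.2⟩ →
      Relation.ReflTransGen (wiredGraph G s).Adj (some j) none := by
  induction h using Relation.ReflTransGen.head_induction_on with
  | refl => rintro j ⟨⟩
  | head hik _ ih =>
    rename_i k _
    rintro j rfl
    rcases k with _ | k
    · obtain ⟨l, hl, hjl⟩ : ∃ l ∉ s', G.Adj j l := hik
      exact Relation.ReflTransGen.single (show ∃ l ∉ s, G.Adj j l from
        ⟨l, fun h => hl (hs h), hjl⟩)
    · have hjk : G.Adj j k := hik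
      by_cases hk : (k : V) ∈ s
      · exact Relation.ReflTransGen.head (show (wiredGraph G s).Adj (some j) (some ⟨k, hk⟩)
          from hjk) (ih ⟨k, hk⟩ rfl)
      · exact Relation.ReflTransGen.single (show ∃ l ∉ s, G.Adj j l from ⟨k, hk, hjk⟩)

/-- The wired weights on every subset of `s'` are positive if the graph on `s'` is connected. -/
theorem isPosWeight_wiredWeight (hW_symm : ∀ i j, W i j = W j i)
    (hW_even : ∀ i j, IsEven (W i j))
    (hW_pos : ∀ i j, G.Adj i j → ∃ r : ℝ, 0 < r ∧ body (W i j) = r)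
    (hW_zero : ∀ i j, ¬ G.Adj i j → W i j = 0) (hx : ∀ i, HasWeakSum (W i) (x i))
    {s s' : Finset V} (hs : s ⊆ s') (hconn : (wiredGraph G s').Connected) :
    IsPosWeight (wiredWeight W s) := by
  have hev : ∀ i : s, IsEven (wiredWeight W s (some i) none) := by
    intro i
    rw [wiredWeight_none hx]
    refine IsEven.sub ?_ (IsEven.sum fun j _ => hW_even _ _)
    -- a weakly convergent sum of even elements is even: otherwise a linear functional which vanishes
    -- on even elements would separate it from them
    by_contra hne
    obtain ⟨l, hl, hle⟩ := Submodule.exists_le_ker_of_notMem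
      (p := CliffordAlgebra.evenOdd (0 : QuadraticForm ℂ E) 0) hne
    refine hl ((hx i l).unique ?_)
    have : (fun j => l (W i j)) = fun _ => 0 := funext fun j => hle (hW_even i j)
    rw [this]
    exact hasSum_zero
  have hnone := wiredWeight_cases hW_pos hW_zero hx s
  have hpos : ∀ i : s, wiredWeight W s (some i) none = 0 ∨
      ∃ r : ℝ, 0 < r ∧ body (wiredWeight W s (some i) none) = r := fun i => by
    by_cases h : ∃ j ∉ s, G.Adj i j
    exacts [Or.inr ((hnone i).1 h), Or.inl ((hnone i).2 h)]
  have hne : ∀ {y : ParAlg E} {r : ℝ}, 0 < r → body y = r → y ≠ 0 := by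
    rintro y r hr e rfl
    rw [body_zero] at e
    exact hr.ne (Complex.ofReal_inj.1 (by simpa using e))
  have hsymm : ∀ i j, wiredWeight W s i j = wiredWeight W s j i := by
    rintro (_ | i) (_ | j)
    exacts [rfl, rfl, rfl, hW_symm _ _]
  have hadj : ∀ i j, (wiredGraph G s).Adj i j → wiredWeight W s i j ≠ 0 := by
    have h1 : ∀ i : s, (∃ j ∉ s, G.Adj i j) → wiredWeight W s (some i) none ≠ 0 := fun i h => by
      obtain ⟨r, hr, e⟩ := (hnone i).1 h
      exact hne hr e
    rintro (_ | i) (_ | j) h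
    · exact absurd h (SimpleGraph.irrefl _)
    · rw [hsymm]; exact h1 j h
    · exact h1 i h
    · obtain ⟨r, hr, e⟩ := hW_pos _ _ (show G.Adj i j from h)
      exact hne hr e
  refine ⟨hsymm, ?_, ?_, ?_, fun i => ?_⟩
  · rintro (_ | i)
    exacts [rfl, hW_zero _ _ (SimpleGraph.irrefl _)]
  · rintro (_ | i) (_ | j)
    exacts [Submodule.zero_mem _, hev j, hev i, hW_even _ _]
  · rintro (_ | i) (_ | j)
    · exact Or.inl rfl
    · exact hpos j
    · exact hpos i
    · by_cases h : G.Adj i j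
      exacts [Or.inr (hW_pos _ _ h), Or.inl (hW_zero _ _ h)]
  · cases i with
    | none => exact Relation.ReflTransGen.refl
    | some i =>
      have h1 := (SimpleGraph.reachable_iff_reflTransGen _ _).1
        (hconn.preconnected (some ⟨i, hs i.2⟩) none)
      exact Relation.ReflTransGen.mono hadj _ _ (reflTransGen_wiredGraph hs h1 i rfl)

end Wired

/-! ### Removing one vertex from the superintegral -/

section RealFactor

variable {V : Type*} [DecidableEq V] {s : Finset V} {a : V}

/-- The factor `exp ⟨α, e^u (1 + i s)⟩`. -/
def alphaExp (α : Option s → ℝ) (p : Pts s) : ℂ :=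
  Complex.exp (∑ j, (α j : ℂ) * (Real.exp (ext0 p.1 j) * (1 + Complex.I * ext0 p.2 j)))

theorem continuous_alphaExp (α : Option s → ℝ) : Continuous (alphaExp α) := by
  have h1 : ∀ j : Option s, Continuous fun p : Pts s => ext0 p.1 j := by
    rintro (_ | j)
    · exact continuous_const
    · exact (continuous_apply j).comp continuous_fst
  have h2 : ∀ j : Option s, Continuous fun p : Pts s => ext0 p.2 j := by
    rintro (_ | j)
    · exact continuous_const
    · exact (continuous_apply j).comp continuous_snd
  unfold alphaExp
  fun_prop

theorem norm_alphaExp_le {α : Option s → ℝ} (hα : ∀ j, α j ≤ 0) (p : Pts s) :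
    ‖alphaExp α p‖ ≤ 1 := by
  rw [alphaExp, Complex.norm_exp, Real.exp_le_one_iff, Complex.re_sum]
  refine Finset.sum_nonpos fun j _ => ?_
  have : ((α j : ℂ) * (Real.exp (ext0 p.1 j) * (1 + Complex.I * ext0 p.2 j))).re =
      α j * Real.exp (ext0 p.1 j) := by
    simp [-Complex.ofReal_exp]
  rw [this]
  exact mul_nonpos_of_nonpos_of_nonneg (hα j) (Real.exp_pos _).le

/-- The factor which contains `α` splits under elimination, with the source
`α_a + ∑ κ_i α_i` at the removed vertex. -/
theorem alphaExp_elim {b : Option ↥(insert a s) → Option ↥(insert a s) → ℝ}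
    {p' : Pts (insert a s)} {κ : s → ℝ} {p : Pts s} (h : IsElim b p' κ p) (ha : a ∉ s)
    {α' : Option ↥(insert a s) → ℝ} {α : Option s → ℝ} (hα : ∀ i : s, α' (some (incl i)) = α (some i))
    (hα0 : α' none + α' (some newV) = α none) :
    alphaExp α' p' = Complex.exp (((α' (some newV) + ∑ i, α (some i) * κ i : ℝ) : ℂ) *
      ((Real.exp (p'.1 newV) - 1) + Complex.I * (Real.exp (p'.1 newV) * p'.2 newV))) *
        alphaExp α p := by
  rw [alphaExp, alphaExp, ← Complex.exp_add]
  congr 1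
  rw [Fintype.sum_option, Fintype.sum_option, sum_insert_subtype ha]
  simp only [ext0_some, ext0_none, hα, Real.exp_zero, Complex.ofReal_zero, mul_zero, add_zero,
    Complex.ofReal_one, mul_one]
  have h1 : ∀ i : s, (α (some i) : ℂ) *
      (Real.exp (p'.1 (incl i)) * (1 + Complex.I * p'.2 (incl i))) =
      α (some i) * (Real.exp (p.1 i) * (1 + Complex.I * p.2 i)) + (α (some i) * κ i) *
        ((Real.exp (p'.1 newV) - 1) + Complex.I * (Real.exp (p'.1 newV) * p'.2 newV)) := by
    intro i
    have e1 := congrArg (fun r : ℝ => (r : ℂ)) (h.exp i)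
    have e2 := congrArg (fun r : ℝ => (r : ℂ)) (h.s i)
    push_cast at e1 e2 ⊢
    linear_combination -(α (some i) : ℂ) * e1 - (α (some i) : ℂ) * Complex.I * e2
  simp only [h1, Finset.sum_add_distrib, ← Finset.sum_mul, ← hα0]
  push_cast
  ring

/-- The identity of the integrals for real weights. The sign of `α` and `κ ≥ 0` make the source at
the removed vertex nonpositive. -/
theorem integral_elim_alphaExp {b₀ b : Option ↥(insert a s) → Option ↥(insert a s) → ℝ}
    (ha : a ∉ s) (h₀ : IsNetwork b₀ b₀) (h : IsNetwork b₀ b)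
    {α' : Option ↥(insert a s) → ℝ} {α : Option s → ℝ} (hα'0 : ∀ j, α' j ≤ 0)
    (hα : ∀ i : s, α' (some (incl i)) = α (some i)) (hα0 : α' none + α' (some newV) = α none)
    {f : Pts s → ℂ} (hf : Continuous f)
    (hi : Integrable fun p => alphaExp α' p * ((elimWeight b p : ℂ) * f (elimPts b p))) :
    ∫ p, alphaExp α' p * ((elimWeight b p : ℂ) * f (elimPts b p)) =
      ∫ p, alphaExp α p * f p := by
  let e : Pts s → ℝ := fun p => α' (some newV) + ∑ i, α (some i) * elimKappa b (joinV p.1 0) i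
  have he0 : ∀ p, e p ≤ 0 := fun p => add_nonpos (hα'0 _) (Finset.sum_nonpos fun i _ =>
    mul_nonpos_of_nonpos_of_nonneg (hα i ▸ hα'0 _) (h.kappa_nonneg ha _ i))
  have hκ : ∀ i, Continuous fun p : Pts s => elimKappa b (joinV p.1 0) i := by
    intro i
    have h1 := (contDiff_elimKappa (B := ℝ) (b := fun _ => b) ha h₀
      (fun _ _ => HasTemperateGrowth.const _) (fun _ => h) i).continuous
    have h2 : Continuous fun p : Pts s => ((0 : ℝ), ((joinV p.1 0, 0) : Pts (insert a s))) :=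
      continuous_const.prodMk (((contDiff_joinV ha).continuous.comp
        (continuous_fst.prodMk continuous_const)).prodMk continuous_const)
    have h3 := Continuous.comp (f := fun p : Pts s =>
      ((0 : ℝ), ((joinV p.1 0, 0) : Pts (insert a s)))) h1 h2
    simpa only [Function.comp_def] using h3
  have hec : Continuous e := continuous_const.add
    (continuous_finsetSum _ fun i _ => continuous_const.mul (hκ i))
  have hEq : ∀ p, alphaExp α' p * ((elimWeight b p : ℂ) * f (elimPts b p)) =
      (elimWeight b p : ℂ) * (Complex.exp (e (elimPts b p) *
        ((Real.exp (p.1 newV) - 1) + Complex.I * (Real.exp (p.1 newV) * p.2 newV))) *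
        (alphaExp α (elimPts b p) * f (elimPts b p))) := by
    intro p
    rw [alphaExp_elim (h.isElim ha p) ha hα hα0]
    simp only [e, h.elimKappa_joinV ha]
    ring
  simp only [hEq] at hi ⊢
  exact integral_elim ha h₀ h hec he0 ((continuous_alphaExp α).mul hf) hi

end RealFactor

section WeakIntegral

variable {V E : Type*} [AddCommGroup E] [Module ℂ E] [LinearOrder V] {s : Finset V}

/-- Sums of Schwartz functions in the coordinates `(sinh u, s)` are integrable against bounded
functions. -/
theorem hasWeakIntegral_sinhSchwartz {F : Type*} [AddCommGroup F] [Module ℂ F] {m : Pts s → ℂ}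
    (hm : Continuous m) {M : ℝ} (hM : ∀ p, ‖m p‖ ≤ M) {f : Pts s → ExteriorAlgebra ℂ F} {N : ℕ}
    {h : Fin N → 𝓢(Pts s, ℂ)} {a : Fin N → ExteriorAlgebra ℂ F}
    (hf : ∀ p, f p = ∑ i, h i (sinhPts p) • a i) :
    HasWeakIntegral (fun p => m p • f p) (∑ i, (∫ p, m p * h i (sinhPts p)) • a i) := by
  intro l
  have hi : ∀ i, Integrable fun p => m p * h i (sinhPts p) * l (a i) := fun i => by
    -- regard `h i` as a function which also depends on a trivial space of parameters
    have hT : HasTemperateGrowth fun z : (Fin 0 → ℝ) × Pts s => z.2 :=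
      (ContinuousLinearMap.snd ℝ (Fin 0 → ℝ) (Pts s)).hasTemperateGrowth
    have hup : ∃ (k : ℕ) (C : ℝ), ∀ z : (Fin 0 → ℝ) × Pts s, ‖z‖ ≤ C * (1 + ‖z.2‖) ^ k :=
      ⟨1, 1, fun z => by
        rw [Prod.norm_def, Subsingleton.elim z.1 0, norm_zero, max_eq_right (norm_nonneg _)]
        linarith⟩
    exact (integrable_mul_schwartz hm hM (SchwartzMap.compCLM ℂ hT hup (h i)) 0).mul_const _
  have e : ∀ p, l (m p • f p) = ∑ i, m p * h i (sinhPts p) * l (a i) := fun p => by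
    rw [hf, Finset.smul_sum, map_sum]
    refine Finset.sum_congr rfl fun i _ => ?_
    rw [smul_smul, map_smul, smul_eq_mul]
  simp only [e]
  refine ⟨integrable_finsetSum _ fun i _ => hi i, ?_⟩
  rw [integral_finsetSum _ fun i _ => hi i, map_sum]
  refine Finset.sum_congr rfl fun i _ => ?_
  rw [integral_mul_const, map_smul, smul_eq_mul]

/-- A weak integral of a function with values in a subspace lies in the subspace. -/
theorem HasWeakIntegral.mem {F X : Type*} [AddCommGroup F] [Module ℂ F] [MeasureSpace X]
    {f : X → ExteriorAlgebra ℂ F} {J : ExteriorAlgebra ℂ F} (h : HasWeakIntegral f J)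
    {S : Submodule ℂ (ExteriorAlgebra ℂ F)} (hS : ∀ p, f p ∈ S) : J ∈ S := by
  by_contra hne
  obtain ⟨l, hl, hle⟩ := Submodule.exists_le_ker_of_notMem hne
  refine hl ((h l).2.symm.trans ?_)
  have : (fun p => l (f p)) = fun _ => 0 := funext fun p => hle (hS p)
  rw [this, integral_zero]

end WeakIntegral

section Insert

variable {V E : Type*} [AddCommGroup E] [Module ℂ E] [LinearOrder V] {s s₀ : Finset V} {a : V}
  {K : Type*} [Fintype K] [DecidableEq K] {m : K → ParAlg E} {L : List K}
  {b b₀ : Option ↥(insert a s) → Option ↥(insert a s) → ℝ}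
  {Λ : Option ↥(insert a s) → Option ↥(insert a s) → K → ℝ}
  {w : Option ↥(insert a s) → Option ↥(insert a s) → ParAlg E}

/-- The density on `insert a s` in terms of the density on `s`. -/
theorem density_eq_subst (ha : a ∉ s) (hf : IsFamily m L b Λ w) (h₀ : IsNetwork b₀ b₀)
    {B : (K → ℝ) → Option ↥(insert a s) → Option ↥(insert a s) → ℝ} {χ : 𝓢(K → ℝ, ℂ)}
    (hB : ∀ i j, HasTemperateGrowth fun t => B t i j) (hn : ∀ t, IsNetwork b₀ (B t))
    (hχ : ∀ᶠ t in 𝓝 (0 : K → ℝ), B t = affW b Λ t ∧ χ t = 1)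
    (hs₀ : s₀ ⊆ s) (hs₀' : s₀ ⊆ insert a s) (g : SuperFun s₀ E)
    {τ : V → ParAlg E} (hτ : ∀ i, IsOdd (τ i)) {N : ℕ} {h : Fin N → 𝓢(Pts s, ℂ)}
    {c : Fin N → Alg V E}
    (hD : ∀ p, density hs₀ g τ (contract w) p = ∑ i, h i (sinhPts p) • c i)
    {H : Fin N → 𝓢((K → ℝ) × Pts (insert a s), ℂ)}
    (hH : ∀ i t p, H i (t, sinhPts p) =
      (elimWeight (B t) p : ℂ) * h i (sinhPts (elimPts (B t) p)) * χ t)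
    (p : Pts (insert a s)) : density hs₀' g τ w p =
      ∑ i, subst (fun k => (par (m k) : Alg V E)) L (fun t => H i (t, sinhPts p)) * c i := by
  have hnil := hf.isNil (V := V)
  have hω : ContDiff ℝ ∞ fun z : (K → ℝ) × Pts (insert a s) => (elimWeight (B z.1) z.2 : ℂ) :=
    contDiff_ofReal (contDiff_elimWeight ha h₀ hB hn)
  have hω' := isSuperExt_smul_const (n := fun k => (par (m k) : Alg V E)) (L := L) hω 1
  -- the density on `s` at the eliminated variables, which themselves depend on the parameters,
  -- is the extension of two families: one with real weights, and one with the weights `w`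
  obtain ⟨f, hf1, hf2⟩ := (hf.contract.isSuperExt_density hs₀ g hτ).comp hnil
    (contDiff_elimPts ha h₀ hB hn)
  -- compare with the family given by `IsElim.density_eq`
  have e1 := IsSuperExt.unique (x := p) (hf.isSuperExt_density hs₀' g hτ)
    (hω'.mul hnil hf1) (by
      filter_upwards [hχ] with t ht
      rw [← ht.1, affW_contract, ← ht.1, smul_mul_assoc, one_mul]
      exact ((hn t).isElim ha p).density_eq ha (hn t).symm (hn t).diag hs₀ hs₀' g hτ)
  have hG : IsSuperExt (fun k => (par (m k) : Alg V E)) L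
      (fun t (p : Pts (insert a s)) => ∑ i, H i (t, sinhPts p) • c i)
      fun p => ∑ i, subst (fun k => (par (m k) : Alg V E)) L
        (fun t => H i (t, sinhPts p)) * c i :=
    IsSuperExt.sum _ fun i _ => isSuperExt_smul_const
      (φ := fun z : (K → ℝ) × Pts (insert a s) => H i (z.1, sinhPts z.2))
      (((H i).smooth ⊤).comp (contDiff_fst.prodMk (contDiff_sinhPts.comp contDiff_snd))) (c i)
  -- compare with the family given by the decomposition of the density on `s` into Schwartz functions
  have e2 := IsSuperExt.unique (x := p) (hω'.mul hnil hf2) hG (by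
    filter_upwards [hχ] with t ht
    simp only [hD, hH, ht.2, mul_one, smul_mul_assoc, one_mul, Finset.smul_sum, smul_smul])
  exact e1.trans e2

/-- Both the integrability and the value of the superintegral pass from `s` to `insert a s`. -/
theorem IsPosWeight.density_insert (hw : IsPosWeight w) (ha : a ∉ s) (hs₀ : s₀ ⊆ s)
    (hs₀' : s₀ ⊆ insert a s) (g : SuperFun s₀ E) {τ : V → ParAlg E} (hτ : ∀ i, IsOdd (τ i))
    (hD : density hs₀ g τ (contract w) ∈ sinhSchwartz s (Alg V E)) :
    density hs₀' g τ w ∈ sinhSchwartz (insert a s) (Alg V E) ∧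
      ∀ (α' : Option ↥(insert a s) → ℝ) (α : Option s → ℝ), (∀ j, α' j ≤ 0) → (∀ j, α j ≤ 0) →
        (∀ i : s, α' (some (incl i)) = α (some i)) → α' none + α' (some newV) = α none →
        ∀ J, HasWeakIntegral (fun p => alphaExp α p • density hs₀ g τ (contract w) p) J →
          HasWeakIntegral (fun p => alphaExp α' p • density hs₀' g τ w p) J := by
  obtain ⟨K, _, _, m, L, b, Λ, hf, hb⟩ := hw.exists_family
  obtain ⟨hev, h₀⟩ := hw.eventually_isNetwork hf hb
  obtain ⟨B, χ, hB, hn, hχ⟩ := exists_temperate_cutoff hev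
  obtain ⟨N, h, c, hh⟩ := exists_of_mem_sinhSchwartz hD
  choose H hH using fun i => exists_schwartz_elim ha h₀ hB hn (h i) χ
  have hD' := density_eq_subst ha hf h₀ hB hn hχ hs₀ hs₀' g hτ hh hH
  have hnil := hf.isNil (V := V)
  constructor
  · have : density hs₀' g τ w = ∑ i, fun p =>
        subst (fun k => (par (m k) : Alg V E)) L (fun t => H i (t, sinhPts p)) * c i := by
      funext p
      rw [hD', Finset.sum_apply]
    rw [this]
    exact Submodule.sum_mem _ fun i _ => subst_mem_sinhSchwartz hnil L (H i) (c i)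
  intro α' α hα' hα hαi hα0 J hJ
  have hJ' : J = ∑ i, (∫ p, alphaExp α p * h i (sinhPts p)) • c i := by
    refine eq_of_forall_dual fun l => ?_
    rw [← (hJ l).2, ← (hasWeakIntegral_sinhSchwartz (continuous_alphaExp α)
      (norm_alphaExp_le hα) hh l).2]
  have hint := fun i l => integral_subst hnil L (continuous_alphaExp α')
    (norm_alphaExp_le hα') (H i) (c i) l
  -- for real parameters near `0` the integral does not depend on the parameters
  have hreal : ∀ i, (fun t => ∫ p, alphaExp α' p * H i (t, sinhPts p)) =ᶠ[𝓝 0]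
      fun _ => ∫ p, alphaExp α p * h i (sinhPts p) := by
    intro i
    filter_upwards [hχ] with t ht
    have hi := integrable_mul_schwartz (continuous_alphaExp α') (norm_alphaExp_le hα') (H i) t
    simp only [hH, ht.2, mul_one] at hi ⊢
    exact integral_elim_alphaExp ha h₀ (hn t) hα' hαi hα0
      ((h i).continuous.comp continuous_sinhPts) hi
  intro l
  have hsum : ∀ p, l (alphaExp α' p • density hs₀' g τ w p) = ∑ i, alphaExp α' p *
      l (subst (fun k => (par (m k) : Alg V E)) L (fun t => H i (t, sinhPts p)) * c i) := by
    intro p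
    rw [hD', map_smul, map_sum, smul_eq_mul, Finset.mul_sum]
  simp only [hsum]
  refine ⟨integrable_finsetSum _ fun i _ => (hint i l).1, ?_⟩
  rw [integral_finsetSum _ fun i _ => (hint i l).1, hJ', map_sum]
  refine Finset.sum_congr rfl fun i _ => ?_
  -- nilpotent substitution into a function which is constant near `0`
  rw [(hint i l).2, subst_congr_of_eventually (hreal i), subst_const, ← Algebra.smul_def]

end Insert

/-! ### Consistency of the superintegrals -/

section Consistency

variable {V E : Type*} [LinearOrder V] [AddCommGroup E] [Module ℂ E]

theorem generatingM_eq (α : V →₀ ℝ) {τ : V → ParAlg E} (hτ : ∀ i, IsOdd (τ i)) (s : Finset V)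
    (p : Pts s) : generatingM α τ s p.1 p.2 = alphaExp (wiredAlpha α s) p • tauExp τ p.1 := by
  have hev : IsEven (∑ i : s, (par (τ i) : Alg V E) *
      ((Real.exp (p.1 i) : ℂ) • (psiBar (i : V) + Complex.I • psi (i : V)))) :=
    IsEven.sum fun i _ => (hτ i).par.mul ((isOdd_psiBar_add _).smul _)
  rw [generatingM, superExp_add (isEven_algebraMap _) hev, superExp_algebraMap,
    ← Algebra.smul_def]
  rfl

theorem hasSuperIntegral_iff (α : V →₀ ℝ) {τ : V → ParAlg E} (hτ : ∀ i, IsOdd (τ i))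
    (W : V → V → ParAlg E) {s₀ s : Finset V} (h : s₀ ⊆ s) (g : SuperFun s₀ E) (I : ParAlg E) :
    HasSuperIntegral (wiredWeight W s)
      (fun u t => generatingM α τ s u t * insertVarpi W h g u t) I ↔
    HasWeakIntegral (fun p => alphaExp (wiredAlpha α s) p • density h g τ (wiredWeight W s) p)
      (par I : Alg V E) := by
  unfold HasSuperIntegral
  refine iff_of_eq (congrArg (fun f => HasWeakIntegral f (par I : Alg V E)) (funext fun p => ?_))
  simp only [generatingM_eq α hτ]
  rw [smul_mul_assoc, mul_smul_comm, map_smul, smul_comm]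
  rfl

variable {G : SimpleGraph V} {W : V → V → ParAlg E}

/-- Induction over the vertices to be added; only the graph on the largest set has to be connected. -/
theorem density_wiredWeight_extend (hW_symm : ∀ i j, W i j = W j i)
    (hW_even : ∀ i j, IsEven (W i j))
    (hW_pos : ∀ i j, G.Adj i j → ∃ r : ℝ, 0 < r ∧ body (W i j) = r)
    (hW_zero : ∀ i j, ¬ G.Adj i j → W i j = 0) (hW_sum : ∀ i, ∃ x, HasWeakSum (W i) x)
    {α : V →₀ ℝ} (hα : ∀ i, α i ≤ 0) {τ : V → ParAlg E} (hτ : ∀ i, IsOdd (τ i))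
    {s₀ s' : Finset V} (hconn : (wiredGraph G s').Connected) (g : SuperFun s₀ E)
    (h0 : density subset_rfl g τ (wiredWeight W s₀) ∈ sinhSchwartz s₀ (Alg V E))
    {J : Alg V E} (hJ : HasWeakIntegral (fun p => alphaExp (wiredAlpha α s₀) p •
      density subset_rfl g τ (wiredWeight W s₀) p) J) (D : Finset V) :
    s₀ ∪ D ⊆ s' → ∀ hs : s₀ ⊆ s₀ ∪ D,
      density hs g τ (wiredWeight W (s₀ ∪ D)) ∈ sinhSchwartz (s₀ ∪ D) (Alg V E) ∧
        HasWeakIntegral (fun p => alphaExp (wiredAlpha α (s₀ ∪ D)) p •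
          density hs g τ (wiredWeight W (s₀ ∪ D)) p) J := by
  choose x hx using hW_sum
  induction D using Finset.induction with
  | empty =>
    rw [Finset.union_empty]
    exact fun _ _ => ⟨h0, hJ⟩
  | insert a D _ ih =>
    rw [Finset.union_insert]
    by_cases ha : a ∈ s₀ ∪ D
    · rw [Finset.insert_eq_of_mem ha]
      exact ih
    · intro hs' hs
      have hsD : s₀ ⊆ s₀ ∪ D := Finset.subset_union_left
      obtain ⟨i1, i2⟩ := ih ((Finset.subset_insert _ _).trans hs') hsD
      have hw := isPosWeight_wiredWeight hW_symm hW_even hW_pos hW_zero hx hs' hconn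
      have hc := contract_wiredWeight hx hW_symm ha
      rw [← hc] at i1 i2
      obtain ⟨j1, j2⟩ := hw.density_insert ha hsD hs g hτ i1
      exact ⟨j1, j2 _ _ (wiredAlpha_nonpos hα _) (wiredAlpha_nonpos hα _) (fun i => rfl)
        (contract_wiredAlpha α ha) J i2⟩

end Consistency

end SusySigma

end

open SusySigma in
theorem mainTheorem7 {V E : Type*} [LinearOrder V] [AddCommGroup E] [Module ℂ E]
    (G : SimpleGraph V) (Vn : ℕ → Finset V) (hmono : Monotone Vn)
    (hunion : ∀ i, ∃ n, i ∈ Vn n)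
    (hconn : ∀ n, (wiredGraph G (Vn n)).Connected)
    (W : V → V → ParAlg E)
    (hW_symm : ∀ i j, W i j = W j i)
    (hW_even : ∀ i j, IsEven (W i j))
    (hW_pos : ∀ i j, G.Adj i j → ∃ r : ℝ, 0 < r ∧ body (W i j) = r)
    (hW_zero : ∀ i j, ¬ G.Adj i j → W i j = 0)
    (hW_sum : ∀ i, ∃ x, HasWeakSum (W i) x)
    (α : V →₀ ℝ) (hα : ∀ i, α i ≤ 0)
    (τ : V → ParAlg E) (hτ : ∀ i, IsOdd (τ i))
    (n : ℕ) (g : SuperFun (Vn n) E)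
    (hg : IsTest (wiredWeight W (Vn n)) (insertVarpi W subset_rfl g)) :
    ∃ I : ParAlg E,
      HasSuperIntegral (wiredWeight W (Vn (n + 1)))
        (fun u t => generatingM α τ (Vn (n + 1)) u t *
          insertVarpi W (hmono n.le_succ) g u t) I ∧
      HasSuperIntegral (wiredWeight W (Vn n))
        (fun u t => generatingM α τ (Vn n) u t * insertVarpi W subset_rfl g u t) I := by
  obtain ⟨x, hx⟩ := Classical.axiomOfChoice hW_sum
  have hw := isPosWeight_wiredWeight hW_symm hW_even hW_pos hW_zero hx subset_rfl (hconn n)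
  have h0 : density subset_rfl g τ (wiredWeight W (Vn n)) ∈ sinhSchwartz (Vn n) (Alg V E) :=
    IsTest.density_mem hw.symm hw.diag hw.even hg hτ
  obtain ⟨N, h, c, hh⟩ := exists_of_mem_sinhSchwartz h0
  have hJ := hasWeakIntegral_sinhSchwartz (continuous_alphaExp (wiredAlpha α (Vn n)))
    (norm_alphaExp_le (wiredAlpha_nonpos hα _)) hh
  -- the integrand, hence the integral, contains none of the variables `ψbar i`, `ψ i`
  obtain ⟨I, hI⟩ := hJ.mem (S := LinearMap.range (par : ParAlg E →ₐ[ℂ] Alg V E).toLinearMap)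
    fun p => Submodule.smul_mem _ _ (density_mem_range _ subset_rfl g τ p)
  replace hI : par I = _ := hI
  rw [← hI] at hJ
  have key := density_wiredWeight_extend hW_symm hW_even hW_pos hW_zero hW_sum hα hτ
    (hconn (n + 1)) g h0 hJ (Vn (n + 1))
  rw [Finset.union_eq_right.2 (hmono n.le_succ)] at key
  exact ⟨I, (hasSuperIntegral_iff α hτ W _ g I).2 (key subset_rfl (hmono n.le_succ)).2,
    (hasSuperIntegral_iff α hτ W subset_rfl g I).2 hJ⟩
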